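/- Let $f,c\ge 0$ be integer constants. Networks are connected, undirected, unweighted simple graphs $G=(V,E)$ with $n\ge 2$ nodes, $m$ links and diameter $D$. An oracle with sensitivity $f$ for distances preprocesses $G$, using random bits, into a data structure. A query consists of a set $F\subseteq V\cup E$ with $|F|\le f$ and two nodes $s,t\in V\setminus F$; it is answered deterministically from the data structure. Write $d_{G-F}(s,t)\in\mathbb N\cup\{\infty\}$ for the length of a shortest $s$-$t$-path in $G-F$, with no restriction on the number of its links. With probability at least $1-n^{-c}$ over the random bits, the following is required to hold for all queries simultaneously. If $F\subseteq E$, then the answer is exactly $d_{G-F}(s,t)$. If $F$ contains nodes, the answer is never smaller than $d_{G-F}(s,t)$, and it equals $d_{G-F}(s,t)$ whenever $d_{G-F}(s,t)\le (f+1)D$ or $d_{G-F}(s,t)=\infty$. There are such oracles, on a randomized word RAM with words of $O(\log n)$ bits, with the following worst-case bounds, where $o(1)$ denotes $\varepsilon(D)$ for a function $\varepsilon$ with $\varepsilon(D)\to 0$ as $D\to\infty$ (so that it is $o(1)$ on every family of networks with $D=\omega(1)$), and $\widetilde O(g)$ means at most $C\,g\,(\log n)^k$. The data structure takes $\widetilde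 O(D^{f+o(1)}n^2)$ words of space, and the query time is $\widetilde O(D^{o(1)})$. The preprocessing time is 1. $\widetilde O(D^{f+o(1)}\,mn)$, for one oracle; and 2. $\widetilde O(D^{f+o(1)}\,n^{\omega+\delta})$, for another oracle for each constant $\delta>0$, where $\omega$ is the exponent of matrix multiplication, that is, the infimum of all $\tau$ such that the tensor of $n\times n$ matrix multiplication over $\mathbb Q$ has rank $O(n^\tau)$. In each case one oracle (a pair of programs and a constant for the word length), one function $\varepsilon$ and constants $C,k$ serve all networks; they depend only on $f$ and $c$, and in case 2 also on $\delta$. -/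

import Mathlib

open Filter Topology MeasureTheory

/-! Randomized word RAM: a structured programming language over machine words of `w` bits,
with finitely many named registers and finitely many named arrays per program.  All operations
on words, including indirect array access and tossing one fair coin, take unit time. -/

namespace WordRAM

/-- The binary operations on words.  Comparisons return `1` or `0`, subtraction is truncated at
`0`, division and remainder are those of natural numbers. -/
inductive BinOp where
  | add | sub | mul | div | mod | lt | eq

/-- The value of an operation on words of `w` bits (results are reduced modulo `2 ^ w`). -/
def BinOp.eval (w : ℕ) (o : BinOp) (x y : ℕ) : ℕ :=
  (match o with
    | .add => x + y
    | .sub => x - y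
    | .mul => x * y
    | .div => x / y
    | .mod => x % y
    | .lt => if x < y then 1 else 0
    | .eq => if x = y then 1 else 0) % 2 ^ w

/-- Expressions: constants, registers, array cells, binary operations. -/
inductive Expr where
  | const (c : ℕ)
  | reg (x : ℕ)
  | get (a : ℕ) (i : Expr)
  | op (o : BinOp) (e₁ e₂ : Expr)

/-- Machine states: the registers, the arrays, and the coin tosses not used up so far. -/
structure State where
  reg : ℕ → ℕ
  arr : ℕ → ℕ → ℕ
  coin : ℕ → Bool

/-- The value of an expression on words of `w` bits. -/
def Expr.eval (w : ℕ) (s : State) : Expr → ℕ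
  | .const c => c % 2 ^ w
  | .reg x => s.reg x
  | .get a i => s.arr a (i.eval w s)
  | .op o e₁ e₂ => o.eval w (e₁.eval w s) (e₂.eval w s)

/-- The time to evaluate an expression: one unit per constant, register access, array access and
operation. -/
def Expr.cost : Expr → ℕ
  | .const _ => 1
  | .reg _ => 1
  | .get _ i => i.cost + 1
  | .op _ e₁ e₂ => e₁.cost + e₂.cost + 1

/-- Programs. -/
inductive Prog where
  /-- do nothing -/
  | skip
  /-- write the value of `e` to register `x` -/
  | assign (x : ℕ) (e : Expr)
  /-- write the value of `e` to the cell of array `a` with index the value of `i` -/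
  | store (a : ℕ) (i e : Expr)
  /-- write a fresh random bit to register `x` -/
  | flip (x : ℕ)
  /-- run `p`, then `q` -/
  | seq (p q : Prog)
  /-- run `p` if the value of `b` is not `0`, otherwise run `q` -/
  | cond (b : Expr) (p q : Prog)
  /-- as long as the value of `b` is not `0`, run `p` -/
  | loop (b : Expr) (p : Prog)

/-- Writing `v` to register `x`. -/
def State.setReg (s : State) (x v : ℕ) : State :=
  { s with reg := Function.update s.reg x v }

/-- Writing `v` to cell `i` of array `a`. -/
def State.setArr (s : State) (a i v : ℕ) : State :=
  { s with arr := Function.update s.arr a (Function.update (s.arr a) i v) }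

/-- Writing the next coin toss to register `x` and using it up. -/
def State.toss (s : State) (x : ℕ) : State :=
  { s with
    reg := Function.update s.reg x (s.coin 0).toNat
    coin := fun i => s.coin (i + 1) }

/-- `Exec w p s t s'`: on words of `w` bits, program `p`, started in state `s`, halts in state
`s'` after exactly `t` time units. -/
inductive Exec (w : ℕ) : Prog → State → ℕ → State → Prop where
  | skip (s : State) : Exec w .skip s 1 s
  | assign (x : ℕ) (e : Expr) (s : State) :
      Exec w (.assign x e) s (e.cost + 1) (s.setReg x (e.eval w s))
  | store (a : ℕ) (i e : Expr) (s : State) :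
      Exec w (.store a i e) s (i.cost + e.cost + 1) (s.setArr a (i.eval w s) (e.eval w s))
  | flip (x : ℕ) (s : State) : Exec w (.flip x) s 1 (s.toss x)
  | seq {p q : Prog} {s s₁ s₂ : State} {t₁ t₂ : ℕ} :
      Exec w p s t₁ s₁ → Exec w q s₁ t₂ s₂ → Exec w (.seq p q) s (t₁ + t₂) s₂
  | cond_true {b : Expr} {p q : Prog} {s s₁ : State} {t : ℕ} :
      b.eval w s ≠ 0 → Exec w p s t s₁ → Exec w (.cond b p q) s (b.cost + 1 + t) s₁
  | cond_false {b : Expr} {p q : Prog} {s s₁ : State} {t : ℕ} :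
      b.eval w s = 0 → Exec w q s t s₁ → Exec w (.cond b p q) s (b.cost + 1 + t) s₁
  | loop_stop {b : Expr} {p : Prog} {s : State} :
      b.eval w s = 0 → Exec w (.loop b p) s (b.cost + 1) s
  | loop_step {b : Expr} {p : Prog} {s s₁ s₂ : State} {t₁ t₂ : ℕ} :
      b.eval w s ≠ 0 → Exec w p s t₁ s₁ → Exec w (.loop b p) s₁ t₂ s₂ →
        Exec w (.loop b p) s (b.cost + 1 + t₁ + t₂) s₂

/-- Running time and final state are determined by the program and the start state. -/
theorem Exec.det {w : ℕ} {p : Prog} {s s₁ s₂ : State} {t₁ t₂ : ℕ} (h₁ : Exec w p s t₁ s₁)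
    (h₂ : Exec w p s t₂ s₂) : t₁ = t₂ ∧ s₁ = s₂ := by
  induction h₁ generalizing t₂ s₂ with
  | skip | assign | store | flip => cases h₂; exact ⟨rfl, rfl⟩
  | seq _ _ ih₁ ih₂ =>
    cases h₂ with
    | seq a b => obtain ⟨rfl, rfl⟩ := ih₁ a; obtain ⟨rfl, rfl⟩ := ih₂ b; exact ⟨rfl, rfl⟩
  | cond_true hb _ ih | cond_false hb _ ih =>
    cases h₂ with
    | cond_true hb' a => first | exact absurd hb hb' | (obtain ⟨rfl, rfl⟩ := ih a; exact ⟨rfl, rfl⟩)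
    | cond_false hb' a => first | exact absurd hb' hb | (obtain ⟨rfl, rfl⟩ := ih a; exact ⟨rfl, rfl⟩)
  | loop_stop hb =>
    cases h₂ with
    | loop_stop => exact ⟨rfl, rfl⟩
    | loop_step hb' => exact absurd hb hb'
  | loop_step hb _ _ ih₁ ih₂ =>
    cases h₂ with
    | loop_stop hb' => exact absurd hb' hb
    | loop_step _ a b => obtain ⟨rfl, rfl⟩ := ih₁ a; obtain ⟨rfl, rfl⟩ := ih₂ b; exact ⟨rfl, rfl⟩

/-- The start state with the list `l₀` in array `0`, the list `l₁` in array `1`, the coin tosses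
`ρ`, and `0` everywhere else. -/
def initState (l₀ l₁ : List ℕ) (ρ : ℕ → Bool) : State where
  reg := fun _ => 0
  arr := fun a i => if a = 0 then l₀.getD i 0 else if a = 1 then l₁.getD i 0 else 0
  coin := ρ

/-- The law of an infinite sequence of independent fair coin tosses. -/
noncomputable def coinMeasure : Measure (ℕ → Bool) :=
  Measure.infinitePi fun _ => (PMF.uniformOfFintype Bool).toMeasure

end WordRAM

/-! Networks, failures, distance sensitivity oracles. -/

namespace DSO

open WordRAM

/-- The numbers `u₁, v₁, u₂, v₂, …` for a list of pairs of nodes `(u₁, v₁), (u₂, v₂), …`. -/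
def flatten {n : ℕ} (l : List (Fin n × Fin n)) : List ℕ :=
  l.flatMap fun p => [(p.1 : ℕ), (p.2 : ℕ)]

/-- `l` lists every link of `G` exactly once, each in one of its two orientations. -/
def IsLinkList {n : ℕ} (G : SimpleGraph (Fin n)) (l : List (Fin n × Fin n)) : Prop :=
  (l.map fun p => s(p.1, p.2)).Nodup ∧ {e | e ∈ l.map fun p => s(p.1, p.2)} = G.edgeSet

/-- The encoding of a network with `n` nodes as input: `n`, the number of links, the links. -/
def encodeNetwork {n : ℕ} (l : List (Fin n × Fin n)) : List ℕ :=
  n :: l.length :: flatten l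

/-- A query to an oracle with sensitivity `f` for the network `G`: a set `F` of at most `f`
failing nodes and links of `G` (given by a list of nodes and a list of links), and two nodes
`src`, `tgt` of `G - F`. -/
structure Query {n : ℕ} (G : SimpleGraph (Fin n)) (f : ℕ) where
  nodes : List (Fin n)
  links : List (Fin n × Fin n)
  links_adj : ∀ p ∈ links, G.Adj p.1 p.2
  card_le : nodes.length + links.length ≤ f
  src : Fin n
  tgt : Fin n
  src_notMem : src ∉ nodes
  tgt_notMem : tgt ∉ nodes

variable {n : ℕ} {G : SimpleGraph (Fin n)} {f : ℕ}

/-- The encoding of a query as input. -/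
def Query.encode (q : Query G f) : List ℕ :=
  (q.src : ℕ) :: (q.tgt : ℕ) :: q.nodes.length :: q.links.length ::
    (q.nodes.map fun v => (v : ℕ)) ++ flatten q.links

/-- The network `G - F`: failing links are deleted, and failing nodes are deleted together with
all their links. -/
def Query.remaining (q : Query G f) : SimpleGraph {v : Fin n | v ∉ q.nodes} :=
  (G.deleteEdges {e | e ∈ q.links.map fun p => s(p.1, p.2)}).induce {v : Fin n | v ∉ q.nodes}

/-- The length of a shortest path from `src` to `tgt` in `G - F` (`⊤` if there is no path). -/
noncomputable def Query.dist (q : Query G f) : ℕ∞ :=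
  q.remaining.edist ⟨q.src, q.src_notMem⟩ ⟨q.tgt, q.tgt_notMem⟩

/-- An answer of the oracle: `0` stands for `⊤` and `d + 1` for the distance `d`. -/
def decodeAnswer : ℕ → ℕ∞
  | 0 => ⊤
  | d + 1 => (d : ℕ∞)

/-- The requirement on the answer `a`: it never underestimates the distance in `G - F`.  If only
links fail, it is exactly this distance.  If nodes fail too, it is exact whenever the distance is
at most `(f + 1) * D`, where `D` is the diameter of `G`. -/
def Query.Correct (q : Query G f) (a : ℕ∞) : Prop :=
  q.dist ≤ a ∧ (q.nodes = [] ∨ q.dist ≤ ((f + 1) * G.diam : ℕ) → a = q.dist)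

/-- An oracle: a randomized preprocessing program, a query program, and the factor `κ` in the
word size. -/
structure Oracle where
  κ : ℕ
  pre : Prog
  query : Prog

/-- Words have `κ` times as many bits as the number `n` of nodes. -/
def Oracle.wordSize (O : Oracle) (n : ℕ) : ℕ := O.κ * Nat.size n

/-- With coin tosses `ρ`, preprocessing the network given by the link list `l` takes `t` time and
leaves the data structure `data`: the initial segment of array `1` whose length is announced in
register `0`. -/
def Oracle.Preprocesses (O : Oracle) (l : List (Fin n × Fin n)) (ρ : ℕ → Bool) (t : ℕ)
    (data : List ℕ) : Prop :=
  ∃ s : State, Exec (O.wordSize n) O.pre (initState (encodeNetwork l) [] ρ) t s ∧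
    data = (List.range (s.reg 0)).map (s.arr 1)

/-- On the data structure `data`, the query `q` takes `t` time and is answered by `a`.  The query
program has access to the query and the data structure only, and to no random bits. -/
def Oracle.Answers (O : Oracle) (data : List ℕ) (q : Query G f) (t : ℕ) (a : ℕ∞) : Prop :=
  ∃ s : State, Exec (O.wordSize n) O.query (initState q.encode data fun _ => false) t s ∧
    a = decodeAnswer (s.reg 0)

/-- `O` is an oracle with sensitivity `f` for distances in `G`: preprocessing takes time at most
`P`, the data structure has at most `S` words, and each query takes time at most `Q`, all of this
for all outcomes of the coin tosses; and with probability at least `1 - n ^ (-c)` over the coin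
tosses of the preprocessing, all queries are answered correctly. -/
def Oracle.Works (O : Oracle) (G : SimpleGraph (Fin n)) (f c : ℕ) (P S Q : ℝ) : Prop :=
  ∀ l : List (Fin n × Fin n), IsLinkList G l →
    (∀ ρ : ℕ → Bool, ∃ (t : ℕ) (data : List ℕ), O.Preprocesses l ρ t data ∧
      (t : ℝ) ≤ P ∧ (data.length : ℝ) ≤ S ∧
      ∀ q : Query G f, ∃ (t' : ℕ) (a : ℕ∞), O.Answers data q t' a ∧ (t' : ℝ) ≤ Q) ∧
    1 - 1 / (n : ℝ) ^ c ≤ coinMeasure.real {ρ | ∃ (t : ℕ) (data : List ℕ),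
      O.Preprocesses l ρ t data ∧
        ∀ q : Query G f, ∃ (t' : ℕ) (a : ℕ∞), O.Answers data q t' a ∧ q.Correct a}

end DSO

/-! The exponent of matrix multiplication. -/

/-- The product of two `n × n` matrices over `ℚ` can be computed with `r` bilinear
multiplications, that is, the tensor of matrix multiplication has rank at most `r`. -/
def MatMulRankLE (n r : ℕ) : Prop :=
  ∃ (α β : Fin r → Matrix (Fin n) (Fin n) ℚ →ₗ[ℚ] ℚ) (M : Fin r → Matrix (Fin n) (Fin n) ℚ),
    ∀ A B : Matrix (Fin n) (Fin n) ℚ, A * B = ∑ i, (α i A * β i B) • M i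

/-- The exponent `ω` of matrix multiplication: the infimum of all `τ` such that `n × n` matrices
can be multiplied with `O(n ^ τ)` bilinear multiplications. -/
noncomputable def matMulExponent : ℝ :=
  sInf {τ : ℝ | ∃ C : ℝ, ∀ n : ℕ, 1 ≤ n → ∃ r : ℕ, (r : ℝ) ≤ C * (n : ℝ) ^ τ ∧ MatMulRankLE n r}

/-!
# Distance sensitivity oracles by colour coding

The oracle tabulates distances in subgraphs that avoid few random colours.  In each of
`R = O(log n)` rounds, every node and every orientation of every link gets a random colour out of
`2 ^ k = O(D)` colours (`colour`); nodes are treated as pairs `(v, v)`.  For each palette of at most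
`f` colours, the preprocessing computes all distances in the subgraph `avoiding` these colours.  These
are `R * O(D) ^ f` computations of all distances, with `n ^ 2` words each, which gives the bounds with
`D ^ f`, so that one can take `ε = 0`.  A query looks up, in each round, the distance for the palette
that consists of the colours of the failing elements, and returns the smallest of these `R` values
(`Query.answer`).

No value is too small, because all failing elements are avoided (`Query.dist_le_edist_avoiding`).  A
round finds the distance `d` exactly if no failing element has the colour of one of the at most
`3 * d + 1` elements of some shortest path in `G - F` (`Query.exists_elements`).  If `d` is at most a
constant multiple of `D`, this holds in one round with probability at least `1 / 2`; so a union bound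
over the at most `n ^ (3 * f + 2)` queries shows that, with high probability, all distances of this
kind are found (`measure_served_ge`).  If only links fail, then all finite distances are of this kind:
every node is at distance at most `D` in `G - F` from the source or from an end of a failing link, so
a shortest path cannot be longer than `(2 * f + 1) * (2 * D + 1)` (`Query.dist_le_of_links`).  If nodes
fail, the answers have to be exact only up to distance `(f + 1) * D`, and when there is no path.

The two oracles differ in the program that computes all distances in a subgraph, for which
`ComputesDistances` is the interface.  The first one uses breadth-first search
(`breadthFirst_computesDistances`).  The second one uses Seidel's algorithm in a form that works for
graphs that are not connected: Boolean squaring gives the pairs at distance at most `2 ^ k`, and the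
distances, in units of `2 ^ k`, are refined from `k + 1` to `k` with one matrix product, by a parity
test (`Seidel.scaledDist_eq`).  Matrices are multiplied by the powers of one fixed bilinear algorithm,
which exists by the definition of the exponent (`MatMul.exists_bilinearAlgorithm_exponent`); its
linear maps are evaluated one Kronecker factor at a time, in arithmetic modulo `2 ^ w`, in which the
entries of the product are small enough to be recognized (`MatMul.matMulProg_computes`).

Programs are verified in a logic of total correctness with time bounds, `WordRAM.Runs`.
-/

open WordRAM

/-! ### Reasoning about programs -/

namespace WordRAM

instance : Add Expr := ⟨.op .add⟩
instance : Sub Expr := ⟨.op .sub⟩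
instance : Mul Expr := ⟨.op .mul⟩
instance : Div Expr := ⟨.op .div⟩
instance : Mod Expr := ⟨.op .mod⟩

/-- The contents of a register. -/
notation "𝐫" => Expr.reg
/-- A constant. -/
notation "𝐜" => Expr.const
/-- The contents of an array cell. -/
notation "𝐚" => Expr.get

/-- Running one program after the other. -/
infixr:60 " ;; " => Prog.seq

/-- The value of a binary operation when nothing is reduced modulo `2 ^ w`. -/
def BinOp.val (o : BinOp) (x y : ℕ) : ℕ :=
  match o with
  | .add => x + y
  | .sub => x - y
  | .mul => x * y
  | .div => x / y
  | .mod => x % y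
  | .lt => if x < y then 1 else 0
  | .eq => if x = y then 1 else 0

/-- The value of an expression when nothing is reduced modulo `2 ^ w`. -/
def Expr.val (s : State) : Expr → ℕ
  | .const c => c
  | .reg x => s.reg x
  | .get a i => s.arr a (i.val s)
  | .op o e₁ e₂ => o.val (e₁.val s) (e₂.val s)

/-- Only sums and products can overflow, the other operations return values that are bounded by
one of their arguments or by `1`. -/
def BinOp.Fits (w : ℕ) (o : BinOp) (x y : ℕ) : Prop :=
  match o with
  | .add => x + y < 2 ^ w
  | .mul => x * y < 2 ^ w
  | _ => True

/-- The evaluation of the expression does not overflow on words of `w` bits. -/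
def Expr.Fits (w : ℕ) (s : State) : Expr → Prop
  | .const c => c < 2 ^ w
  | .reg _ => True
  | .get _ i => i.Fits w s
  | .op o e₁ e₂ => e₁.Fits w s ∧ e₂.Fits w s ∧ o.Fits w (e₁.val s) (e₂.val s)

/-- The contents of all registers and array cells are words of `w` bits. -/
structure State.WF (w : ℕ) (s : State) : Prop where
  pos : 0 < w
  reg : ∀ x, s.reg x < 2 ^ w
  arr : ∀ a i, s.arr a i < 2 ^ w

section lemmas

variable (s : State) (e₁ e₂ e : Expr) (w k : ℕ)

@[simp] theorem Expr.val_add : (e₁ + e₂).val s = e₁.val s + e₂.val s := rfl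
@[simp] theorem Expr.val_sub : (e₁ - e₂).val s = e₁.val s - e₂.val s := rfl
@[simp] theorem Expr.val_mul : (e₁ * e₂).val s = e₁.val s * e₂.val s := rfl
@[simp] theorem Expr.val_div : (e₁ / e₂).val s = e₁.val s / e₂.val s := rfl
@[simp] theorem Expr.val_mod : (e₁ % e₂).val s = e₁.val s % e₂.val s := rfl
@[simp] theorem Expr.val_lt :
    (Expr.op .lt e₁ e₂).val s = if e₁.val s < e₂.val s then 1 else 0 := rfl
@[simp] theorem Expr.val_eq :
    (Expr.op .eq e₁ e₂).val s = if e₁.val s = e₂.val s then 1 else 0 := rfl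
@[simp] theorem Expr.val_reg : (Expr.reg k).val s = s.reg k := rfl
@[simp] theorem Expr.val_const : (Expr.const k).val s = k := rfl
@[simp] theorem Expr.val_get : (Expr.get k e).val s = s.arr k (e.val s) := rfl

@[simp] theorem Expr.cost_add : (e₁ + e₂).cost = e₁.cost + e₂.cost + 1 := rfl
@[simp] theorem Expr.cost_sub : (e₁ - e₂).cost = e₁.cost + e₂.cost + 1 := rfl
@[simp] theorem Expr.cost_mul : (e₁ * e₂).cost = e₁.cost + e₂.cost + 1 := rfl
@[simp] theorem Expr.cost_div : (e₁ / e₂).cost = e₁.cost + e₂.cost + 1 := rfl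
@[simp] theorem Expr.cost_mod : (e₁ % e₂).cost = e₁.cost + e₂.cost + 1 := rfl

@[simp] theorem Expr.fits_add : (e₁ + e₂).Fits w s ↔
    e₁.Fits w s ∧ e₂.Fits w s ∧ e₁.val s + e₂.val s < 2 ^ w := Iff.rfl
@[simp] theorem Expr.fits_mul : (e₁ * e₂).Fits w s ↔
    e₁.Fits w s ∧ e₂.Fits w s ∧ e₁.val s * e₂.val s < 2 ^ w := Iff.rfl
@[simp] theorem Expr.fits_sub : (e₁ - e₂).Fits w s ↔ e₁.Fits w s ∧ e₂.Fits w s := by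
  change _ ∧ _ ∧ True ↔ _; simp
@[simp] theorem Expr.fits_div : (e₁ / e₂).Fits w s ↔ e₁.Fits w s ∧ e₂.Fits w s := by
  change _ ∧ _ ∧ True ↔ _; simp
@[simp] theorem Expr.fits_mod : (e₁ % e₂).Fits w s ↔ e₁.Fits w s ∧ e₂.Fits w s := by
  change _ ∧ _ ∧ True ↔ _; simp
@[simp] theorem Expr.fits_lt : (Expr.op .lt e₁ e₂).Fits w s ↔ e₁.Fits w s ∧ e₂.Fits w s := by
  change _ ∧ _ ∧ True ↔ _; simp
@[simp] theorem Expr.fits_eq : (Expr.op .eq e₁ e₂).Fits w s ↔ e₁.Fits w s ∧ e₂.Fits w s := by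
  change _ ∧ _ ∧ True ↔ _; simp
@[simp] theorem Expr.fits_reg : (Expr.reg k).Fits w s := trivial
@[simp] theorem Expr.fits_const : (Expr.const k).Fits w s ↔ k < 2 ^ w := Iff.rfl
@[simp] theorem Expr.fits_get : (Expr.get k e).Fits w s ↔ e.Fits w s := Iff.rfl

variable (x y a b i v : ℕ)

@[simp] theorem State.setReg_reg :
    (s.setReg x v).reg y = if y = x then v else s.reg y := Function.update_apply ..
@[simp] theorem State.setReg_arr : (s.setReg x v).arr = s.arr := rfl
@[simp] theorem State.setReg_coin : (s.setReg x v).coin = s.coin := rfl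
@[simp] theorem State.setArr_reg : (s.setArr a i v).reg = s.reg := rfl
@[simp] theorem State.setArr_coin : (s.setArr a i v).coin = s.coin := rfl
@[simp] theorem State.setArr_arr :
    (s.setArr a i v).arr b = if b = a then Function.update (s.arr a) i v else s.arr b :=
  Function.update_apply ..
@[simp] theorem State.toss_reg :
    (s.toss x).reg y = if y = x then (s.coin 0).toNat else s.reg y := Function.update_apply ..
@[simp] theorem State.toss_arr : (s.toss x).arr = s.arr := rfl
@[simp] theorem State.toss_coin : (s.toss x).coin i = s.coin (i + 1) := rfl

end lemmas

variable {w : ℕ} {p q : Prog} {s s' : State}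

theorem BinOp.eval_lt (o : BinOp) (x y : ℕ) : o.eval w x y < 2 ^ w :=
  Nat.mod_lt _ (by positivity)

theorem Expr.eval_lt (h : s.WF w) (e : Expr) : e.eval w s < 2 ^ w := by
  cases e with
  | const c => exact Nat.mod_lt _ (by positivity)
  | reg x => exact h.reg x
  | get a i => exact h.arr _ _
  | op o a b => exact BinOp.eval_lt ..

theorem BinOp.eval_eq_val {o : BinOp} {x y : ℕ} (hw : 0 < w) (hx : x < 2 ^ w)
    (h : o.Fits w x y) : o.eval w x y = o.val x y := by
  have h1 : 1 < 2 ^ w := Nat.one_lt_two_pow hw.ne'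
  cases o
  · exact Nat.mod_eq_of_lt h
  · exact Nat.mod_eq_of_lt ((Nat.sub_le _ _).trans_lt hx)
  · exact Nat.mod_eq_of_lt h
  · exact Nat.mod_eq_of_lt ((Nat.div_le_self _ _).trans_lt hx)
  · exact Nat.mod_eq_of_lt ((Nat.mod_le _ _).trans_lt hx)
  · refine Nat.mod_eq_of_lt ?_; dsimp only; split_ifs <;> omega
  · refine Nat.mod_eq_of_lt ?_; dsimp only; split_ifs <;> omega

/-- If nothing overflows, machine arithmetic is arithmetic of natural numbers. -/
theorem Expr.eval_eq_val (h : s.WF w) {e : Expr} (he : e.Fits w s) : e.eval w s = e.val s := by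
  induction e with
  | const c => exact Nat.mod_eq_of_lt he
  | reg x => rfl
  | get a i ih => simp only [Expr.eval, Expr.val, ih he]
  | op o a b iha ihb =>
    have ha := iha he.1
    have := Expr.eval_lt h a
    simp only [Expr.eval, Expr.val, ihb he.2.1, ha]
    rw [ha] at this
    exact BinOp.eval_eq_val h.pos this he.2.2

theorem State.WF.setReg (h : s.WF w) {x v : ℕ} (hv : v < 2 ^ w) : (s.setReg x v).WF w := by
  refine ⟨h.pos, fun y => ?_, h.arr⟩
  rw [State.setReg_reg]; split_ifs
  exacts [hv, h.reg y]

theorem State.WF.setArr (h : s.WF w) {a i v : ℕ} (hv : v < 2 ^ w) : (s.setArr a i v).WF w := by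
  refine ⟨h.pos, h.reg, fun b j => ?_⟩
  rw [State.setArr_arr]; split_ifs
  · rw [Function.update_apply]; split_ifs
    exacts [hv, h.arr a j]
  · exact h.arr b j

theorem State.WF.toss (h : s.WF w) {x : ℕ} : (s.toss x).WF w := by
  refine ⟨h.pos, fun y => ?_, h.arr⟩
  rw [State.toss_reg]; split_ifs
  · exact (Bool.toNat_le _).trans_lt (Nat.one_lt_two_pow h.pos.ne')
  · exact h.reg y

theorem Exec.wf {t : ℕ} (h : Exec w p s t s') (hs : s.WF w) : s'.WF w := by
  induction h with
  | skip => exact hs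
  | assign x e s => exact hs.setReg (e.eval_lt hs)
  | store a i e s => exact hs.setArr (e.eval_lt hs)
  | flip => exact hs.toss
  | seq _ _ ih₁ ih₂ => exact ih₂ (ih₁ hs)
  | cond_true _ _ ih | cond_false _ _ ih => exact ih hs
  | loop_stop => exact hs
  | loop_step _ _ _ ih₁ ih₂ => exact ih₂ (ih₁ hs)

/-- The program contains an instruction that writes to register `x`. -/
def Prog.WritesReg (x : ℕ) : Prog → Prop
  | .skip => False
  | .assign y _ => x = y
  | .store _ _ _ => False
  | .flip y => x = y
  | .seq p q => p.WritesReg x ∨ q.WritesReg x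
  | .cond _ p q => p.WritesReg x ∨ q.WritesReg x
  | .loop _ p => p.WritesReg x

/-- The program contains an instruction that writes to array `a`. -/
def Prog.WritesArr (a : ℕ) : Prog → Prop
  | .skip => False
  | .assign _ _ => False
  | .store b _ _ => a = b
  | .flip _ => False
  | .seq p q => p.WritesArr a ∨ q.WritesArr a
  | .cond _ p q => p.WritesArr a ∨ q.WritesArr a
  | .loop _ p => p.WritesArr a

/-- The program contains a coin toss. -/
def Prog.Tosses : Prog → Prop
  | .skip => False
  | .assign _ _ => False
  | .store _ _ _ => False
  | .flip _ => True
  | .seq p q => p.Tosses ∨ q.Tosses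
  | .cond _ p q => p.Tosses ∨ q.Tosses
  | .loop _ p => p.Tosses

/-- The states `s` and `s'` agree in everything that `p` has no instruction to change. -/
structure Frame (p : Prog) (s s' : State) : Prop where
  reg : ∀ x, ¬ p.WritesReg x → s'.reg x = s.reg x
  arr : ∀ a, ¬ p.WritesArr a → s'.arr a = s.arr a
  coin : ¬ p.Tosses → s'.coin = s.coin

theorem Frame.refl (p : Prog) (s : State) : Frame p s s :=
  ⟨fun _ _ => rfl, fun _ _ => rfl, fun _ => rfl⟩

theorem Frame.trans {s₁ s₂ s₃ : State} (h₁ : Frame p s₁ s₂) (h₂ : Frame p s₂ s₃) :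
    Frame p s₁ s₃ :=
  ⟨fun x hx => (h₂.reg x hx).trans (h₁.reg x hx), fun a ha => (h₂.arr a ha).trans (h₁.arr a ha),
    fun h => (h₂.coin h).trans (h₁.coin h)⟩

theorem Frame.mono (h : Frame p s s') (hr : ∀ x, p.WritesReg x → q.WritesReg x)
    (ha : ∀ a, p.WritesArr a → q.WritesArr a) (hc : p.Tosses → q.Tosses) : Frame q s s' :=
  ⟨fun x hx => h.reg x (mt (hr x) hx), fun a hx => h.arr a (mt (ha a) hx),
    fun hx => h.coin (mt hc hx)⟩

/-- Registers, arrays and coins that a program has no instruction to change keep their contents,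
whatever else happens: this is how facts are carried past a program. -/
theorem Exec.frame {t : ℕ} (h : Exec w p s t s') : Frame p s s' := by
  induction h with
  | skip s => exact Frame.refl _ s
  | assign x e s =>
    exact ⟨fun y hy => by exact (State.setReg_reg ..).trans (if_neg hy), fun _ _ => rfl, fun _ => rfl⟩
  | store a i e s =>
    exact ⟨fun _ _ => rfl, fun b hb => by exact (State.setArr_arr ..).trans (if_neg hb), fun _ => rfl⟩
  | flip x s =>
    exact ⟨fun y hy => by exact (State.toss_reg ..).trans (if_neg hy), fun _ _ => rfl,
      fun h => absurd trivial h⟩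
  | seq _ _ ih₁ ih₂ =>
    exact (ih₁.mono (fun _ => Or.inl) (fun _ => Or.inl) Or.inl).trans
      (ih₂.mono (fun _ => Or.inr) (fun _ => Or.inr) Or.inr)
  | cond_true _ _ ih => exact ih.mono (fun _ => Or.inl) (fun _ => Or.inl) Or.inl
  | cond_false _ _ ih => exact ih.mono (fun _ => Or.inr) (fun _ => Or.inr) Or.inr
  | loop_stop => exact Frame.refl _ _
  | loop_step _ _ _ ih₁ ih₂ =>
    exact (ih₁.mono (q := .loop _ _) (fun _ h => h) (fun _ h => h) (fun h => h)).trans ih₂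

/-- Total correctness with a time bound: on words of `w` bits, `p` halts from `s` after at most
`T` time units, in a state that satisfies `Q`. -/
def Runs (w : ℕ) (p : Prog) (s : State) (T : ℕ) (Q : State → Prop) : Prop :=
  s.WF w → ∃ t s', Exec w p s t s' ∧ t ≤ T ∧ Q s'

variable {T T₁ T₂ : ℕ} {Q Q' : State → Prop}

/-- Weakening the time bound and the postcondition, where the frame of the program may be used. -/
theorem Runs.mono (h : Runs w p s T Q) {T' : ℕ} (hT : T ≤ T')
    (hQ : ∀ s', s'.WF w → Frame p s s' → Q s' → Q' s') : Runs w p s T' Q' := fun hs =>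
  let ⟨t, s', he, ht, hq⟩ := h hs
  ⟨t, s', he, ht.trans hT, hQ s' (he.wf hs) he.frame hq⟩

theorem Runs.seq (h₁ : Runs w p s T₁ Q)
    (h₂ : ∀ s₁, s₁.WF w → Frame p s s₁ → Q s₁ → Runs w q s₁ T₂ Q') :
    Runs w (p ;; q) s (T₁ + T₂) Q' := fun hs =>
  let ⟨_, _, he₁, ht₁, hq₁⟩ := h₁ hs
  let ⟨_, _, he₂, ht₂, hq₂⟩ := h₂ _ (he₁.wf hs) he₁.frame hq₁ (he₁.wf hs)
  ⟨_, _, he₁.seq he₂, add_le_add ht₁ ht₂, hq₂⟩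

/-- A time bound for programs without loops. -/
def Prog.size : Prog → ℕ
  | .skip => 1
  | .assign _ e => e.cost + 1
  | .store _ i e => i.cost + e.cost + 1
  | .flip _ => 1
  | .seq p q => p.size + q.size
  | .cond b p q => b.cost + 1 + p.size + q.size
  | .loop _ _ => 0

/-- The final state of a program without loops when nothing is reduced modulo `2 ^ w`. -/
def Prog.after (s : State) : Prog → State
  | .skip => s
  | .assign x e => s.setReg x (e.val s)
  | .store a i e => s.setArr a (i.val s) (e.val s)
  | .flip x => s.toss x
  | .seq p q => q.after (p.after s)
  | .cond b p q => if b.val s ≠ 0 then p.after s else q.after s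
  | .loop _ _ => s

/-- The program has no loops, and nothing overflows when it is run from `s`. -/
def Prog.Fits (w : ℕ) (s : State) : Prog → Prop
  | .skip => True
  | .assign _ e => e.Fits w s
  | .store _ i e => i.Fits w s ∧ e.Fits w s
  | .flip _ => True
  | .seq p q => p.Fits w s ∧ q.Fits w (p.after s)
  | .cond b p q => b.Fits w s ∧ (b.val s ≠ 0 → p.Fits w s) ∧ (b.val s = 0 → q.Fits w s)
  | .loop _ _ => False

theorem Prog.exec_after (hs : s.WF w) (h : p.Fits w s) :
    ∃ t, Exec w p s t (p.after s) ∧ t ≤ p.size := by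
  induction p generalizing s with
  | skip => exact ⟨_, .skip s, le_rfl⟩
  | assign x e =>
    refine ⟨_, ?_, le_rfl⟩
    rw [Prog.after, ← Expr.eval_eq_val hs h]
    exact .assign x e s
  | store a i e =>
    refine ⟨_, ?_, le_rfl⟩
    rw [Prog.after, ← Expr.eval_eq_val hs h.1, ← Expr.eval_eq_val hs h.2]
    exact .store a i e s
  | flip x => exact ⟨_, .flip x s, le_rfl⟩
  | seq p q ihp ihq =>
    obtain ⟨t₁, h₁, ht₁⟩ := ihp hs h.1
    obtain ⟨t₂, h₂, ht₂⟩ := ihq (h₁.wf hs) h.2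
    exact ⟨_, h₁.seq h₂, add_le_add ht₁ ht₂⟩
  | cond b p q ihp ihq =>
    have hb := Expr.eval_eq_val hs h.1
    by_cases hb0 : b.val s = 0
    · obtain ⟨t, h₁, ht⟩ := ihq hs (h.2.2 hb0)
      rw [Prog.after, if_neg (not_not.2 hb0)]
      exact ⟨_, .cond_false (hb.trans hb0) h₁, by simp only [Prog.size]; omega⟩
    · obtain ⟨t, h₁, ht⟩ := ihp hs (h.2.1 hb0)
      rw [Prog.after, if_pos hb0]
      exact ⟨_, .cond_true (hb ▸ hb0) h₁, by simp only [Prog.size]; omega⟩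
  | loop => exact h.elim

/-- A program without loops is run by computing `Prog.after`. -/
theorem Runs.of_after (hf : s.WF w → p.Fits w s) (hQ : s.WF w → Q (p.after s)) :
    Runs w p s p.size Q := fun hs =>
  let ⟨t, h, ht⟩ := Prog.exec_after hs (hf hs)
  ⟨t, _, h, ht, hQ hs⟩

theorem Runs.le (h : Runs w p s T Q) {T' : ℕ} (hT : T ≤ T') : Runs w p s T' Q :=
  h.mono hT fun _ _ _ h => h

theorem Runs.step (hf : s.WF w → p.Fits w s) (h : Runs w q (p.after s) T Q) :
    Runs w (p ;; q) s (p.size + T) Q :=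
  Runs.seq (Q := fun s₁ => s₁ = p.after s) (Runs.of_after hf fun _ => rfl) fun _ _ _ e => e ▸ h

theorem Runs.cond {b : Expr} (hb : b.Fits w s) (hp : b.val s ≠ 0 → Runs w p s T Q)
    (hq : b.val s = 0 → Runs w q s T Q) : Runs w (.cond b p q) s (b.cost + 1 + T) Q := by
  intro hs
  have hbv := Expr.eval_eq_val hs hb
  by_cases hb0 : b.val s = 0
  · obtain ⟨t, s', he, ht, h⟩ := hq hb0 hs
    exact ⟨_, s', .cond_false (hbv.trans hb0) he, by omega, h⟩
  · obtain ⟨t, s', he, ht, h⟩ := hp hb0 hs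
    exact ⟨_, s', .cond_true (hbv ▸ hb0) he, by omega, h⟩

/-- Loops: `I k` is an invariant, `k` bounds the number of iterations that are still to come. -/
theorem Runs.loop_eval {b : Expr} (I : ℕ → State → Prop)
    (hstep : ∀ k s₁, s₁.WF w → Frame p s s₁ → I k s₁ → b.eval w s₁ ≠ 0 →
      Runs w p s₁ T fun s₂ => ∃ k' < k, I k' s₂)
    {K : ℕ} (h0 : I K s) :
    Runs w (.loop b p) s (K * (T + b.cost + 1) + (b.cost + 1))
      fun s' => b.eval w s' = 0 ∧ ∃ k, I k s' := by
  intro hs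
  suffices H : ∀ k s₁, s₁.WF w → Frame p s s₁ → I k s₁ → ∃ t s', Exec w (.loop b p) s₁ t s' ∧
      t ≤ k * (T + b.cost + 1) + (b.cost + 1) ∧ b.eval w s' = 0 ∧ ∃ k, I k s' from
    H K s hs (Frame.refl _ _) h0
  intro k
  induction k using Nat.strong_induction_on with
  | _ k ih =>
    intro s₁ hs₁ hf hI
    by_cases hb0 : b.eval w s₁ = 0
    · exact ⟨_, s₁, (Exec.loop_stop) hb0, by omega, hb0, k, hI⟩
    · obtain ⟨t, s₂, he, ht, k', hk', hI'⟩ := hstep k s₁ hs₁ hf hI hb0 hs₁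
      obtain ⟨t', s₃, he', ht', hQ⟩ := ih k' hk' s₂ (he.wf hs₁) (hf.trans he.frame) hI'
      refine ⟨_, s₃, .loop_step hb0 he he', ?_, hQ⟩
      calc b.cost + 1 + t + t'
          ≤ (k' + 1) * (T + b.cost + 1) + (b.cost + 1) := by rw [Nat.succ_mul]; omega
        _ ≤ _ := by gcongr; omega

/-- The rule `Runs.loop_eval` for conditions that do not overflow. -/
theorem Runs.loop {b : Expr} (I : ℕ → State → Prop)
    (hb : ∀ k s₁, s₁.WF w → Frame p s s₁ → I k s₁ → b.Fits w s₁)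
    (hstep : ∀ k s₁, s₁.WF w → Frame p s s₁ → I k s₁ → b.val s₁ ≠ 0 →
      Runs w p s₁ T fun s₂ => ∃ k' < k, I k' s₂)
    {K : ℕ} (h0 : I K s) :
    Runs w (.loop b p) s (K * (T + b.cost + 1) + (b.cost + 1))
      fun s' => b.val s' = 0 ∧ ∃ k, I k s' :=
  (Runs.loop_eval I (fun k s₁ hs₁ hf hI h0 => hstep k s₁ hs₁ hf hI
    (Expr.eval_eq_val hs₁ (hb k s₁ hs₁ hf hI) ▸ h0)) h0).mono le_rfl
    fun s' hs' hf ⟨h1, k, hI⟩ => ⟨(Expr.eval_eq_val hs'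
      (hb k s' hs' ⟨hf.reg, hf.arr, hf.coin⟩ hI)).symm.trans h1, k, hI⟩

/-- Running `p` with register `i` counting from `0` up to the value of register `b`. -/
def Prog.count (i b : ℕ) (p : Prog) : Prog :=
  .assign i (𝐜 0) ;; .loop (.op .lt (𝐫 i) (𝐫 b)) (p ;; .assign i (𝐫 i + 𝐜 1))

/-- Counting loops: `I k` holds before the iteration with counter `k`. -/
theorem Runs.count {i b N : ℕ} (I : ℕ → State → Prop) (hi : ¬ p.WritesReg i)
    (hb : ¬ p.WritesReg b) (hib : b ≠ i) (hN : s.reg b = N)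
    (hI : ∀ k s₁ v, I k s₁ → I k (s₁.setReg i v)) (h0 : I 0 s)
    (hstep : ∀ k < N, ∀ s₁, s₁.WF w → Frame (Prog.count i b p) s s₁ → s₁.reg i = k →
      s₁.reg b = N → I k s₁ → Runs w p s₁ T (I (k + 1))) :
    Runs w (Prog.count i b p) s (N * (T + 8) + 6) (I N) := by
  have hfr : ∀ s₁, Frame (p ;; .assign i (𝐫 i + 𝐜 1)) (s.setReg i 0) s₁ →
      Frame (Prog.count i b p) s s₁ := fun s₁ h =>
    ⟨fun x hx => by
      have hx' : ¬ x = i := fun h => hx (.inl h)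
      rw [h.reg x (fun h => hx (.inr h)), State.setReg_reg, if_neg hx'],
     fun x hx => h.arr x (fun h => hx (.inr h)), fun hx => h.coin (fun h => hx (.inr h))⟩
  have hib' : ∀ s₁, Frame (p ;; .assign i (𝐫 i + 𝐜 1)) (s.setReg i 0) s₁ → s₁.reg b = N := by
    intro s₁ h
    rw [h.reg b (not_or.2 ⟨hb, hib⟩), State.setReg_reg, if_neg hib, hN]
  refine Runs.mono (T := 2 + (N * ((T + 4) + 3 + 1) + (3 + 1))) ?_ (by
    rw [show T + 4 + 3 + 1 = T + 8 by rfl]; omega)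
    (fun _ _ _ h => h) (Q := I N)
  refine Runs.seq (Q := fun s₁ => s₁ = s.setReg i 0)
    (Runs.of_after (fun _ => by simp [Prog.Fits]) fun _ => rfl) ?_
  rintro _ _ - rfl
  refine Runs.mono (Runs.loop (T := T + 4) (K := N) (fun k s₁ => k ≤ N ∧ s₁.reg i = N - k ∧
    I (N - k) s₁) ?_ ?_ ⟨le_rfl, by simp, by simpa using hI _ _ _ h0⟩) le_rfl ?_
  · intros; simp
  · rintro k s₁ hs₁ hf ⟨hk, hr, hIk⟩ hlt
    have hlt : s₁.reg i < s₁.reg b := by 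
      by_contra h; exact hlt (if_neg h)
    have hbN := hib' s₁ hf
    refine Runs.seq (hstep (N - k) (by omega) s₁ hs₁ (hfr s₁ hf) hr hbN hIk) ?_
    intro s₂ hs₂ hf₂ hI₂
    have hi₂ : s₂.reg i = N - k := (hf₂.reg i hi).trans hr
    have hN2 : N < 2 ^ w := hbN ▸ hs₁.reg b
    refine Runs.of_after (fun _ => ?_) fun _ => ⟨k - 1, by omega, by omega, ?_, ?_⟩
    · have := Nat.one_lt_two_pow hs₂.pos.ne'
      simp only [Prog.Fits, Expr.fits_add, Expr.fits_reg, Expr.fits_const, Expr.val_reg,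
        Expr.val_const, true_and]
      omega
    · simp only [Prog.after, State.setReg_reg, if_true, Expr.val_add, Expr.val_reg,
          Expr.val_const, hi₂]; omega
    · have : N - (k - 1) = N - k + 1 := by omega
      rw [this]
      exact hI _ _ _ hI₂
  · rintro s₁ hs₁ hf ⟨hb0, k, hk, hr, hIk⟩
    have hbN := hib' s₁ ⟨hf.reg, hf.arr, hf.coin⟩
    have : ¬ s₁.reg i < s₁.reg b := by 
      intro h; exact one_ne_zero ((if_pos h).symm.trans hb0)
    have hk0 : k = 0 := by omega
    simpa [hk0] using hIk

end WordRAM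

namespace WordRAM

@[simp] theorem Prog.count_writesReg {x i b : ℕ} {p : Prog} :
    (Prog.count i b p).WritesReg x ↔ x = i ∨ p.WritesReg x := by
  simp only [Prog.count, Prog.WritesReg]; tauto

@[simp] theorem Prog.count_writesArr {a i b : ℕ} {p : Prog} :
    (Prog.count i b p).WritesArr a ↔ p.WritesArr a := by
  simp [Prog.count, Prog.WritesArr]

@[simp] theorem Prog.count_tosses {i b : ℕ} {p : Prog} :
    (Prog.count i b p).Tosses ↔ p.Tosses := by
  simp [Prog.count, Prog.Tosses]

end WordRAM

namespace DSO

/-! ### Computing distances: the interface -/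

/-- The encoding of distances as machine words that `decodeAnswer` inverts. -/
noncomputable def encodeDist (d : ℕ∞) : ℕ := if d = ⊤ then 0 else d.toNat + 1

/-- `encodeDist` is a section of the decoding that the definition of the oracle prescribes. -/
theorem decodeAnswer_encodeDist (d : ℕ∞) : decodeAnswer (encodeDist d) = d := by
  induction d using ENat.recTopCoe with
  | top => simp [encodeDist, decodeAnswer]
  | coe d => simp [encodeDist, decodeAnswer]

open Classical in
/-- The program `P` computes all distances in a graph with `n` nodes and at most `m` links, in time
`T w n m` on words of `w ≥ κ * Nat.size n` bits: it expects `n` in register `1` and the adjacency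
matrix in array `3`, and leaves the matrix of distances in array `4`.  It does not touch the registers
below `20` and the arrays below `4`. -/
structure ComputesDistances (P : Prog) (T : ℕ → ℕ → ℕ → ℕ) (κ : ℕ) : Prop where
  reg : ∀ x, P.WritesReg x → 20 ≤ x
  arr : ∀ a, P.WritesArr a → 4 ≤ a
  tosses : ¬ P.Tosses
  runs : ∀ (w n m : ℕ) (s : State) (H : SimpleGraph (Fin n)), 2 ≤ n → κ * n.size ≤ w →
    s.reg 1 = n → H.edgeSet.ncard ≤ m →
    (∀ u v : Fin n, s.arr 3 (u * n + v) = if H.Adj u v then 1 else 0) →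
    Runs w P s (T w n m) fun s' => ∀ u v : Fin n, s'.arr 4 (u * n + v) = encodeDist (H.edist u v)

theorem index_lt {n u v : ℕ} (hu : u < n) (hv : v < n) : u * n + v < n * n := by
  calc u * n + v < u * n + n := by omega
    _ = (u + 1) * n := by ring
    _ ≤ n * n := by gcongr; omega

theorem index_div {n v : ℕ} (u : ℕ) (hv : v < n) : (u * n + v) / n = u := by
  rw [mul_comm, Nat.mul_add_div (by omega), Nat.div_eq_of_lt hv, add_zero]

theorem index_mod {n v : ℕ} (u : ℕ) (hv : v < n) : (u * n + v) % n = v := by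
  rw [mul_comm, Nat.mul_add_mod, Nat.mod_eq_of_lt hv]

/-! ### Breadth-first search -/

open Classical in
/-- The number of neighbours of `u` below `c`. -/
noncomputable def degBelow (A : ℕ → ℕ → Prop) (u c : ℕ) : ℕ := ((Finset.range c).filter (A u)).card

/-- The invariant of breadth-first search from `src` for the adjacency relation `A` on the nodes
below `n`: `d` holds the distances increased by `1`, with `0` for nodes that have not been found,
`Q` is the queue of all nodes found so far, `tail` their number; those before `head` are finished, and
the node at `head` has been joined to its neighbours below `cur`. -/
structure SearchInv (n : ℕ) (A : ℕ → ℕ → Prop) (src : ℕ) (d Q : ℕ → ℕ) (head tail cur : ℕ) :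
    Prop where
  head_le : head ≤ tail
  queue_lt : ∀ i < tail, Q i < n
  queue_inj : ∀ i < tail, ∀ j < tail, Q i = Q j → i = j
  found : ∀ i < tail, d (Q i) ≠ 0
  mem_queue : ∀ v < n, d v ≠ 0 → ∃ i < tail, Q i = v
  small : ∀ i < tail, d (Q i) ≤ i + 1
  source : d src = 1
  parent : ∀ v < n, d v ≠ 0 →
    v = src ∧ d v = 1 ∨ ∃ u < n, A u v ∧ d u ≠ 0 ∧ d v = d u + 1
  mono : ∀ i < tail, ∀ j < tail, i ≤ j → d (Q i) ≤ d (Q j)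
  near : ∀ i < tail, ∀ j < tail, head ≤ j → d (Q i) ≤ d (Q j) + 1
  finished : ∀ i < head, ∀ v < n, A (Q i) v → d v ≠ 0 ∧ d v ≤ d (Q i) + 1
  current : head < tail → ∀ v < n, v < cur → A (Q head) v → d v ≠ 0 ∧ d v ≤ d (Q head) + 1

namespace SearchInv

variable {n : ℕ} {A : ℕ → ℕ → Prop} {src : ℕ} {d Q : ℕ → ℕ} {head tail cur : ℕ}

theorem init (hs : src < n) {d Q : ℕ → ℕ} (hd : ∀ v < n, d v = if v = src then 1 else 0)
    (hQ : Q 0 = src) : SearchInv n A src d Q 0 1 0 := by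
  have hsrc : d src = 1 := by rw [hd _ hs, if_pos rfl]
  constructor
  · omega
  · intro i hi; obtain rfl : i = 0 := by omega
    omega
  · omega
  · intro i hi; obtain rfl : i = 0 := by omega
    rw [hQ]; omega
  · intro v hv h
    rw [hd v hv] at h
    refine ⟨0, by omega, ?_⟩
    by_contra h'
    exact h (if_neg fun h'' => h' (hQ.trans h''.symm))
  · intro i hi; obtain rfl : i = 0 := by omega
    rw [hQ]; omega
  · exact hsrc
  · intro v hv h
    rw [hd v hv] at h
    left
    by_contra h'
    exact h (if_neg fun h'' => h' ⟨h'', h'' ▸ hsrc⟩)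
  · intro i hi j hj _
    rw [show i = j by omega]
  · intro i hi j hj _
    rw [show i = j by omega]; omega
  · omega
  · omega

theorem tail_le (h : SearchInv n A src d Q head tail cur) : tail ≤ n := by
  have := Finset.card_le_card_of_injOn (s := Finset.range tail) (t := Finset.range n) Q
    (fun i hi => by simpa using h.queue_lt i (by simpa using hi))
    (fun i hi j hj => h.queue_inj i (by simpa using hi) j (by simpa using hj))
  simpa using this

theorem sum_le (h : SearchInv n A src d Q head tail cur) {k : ℕ} (hk : k ≤ tail) (g : ℕ → ℕ) :
    ∑ i ∈ Finset.range k, g (Q i) ≤ ∑ v ∈ Finset.range n, g v := by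
  rw [← Finset.sum_image (f := g) (g := Q)]
  · refine Finset.sum_le_sum_of_subset fun v hv => ?_
    obtain ⟨i, hi, rfl⟩ := Finset.mem_image.1 hv
    exact Finset.mem_range.2 (h.queue_lt i ((Finset.mem_range.1 hi).trans_le hk))
  · intro i hi j hj
    have hi' := Finset.mem_range.1 hi
    have hj' := Finset.mem_range.1 hj
    exact h.queue_inj i (by omega) j (by omega)

theorem advance (h : SearchInv n A src d Q head tail cur) (hlt : head < tail)
    (hA : ∀ v < n, cur ≤ v → ¬ A (Q head) v) : SearchInv n A src d Q (head + 1) tail 0 :=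
  { h with
    head_le := hlt
    near := fun i hi j hj hij => h.near i hi j hj (by omega)
    finished := fun i hi v hv hAv => by
      rcases Nat.lt_succ_iff_lt_or_eq.1 hi with hi | rfl
      · exact h.finished i hi v hv hAv
      · exact h.current hlt v hv (not_le.1 fun hc => hA v hv hc hAv) hAv
    current := fun _ v _ hv => absurd hv (by omega) }

theorem skip (h : SearchInv n A src d Q head tail cur) {v : ℕ} (hlt : head < tail)
    (hv : v < n) (hA : ∀ x, cur ≤ x → x < v → ¬ A (Q head) x) (hd : d v ≠ 0) :
    SearchInv n A src d Q head tail (v + 1) :=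
  { h with
    current := fun _ x hx hxv hAx => by
      by_cases hc : x < cur
      · exact h.current hlt x hx hc hAx
      · obtain rfl : x = v := by
          by_contra hne
          exact hA x (by omega) (by omega) hAx
        obtain ⟨i, hi, rfl⟩ := h.mem_queue x hx hd
        exact ⟨hd, h.near i hi head hlt le_rfl⟩ }

theorem visit (h : SearchInv n A src d Q head tail cur) {v : ℕ} (hlt : head < tail)
    (hv : v < n) (hA : ∀ x, cur ≤ x → x < v → ¬ A (Q head) x) (hAv : A (Q head) v) (hd : d v = 0) :
    SearchInv n A src (Function.update d v (d (Q head) + 1)) (Function.update Q tail v)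
      head (tail + 1) (v + 1) := by
  have hQ : ∀ i < tail, Function.update Q tail v i = Q i := fun i hi =>
    Function.update_of_ne (by omega) ..
  have hQt : Function.update Q tail v tail = v := Function.update_self ..
  set d' := Function.update d v (d (Q head) + 1) with hd'
  have hdv : d' v = d (Q head) + 1 := Function.update_self ..
  have hdx : ∀ x, d x ≠ 0 → d' x = d x := fun x hx =>
    Function.update_of_ne (by rintro rfl; exact hx hd) ..
  have hdQ : ∀ i < tail, d' (Q i) = d (Q i) := fun i hi => hdx _ (h.found i hi)
  have key : ∀ i < tail + 1, i < tail ∨ i = tail := fun i hi => by omega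
  have hne : ∀ i < tail, Q i ≠ v := fun i hi hc => h.found i hi (hc ▸ hd)
  constructor
  · have := h.head_le; omega
  · intro i hi
    rcases key i hi with hi | rfl
    · rw [hQ i hi]; exact h.queue_lt i hi
    · rwa [hQt]
  · intro i hi j hj hij
    rcases key i hi with hi | rfl <;> rcases key j hj with hj | rfl
    · rw [hQ i hi, hQ j hj] at hij; exact h.queue_inj i hi j hj hij
    · rw [hQ i hi, hQt] at hij; exact absurd hij (hne i hi)
    · rw [hQ j hj, hQt] at hij; exact absurd hij.symm (hne j hj)
    · rfl
  · intro i hi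
    rcases key i hi with hi | rfl
    · rw [hQ i hi, hdQ i hi]; exact h.found i hi
    · rw [hQt, hdv]; omega
  · intro x hx hdx'
    by_cases hxv : x = v
    · exact ⟨tail, by omega, hxv ▸ hQt⟩
    · rw [hd', Function.update_of_ne hxv] at hdx'
      obtain ⟨i, hi, rfl⟩ := h.mem_queue x hx hdx'
      exact ⟨i, by omega, hQ i hi⟩
  · intro i hi
    rcases key i hi with hi | rfl
    · rw [hQ i hi, hdQ i hi]; exact h.small i hi
    · rw [hQt, hdv]; have := h.small head hlt; omega
  · rw [hdx _ (by rw [h.source]; omega), h.source]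
  · intro x hx hdx'
    by_cases hxv : x = v
    · subst hxv
      exact .inr ⟨Q head, h.queue_lt head hlt, hAv, by rw [hdQ head hlt]; exact h.found head hlt,
        by rw [hdQ head hlt, hdv]⟩
    · rw [hd', Function.update_of_ne hxv] at hdx'
      rcases h.parent x hx hdx' with ⟨rfl, h1⟩ | ⟨u, hu, hAu, hdu, h1⟩
      · exact .inl ⟨rfl, by rw [hdx _ hdx', h1]⟩
      · exact .inr ⟨u, hu, hAu, by rwa [hdx _ hdu], by rw [hdx _ hdx', hdx _ hdu, h1]⟩
  · intro i hi j hj hij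
    rcases key i hi with hi | rfl <;> rcases key j hj with hj | rfl
    · rw [hQ i hi, hQ j hj, hdQ i hi, hdQ j hj]; exact h.mono i hi j hj hij
    · rw [hQ i hi, hQt, hdv, hdQ i hi]; exact h.near i hi head hlt le_rfl
    · omega
    · rfl
  · intro i hi j hj hij
    rcases key i hi with hi | rfl <;> rcases key j hj with hj | rfl
    · rw [hQ i hi, hQ j hj, hdQ i hi, hdQ j hj]; exact h.near i hi j hj hij
    · rw [hQ i hi, hQt, hdv, hdQ i hi]
      have := h.near i hi head hlt le_rfl; omega
    · rw [hQ j hj, hQt, hdv, hdQ j hj]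
      have := h.mono head hlt j hj hij; omega
    · omega
  · intro i hi x hx hAx
    rw [hQ i (by omega)] at hAx ⊢
    obtain ⟨h1, h2⟩ := h.finished i hi x hx hAx
    rw [hdx x h1, hdQ i (by omega)]
    exact ⟨h1, h2⟩
  · intro _ x hx hxv hAx
    rw [hQ head hlt] at hAx ⊢
    rw [hdQ head hlt]
    by_cases hxv' : x = v
    · subst hxv'; rw [hdv]; omega
    · by_cases hc : x < cur
      · obtain ⟨h1, h2⟩ := h.current hlt x hx hc hAx
        rw [hdx x h1]
        exact ⟨h1, h2⟩
      · exact absurd hAx (hA x (by omega) (by omega))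

theorem found_of_adj (h : SearchInv n A src d Q tail tail cur) {u v : ℕ} (hu : u < n) (hv : v < n)
    (hd : d u ≠ 0) (hA : A u v) : d v ≠ 0 ∧ d v ≤ d u + 1 := by
  obtain ⟨i, hi, rfl⟩ := h.mem_queue u hu hd
  exact h.finished i hi v hv hA

end SearchInv

/-- A function with these local properties is the distance from `s`. -/
theorem eq_encodeDist {n : ℕ} (H : SimpleGraph (Fin n)) (s : Fin n) (d : Fin n → ℕ)
    (hs : d s = 1)
    (hp : ∀ v, d v ≠ 0 → v = s ∧ d v = 1 ∨ ∃ u, H.Adj u v ∧ d u ≠ 0 ∧ d v = d u + 1)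
    (hA : ∀ u v, d u ≠ 0 → H.Adj u v → d v ≠ 0 ∧ d v ≤ d u + 1) (v : Fin n) :
    d v = encodeDist (H.edist s v) := by
  have h1 : ∀ k v, d v = k + 1 → H.edist s v ≤ k := by
    intro k
    induction k with
    | zero =>
      intro v hv
      rcases hp v (by omega) with ⟨rfl, -⟩ | ⟨u, -, h, h'⟩
      · simp
      · omega
    | succ k ih =>
      intro v hv
      rcases hp v (by omega) with ⟨rfl, -⟩ | ⟨u, hu, h, h'⟩
      · simp
      · calc H.edist s v ≤ H.edist s u + H.edist u v := SimpleGraph.edist_triangle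
          _ ≤ k + 1 := by
            gcongr
            · exact ih u (by omega)
            · exact (SimpleGraph.edist_eq_one_iff_adj.2 hu).le
          _ = _ := by push_cast; rfl
  have h2 : ∀ (u v : Fin n) (p : H.Walk u v), d u ≠ 0 → d v ≠ 0 ∧ d v ≤ d u + p.length := by
    intro u v p
    induction p with
    | nil => intro h; exact ⟨h, by simp⟩
    | cons hadj p ih =>
      intro h
      obtain ⟨h3, h4⟩ := hA _ _ h hadj
      obtain ⟨h5, h6⟩ := ih h3
      exact ⟨h5, by rw [SimpleGraph.Walk.length_cons]; omega⟩
  by_cases hv : d v = 0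
  · have : ¬ H.Reachable s v := fun ⟨p⟩ => (h2 s v p (by omega)).1 hv
    rw [encodeDist, if_pos (SimpleGraph.edist_eq_top_of_not_reachable this), hv]
  · have h3 := h1 (d v - 1) v (by omega)
    have hne : H.edist s v ≠ ⊤ := fun h => by rw [h] at h3; exact absurd h3 (by simp)
    obtain ⟨p, hp'⟩ := SimpleGraph.exists_walk_of_edist_ne_top hne
    have h4 := (h2 s v p (by omega)).2
    rw [← hp'] at h3 ⊢
    rw [encodeDist, if_neg (by simp), ENat.toNat_natCast]
    have : p.length ≤ d v - 1 := by exact_mod_cast h3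
    omega

end DSO

/-! ### Breadth-first search: the program -/

namespace DSO

/-- The specification of the table of next neighbours: `J (u * (n + 1) + v)` is the first neighbour
of `u` that is at least `v`, or `n` if there is none. -/
def IsNeighbourTable (n : ℕ) (A : ℕ → ℕ → Prop) (J : ℕ → ℕ) : Prop :=
  ∀ u < n, ∀ v ≤ n, v ≤ J (u * (n + 1) + v) ∧ J (u * (n + 1) + v) ≤ n ∧
    (J (u * (n + 1) + v) < n → A u (J (u * (n + 1) + v))) ∧
    ∀ x, v ≤ x → x < J (u * (n + 1) + v) → ¬ A u x

/-- Filling array `5` with the table of next neighbours, from the end backwards: entry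
`u * (n + 1) + v` is the first neighbour of `u` that is at least `v`, or `n` if there is none.  With
this table, the search spends constant time on every link, although the graph is given by its
adjacency matrix. -/
def neighbourTable : Prog :=
  .assign 21 (𝐫 1 + 𝐜 1) ;;
  .assign 22 (𝐫 1 * 𝐫 21) ;;
  .count 20 22 (
    .assign 24 (𝐫 22 - 𝐜 1 - 𝐫 20) ;;
    .assign 25 (𝐫 24 / 𝐫 21) ;;
    .assign 26 (𝐫 24 % 𝐫 21) ;;
    .cond (.op .eq (𝐫 26) (𝐫 1))
      (.store 5 (𝐫 24) (𝐫 1))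
      (.cond (𝐚 3 (𝐫 25 * 𝐫 1 + 𝐫 26))
        (.store 5 (𝐫 24) (𝐫 26))
        (.store 5 (𝐫 24) (𝐚 5 (𝐫 24 + 𝐜 1)))))

theorem bfs_word_bounds {n w : ℕ} (hn : 2 ≤ n) (hw : 4 * n.size ≤ w) :
    n * (n + 1) + 2 * n + 8 < 2 ^ w := by
  have h1 : n + 1 ≤ 2 ^ n.size := Nat.lt_size_self n
  calc n * (n + 1) + 2 * n + 8 < (n + 1) ^ 4 := by nlinarith [Nat.pow_le_pow_left hn 2, Nat.pow_le_pow_left hn 3, Nat.pow_le_pow_left hn 4]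
    _ ≤ (2 ^ n.size) ^ 4 := by gcongr
    _ = 2 ^ (4 * n.size) := by rw [← pow_mul, mul_comm]
    _ ≤ 2 ^ w := Nat.pow_le_pow_right (by omega) hw

theorem neighbourTable_runs {w n : ℕ} {s : State} {A : ℕ → ℕ → Prop} (hn : 2 ≤ n)
    (hw : 4 * n.size ≤ w)
    (h1 : s.reg 1 = n) (hA : ∀ u < n, ∀ v < n, s.arr 3 (u * n + v) ≠ 0 ↔ A u v) :
    Runs w neighbourTable s (200 * n ^ 2) fun s' =>
      s'.reg 21 = n + 1 ∧ IsNeighbourTable n A (s'.arr 5) := by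
  have hb := bfs_word_bounds hn hw
  have hb' : n * n + n = n * (n + 1) := by ring
  have hw0 : w ≠ 0 := by rintro rfl; omega
  obtain ⟨N, hN⟩ : ∃ N, n * (n + 1) = N := ⟨_, rfl⟩
  rw [hN] at hb hb'
  refine Runs.le (Runs.step (T := 4 + (N * (60 + 8) + 6)) ?_ (Runs.step ?_ (Runs.mono
    (Runs.count (N := N) (T := 60) (I := fun k s' => ∀ u < n, ∀ v ≤ n, N ≤ u * (n + 1) + v + k →
        v ≤ s'.arr 5 (u * (n + 1) + v) ∧ s'.arr 5 (u * (n + 1) + v) ≤ n ∧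
        (s'.arr 5 (u * (n + 1) + v) < n → A u (s'.arr 5 (u * (n + 1) + v))) ∧
        ∀ x, v ≤ x → x < s'.arr 5 (u * (n + 1) + v) → ¬ A u x) ?_ ?_ ?_ ?_ ?_ ?_ ?_) le_rfl ?_))) ?_
  · intro hs
    simp [Prog.Fits, h1, hw0]
    omega
  · intro hs
    simp [Prog.Fits, h1, Prog.after, hN]
    omega
  · simp [Prog.WritesReg]
  · simp [Prog.WritesReg]
  · simp
  · simp [Prog.after, h1, hN]
  · intro k s v h; exact h
  · intro u hu v hv h
    have : u * (n + 1) + v < N := by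
      calc u * (n + 1) + v < u * (n + 1) + (n + 1) := by omega
        _ = (u + 1) * (n + 1) := by ring
        _ ≤ N := by rw [← hN]; gcongr; omega
    omega
  · intro k hk s₁ hs₁ hf hi hN₁ ih
    have r1 : s₁.reg 1 = n := by
      rw [hf.reg 1 (by simp [Prog.WritesReg])]; simp [Prog.after, h1]
    have r21 : s₁.reg 21 = n + 1 := by
      rw [hf.reg 21 (by simp [Prog.WritesReg])]; simp [Prog.after, h1]
    have a3 : s₁.arr 3 = s.arr 3 := by
      rw [hf.arr 3 (by simp [Prog.WritesArr])]; simp [Prog.after]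
    obtain ⟨p, hp⟩ : ∃ p, N - 1 - k = p := ⟨_, rfl⟩
    have hpN : p < N := by omega
    have hpu : p / (n + 1) < n := by
      rw [Nat.div_lt_iff_lt_mul (by omega)]; omega
    have hpv : p % (n + 1) < n + 1 := Nat.mod_lt _ (by omega)
    have hpe : p / (n + 1) * (n + 1) + p % (n + 1) = p := by
      rw [mul_comm]; exact Nat.div_add_mod ..
    obtain ⟨u, hu⟩ : ∃ u, p / (n + 1) = u := ⟨_, rfl⟩
    obtain ⟨v, hv⟩ : ∃ v, p % (n + 1) = v := ⟨_, rfl⟩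
    rw [hu] at hpu hpe
    rw [hv] at hpv hpe
    have hun : u * n + v ≤ N := by
      have : u * n ≤ u * (n + 1) := by gcongr; omega
      omega
    have huv : ∀ u', u' < n → ∀ v' ≤ n, N ≤ u' * (n + 1) + v' + (k + 1) →
        N ≤ u' * (n + 1) + v' + k ∧ u' * (n + 1) + v' ≠ p ∨ u' = u ∧ v' = v := by
      intro u' hu' v' hv' h
      by_cases h2 : N ≤ u' * (n + 1) + v' + k
      · left; exact ⟨h2, by omega⟩
      · right
        have : u' * (n + 1) + v' = p := by omega
        rw [← hu, ← hv, ← this, index_div _ (by omega), index_mod _ (by omega)]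
        exact ⟨rfl, rfl⟩
    refine Runs.le (Runs.of_after (fun _ => ?_) (fun _ => ?_)) ?_
    · simp [Prog.Fits, Prog.after, hi, hN₁, r1, r21, hp, hu, hv, hw0]
      omega
    · simp [Prog.after, hi, hN₁, r1, r21, hp, hu, hv, a3]
      intro u' hu' v' hv' hk'
      rcases huv u' hu' v' hv' hk' with ⟨h2, h3⟩ | ⟨rfl, rfl⟩
      · have := ih u' hu' v' hv' h2
        split_ifs <;> simpa [Function.update_of_ne h3] using this
      · rw [hpe]
        split_ifs with h3 h4
        · simp only [State.setArr_arr, if_true, Function.update_self]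
          refine ⟨by omega, le_rfl, by omega, fun x hx => by omega⟩
        · simp only [State.setArr_arr, if_true, Function.update_self]
          have hA' := hA u' hu' v' (by omega)
          obtain ⟨i1, i2, i3, i4⟩ := ih u' hu' (v' + 1) (by omega) (by omega)
          rw [← add_assoc, hpe] at i1 i2 i3 i4
          refine ⟨by omega, i2, i3, fun x hx => ?_⟩
          by_cases hxv : x = v'
          · rw [hxv]
            intro _ hAx
            exact hA'.2 hAx h4
          · exact i4 x (by omega)
        · simp only [State.setArr_arr, if_true, Function.update_self]
          have hA' := hA u' hu' v' (by omega)
          exact ⟨le_rfl, hv', fun _ => hA'.1 h4, fun x hx => by omega⟩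
    · simp [Prog.size, Expr.cost]
  · intro s' _ hf h
    refine ⟨?_, fun u hu v hv => h u hu v hv (by omega)⟩
    rw [hf.reg 21 (by simp [Prog.WritesReg])]
    simp [Prog.after, h1]
  · simp [Prog.size, Expr.cost]
    nlinarith [Nat.pow_le_pow_left hn 2]

/-- One step of breadth-first search: the node at the head of the queue (array `6`) is joined to its
next neighbour. -/
def searchStep : Prog :=
  (.assign 34 (𝐚 6 (𝐫 31)) ;;
  .assign 35 (𝐚 5 (𝐫 34 * 𝐫 21 + 𝐫 33))) ;;
  .cond (.op .eq (𝐫 35) (𝐫 1))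
    (.assign 31 (𝐫 31 + 𝐜 1) ;; .assign 33 (𝐜 0))
    (.assign 33 (𝐫 35 + 𝐜 1) ;;
    .cond (𝐚 4 (𝐫 30 + 𝐫 35)) .skip
      (.store 4 (𝐫 30 + 𝐫 35) (𝐚 4 (𝐫 30 + 𝐫 34) + 𝐜 1) ;;
      .store 6 (𝐫 32) (𝐫 35) ;;
      .assign 32 (𝐫 32 + 𝐜 1)))

/-- The start of the search: the queue consists of the source.  Registers `31`, `32` and `33` are
`head`, `tail` and `cur` of `SearchInv`. -/
def searchInit : Prog :=
  .assign 30 (𝐫 27 * 𝐫 1) ;;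
  .store 4 (𝐫 30 + 𝐫 27) (𝐜 1) ;;
  .store 6 (𝐜 0) (𝐫 27) ;;
  .assign 31 (𝐜 0) ;;
  .assign 32 (𝐜 1) ;;
  .assign 33 (𝐜 0)

/-- Breadth-first search from the node in register `27`. -/
def searchFrom : Prog := searchInit ;; .loop (.op .lt (𝐫 31) (𝐫 32)) searchStep

theorem degBelow_succ_of {A : ℕ → ℕ → Prop} {u c v : ℕ} (hcv : c ≤ v)
    (hA : ∀ x, c ≤ x → x < v → ¬ A u x) (hv : A u v) :
    degBelow A u (v + 1) = degBelow A u c + 1 := by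
  classical
  unfold degBelow
  rw [Finset.range_add_one, Finset.filter_insert, if_pos hv, Finset.card_insert_of_notMem (by simp)]
  congr 2
  ext x
  simp only [Finset.mem_filter, Finset.mem_range]
  refine ⟨fun ⟨h1, h2⟩ => ⟨?_, h2⟩, fun ⟨h1, h2⟩ => ⟨by omega, h2⟩⟩
  by_contra h
  exact hA x (by omega) h1 h2

theorem degBelow_mono {A : ℕ → ℕ → Prop} {u c v : ℕ} (hcv : c ≤ v) :
    degBelow A u c ≤ degBelow A u v := by
  classical
  exact Finset.card_le_card (Finset.filter_subset_filter _ (Finset.range_subset_range.2 hcv))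

theorem degBelow_eq_of {A : ℕ → ℕ → Prop} {u c n : ℕ} (hcv : c ≤ n)
    (hA : ∀ x, c ≤ x → x < n → ¬ A u x) : degBelow A u c = degBelow A u n := by
  classical
  refine (degBelow_mono hcv).antisymm (Finset.card_le_card fun x hx => ?_)
  simp only [Finset.mem_filter, Finset.mem_range] at hx ⊢
  refine ⟨?_, hx.2⟩
  by_contra h
  exact hA x (by omega) hx.1 hx.2

/-- The state of the search from `src` when `k` more steps may follow.  Every step raises the sum
below, which counts the finished nodes and the links treated so far, and `total` is a bound for it. -/
def SearchState (n : ℕ) (A : ℕ → ℕ → Prop) (src total : ℕ) (a₄ : ℕ → ℕ) (k : ℕ) (s : State) :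
    Prop :=
  SearchInv n A src (fun v => s.arr 4 (src * n + v)) (s.arr 6) (s.reg 31) (s.reg 32) (s.reg 33) ∧
  s.reg 33 ≤ n ∧
  (∑ i ∈ Finset.range (s.reg 31), (degBelow A (s.arr 6 i) n + 1)) +
    degBelow A (s.arr 6 (s.reg 31)) (s.reg 33) + k = total ∧
  ∀ j, (∀ v < n, j ≠ src * n + v) → s.arr 4 j = a₄ j

theorem searchStep_runs {w n src total k : ℕ} {s : State} {A : ℕ → ℕ → Prop} {a₄ : ℕ → ℕ}
    (hn : 2 ≤ n) (hw : 4 * n.size ≤ w) (h1 : s.reg 1 = n) (h21 : s.reg 21 = n + 1)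
    (h30 : s.reg 30 = src * n) (hsrc : src < n) (hJ : IsNeighbourTable n A (s.arr 5))
    (htotal : ∑ v ∈ Finset.range n, (degBelow A v n + 1) = total)
    (hlt : s.reg 31 < s.reg 32) (hs : SearchState n A src total a₄ k s) :
    Runs w searchStep s 80 fun s' => ∃ k' < k, SearchState n A src total a₄ k' s' := by
  have hb := bfs_word_bounds hn hw
  have hw0 : w ≠ 0 := by rintro rfl; omega
  obtain ⟨hI, hcur, hk, hfr⟩ := hs
  have htail := hI.tail_le
  set u := s.arr 6 (s.reg 31) with hu
  have hun : u < n := hI.queue_lt _ hlt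
  set v := s.arr 5 (u * (n + 1) + s.reg 33) with hv
  obtain ⟨j1, j2, j3, j4⟩ := hJ u hun (s.reg 33) hcur
  rw [← hv] at j1 j2 j3 j4
  have hidx : u * (n + 1) + s.reg 33 ≤ n * (n + 1) := by
    calc u * (n + 1) + s.reg 33 ≤ u * (n + 1) + (n + 1) := by omega
      _ = (u + 1) * (n + 1) := by ring
      _ ≤ _ := by gcongr; omega
  have hidx2 : ∀ x < n, src * n + x ≤ n * (n + 1) := by
    intro x hx
    have := index_lt hsrc hx
    have : n * (n + 1) = n * n + n := by ring
    omega
  have hdu : s.arr 4 (src * n + u) ≤ s.reg 31 + 1 := hI.small _ hlt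
  have hsum := hI.sum_le (k := s.reg 31 + 1) hlt (fun x => degBelow A x n + 1)
  rw [htotal, Finset.sum_range_succ, ← hu] at hsum
  have hsrcn := hidx2 0 (by omega)
  refine Runs.le (Runs.step ?_ (Runs.cond (T := 50) ?_ ?_ ?_)) ?_
  · intro _
    simp [Prog.Fits, Prog.after, h21, ← hu]
    omega
  · simp
  · simp only [Prog.after]
    simp [h21, ← hu, ← hv, h1]
    intro hvn
    refine Runs.le (Runs.of_after (fun _ => ?_) (fun _ => ?_)) ?_
    · simp [Prog.Fits, hw0]
      omega
    · have hno : ∀ x, s.reg 33 ≤ x → x < n → ¬ A u x := fun x hx hxn => j4 x hx (by omega)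
      have hdeg := degBelow_eq_of hcur hno
      have h0 : degBelow A (s.arr 6 (s.reg 31 + 1)) 0 = 0 := by simp [degBelow]
      refine ⟨k - 1, by omega, ?_, ?_, ?_, ?_⟩
      · simpa [Prog.after] using hI.advance hlt (fun x hxn hx => hno x hx hxn)
      · simp [Prog.after]
      · simp [Prog.after, Finset.sum_range_succ, ← hu, h0]
        omega
      · simpa [Prog.after] using hfr
    · simp [Prog.size, Expr.cost]
  · simp only [Prog.after]
    simp [h21, ← hu, ← hv, h1]
    intro hvn
    have hvn' : v < n := by omega
    have hAv := j3 hvn'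
    have hdeg := degBelow_succ_of j1 j4 hAv
    have hdeg' : degBelow A u (v + 1) ≤ degBelow A u n := degBelow_mono hvn'
    have hi1 := hidx2 v hvn'
    have hi2 := hidx2 u hun
    refine Runs.le (Runs.of_after (fun _ => ?_) (fun _ => ?_)) ?_
    · simp [Prog.Fits, hw0, Prog.after, h30]
      omega
    · refine ⟨k - 1, by omega, ?_⟩
      simp only [Prog.after, Expr.val_get, Expr.val_add, Expr.val_reg, State.setReg_reg,
        State.setReg_arr, h30]
      simp
      split_ifs with hd
      · have hQ : ∀ i ≤ s.reg 31, Function.update (s.arr 6) (s.reg 32) v i = s.arr 6 i := fun i hi =>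
          Function.update_of_ne (by omega) ..
        refine ⟨?_, ?_, ?_, ?_⟩
        · have := hI.visit hlt hvn' j4 hAv hd
          simp only [← hu] at this
          simp
          convert this using 1
          funext x
          simp [Function.update_apply]
        · simp; omega
        · simp [hQ]
          rw [Finset.sum_congr rfl fun i hi => by rw [hQ i (Finset.mem_range.1 hi).le]]
          rw [← hu]
          omega
        · simp
          intro j hj
          rw [Function.update_of_ne (hj v hvn')]
          exact hfr j hj
      · refine ⟨?_, ?_, ?_, ?_⟩
        · simpa using hI.skip hlt hvn' j4 hd
        · simp; omega
        · simp [← hu]; omega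
        · simpa using hfr
    · simp [Prog.size, Expr.cost]
  · simp [Prog.size, Expr.cost]

/-- Row `src` of array `4` ends up as the distances from `src`, and the other rows are left alone.
-/
theorem searchFrom_runs {w n src total : ℕ} {s : State} {A : ℕ → ℕ → Prop}
    (hn : 2 ≤ n) (hw : 4 * n.size ≤ w) (h1 : s.reg 1 = n) (h21 : s.reg 21 = n + 1)
    (h27 : s.reg 27 = src) (hsrc : src < n) (hJ : IsNeighbourTable n A (s.arr 5))
    (htotal : ∑ v ∈ Finset.range n, (degBelow A v n + 1) = total)
    (h4 : ∀ v < n, s.arr 4 (src * n + v) = 0) :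
    Runs w searchFrom s (100 * total + 100) fun s' =>
      (∃ Q tail cur, SearchInv n A src (fun v => s'.arr 4 (src * n + v)) Q tail tail cur) ∧
      ∀ j, (∀ v < n, j ≠ src * n + v) → s'.arr 4 j = s.arr 4 j := by
  have hb := bfs_word_bounds hn hw
  have hw0 : w ≠ 0 := by rintro rfl; omega
  have hidx := index_lt hsrc hsrc
  have hnn : n * (n + 1) = n * n + n := by ring
  have h0 : degBelow A src 0 = 0 := by simp [degBelow]
  refine Runs.le (Runs.step ?_ (Runs.mono (Runs.loop (T := 80) (K := total)
    (SearchState n A src total (s.arr 4)) ?_ ?_ ?_) le_rfl ?_)) ?_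
  · intro _
    simp [searchInit, Prog.Fits, Prog.after, h1, h27, hw0]
    omega
  · simp
  · intro k s₁ hs₁ hf hI hlt
    refine searchStep_runs hn hw ?_ ?_ ?_ hsrc ?_ htotal ?_ hI
    · rw [hf.reg 1 (by simp [Prog.WritesReg, searchStep])]; simp [Prog.after, searchInit, h1]
    · rw [hf.reg 21 (by simp [Prog.WritesReg, searchStep])]; simp [Prog.after, searchInit, h21]
    · rw [hf.reg 30 (by simp [Prog.WritesReg, searchStep])]
      simp [Prog.after, searchInit, h27, h1]
    · rw [hf.arr 5 (by simp [Prog.WritesArr, searchStep])]; simpa [Prog.after, searchInit] using hJ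
    · by_contra h
      simp [h] at hlt
  · refine ⟨?_, ?_, ?_, ?_⟩
    · simp [Prog.after, searchInit, h1, h27]
      refine SearchInv.init hsrc (fun v hv => ?_) (by simp)
      simp [Function.update_apply, h4 v hv]
    · simp [Prog.after, searchInit]
    · simp [Prog.after, searchInit, h27, h0]
    · simp [Prog.after, searchInit, h27, h1]
      intro j hj
      rw [Function.update_of_ne (hj src hsrc)]
  · rintro s' _ _ ⟨hb, k, hI, hcur, hk, hfr⟩
    refine ⟨⟨s'.arr 6, s'.reg 32, s'.reg 33, ?_⟩, hfr⟩
    have hle := hI.head_le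
    have : s'.reg 31 = s'.reg 32 := by
      by_contra h
      have : s'.reg 31 < s'.reg 32 := by omega
      simp [this] at hb
    rwa [this] at hI
  · simp [Prog.size, Expr.cost, searchInit]
    omega

/-- All distances by breadth-first search from every node. -/
def breadthFirst : Prog :=
  neighbourTable ;;
  .assign 23 (𝐫 1 * 𝐫 1) ;;
  .count 20 23 (.store 4 (𝐫 20) (𝐜 0)) ;;
  .count 27 1 searchFrom

/-- The degrees add up to twice the number of links, so the searches take time `O(n * (n + m))`. -/
theorem sum_degBelow {n m : ℕ} (H : SimpleGraph (Fin n)) (hm : H.edgeSet.ncard ≤ m) :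
    ∑ v ∈ Finset.range n, (degBelow (fun u v => ∃ (hu : u < n) (hv : v < n),
      H.Adj ⟨u, hu⟩ ⟨v, hv⟩) v n + 1) ≤ n + 2 * m := by
  classical
  rw [Finset.sum_add_distrib, Finset.sum_range]
  have : ∀ u : Fin n, degBelow (fun u v => ∃ (hu : u < n) (hv : v < n),
      H.Adj ⟨u, hu⟩ ⟨v, hv⟩) u n = H.degree u := by
    intro u
    rw [← SimpleGraph.card_neighborFinset_eq_degree, degBelow, ← Finset.card_map Fin.valEmbedding]
    congr 1
    ext x
    simp only [Finset.mem_filter, Finset.mem_range, Finset.mem_map, SimpleGraph.mem_neighborFinset,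
      Fin.valEmbedding_apply]
    constructor
    · rintro ⟨hx, hu, hx', h⟩
      exact ⟨⟨x, hx⟩, h, rfl⟩
    · rintro ⟨y, h, rfl⟩
      exact ⟨y.2, u.2, y.2, h⟩
  rw [Finset.sum_congr rfl fun u _ => this u, SimpleGraph.sum_degrees_eq_twice_card_edges]
  rw [← SimpleGraph.coe_edgeFinset, Set.ncard_coe_finset] at hm
  simp
  omega

theorem breadthFirst_computesDistances :
    ComputesDistances breadthFirst (fun _ n m => 1000 * (n * (n + m))) 4 where
  reg x := by
    simp [breadthFirst, neighbourTable, searchFrom, searchInit, searchStep, Prog.WritesReg]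
    omega
  arr x := by
    simp [breadthFirst, neighbourTable, searchFrom, searchInit, searchStep, Prog.WritesArr]
    omega
  tosses := by
    simp [breadthFirst, neighbourTable, searchFrom, searchInit, searchStep, Prog.Tosses]
  runs := by
    intro w n m s H hn hw h1 hm hA
    have hb := bfs_word_bounds hn hw
    have hnn : n * (n + 1) = n * n + n := by ring
    set A : ℕ → ℕ → Prop := fun u v => ∃ (hu : u < n) (hv : v < n), H.Adj ⟨u, hu⟩ ⟨v, hv⟩ with hAdef
    obtain ⟨total, htotal⟩ : ∃ t, ∑ v ∈ Finset.range n, (degBelow A v n + 1) = t := ⟨_, rfl⟩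
    have htm : total ≤ n + 2 * m := htotal ▸ sum_degBelow H hm
    have hA' : ∀ u < n, ∀ v < n, s.arr 3 (u * n + v) ≠ 0 ↔ A u v := by
      intro u hu v hv
      have := hA ⟨u, hu⟩ ⟨v, hv⟩
      simp only at this
      rw [this]
      simp [A, hu, hv]
    refine Runs.le (Runs.seq (neighbourTable_runs hn hw h1 hA') fun s₁ hs₁ hf₁ ⟨h21, hJ⟩ =>
      Runs.step (T := n * n * (4 + 8) + 6 + (n * (100 * total + 100 + 8) + 6)) ?_
      (Runs.seq (Q := fun s' => ∀ j < n * n, s'.arr 4 j = 0) (Runs.mono (Runs.count (N := n * n)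
        (fun k s' => ∀ j < k, s'.arr 4 j = 0) ?_ ?_ ?_ ?_ ?_ ?_ ?_) le_rfl ?_)
        fun s₂ hs₂ hf₂ hz => Runs.mono (Runs.count (N := n) (T := 100 * total + 100)
        (fun k s' => (∀ i v : Fin n, i < k →
          s'.arr 4 (i * n + v) = encodeDist (H.edist i v)) ∧
          ∀ i < n, k ≤ i → ∀ v < n, s'.arr 4 (i * n + v) = 0) ?_ ?_ ?_ ?_ ?_ ?_ ?_) le_rfl ?_)) ?_
    · intro _
      have r1 : s₁.reg 1 = n := by
        rw [hf₁.reg 1 (by simp [neighbourTable, Prog.WritesReg]), h1]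
      simp [Prog.Fits, r1]
      omega
    · simp [Prog.WritesReg]
    · simp [Prog.WritesReg]
    · simp
    · have r1 : s₁.reg 1 = n := by
        rw [hf₁.reg 1 (by simp [neighbourTable, Prog.WritesReg]), h1]
      simp [Prog.after, r1]
    · intro k s v h; exact h
    · intro j hj; omega
    · intro k hk s₂ hs₂ hf₂ hi hN ih
      refine Runs.le (Runs.of_after (fun _ => ?_) (fun _ => ?_)) ?_
      · simp [Prog.Fits]
      · intro j hj
        simp [Prog.after, hi, Function.update_apply]
        intro hne
        exact ih j (by omega)
      · simp [Prog.size, Expr.cost]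
    · intro s' _ _ h; exact h
    · simp [searchFrom, searchInit, searchStep, Prog.WritesReg]
    · simp [searchFrom, searchInit, searchStep, Prog.WritesReg]
    · simp
    · rw [hf₂.reg 1 (by simp [Prog.WritesReg])]
      simp only [Prog.after, State.setReg_reg]
      simp [hf₁.reg 1 (by simp [neighbourTable, Prog.WritesReg]), h1]
    · intro k s v h; exact h
    · refine ⟨fun _ _ h => absurd h (by omega), fun i hi _ v hv => hz _ (index_lt hi hv)⟩
    · intro k hk s₃ hs₃ hf₃ hi hN ih
      refine Runs.mono (searchFrom_runs (src := k) (total := total) hn hw hN ?_ hi hk ?_ htotal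
        (ih.2 k hk le_rfl)) le_rfl ?_
      · rw [hf₃.reg 21 (by simp [searchFrom, searchInit, searchStep, Prog.WritesReg]),
          hf₂.reg 21 (by simp [Prog.WritesReg])]
        simp [Prog.after, h21]
      · rw [hf₃.arr 5 (by simp [searchFrom, searchInit, searchStep, Prog.WritesArr]),
          hf₂.arr 5 (by simp [Prog.WritesArr])]
        exact hJ
      · rintro s₄ _ _ ⟨h4, h5⟩
        have hne : ∀ i, i ≠ k → ∀ v < n, s₄.arr 4 (i * n + v) = s₃.arr 4 (i * n + v) := by
          intro i hik v hv
          refine h5 _ fun v' hv' hc => hik ?_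
          rw [← index_div i hv, hc, index_div k hv']
        refine ⟨fun i v hik => ?_, fun i hi' hki v hv => ?_⟩
        · rcases Nat.lt_succ_iff_lt_or_eq.1 hik with hik | hik
          · rw [hne i (by omega) v v.2]
            exact ih.1 i v hik
          · rw [← hik] at h4
            obtain ⟨Q, tail, cur, hI⟩ := h4
            refine eq_encodeDist H i (fun v => s₄.arr 4 (i * n + v)) hI.source ?_ ?_ v
            · intro v hv
              rcases hI.parent v v.2 hv with ⟨h2, h3⟩ | ⟨x, hx, ⟨_, _, hA⟩, h2⟩
              · exact .inl ⟨Fin.ext h2, h3⟩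
              · exact .inr ⟨⟨x, hx⟩, hA, h2⟩
            · intro x y hx hxy
              exact hI.found_of_adj x.2 y.2 hx ⟨x.2, y.2, hxy⟩
        · rw [hne i (by omega) v hv]
          exact ih.2 i hi' (by omega) v hv
    · rintro s' _ _ ⟨h, -⟩ u v
      exact h u v u.2
    · simp [Prog.size, Expr.cost]
      nlinarith [Nat.mul_le_mul_left n htm]

end DSO

/-! ### Powers of bilinear algorithms -/

namespace MatMul

theorem sum_range_mul {M : Type*} [AddCommMonoid M] (f : ℕ → M) (a b : ℕ) :
    ∑ i ∈ Finset.range (a * b), f i =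
      ∑ i ∈ Finset.range a, ∑ j ∈ Finset.range b, f (i * b + j) := by
  induction a with
  | zero => simp
  | succ a ih => rw [Nat.succ_mul, Finset.sum_range_add, ih, Finset.sum_range_succ]

variable {R : Type*} [CommRing R]

/-- The entries of the `i`-th Kronecker power of the matrix `α`, whose rows are indexed by digits to
base `r` and whose columns are indexed by digits to base `q`. -/
def kron (α : ℕ → ℕ → R) (r q : ℕ) : ℕ → ℕ → ℕ → R
  | 0, _, _ => 1
  | i + 1, p, a => α (p % r) (a % q) * kron α r q i (p / r) (a / q)

theorem kron_succ (α : ℕ → ℕ → R) {r q i ρ b : ℕ} (p a : ℕ) (hρ : ρ < r) (hb : b < q) :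
    kron α r q (i + 1) (p * r + ρ) (a * q + b) = α ρ b * kron α r q i p a := by
  rw [kron, DSO.index_div _ hρ, DSO.index_div _ hb, DSO.index_mod _ hρ, DSO.index_mod _ hb]

/-- The step of Yates's algorithm: multiplying with the Kronecker power one factor at a time.  After
`i` steps, the vector has `q ^ (H - i) * r ^ i` entries: the leading `H - i` digits of an index still
belong to the input, and the others to the output. -/
theorem kron_step (α : ℕ → ℕ → R) {r q i H : ℕ} (hi : i < H) {X₀ X X' : ℕ → R}
    (hX : ∀ c < q ^ (H - i), ∀ p < r ^ i, X (c * r ^ i + p) =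
      ∑ a ∈ Finset.range (q ^ i), kron α r q i p a * X₀ (a * q ^ (H - i) + c))
    (hX' : ∀ y < q ^ (H - (i + 1)) * r ^ i, ∀ ρ < r, X' (y * r + ρ) =
      ∑ b ∈ Finset.range q, α ρ b * X (b * (q ^ (H - (i + 1)) * r ^ i) + y)) :
    ∀ c < q ^ (H - (i + 1)), ∀ p < r ^ (i + 1), X' (c * r ^ (i + 1) + p) =
      ∑ a ∈ Finset.range (q ^ (i + 1)),
        kron α r q (i + 1) p a * X₀ (a * q ^ (H - (i + 1)) + c) := by
  intro c hc p hp
  obtain ⟨j, hj⟩ : ∃ j, H - (i + 1) = j := ⟨_, rfl⟩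
  have hj' : H - i = j + 1 := by omega
  rw [hj] at hc hX' ⊢
  rw [hj'] at hX
  have hr : 0 < r := by
    rcases Nat.eq_zero_or_pos r with rfl | h
    · simp at hp
    · exact h
  have hp' : p / r < r ^ i := by
    rw [Nat.div_lt_iff_lt_mul hr, ← pow_succ]; exact hp
  have hρ : p % r < r := Nat.mod_lt _ hr
  obtain ⟨p', ρ, rfl, rfl, hp', hρ⟩ : ∃ p' ρ, p' = p / r ∧ ρ = p % r ∧ p' < r ^ i ∧ ρ < r :=
    ⟨_, _, rfl, rfl, hp', hρ⟩
  have hpe : p / r * r + p % r = p := by rw [mul_comm]; exact Nat.div_add_mod ..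
  have hy : c * r ^ i + p / r < q ^ j * r ^ i := by
    calc c * r ^ i + p / r < c * r ^ i + r ^ i := by omega
      _ = (c + 1) * r ^ i := by ring
      _ ≤ _ := by gcongr; omega
  have h1 : c * r ^ (i + 1) + p = (c * r ^ i + p / r) * r + p % r := by
    conv_lhs => rw [← hpe]
    ring
  rw [h1, hX' _ hy _ hρ, pow_succ, sum_range_mul, Finset.sum_comm]
  refine Finset.sum_congr rfl fun b hb => ?_
  have hb' := Finset.mem_range.1 hb
  have h2 : b * (q ^ j * r ^ i) + (c * r ^ i + p / r) = (b * q ^ j + c) * r ^ i + p / r := by ring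
  have h3 : b * q ^ j + c < q ^ (j + 1) := by
    calc b * q ^ j + c < b * q ^ j + q ^ j := by omega
      _ = (b + 1) * q ^ j := by ring
      _ ≤ q * q ^ j := by gcongr; omega
      _ = _ := by ring
  rw [h2, hX _ h3 _ hp', Finset.mul_sum]
  refine Finset.sum_congr rfl fun a _ => ?_
  conv_rhs => rw [← hpe, kron_succ _ _ _ hρ hb']
  rw [mul_assoc]
  congr 3
  ring

/-- A bilinear algorithm over `ℤ` that computes `Q` times the product of `n₀ × n₀` matrices with
`r` multiplications.  Entry `(u, v)` of a matrix has the index `u * n₀ + v`. -/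
structure BilinearAlgorithm (n₀ r Q : ℕ) where
  α : ℕ → ℕ → ℤ
  β : ℕ → ℕ → ℤ
  γ : ℕ → ℕ → ℤ
  eq : ∀ x < n₀, ∀ y < n₀, ∀ u < n₀, ∀ v < n₀, ∀ v' < n₀, ∀ z < n₀,
    ∑ ρ ∈ Finset.range r, γ (x * n₀ + y) ρ * α ρ (u * n₀ + v) * β ρ (v' * n₀ + z) =
      if x = u ∧ v = v' ∧ z = y then (Q : ℤ) else 0

/-- The index of the entry `(u, v)` of an `n₀ ^ i × n₀ ^ i` matrix: the digits of `u` and `v` are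
interleaved. -/
def interleave (n₀ : ℕ) : ℕ → ℕ → ℕ → ℕ
  | 0, _, _ => 0
  | i + 1, u, v => interleave n₀ i (u / n₀) (v / n₀) * (n₀ * n₀) + (u % n₀ * n₀ + v % n₀)

theorem interleave_lt {n₀ : ℕ} (h : 0 < n₀) (i u v : ℕ) : interleave n₀ i u v < (n₀ * n₀) ^ i := by
  induction i generalizing u v with
  | zero => simp [interleave]
  | succ i ih =>
    rw [interleave, pow_succ]
    have h1 := DSO.index_lt (Nat.mod_lt u h) (Nat.mod_lt v h)
    calc _ < interleave n₀ i (u / n₀) (v / n₀) * (n₀ * n₀) + n₀ * n₀ := by omega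
      _ = (interleave n₀ i (u / n₀) (v / n₀) + 1) * (n₀ * n₀) := by ring
      _ ≤ _ := by gcongr; exact ih _ _

theorem interleave_succ {n₀ a b : ℕ} (i u v : ℕ) (ha : a < n₀) (hb : b < n₀) :
    interleave n₀ (i + 1) (u * n₀ + a) (v * n₀ + b) =
      interleave n₀ i u v * (n₀ * n₀) + (a * n₀ + b) := by
  rw [interleave, DSO.index_div _ ha, DSO.index_div _ hb, DSO.index_mod _ ha, DSO.index_mod _ hb]

/-- Every index of a matrix entry is the interleaved index of exactly one pair. -/
theorem sum_interleave {n₀ : ℕ} (i : ℕ) (f : ℕ → R) :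
    ∑ a ∈ Finset.range ((n₀ * n₀) ^ i), f a =
      ∑ u ∈ Finset.range (n₀ ^ i), ∑ v ∈ Finset.range (n₀ ^ i), f (interleave n₀ i u v) := by
  induction i generalizing f with
  | zero => simp [interleave]
  | succ i ih =>
    rw [pow_succ, sum_range_mul, ih (fun a => ∑ j ∈ Finset.range (n₀ * n₀), f (a * (n₀ * n₀) + j)),
      pow_succ, sum_range_mul]
    refine Finset.sum_congr rfl fun u _ => ?_
    simp_rw [sum_range_mul]
    rw [Finset.sum_comm]
    refine Finset.sum_congr rfl fun a ha => Finset.sum_congr rfl fun v _ =>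
      Finset.sum_congr rfl fun b hb => ?_
    rw [interleave_succ _ _ _ (Finset.mem_range.1 ha) (Finset.mem_range.1 hb)]

variable {n₀ r Q : ℕ} (B : BilinearAlgorithm n₀ r Q)

/-- The identity that defines a bilinear algorithm, for the `i`-th power of the algorithm. -/
theorem sum_kron (hn : 0 < n₀) (i : ℕ) (x y u v v' z : ℕ)
    (hx : x < n₀ ^ i) (hy : y < n₀ ^ i) (hu : u < n₀ ^ i) (hv : v < n₀ ^ i) (hv' : v' < n₀ ^ i)
    (hz : z < n₀ ^ i) :
    ∑ p ∈ Finset.range (r ^ i), kron B.γ (n₀ * n₀) r i (interleave n₀ i x y) p *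
      kron B.α r (n₀ * n₀) i p (interleave n₀ i u v) *
      kron B.β r (n₀ * n₀) i p (interleave n₀ i v' z) =
      if x = u ∧ v = v' ∧ z = y then (Q : ℤ) ^ i else 0 := by
  induction i generalizing x y u v v' z with
  | zero =>
    simp only [pow_zero, Nat.lt_one_iff] at *
    subst hx hy hu hv hv' hz
    simp [kron]
  | succ i ih =>
    have hd : ∀ {k}, k < n₀ ^ (i + 1) → k / n₀ < n₀ ^ i := fun hk => by
      rw [Nat.div_lt_iff_lt_mul hn, ← pow_succ]; exact hk
    have hm : ∀ k, k % n₀ < n₀ := fun k => Nat.mod_lt k hn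
    have hmd : ∀ k l : ℕ, k = l ↔ k / n₀ = l / n₀ ∧ k % n₀ = l % n₀ := fun k l =>
      ⟨by rintro rfl; exact ⟨rfl, rfl⟩, fun ⟨h1, h2⟩ => by
        rw [← Nat.div_add_mod k n₀, h1, h2, Nat.div_add_mod]⟩
    rw [pow_succ, sum_range_mul]
    have : ∀ p ∈ Finset.range (r ^ i), ∀ ρ ∈ Finset.range r,
        kron B.γ (n₀ * n₀) r (i + 1) (interleave n₀ (i + 1) x y) (p * r + ρ) *
          kron B.α r (n₀ * n₀) (i + 1) (p * r + ρ) (interleave n₀ (i + 1) u v) *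
          kron B.β r (n₀ * n₀) (i + 1) (p * r + ρ) (interleave n₀ (i + 1) v' z) =
        (kron B.γ (n₀ * n₀) r i (interleave n₀ i (x / n₀) (y / n₀)) p *
          kron B.α r (n₀ * n₀) i p (interleave n₀ i (u / n₀) (v / n₀)) *
          kron B.β r (n₀ * n₀) i p (interleave n₀ i (v' / n₀) (z / n₀))) *
        (B.γ (x % n₀ * n₀ + y % n₀) ρ * B.α ρ (u % n₀ * n₀ + v % n₀) *
          B.β ρ (v' % n₀ * n₀ + z % n₀)) := by
      intro p _ ρ hρ
      have hρ' := Finset.mem_range.1 hρ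
      simp only [interleave]
      rw [kron_succ _ _ _ (DSO.index_lt (hm x) (hm y)) hρ', kron_succ _ _ _ hρ' (DSO.index_lt (hm u) (hm v)),
        kron_succ _ _ _ hρ' (DSO.index_lt (hm v') (hm z))]
      ring
    rw [Finset.sum_congr rfl fun p hp => Finset.sum_congr rfl (this p hp)]
    simp_rw [← Finset.mul_sum]
    rw [B.eq _ (hm x) _ (hm y) _ (hm u) _ (hm v) _ (hm v') _ (hm z), ← Finset.sum_mul,
      ih _ _ _ _ _ _ (hd hx) (hd hy) (hd hu) (hd hv) (hd hv') (hd hz)]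
    have e : (x = u ∧ v = v' ∧ z = y) ↔ (x / n₀ = u / n₀ ∧ v / n₀ = v' / n₀ ∧ z / n₀ = y / n₀) ∧
        (x % n₀ = u % n₀ ∧ v % n₀ = v' % n₀ ∧ z % n₀ = y % n₀) := by
      rw [hmd x u, hmd v v', hmd z y]; tauto
    rw [if_congr e rfl rfl]
    conv_rhs => rw [ite_and]
    split_ifs <;> ring

theorem map_kron (α : ℕ → ℕ → ℤ) (r q i p a : ℕ) :
    ((kron α r q i p a : ℤ) : R) = kron (fun x y => (α x y : R)) r q i p a := by
  induction i generalizing p a with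
  | zero => simp [kron]
  | succ i ih => simp [kron, ih]

/-- The `i`-th power of the algorithm multiplies `n₀ ^ i × n₀ ^ i` matrices over every commutative
ring. -/
theorem kron_mul (hn : 0 < n₀) (i : ℕ) (X Y : ℕ → R) {x y : ℕ} (hx : x < n₀ ^ i)
    (hy : y < n₀ ^ i) :
    ∑ p ∈ Finset.range (r ^ i),
      kron (fun a b => (B.γ a b : R)) (n₀ * n₀) r i (interleave n₀ i x y) p *
      ((∑ a ∈ Finset.range ((n₀ * n₀) ^ i), kron (fun a b => (B.α a b : R)) r (n₀ * n₀) i p a * X a) *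
      (∑ b ∈ Finset.range ((n₀ * n₀) ^ i), kron (fun a b => (B.β a b : R)) r (n₀ * n₀) i p b * Y b)) =
      Q ^ i * ∑ v ∈ Finset.range (n₀ ^ i), X (interleave n₀ i x v) * Y (interleave n₀ i v y) := by
  simp_rw [sum_interleave, ← map_kron]
  have h : ∀ u ∈ Finset.range (n₀ ^ i), ∀ v ∈ Finset.range (n₀ ^ i), ∀ v' ∈ Finset.range (n₀ ^ i),
      ∀ z ∈ Finset.range (n₀ ^ i), ∑ p ∈ Finset.range (r ^ i),
        ((kron B.γ (n₀ * n₀) r i (interleave n₀ i x y) p : ℤ) : R) *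
        (kron B.α r (n₀ * n₀) i p (interleave n₀ i u v) : ℤ) *
        (kron B.β r (n₀ * n₀) i p (interleave n₀ i v' z) : ℤ) =
        if x = u ∧ v = v' ∧ z = y then (Q : R) ^ i else 0 := by
    intro u hu v hv v' hv' z hz
    have := congrArg (Int.cast : ℤ → R) (sum_kron B hn i x y u v v' z hx hy (Finset.mem_range.1 hu)
      (Finset.mem_range.1 hv) (Finset.mem_range.1 hv') (Finset.mem_range.1 hz))
    push_cast at this
    exact this
  calc _ = ∑ u ∈ Finset.range (n₀ ^ i), ∑ v ∈ Finset.range (n₀ ^ i), ∑ v' ∈ Finset.range (n₀ ^ i),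
      ∑ z ∈ Finset.range (n₀ ^ i), (∑ p ∈ Finset.range (r ^ i),
        ((kron B.γ (n₀ * n₀) r i (interleave n₀ i x y) p : ℤ) : R) *
        (kron B.α r (n₀ * n₀) i p (interleave n₀ i u v) : ℤ) *
        (kron B.β r (n₀ * n₀) i p (interleave n₀ i v' z) : ℤ)) *
        (X (interleave n₀ i u v) * Y (interleave n₀ i v' z)) := by
        simp_rw [Finset.sum_mul, Finset.mul_sum]
        rw [Finset.sum_comm]
        refine Finset.sum_congr rfl fun u _ => ?_
        rw [Finset.sum_comm]
        refine Finset.sum_congr rfl fun v _ => ?_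
        rw [Finset.sum_comm]
        refine Finset.sum_congr rfl fun v' _ => ?_
        rw [Finset.sum_comm]
        refine Finset.sum_congr rfl fun z _ => ?_
        refine Finset.sum_congr rfl fun p _ => ?_
        ring
    _ = ∑ u ∈ Finset.range (n₀ ^ i), ∑ v ∈ Finset.range (n₀ ^ i), ∑ v' ∈ Finset.range (n₀ ^ i),
      ∑ z ∈ Finset.range (n₀ ^ i), (if x = u ∧ v = v' ∧ z = y then (Q : R) ^ i else 0) *
        (X (interleave n₀ i u v) * Y (interleave n₀ i v' z)) := by
        refine Finset.sum_congr rfl fun u hu => Finset.sum_congr rfl fun v hv =>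
          Finset.sum_congr rfl fun v' hv' => Finset.sum_congr rfl fun z hz => ?_
        rw [h u hu v hv v' hv' z hz]
    _ = _ := by
        rw [Finset.sum_eq_single_of_mem x (Finset.mem_range.2 hx), Finset.mul_sum]
        · refine Finset.sum_congr rfl fun v hv => ?_
          rw [Finset.sum_eq_single_of_mem v hv, Finset.sum_eq_single_of_mem y (Finset.mem_range.2 hy)]
          · simp
          · intro z _ hz; simp [hz]
          · intro v' _ hv'; simp [hv'.symm]
        · intro u _ hu
          simp [hu.symm]

end MatMul

namespace WordRAM

variable {w : ℕ} {s : State}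

theorem Runs.store (a : ℕ) (i e : Expr) :
    Runs w (.store a i e) s (Prog.store a i e).size
      fun s' => s' = s.setArr a (i.eval w s) (e.eval w s) := fun _ =>
  ⟨_, _, .store a i e s, le_rfl, rfl⟩

theorem Expr.cast_eval_add (e₁ e₂ : Expr) :
    (((e₁ + e₂).eval w s : ℕ) : ZMod (2 ^ w)) = e₁.eval w s + e₂.eval w s := by
  change (((e₁.eval w s + e₂.eval w s) % 2 ^ w : ℕ) : ZMod (2 ^ w)) = _
  rw [ZMod.natCast_mod, Nat.cast_add]

theorem Expr.cast_eval_mul (e₁ e₂ : Expr) :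
    (((e₁ * e₂).eval w s : ℕ) : ZMod (2 ^ w)) = e₁.eval w s * e₂.eval w s := by
  change (((e₁.eval w s * e₂.eval w s) % 2 ^ w : ℕ) : ZMod (2 ^ w)) = _
  rw [ZMod.natCast_mod, Nat.cast_mul]

theorem Expr.cast_eval_const (c : ℕ) : (((𝐜 c).eval w s : ℕ) : ZMod (2 ^ w)) = c := by
  change ((c % 2 ^ w : ℕ) : ZMod (2 ^ w)) = _
  rw [ZMod.natCast_mod]

end WordRAM

namespace MatMul

/-! ### The program for matrix multiplication -/

/-- An integer constant modulo `2 ^ w`; register `40` holds `2 ^ w - 1`, which stands for `-1`.  In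
the middle of matrix multiplication, numbers are negative or large, and machine words are read as
elements of `ZMod (2 ^ w)`. -/
def intExpr (z : ℤ) : Expr := if 0 ≤ z then 𝐜 z.toNat else 𝐜 (-z).toNat * 𝐫 40

variable {w : ℕ} {s : State}

theorem cast_eval_intExpr (h : s.reg 40 + 1 = 2 ^ w) (z : ℤ) :
    (((intExpr z).eval w s : ℕ) : ZMod (2 ^ w)) = z := by
  unfold intExpr
  split_ifs with hz
  · rw [Expr.cast_eval_const, ← Int.cast_natCast, Int.toNat_of_nonneg hz]
  · rw [Expr.cast_eval_mul, Expr.cast_eval_const, ← Int.cast_natCast,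
      Int.toNat_of_nonneg (by omega)]
    have : ((s.reg 40 : ℕ) : ZMod (2 ^ w)) + 1 = 0 := by
      have h2 := congrArg (Nat.cast : ℕ → ZMod (2 ^ w)) h
      rw [ZMod.natCast_self] at h2
      exact_mod_cast h2
    change ((-z : ℤ) : ZMod (2 ^ w)) * ((s.reg 40 : ℕ) : ZMod (2 ^ w)) = _
    rw [eq_neg_of_add_eq_zero_left this]
    push_cast
    ring

/-- The sum of `c b * A[b * S' + y]` over `b < k`, where `S'` and `y` are in registers `53`, `54`. -/
def dotExpr (A : ℕ) (c : ℕ → ℤ) : ℕ → Expr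
  | 0 => 𝐜 0
  | k + 1 => dotExpr A c k + intExpr (c k) * 𝐚 A (𝐜 k * 𝐫 53 + 𝐫 54)

theorem cast_eval_dotExpr (hs : s.WF w) (h : s.reg 40 + 1 = 2 ^ w) (A : ℕ) (c : ℕ → ℤ) {k S' y : ℕ}
    (hS : s.reg 53 = S') (hy : s.reg 54 = y) (hk : k ≤ 2 ^ w)
    (hb : ∀ b < k, b * S' + y < 2 ^ w) :
    (((dotExpr A c k).eval w s : ℕ) : ZMod (2 ^ w)) =
      ∑ b ∈ Finset.range k, (c b : ZMod (2 ^ w)) * ((s.arr A (b * S' + y) : ℕ) : ZMod (2 ^ w)) := by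
  induction k with
  | zero => simp [dotExpr, Expr.cast_eval_const]
  | succ k ih =>
    rw [dotExpr, Expr.cast_eval_add, Expr.cast_eval_mul, cast_eval_intExpr h,
      ih (by omega) (fun b hb' => hb b (by omega)), Finset.sum_range_succ]
    have h1 := hb k (by omega)
    rw [Expr.eval_eq_val (e := 𝐚 A (𝐜 k * 𝐫 53 + 𝐫 54)) hs]
    · simp [hS, hy]
    · simp [hS, hy]
      omega

/-- Writing the first `k` entries of block `y` of the transformed array to array `15`. -/
def blockProg (A : ℕ) (c : ℕ → ℕ → ℤ) (q r : ℕ) : ℕ → Prog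
  | 0 => .skip
  | k + 1 => blockProg A c q r k ;; .store 15 (𝐫 54 * 𝐜 r + 𝐜 k) (dotExpr A (c k) q)

theorem blockProg_writesReg (A : ℕ) (c : ℕ → ℕ → ℤ) (q r k x : ℕ) :
    ¬ (blockProg A c q r k).WritesReg x := by
  induction k with
  | zero => simp [blockProg, Prog.WritesReg]
  | succ k ih => simpa [blockProg, Prog.WritesReg] using ih

theorem blockProg_writesArr (A : ℕ) (c : ℕ → ℕ → ℤ) (q r k x : ℕ) :
    (blockProg A c q r k).WritesArr x → x = 15 := by
  induction k with
  | zero => simp [blockProg, Prog.WritesArr]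
  | succ k ih =>
    simp only [blockProg, Prog.WritesArr]
    exact fun h => h.elim ih id

theorem blockProg_tosses (A : ℕ) (c : ℕ → ℕ → ℤ) (q r k : ℕ) :
    ¬ (blockProg A c q r k).Tosses := by
  induction k with
  | zero => simp [blockProg, Prog.Tosses]
  | succ k ih => simpa [blockProg, Prog.Tosses] using ih

theorem blockProg_runs (h : s.reg 40 + 1 = 2 ^ w) {A : ℕ} (hA : A ≠ 15) (c : ℕ → ℕ → ℤ)
    {q r k S' y : ℕ} (hS : s.reg 53 = S') (hy : s.reg 54 = y) (hq : q < 2 ^ w)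
    (hb : ∀ b < q, b * S' + y < 2 ^ w) (hr : r < 2 ^ w) (hk : k ≤ r) (hyr : y * r + r < 2 ^ w) :
    Runs w (blockProg A c q r k) s (blockProg A c q r k).size fun s' =>
      (∀ ρ < k, ((s'.arr 15 (y * r + ρ) : ℕ) : ZMod (2 ^ w)) = ∑ b ∈ Finset.range q,
        (c ρ b : ZMod (2 ^ w)) * ((s.arr A (b * S' + y) : ℕ) : ZMod (2 ^ w))) ∧
      ∀ j, (∀ ρ < k, j ≠ y * r + ρ) → s'.arr 15 j = s.arr 15 j := by
  induction k with
  | zero => exact Runs.of_after (fun _ => trivial) fun _ => ⟨by omega, fun _ _ => rfl⟩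
  | succ k ih =>
    refine Runs.seq (ih (by omega)) fun s₁ hs₁ hf ⟨h1, h2⟩ => Runs.mono (Runs.store _ _ _) le_rfl ?_
    rintro s₂ - - rfl
    have r53 : s₁.reg 53 = S' := by rw [hf.reg _ (blockProg_writesReg _ _ _ _ _ _), hS]
    have r54 : s₁.reg 54 = y := by rw [hf.reg _ (blockProg_writesReg _ _ _ _ _ _), hy]
    have r40 : s₁.reg 40 + 1 = 2 ^ w := by rw [hf.reg _ (blockProg_writesReg _ _ _ _ _ _), h]
    have aA : s₁.arr A = s.arr A := hf.arr _ fun h => hA (blockProg_writesArr _ _ _ _ _ _ h)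
    rw [Expr.eval_eq_val (e := 𝐫 54 * 𝐜 r + 𝐜 k) hs₁ (by simp [r54]; omega)]
    simp only [State.setArr_arr, if_true, Expr.val_add, Expr.val_mul, Expr.val_reg, Expr.val_const,
      r54]
    refine ⟨fun ρ hρ => ?_, fun j hj => ?_⟩
    · rcases Nat.lt_succ_iff_lt_or_eq.1 hρ with hρ' | rfl
      · rw [Function.update_of_ne (by omega), h1 ρ hρ']
      · rw [Function.update_self, cast_eval_dotExpr hs₁ r40 A (c ρ) r53 r54 hq.le hb, aA]
    · rw [Function.update_of_ne (hj k (by omega)), h2 j fun ρ hρ => hj ρ (by omega)]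

/-- Multiplying the vector in array `A`, which has as many entries as register `52` says, with a
Kronecker power of the matrix `c` with `r` rows and `q` columns.  The exponent is in register `42`. -/
def kronProg (A : ℕ) (c : ℕ → ℕ → ℤ) (q r : ℕ) : Prog :=
  .count 56 42 (
    .assign 53 (𝐫 52 / 𝐜 q) ;;
    .count 54 53 (blockProg A c q r r) ;;
    .assign 52 (𝐫 53 * 𝐜 r) ;;
    .count 55 52 (.store A (𝐫 55) (𝐚 15 (𝐫 55))))

theorem kronProg_writesReg {A : ℕ} {c : ℕ → ℕ → ℤ} {q r x : ℕ} :
    (kronProg A c q r).WritesReg x → x = 52 ∨ x = 53 ∨ x = 54 ∨ x = 55 ∨ x = 56 := by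
  simp [kronProg, Prog.WritesReg, blockProg_writesReg]
  omega

theorem kronProg_writesArr {A : ℕ} {c : ℕ → ℕ → ℤ} {q r x : ℕ} :
    (kronProg A c q r).WritesArr x → x = A ∨ x = 15 := by
  simp only [kronProg, Prog.WritesArr, Prog.count_writesArr, false_or]
  rintro (h | h)
  · exact .inr (blockProg_writesArr _ _ _ _ _ _ h)
  · exact .inl h

theorem kronProg_tosses {A : ℕ} {c : ℕ → ℕ → ℤ} {q r : ℕ} : ¬ (kronProg A c q r).Tosses := by
  simp [kronProg, Prog.Tosses, blockProg_tosses]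

/-- Yates's algorithm multiplies with a Kronecker power, up to a constant factor in the time as fast
as the largest intermediate vector can be written down. The arithmetic is modulo `2 ^ w`. -/
theorem kronProg_runs (h : s.reg 40 + 1 = 2 ^ w) {A : ℕ} (hA : A ≠ 15) (c : ℕ → ℕ → ℤ)
    {q r H M : ℕ} (hq : 0 < q) (hr : 0 < r) (hH : s.reg 42 = H) (hS : s.reg 52 = q ^ H)
    (hM : ∀ i ≤ H, q ^ (H - i) * r ^ i ≤ M) (hMw : M < 2 ^ w) (hqw : q < 2 ^ w) (hrw : r < 2 ^ w) :
    Runs w (kronProg A c q r) s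
      ((H + 1) * (M + 1) * ((blockProg A c q r r).size + 100)) fun s' =>
      s'.reg 52 = r ^ H ∧
      ∀ p < r ^ H, ((s'.arr A p : ℕ) : ZMod (2 ^ w)) = ∑ a ∈ Finset.range (q ^ H),
        kron (fun x y => (c x y : ZMod (2 ^ w))) r q H p a * ((s.arr A a : ℕ) : ZMod (2 ^ w)) := by
  have hw0 : w ≠ 0 := by rintro rfl; simp at hqw; omega
  obtain ⟨B, hB⟩ : ∃ B, (blockProg A c q r r).size = B := ⟨_, rfl⟩
  refine Runs.mono (Runs.count (N := H) (T := (M + 1) * (B + 40)) (fun i s' =>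
    s'.reg 52 = q ^ (H - i) * r ^ i ∧ ∀ d < q ^ (H - i), ∀ p < r ^ i,
      ((s'.arr A (d * r ^ i + p) : ℕ) : ZMod (2 ^ w)) = ∑ a ∈ Finset.range (q ^ i),
        kron (fun x y => (c x y : ZMod (2 ^ w))) r q i p a *
          ((s.arr A (a * q ^ (H - i) + d) : ℕ) : ZMod (2 ^ w))) ?_ ?_ (by omega) hH ?_ ?_ ?_) ?_ ?_
  · simp [Prog.WritesReg, blockProg_writesReg]
  · simp [Prog.WritesReg, blockProg_writesReg]
  · rintro k s v ⟨h1, h2⟩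
    exact ⟨by simpa using h1, h2⟩
  · refine ⟨by simp [hS], fun d hd p hp => ?_⟩
    simp only [pow_zero, Nat.lt_one_iff] at hp
    subst hp
    simp [kron]
  · rintro i hi s₁ hs₁ hf hi' hHr ⟨h52, hX⟩
    have hqi : q ^ (H - i) = q ^ (H - (i + 1)) * q := by
      rw [← pow_succ]; congr 1; omega
    have r40 : s₁.reg 40 + 1 = 2 ^ w := by
      rw [hf.reg 40 fun hc => by have := kronProg_writesReg hc; omega, h]
    obtain ⟨S', hS'⟩ : ∃ S', q ^ (H - (i + 1)) * r ^ i = S' := ⟨_, rfl⟩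
    have hS₁ : s₁.reg 52 = S' * q := by rw [h52, hqi, ← hS']; ring
    have hS₂ : S' * r = q ^ (H - (i + 1)) * r ^ (i + 1) := by rw [← hS']; ring
    have hM₁ : S' * q ≤ M := by rw [← hS₁, h52]; exact hM i hi.le
    have hM₂ : S' * r ≤ M := by rw [hS₂]; exact hM (i + 1) hi
    have hM₃ : S' ≤ M := (Nat.le_mul_of_pos_right _ hq).trans hM₁
    refine Runs.le (Runs.step (T := (S' * (B + 8) + 6) + (4 + (S' * r * (4 + 8) + 6))) ?_
      (Runs.seq (Runs.count (N := S') (T := B) (fun k s' =>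
        ∀ y < k, ∀ ρ < r, ((s'.arr 15 (y * r + ρ) : ℕ) : ZMod (2 ^ w)) = ∑ b ∈ Finset.range q,
          (c ρ b : ZMod (2 ^ w)) * ((s₁.arr A (b * S' + y) : ℕ) : ZMod (2 ^ w))) ?_ ?_ ?_ ?_ ?_ ?_ ?_)
        fun s₂ hs₂ hf₂ h15 => Runs.step ?_ (Runs.mono (Runs.count (N := S' * r) (T := 4) (fun k s' =>
          ∀ j < k, s'.arr A j = s₂.arr 15 j) ?_ ?_ ?_ ?_ ?_ ?_ ?_) le_rfl ?_))) ?_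
    · intro _; simpa [Prog.Fits] using hqw
    · exact blockProg_writesReg _ _ _ _ _ _
    · exact blockProg_writesReg _ _ _ _ _ _
    · omega
    · simp [Prog.after, hS₁, Nat.mul_div_cancel _ hq]
    · intro k s v h; exact h
    · intro y hy; omega
    · intro y hy s₂ hs₂ hf₂ hy' hS₂' ih
      have hyr : y * r + r ≤ S' * r := by
        calc y * r + r = (y + 1) * r := by ring
          _ ≤ _ := by gcongr; omega
      have aA : s₂.arr A = s₁.arr A := by
        rw [hf₂.arr A fun hc => hA (blockProg_writesArr _ _ _ _ _ _ (Prog.count_writesArr.1 hc))]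
        rfl
      refine Runs.mono (blockProg_runs (S' := S') (y := y) ?_ hA c hS₂' hy' hqw ?_ hrw le_rfl
        (by omega)) hB.le ?_
      · rw [hf₂.reg 40 (by simp [blockProg_writesReg])]
        simpa [Prog.after] using r40
      · intro b hb
        calc b * S' + y < b * S' + S' := by omega
          _ = (b + 1) * S' := by ring
          _ ≤ q * S' := by gcongr; omega
          _ < 2 ^ w := by rw [mul_comm]; omega
      · rintro s₃ - - ⟨h1, h2⟩ y' hy'' ρ hρ
        rcases Nat.lt_succ_iff_lt_or_eq.1 hy'' with hlt | rfl
        · rw [h2 _ fun ρ' hρ' hc => ?_, ih y' hlt ρ hρ]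
          have := congrArg (· / r) hc
          simp only [DSO.index_div _ hρ, DSO.index_div _ hρ'] at this
          omega
        · rw [h1 ρ hρ, aA]
    · intro _
      have r53 : s₂.reg 53 = S' := by
        rw [hf₂.reg 53 (by simp [blockProg_writesReg])]
        simp [Prog.after, hS₁, Nat.mul_div_cancel _ hq]
      simp [Prog.Fits, r53]
      omega
    · simp [Prog.WritesReg]
    · simp [Prog.WritesReg]
    · omega
    · have r53 : s₂.reg 53 = S' := by
        rw [hf₂.reg 53 (by simp [blockProg_writesReg])]
        simp [Prog.after, hS₁, Nat.mul_div_cancel _ hq]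
      simp [Prog.after, r53]
    · intro k s v h; exact h
    · intro j hj; omega
    · intro k hk s₃ hs₃ hf₃ hk' _ ih
      have a15 : s₃.arr 15 = s₂.arr 15 := by
        rw [hf₃.arr 15 (by simp [Prog.WritesArr]; omega)]; rfl
      refine Runs.le (Runs.of_after (fun _ => ?_) (fun _ => ?_)) ?_
      · simp [Prog.Fits]
      · intro j hj
        simp [Prog.after, hk', Function.update_apply, a15]
        split_ifs with hjk
        · rw [hjk]
        · exact ih j (by omega)
      · simp [Prog.size, Expr.cost]
    · intro s₃ hs₃ hf₃ hcopy
      refine ⟨?_, ?_⟩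
      · rw [hf₃.reg 52 (by simp [Prog.WritesReg])]
        have r53 : s₂.reg 53 = S' := by
          rw [hf₂.reg 53 (by simp [blockProg_writesReg])]
          simp [Prog.after, hS₁, Nat.mul_div_cancel _ hq]
        simp [Prog.after, r53, hS₂]
      · refine kron_step _ hi (X₀ := fun a => ((s.arr A a : ℕ) : ZMod (2 ^ w)))
          (X := fun a => ((s₁.arr A a : ℕ) : ZMod (2 ^ w)))
          (X' := fun a => ((s₃.arr A a : ℕ) : ZMod (2 ^ w))) hX ?_
        intro y hy ρ hρ
        rw [hS'] at hy
        have hlt : y * r + ρ < S' * r := by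
          calc y * r + ρ < y * r + r := by omega
            _ = (y + 1) * r := by ring
            _ ≤ _ := by gcongr; omega
        simp only [hcopy _ hlt, hS', h15 y hy ρ hρ]
    · simp [Prog.size, Expr.cost]
      nlinarith [Nat.mul_le_mul_right B hM₃]
  · rw [hB]
    nlinarith [Nat.zero_le (H * M * B), Nat.zero_le (H * B), Nat.zero_le (M * B), Nat.zero_le (H * M)]
  · rintro s' - - ⟨h1, h2⟩
    refine ⟨by simpa using h1, fun p hp => ?_⟩
    have := h2 0 (by simp) p hp
    simpa using this

end MatMul

namespace MatMul

variable {w : ℕ} {s : State}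

/-- Register `40` is set to `2 ^ w - 1`. -/
def negOneProg : Prog :=
  .assign 40 (𝐜 1) ;; .loop (𝐫 40 + 𝐜 1) (.assign 40 (𝐫 40 + 𝐫 40 + 𝐜 1))

theorem negOneProg_runs : Runs w negOneProg s (20 * w + 20) fun s' => s'.reg 40 + 1 = 2 ^ w := by
  intro hs
  have hw := hs.pos
  have h1 := Nat.one_lt_two_pow hw.ne'
  refine Runs.le (Runs.step ?_ (Runs.mono (Runs.loop_eval (K := w - 1) (T := 6)
    (fun k s' => k < w ∧ s'.reg 40 + 1 = 2 ^ (w - k)) ?_ ?_) le_rfl ?_)) ?_ hs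
  · intro _; simpa [Prog.Fits] using hw.ne'
  · rintro k s₁ hs₁ - ⟨hk, h40⟩ hb
    have hk0 : k ≠ 0 := by
      rintro rfl
      apply hb
      change (s₁.reg 40 + 1 % 2 ^ w) % 2 ^ w = 0
      rw [Nat.mod_eq_of_lt h1, h40]
      simp
    have h2 : 2 ^ (w - (k - 1)) = 2 * 2 ^ (w - k) := by
      rw [← pow_succ']; congr 1; omega
    have h3 : 2 ^ (w - (k - 1)) ≤ 2 ^ w := Nat.pow_le_pow_right (by omega) (by omega)
    refine Runs.le (Runs.of_after (fun _ => ?_) fun _ => ?_) ?_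
    · simp [Prog.Fits, hw.ne']
      omega
    · refine ⟨k - 1, by omega, by omega, ?_⟩
      simp [Prog.after]
      omega
    · simp [Prog.size, Expr.cost]
  · refine ⟨by omega, ?_⟩
    have : w - (w - 1) = 1 := by omega
    simp [Prog.after, this]
  · rintro s' - - ⟨hb, k, hk, h40⟩
    change (s'.reg 40 + 1 % 2 ^ w) % 2 ^ w = 0 at hb
    rw [Nat.mod_eq_of_lt h1, h40] at hb
    have := Nat.le_of_dvd (by positivity) (Nat.dvd_of_mod_eq_zero hb)
    have := (Nat.pow_le_pow_iff_right (by omega)).1 this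
    have hk0 : k = 0 := by omega
    rw [h40, hk0, Nat.sub_zero]
  · simp [Prog.size, Expr.cost]
    omega

/-- Registers `41` to `44` are set to `n₀ ^ H`, `H`, `Q ^ H` and `n₀ ^ (2 * H)`, where `H` is minimal
with `n ≤ n₀ ^ H`. -/
def powersProg (n₀ Q : ℕ) : Prog :=
  (.assign 41 (𝐜 1) ;; .assign 42 (𝐜 0) ;; .assign 43 (𝐜 1) ;; .assign 44 (𝐜 1)) ;;
  .loop (.op .lt (𝐫 41) (𝐫 1))
    (.assign 41 (𝐫 41 * 𝐜 n₀) ;; .assign 42 (𝐫 42 + 𝐜 1) ;; .assign 43 (𝐫 43 * 𝐜 Q) ;;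
      .assign 44 (𝐫 44 * 𝐜 (n₀ * n₀)))

theorem powersProg_runs {n₀ Q n H : ℕ} (hn₀ : 2 ≤ n₀) (hn : s.reg 1 = n) (hH : Nat.clog n₀ n = H)
    (hw₁ : (n₀ * n₀) ^ H < 2 ^ w) (hw₂ : Q ^ H < 2 ^ w) (hw₃ : n₀ * n₀ < 2 ^ w) (hQ : 0 < Q)
    (hQw : Q < 2 ^ w) :
    Runs w (powersProg n₀ Q) s (50 * H + 50) fun s' =>
      s'.reg 41 = n₀ ^ H ∧ s'.reg 42 = H ∧ s'.reg 43 = Q ^ H ∧ s'.reg 44 = (n₀ * n₀) ^ H := by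
  intro hs
  have hw0 : w ≠ 0 := hs.pos.ne'
  have hn₀w : n₀ < 2 ^ w := (Nat.le_mul_self n₀).trans_lt hw₃
  refine Runs.le (Runs.step ?_ (Runs.mono (Runs.loop (K := H) (T := 30)
    (fun k s' => k ≤ H ∧ s'.reg 41 = n₀ ^ (H - k) ∧ s'.reg 42 = H - k ∧ s'.reg 43 = Q ^ (H - k) ∧
      s'.reg 44 = (n₀ * n₀) ^ (H - k)) ?_ ?_ ?_) le_rfl ?_)) ?_ hs
  · intro _
    simp [Prog.Fits, hw0]
  · intros; simp
  · rintro k s₁ hs₁ hf ⟨hk, h41, h42, h43, h44⟩ hb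
    have r1 : s₁.reg 1 = n := by
      rw [hf.reg 1 (by simp [Prog.WritesReg])]; simpa [Prog.after] using hn
    have hlt : n₀ ^ (H - k) < n := by
      by_contra h
      simp [h41, r1, h] at hb
    have hlt' : H - k < H := by
      by_contra h
      have h2 : H - k = H := by omega
      rw [h2, ← hH] at hlt
      exact absurd (Nat.le_pow_clog (b := n₀) (by omega) n) (by omega)
    have e : H - (k - 1) = H - k + 1 := by omega
    have b1 : Q ^ (H - k + 1) ≤ Q ^ H := Nat.pow_le_pow_right hQ (by omega)
    have b2 : (n₀ * n₀) ^ (H - k + 1) ≤ (n₀ * n₀) ^ H :=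
      Nat.pow_le_pow_right (by positivity) (by omega)
    have b3 : n₀ ^ (H - k + 1) ≤ (n₀ * n₀) ^ (H - k + 1) :=
      Nat.pow_le_pow_left (Nat.le_mul_self n₀) _
    have b4 : H - k + 1 < n₀ ^ (H - k + 1) := Nat.lt_pow_self (by omega)
    refine Runs.le (Runs.of_after (fun _ => ?_) fun _ => ?_) ?_
    · simp [Prog.Fits, Prog.after, h41, h42, h43, h44, hw0, hn₀w, hQw, hw₃]
      rw [← pow_succ, ← pow_succ, ← pow_succ]
      omega
    · refine ⟨k - 1, by omega, by omega, ?_⟩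
      simp [Prog.after, h41, h42, h43, h44, e, pow_succ]
    · simp [Prog.size, Expr.cost]
  · simp [Prog.after]
  · rintro s' - hf ⟨hb, k, hk, h41, h42, h43, h44⟩
    have r1 : s'.reg 1 = n := by
      rw [hf.reg 1 (by simp [Prog.WritesReg])]; simpa [Prog.after] using hn
    have hlt : n ≤ n₀ ^ (H - k) := by
      by_contra h
      simp [h41, r1, not_le.1 h] at hb
    have := (Nat.clog_le_of_le_pow (b := n₀) hlt)
    have hk0 : H - k = H := by omega
    rw [hk0] at h41 h42 h43 h44
    exact ⟨h41, h42, h43, h44⟩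
  · simp [Prog.size, Expr.cost]
    omega

/-- Register `50` is set to the interleaved index of the numbers in registers `47` and `48`. -/
def interleaveProg (n₀ : ℕ) : Prog :=
  (.assign 49 (𝐜 1) ;; .assign 50 (𝐜 0)) ;;
  .count 51 42
    (.assign 50 (𝐫 50 + (𝐫 47 % 𝐜 n₀ * 𝐜 n₀ + 𝐫 48 % 𝐜 n₀) * 𝐫 49) ;;
    .assign 49 (𝐫 49 * 𝐜 (n₀ * n₀)) ;;
    .assign 47 (𝐫 47 / 𝐜 n₀) ;;
    .assign 48 (𝐫 48 / 𝐜 n₀))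

/-- The digits are moved one by one; the sum of register `50` and the contribution of the remaining
digits is invariant. -/
theorem interleaveProg_runs {n₀ H u v : ℕ} (hn₀ : 2 ≤ n₀) (hH : s.reg 42 = H) (hu : s.reg 47 = u)
    (hv : s.reg 48 = v) (hw₁ : (n₀ * n₀) ^ H < 2 ^ w) (hw₃ : n₀ * n₀ < 2 ^ w) :
    Runs w (interleaveProg n₀) s (60 * H + 20) fun s' => s'.reg 50 = interleave n₀ H u v := by
  intro hs
  have hw0 : w ≠ 0 := hs.pos.ne'
  have hn₀w : n₀ < 2 ^ w := (Nat.le_mul_self n₀).trans_lt hw₃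
  have hlt := interleave_lt (n₀ := n₀) (by omega) H u v
  refine Runs.le (Runs.step ?_ (Runs.mono (Runs.count (N := H) (T := 50) (fun i s' =>
    s'.reg 49 = (n₀ * n₀) ^ i ∧ s'.reg 47 = u / n₀ ^ i ∧ s'.reg 48 = v / n₀ ^ i ∧
    s'.reg 50 + interleave n₀ (H - i) (u / n₀ ^ i) (v / n₀ ^ i) * (n₀ * n₀) ^ i =
      interleave n₀ H u v) ?_ ?_ ?_ ?_ ?_ ?_ ?_) le_rfl ?_)) ?_ hs
  · intro _
    simp [Prog.Fits, hw0]
  · simp [Prog.WritesReg]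
  · simp [Prog.WritesReg]
  · omega
  · simpa [Prog.after] using hH
  · intro k s v h; simpa using h
  · simp [Prog.after, hu, hv]
  · rintro i hi s₁ hs₁ hf hi' - ⟨h49, h47, h48, h50⟩
    have e : H - i = H - (i + 1) + 1 := by omega
    rw [e, interleave] at h50
    obtain ⟨d, hd⟩ : ∃ d, u / n₀ ^ i % n₀ * n₀ + v / n₀ ^ i % n₀ = d := ⟨_, rfl⟩
    obtain ⟨I, hI⟩ : ∃ I, interleave n₀ (H - (i + 1)) (u / n₀ ^ i / n₀) (v / n₀ ^ i / n₀) = I :=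
      ⟨_, rfl⟩
    rw [hd, hI] at h50
    have h50' : s₁.reg 50 + d * (n₀ * n₀) ^ i + I * ((n₀ * n₀) ^ i * (n₀ * n₀)) =
      interleave n₀ H u v := by rw [← h50]; ring
    have hpw : (n₀ * n₀) ^ i * (n₀ * n₀) ≤ (n₀ * n₀) ^ H := by
      rw [← pow_succ]; exact Nat.pow_le_pow_right (by positivity) (by omega)
    have hd' : d < n₀ * n₀ := by
      rw [← hd]; exact DSO.index_lt (Nat.mod_lt _ (by omega)) (Nat.mod_lt _ (by omega))
    have hd'' : u / n₀ ^ i % n₀ * n₀ ≤ d := by omega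
    refine Runs.le (Runs.of_after (fun _ => ?_) fun _ => ?_) ?_
    · simp [Prog.Fits, Prog.after, h47, h48, h49, hn₀w, hw₃, hd]
      omega
    · simp [Prog.after, h47, h48, h49, hd]
      rw [pow_succ, pow_succ, ← Nat.div_div_eq_div_mul, ← Nat.div_div_eq_div_mul, hI, h50']
      simp
    · simp [Prog.size, Expr.cost]
  · rintro s' - - ⟨-, -, -, h⟩
    simpa [interleave] using h
  · simp [Prog.size, Expr.cost]
    omega

theorem interleave_inj {n₀ : ℕ} (i : ℕ) {u v u' v' : ℕ} (hu : u < n₀ ^ i)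
    (hv : v < n₀ ^ i) (hu' : u' < n₀ ^ i) (hv' : v' < n₀ ^ i)
    (h : interleave n₀ i u v = interleave n₀ i u' v') : u = u' ∧ v = v' := by
  induction i generalizing u v u' v' with
  | zero => simp at hu hv hu' hv'; omega
  | succ i ih =>
    have hn : 0 < n₀ := Nat.pos_of_ne_zero (by rintro rfl; simp at hu)
    have hd : ∀ {k}, k < n₀ ^ (i + 1) → k / n₀ < n₀ ^ i := fun hk => by
      rw [Nat.div_lt_iff_lt_mul hn, ← pow_succ]; exact hk
    have hm : ∀ k, k % n₀ < n₀ := fun k => Nat.mod_lt k hn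
    have hp : ∀ x y, x % n₀ * n₀ + y % n₀ < n₀ * n₀ := fun x y => DSO.index_lt (hm x) (hm y)
    have h1 := congrArg (· / (n₀ * n₀)) h
    have h2 := congrArg (· % (n₀ * n₀)) h
    simp only [interleave, DSO.index_div _ (hp _ _)] at h1
    simp only [interleave, DSO.index_mod _ (hp _ _)] at h2
    have h3 := congrArg (· / n₀) h2
    have h4 := congrArg (· % n₀) h2
    simp only [DSO.index_div _ (hm _)] at h3
    simp only [DSO.index_mod _ (hm _)] at h4
    obtain ⟨h5, h6⟩ := ih (hd hu) (hd hv) (hd hu') (hd hv') h1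
    exact ⟨by rw [← Nat.div_add_mod u n₀, h5, h3, Nat.div_add_mod],
      by rw [← Nat.div_add_mod v n₀, h6, h4, Nat.div_add_mod]⟩

end MatMul

namespace MatMul

variable {w : ℕ} {s : State}

/-- The program `P` multiplies `n × n` matrices of numbers up to `n` in time `T w n` on words of
`w ≥ κ * Nat.size n` bits: it expects `n` in register `1` and the factors in the arrays `10` and
`11`, and leaves the product in array `12`.  It does not touch the registers below `40` and the
arrays below `12`. -/
structure MultipliesMatrices (P : Prog) (T : ℕ → ℕ → ℕ) (κ : ℕ) : Prop where
  reg : ∀ x, P.WritesReg x → 40 ≤ x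
  arr : ∀ a, P.WritesArr a → 12 ≤ a
  tosses : ¬ P.Tosses
  runs : ∀ (w n : ℕ) (s : State), 2 ≤ n → κ * n.size ≤ w → s.reg 1 = n →
    (∀ i < n * n, s.arr 10 i ≤ n) → (∀ i < n * n, s.arr 11 i ≤ n) →
    Runs w P s (T w n) fun s' => ∀ u < n, ∀ v < n, s'.arr 12 (u * n + v) =
      ∑ l ∈ Finset.range n, s.arr 10 (u * n + l) * s.arr 11 (l * n + v)

/-- The matrix in the array `X`, padded with zeros. -/
def padded (n : ℕ) (X : ℕ → ℕ) (u v : ℕ) : ℕ := if u < n ∧ v < n then X (u * n + v) else 0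

/-- The factors are written to the arrays `13` and `14`, padded and with interleaved indices. -/
def loadProg (n₀ : ℕ) : Prog :=
  .count 45 44 (
    (.assign 47 (𝐫 45 / 𝐫 41) ;; .assign 48 (𝐫 45 % 𝐫 41) ;;
      .assign 60 (𝐫 47) ;; .assign 61 (𝐫 48)) ;;
    interleaveProg n₀ ;;
    .cond (.op .lt (𝐫 60) (𝐫 1) * .op .lt (𝐫 61) (𝐫 1))
      (.store 13 (𝐫 50) (𝐚 10 (𝐫 60 * 𝐫 1 + 𝐫 61)) ;;
        .store 14 (𝐫 50) (𝐚 11 (𝐫 60 * 𝐫 1 + 𝐫 61)))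
      (.store 13 (𝐫 50) (𝐜 0) ;; .store 14 (𝐫 50) (𝐜 0)))

theorem loadProg_runs {n₀ H n : ℕ} (hn₀ : 2 ≤ n₀) (hn : s.reg 1 = n) (h41 : s.reg 41 = n₀ ^ H)
    (h42 : s.reg 42 = H) (h44 : s.reg 44 = (n₀ * n₀) ^ H) (hnw : n * n < 2 ^ w)
    (hw₁ : (n₀ * n₀) ^ H < 2 ^ w) (hw₃ : n₀ * n₀ < 2 ^ w) :
    Runs w (loadProg n₀) s (200 * (H + 1) * (n₀ * n₀) ^ H + 10) fun s' =>
      ∀ u < n₀ ^ H, ∀ v < n₀ ^ H,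
        s'.arr 13 (interleave n₀ H u v) = padded n (s.arr 10) u v ∧
        s'.arr 14 (interleave n₀ H u v) = padded n (s.arr 11) u v := by
  intro hs
  have hw0 : w ≠ 0 := hs.pos.ne'
  obtain ⟨N, hN⟩ : ∃ N, n₀ ^ H = N := ⟨_, rfl⟩
  have hNN : (n₀ * n₀) ^ H = N * N := by rw [mul_pow, hN]
  have hNpos : 0 < N := by rw [← hN]; positivity
  rw [hN] at h41 ⊢
  rw [hNN] at h44 ⊢
  refine Runs.mono (Runs.count (N := N * N) (T := 60 * H + 100) (fun k s' =>
    ∀ u < N, ∀ v < N, u * N + v < k →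
      s'.arr 13 (interleave n₀ H u v) = padded n (s.arr 10) u v ∧
      s'.arr 14 (interleave n₀ H u v) = padded n (s.arr 11) u v)
    ?_ ?_ (by omega) h44 ?_ ?_ ?_) ?_ ?_ hs
  · simp [Prog.WritesReg, interleaveProg]
  · simp [Prog.WritesReg, interleaveProg]
  · intro k s v h; exact h
  · intro u _ v _ h; omega
  · intro k hk s₁ hs₁ hf hi _ ih
    have r1 : s₁.reg 1 = n := by
      rw [hf.reg 1 (by simp [Prog.WritesReg, interleaveProg]), hn]
    have r41 : s₁.reg 41 = N := by
      rw [hf.reg 41 (by simp [Prog.WritesReg, interleaveProg]), h41]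
    have r42 : s₁.reg 42 = H := by
      rw [hf.reg 42 (by simp [Prog.WritesReg, interleaveProg]), h42]
    have a10 : s₁.arr 10 = s.arr 10 := hf.arr 10 (by simp [Prog.WritesArr, interleaveProg])
    have a11 : s₁.arr 11 = s.arr 11 := hf.arr 11 (by simp [Prog.WritesArr, interleaveProg])
    obtain ⟨u, hu⟩ : ∃ u, k / N = u := ⟨_, rfl⟩
    obtain ⟨v, hv⟩ : ∃ v, k % N = v := ⟨_, rfl⟩
    have huN : u < N := by rw [← hu, Nat.div_lt_iff_lt_mul hNpos]; exact hk
    have hvN : v < N := hv ▸ Nat.mod_lt _ hNpos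
    have huv : u * N + v = k := by rw [← hu, ← hv, mul_comm]; exact Nat.div_add_mod ..
    refine Runs.le (Runs.step (T := (60 * H + 20) + 60) ?_ (Runs.seq
      (interleaveProg_runs (H := H) (u := u) (v := v) hn₀ ?_ ?_ ?_ hw₁ hw₃)
      fun s₂ hs₂ hf₂ h50 => Runs.le (Runs.of_after (fun _ => ?_) fun _ => ?_) ?_)) ?_
    · intro _; simp [Prog.Fits]
    · simpa [Prog.after] using r42
    · simp [Prog.after, hi, r41, hu]
    · simp [Prog.after, hi, r41, hv]
    · have r1' : s₂.reg 1 = n := by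
        rw [hf₂.reg 1 (by simp [Prog.WritesReg, interleaveProg])]; simpa [Prog.after] using r1
      have r60 : s₂.reg 60 = u := by
        rw [hf₂.reg 60 (by simp [Prog.WritesReg, interleaveProg])]; simp [Prog.after, hi, r41, hu]
      have r61 : s₂.reg 61 = v := by
        rw [hf₂.reg 61 (by simp [Prog.WritesReg, interleaveProg])]; simp [Prog.after, hi, r41, hv]
      simp [Prog.Fits, Prog.after, r1', r60, r61]
      refine ⟨?_, fun h1 h2 => ?_⟩
      · split_ifs <;> simp [hw0]
      · have := DSO.index_lt h2 h1
        omega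
    · have r1' : s₂.reg 1 = n := by
        rw [hf₂.reg 1 (by simp [Prog.WritesReg, interleaveProg])]; simpa [Prog.after] using r1
      have r60 : s₂.reg 60 = u := by
        rw [hf₂.reg 60 (by simp [Prog.WritesReg, interleaveProg])]; simp [Prog.after, hi, r41, hu]
      have r61 : s₂.reg 61 = v := by
        rw [hf₂.reg 61 (by simp [Prog.WritesReg, interleaveProg])]; simp [Prog.after, hi, r41, hv]
      have aa : ∀ a, s₂.arr a = s₁.arr a := fun a => by
        rw [hf₂.arr a (by simp [Prog.WritesArr, interleaveProg])]; rfl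
      have key : Prog.after s₂ (.cond (.op .lt (𝐫 60) (𝐫 1) * .op .lt (𝐫 61) (𝐫 1))
          (.store 13 (𝐫 50) (𝐚 10 (𝐫 60 * 𝐫 1 + 𝐫 61)) ;;
            .store 14 (𝐫 50) (𝐚 11 (𝐫 60 * 𝐫 1 + 𝐫 61)))
          (.store 13 (𝐫 50) (𝐜 0) ;; .store 14 (𝐫 50) (𝐜 0))) =
          (s₂.setArr 13 (interleave n₀ H u v) (padded n (s.arr 10) u v)).setArr 14
            (interleave n₀ H u v) (padded n (s.arr 11) u v) := by
        by_cases h1 : u < n <;> by_cases h2 : v < n <;>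
          simp [Prog.after, r1', r60, r61, h50, h1, h2, padded, aa, a10, a11]
      rw [key]
      intro u' hu' v' hv' hlt
      simp [Function.update_apply, aa]
      split_ifs with h
      · obtain ⟨rfl, rfl⟩ := interleave_inj H (hN ▸ hu') (hN ▸ hv') (hN ▸ huN) (hN ▸ hvN) h
        simp
      · refine ih u' hu' v' hv' (lt_of_le_of_ne (by omega) fun hc => h ?_)
        rw [← hc] at hu hv
        rw [DSO.index_div _ hv'] at hu
        rw [DSO.index_mod _ hv'] at hv
        rw [hu, hv]
    · simp [Prog.size, Expr.cost]
    · simp [Prog.size, Expr.cost]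
      omega
  · nlinarith [Nat.zero_le (N * N * H)]
  · intro s' _ _ h u hu v hv
    exact h u hu v hv (DSO.index_lt hu hv)

/-- The entries of the product are divided by `Q ^ H` and written to array `12`. -/
def unloadProg (n₀ : ℕ) : Prog :=
  .assign 58 (𝐫 1 * 𝐫 1) ;;
  .count 59 58 (
    (.assign 47 (𝐫 59 / 𝐫 1) ;; .assign 48 (𝐫 59 % 𝐫 1)) ;;
    interleaveProg n₀ ;;
    .store 12 (𝐫 59) (𝐚 13 (𝐫 50) / 𝐫 43))

theorem unloadProg_runs {n₀ H n Q : ℕ} (hn₀ : 2 ≤ n₀) (hn : s.reg 1 = n)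
    (h42 : s.reg 42 = H) (h43 : s.reg 43 = Q) (hnw : n * n < 2 ^ w)
    (hw₁ : (n₀ * n₀) ^ H < 2 ^ w) (hw₃ : n₀ * n₀ < 2 ^ w) :
    Runs w (unloadProg n₀) s (200 * (H + 1) * (n * n) + 20) fun s' => ∀ u < n, ∀ v < n,
      s'.arr 12 (u * n + v) = s.arr 13 (interleave n₀ H u v) / Q := by
  refine Runs.le (Runs.step ?_ (Runs.mono (Runs.count (N := n * n) (T := 60 * H + 100) (fun k s' =>
    ∀ u < n, ∀ v < n, u * n + v < k →
      s'.arr 12 (u * n + v) = s.arr 13 (interleave n₀ H u v) / Q)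
    ?_ ?_ (by omega) ?_ ?_ ?_ ?_) le_rfl ?_)) ?_
  · intro _; simpa [Prog.Fits, hn] using hnw
  · simp [Prog.WritesReg, interleaveProg]
  · simp [Prog.WritesReg, interleaveProg]
  · simp [Prog.after, hn]
  · intro k s v h; exact h
  · intro u _ v _ h; omega
  · intro k hk s₁ hs₁ hf hi _ ih
    have hnpos : 0 < n := Nat.pos_of_ne_zero (by rintro rfl; simp at hk)
    have r1 : s₁.reg 1 = n := by
      rw [hf.reg 1 (by simp [Prog.WritesReg, interleaveProg])]; simpa [Prog.after] using hn
    have r42 : s₁.reg 42 = H := by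
      rw [hf.reg 42 (by simp [Prog.WritesReg, interleaveProg])]; simpa [Prog.after] using h42
    have r43 : s₁.reg 43 = Q := by
      rw [hf.reg 43 (by simp [Prog.WritesReg, interleaveProg])]; simpa [Prog.after] using h43
    have a13 : s₁.arr 13 = s.arr 13 := by
      rw [hf.arr 13 (by simp [Prog.WritesArr, interleaveProg])]; rfl
    obtain ⟨u, hu⟩ : ∃ u, k / n = u := ⟨_, rfl⟩
    obtain ⟨v, hv⟩ : ∃ v, k % n = v := ⟨_, rfl⟩
    refine Runs.le (Runs.step (T := (60 * H + 20) + 60) ?_ (Runs.seq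
      (interleaveProg_runs (H := H) (u := u) (v := v) hn₀ ?_ ?_ ?_ hw₁ hw₃)
      fun s₂ hs₂ hf₂ h50 => Runs.le (Runs.of_after (fun _ => ?_) fun _ => ?_) ?_)) ?_
    · intro _; simp [Prog.Fits]
    · simpa [Prog.after] using r42
    · simp [Prog.after, hi, r1, hu]
    · simp [Prog.after, hi, r1, hv]
    · simp [Prog.Fits]
    · have r43' : s₂.reg 43 = Q := by
        rw [hf₂.reg 43 (by simp [Prog.WritesReg, interleaveProg])]; simpa [Prog.after] using r43
      have r59 : s₂.reg 59 = k := by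
        rw [hf₂.reg 59 (by simp [Prog.WritesReg, interleaveProg])]; simpa [Prog.after] using hi
      have aa : ∀ a, s₂.arr a = s₁.arr a := fun a => by
        rw [hf₂.arr a (by simp [Prog.WritesArr, interleaveProg])]; rfl
      intro u' hu' v' hv' hlt
      simp [Prog.after, r43', r59, aa, a13, h50, Function.update_apply]
      split_ifs with h
      · rw [← h, DSO.index_div _ hv'] at hu
        rw [← h, DSO.index_mod _ hv'] at hv
        rw [hu, hv]
      · exact ih u' hu' v' hv' (by omega)
    · simp [Prog.size, Expr.cost]
    · simp [Prog.size, Expr.cost]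
      omega
  · intro s' _ _ h u hu v hv
    exact h u hu v hv (DSO.index_lt hu hv)
  · simp [Prog.size, Expr.cost]
    nlinarith [Nat.zero_le (n * n * H)]

variable {n₀ r Q : ℕ}

/-- Matrix multiplication by the powers of a bilinear algorithm. -/
def matMulProg (B : BilinearAlgorithm n₀ r Q) : Prog :=
  negOneProg ;; powersProg n₀ Q ;; loadProg n₀ ;;
  .assign 52 (𝐫 44) ;; kronProg 13 B.α (n₀ * n₀) r ;;
  .assign 52 (𝐫 44) ;; kronProg 14 B.β (n₀ * n₀) r ;;
  .count 57 52 (.store 13 (𝐫 57) (𝐚 13 (𝐫 57) * 𝐚 14 (𝐫 57))) ;;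
  kronProg 13 B.γ r (n₀ * n₀) ;;
  unloadProg n₀

end MatMul

namespace MatMul

variable {w : ℕ} {s : State} {n₀ r Q : ℕ}

theorem pow_clog_le {n a e : ℕ} (hn₀ : 2 ≤ n₀) (hn : 2 ≤ n) (ha : a ≤ 2 ^ e) :
    a ^ Nat.clog n₀ n ≤ (2 * n) ^ e := by
  have h1 := Nat.pow_pred_clog_lt_self (b := n₀) (by omega) (x := n) (by omega)
  have hpos : 0 < Nat.clog n₀ n := Nat.clog_pos (by omega) hn
  obtain ⟨H, hH⟩ : ∃ H, Nat.clog n₀ n = H + 1 := ⟨_, (Nat.succ_pred_eq_of_pos hpos).symm⟩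
  rw [hH] at h1 ⊢
  calc a ^ (H + 1) ≤ (2 ^ e) ^ (H + 1) := Nat.pow_le_pow_left ha _
    _ = (2 * 2 ^ H) ^ e := by rw [← pow_succ', ← pow_mul, ← pow_mul, mul_comm]
    _ ≤ (2 * n) ^ e := by
      refine Nat.pow_le_pow_left (Nat.mul_le_mul_left 2 ?_) _
      exact (Nat.pow_le_pow_left hn₀ H).trans h1.le

theorem pow_two_mul_mul_lt {n e : ℕ} (hn : 2 ≤ n) (hw : (2 * e + 4) * n.size ≤ w) :
    (2 * n) ^ e * n ^ 3 < 2 ^ w := by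
  have h1 : n < 2 ^ n.size := Nat.lt_size_self n
  have h2 : 2 ≤ 2 ^ n.size := hn.trans h1.le
  calc (2 * n) ^ e * n ^ 3 ≤ (2 ^ n.size * 2 ^ n.size) ^ e * (2 ^ n.size) ^ 3 := by gcongr
    _ < (2 ^ n.size * 2 ^ n.size) ^ e * (2 ^ n.size) ^ 4 := by
      gcongr
      omega
    _ = 2 ^ ((2 * e + 4) * n.size) := by rw [← pow_add, ← pow_mul, ← pow_mul, ← pow_add]; ring_nf
    _ ≤ 2 ^ w := Nat.pow_le_pow_right (by omega) hw

/-- Padding with zeros does not change the product. -/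
theorem sum_padded {n N u v : ℕ} (hN : n ≤ N) (hu : u < n) (hv : v < n) (X Y : ℕ → ℕ) :
    ∑ l ∈ Finset.range N, padded n X u l * padded n Y l v =
      ∑ l ∈ Finset.range n, X (u * n + l) * Y (l * n + v) := by
  rw [← Finset.sum_subset (Finset.range_subset_range.2 hN) fun l _ hl => ?_]
  rotate_left
  · simp [padded, Finset.mem_range.not.1 hl]
  · refine Finset.sum_congr rfl fun l hl => ?_
    have hl' := Finset.mem_range.1 hl
    simp [padded, hu, hv, hl']

/-- Multiplication of `n × n` matrices with the power number `Nat.clog n₀ n` of a bilinear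
algorithm. The entries of the product and of its multiple by a power of `Q` are less than `2 ^ w`,
so computing modulo `2 ^ w` in between does no harm. -/
theorem matMulProg_computes (B : BilinearAlgorithm n₀ r Q) (hn₀ : 2 ≤ n₀) (hr : n₀ * n₀ ≤ r)
    (hQ : 0 < Q) : ∃ K κ, MultipliesMatrices (matMulProg B)
      (fun w n => K * (w + (Nat.clog n₀ n + 1) * r ^ Nat.clog n₀ n)) κ := by
  obtain ⟨e, he⟩ : ∃ e, r + Q ≤ 2 ^ e := ⟨r + Q, Nat.lt_two_pow_self.le⟩
  obtain ⟨b₁, hb₁⟩ : ∃ b, (blockProg 13 B.α (n₀ * n₀) r r).size = b := ⟨_, rfl⟩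
  obtain ⟨b₂, hb₂⟩ : ∃ b, (blockProg 14 B.β (n₀ * n₀) r r).size = b := ⟨_, rfl⟩
  obtain ⟨b₃, hb₃⟩ : ∃ b, (blockProg 13 B.γ r (n₀ * n₀) (n₀ * n₀)).size = b := ⟨_, rfl⟩
  refine ⟨2000 + 2 * (b₁ + b₂ + b₃), 2 * e + 4, ?_, ?_, ?_, ?_⟩
  · intro x
    have k1 := @kronProg_writesReg 13 B.α (n₀ * n₀) r x
    have k2 := @kronProg_writesReg 14 B.β (n₀ * n₀) r x
    have k3 := @kronProg_writesReg 13 B.γ r (n₀ * n₀) x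
    simp only [matMulProg, negOneProg, powersProg, loadProg, interleaveProg, unloadProg,
      Prog.WritesReg, Prog.count_writesReg]
    intro h
    by_contra hx
    have h1 : ∀ y, 40 ≤ y → x ≠ y := by omega
    simp [h1] at h
    rcases h with h | h | h
    · have := k1 h; omega
    · have := k2 h; omega
    · have := k3 h; omega
  · intro x
    have k1 := @kronProg_writesArr 13 B.α (n₀ * n₀) r x
    have k2 := @kronProg_writesArr 14 B.β (n₀ * n₀) r x
    have k3 := @kronProg_writesArr 13 B.γ r (n₀ * n₀) x
    simp only [matMulProg, negOneProg, powersProg, loadProg, interleaveProg, unloadProg,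
      Prog.WritesArr, Prog.count_writesArr]
    intro h
    by_contra hx
    have h1 : ∀ y, 12 ≤ y → x ≠ y := by omega
    simp [h1] at h
    rcases h with h | h | h
    · have := k1 h; omega
    · have := k2 h; omega
    · have := k3 h; omega
  · simp [matMulProg, negOneProg, powersProg, loadProg, interleaveProg, unloadProg,
      Prog.Tosses, kronProg_tosses]
  intro w n s hn hw h1 hX hY
  obtain ⟨H, hH⟩ : ∃ H, Nat.clog n₀ n = H := ⟨_, rfl⟩
  have hrH : r ^ H ≤ (2 * n) ^ e := hH ▸ pow_clog_le hn₀ hn (by omega)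
  have hQH : Q ^ H ≤ (2 * n) ^ e := hH ▸ pow_clog_le hn₀ hn (by omega)
  have hnN : n ≤ n₀ ^ H := hH ▸ Nat.le_pow_clog (by omega) n
  have hbig := pow_two_mul_mul_lt hn hw
  have hH1 : 1 ≤ H := hH ▸ Nat.clog_pos (by omega) hn
  have hn3 : 1 ≤ n ^ 3 := Nat.one_le_pow _ _ (by omega)
  have hw4 : (2 * n) ^ e < 2 ^ w := (Nat.le_mul_of_pos_right _ hn3).trans_lt hbig
  have hqr : (n₀ * n₀) ^ H ≤ r ^ H := Nat.pow_le_pow_left hr H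
  have hnn : n * n ≤ (n₀ * n₀) ^ H := by rw [mul_pow]; exact Nat.mul_le_mul hnN hnN
  have hr0 : 0 < r := lt_of_lt_of_le (by positivity) hr
  have hrr : r ≤ r ^ H := Nat.le_self_pow (by omega) r
  have hQQ : Q ≤ Q ^ H := Nat.le_self_pow (by omega) Q
  have hq0 : 0 < n₀ * n₀ := by positivity
  simp only [hH]
  have key : ∀ a b : ℕ, a ≤ r → b ≤ r → ∀ i ≤ H, a ^ (H - i) * b ^ i ≤ r ^ H := by
    intro a b ha hb i hi
    calc a ^ (H - i) * b ^ i ≤ r ^ (H - i) * r ^ i := by gcongr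
      _ = r ^ H := by rw [← pow_add]; congr 1; omega
  unfold matMulProg
  refine Runs.le (Runs.seq negOneProg_runs fun s₁ hs₁ hf₁ h40 => Runs.seq (powersProg_runs
    (Q := Q) (n := n) hn₀ ?_ hH (by omega) (by omega) (by omega) hQ (by omega))
    fun s₂ hs₂ hf₂ ⟨h41, h42, h43, h44⟩ => Runs.seq (loadProg_runs (n := n) hn₀ ?_ h41 h42 h44
      (by omega) (by omega) (by omega)) fun s₃ hs₃ hf₃ hload => ?_) (T := 20 * w + 20 +
        ((50 * H + 50) + ((200 * (H + 1) * (n₀ * n₀) ^ H + 10) +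
        (2 + ((H + 1) * (r ^ H + 1) * (b₁ + 100) + (2 + ((H + 1) * (r ^ H + 1) * (b₂ + 100) +
        ((r ^ H * (20 + 8) + 6) + ((H + 1) * (r ^ H + 1) * (b₃ + 100) +
          (200 * (H + 1) * (n * n) + 20)))))))))) ?_
  · rw [hf₁.reg 1 (by simp [negOneProg, Prog.WritesReg]), h1]
  · rw [hf₂.reg 1 (by simp [powersProg, Prog.WritesReg]),
      hf₁.reg 1 (by simp [negOneProg, Prog.WritesReg]), h1]
  · have r1 : s₃.reg 1 = n := by
      rw [hf₃.reg 1 (by simp [loadProg, interleaveProg, Prog.WritesReg]),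
        hf₂.reg 1 (by simp [powersProg, Prog.WritesReg]),
        hf₁.reg 1 (by simp [negOneProg, Prog.WritesReg]), h1]
    have r40 : s₃.reg 40 + 1 = 2 ^ w := by
      rw [hf₃.reg 40 (by simp [loadProg, interleaveProg, Prog.WritesReg]),
        hf₂.reg 40 (by simp [powersProg, Prog.WritesReg]), h40]
    have r42 : s₃.reg 42 = H := by
      rw [hf₃.reg 42 (by simp [loadProg, interleaveProg, Prog.WritesReg]), h42]
    have r43 : s₃.reg 43 = Q ^ H := by
      rw [hf₃.reg 43 (by simp [loadProg, interleaveProg, Prog.WritesReg]), h43]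
    have r44 : s₃.reg 44 = (n₀ * n₀) ^ H := by
      rw [hf₃.reg 44 (by simp [loadProg, interleaveProg, Prog.WritesReg]), h44]
    have a10 : s₂.arr 10 = s.arr 10 := by
      rw [hf₂.arr 10 (by simp [powersProg, Prog.WritesArr]),
        hf₁.arr 10 (by simp [negOneProg, Prog.WritesArr])]
    have a11 : s₂.arr 11 = s.arr 11 := by
      rw [hf₂.arr 11 (by simp [powersProg, Prog.WritesArr]),
        hf₁.arr 11 (by simp [negOneProg, Prog.WritesArr])]
    rw [a10, a11] at hload
    refine Runs.step (by simp [Prog.Fits]) (Runs.seq (Runs.le (kronProg_runs (M := r ^ H) ?_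
      (by omega) B.α hq0 hr0 ?_ ?_ (key _ _ hr le_rfl) (by omega) (by omega) (by omega))
      (by rw [hb₁])) fun s₄ hs₄ hf₄ ⟨_, hα⟩ => Runs.step (by simp [Prog.Fits])
      (Runs.seq (Runs.le (kronProg_runs (M := r ^ H) ?_ (by omega) B.β hq0 hr0 ?_ ?_
        (key _ _ hr le_rfl) (by omega) (by omega) (by omega)) (by rw [hb₂]))
      fun s₅ hs₅ hf₅ ⟨h52, hβ⟩ => ?_))
    · simpa [Prog.after] using r40
    · simpa [Prog.after] using r42
    · simpa [Prog.after] using r44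
    · rw [Prog.after, State.setReg_reg, if_neg (by omega),
        hf₄.reg 40 (fun h => by have := kronProg_writesReg h; omega)]
      simpa [Prog.after] using r40
    · rw [Prog.after, State.setReg_reg, if_neg (by omega),
        hf₄.reg 42 (fun h => by have := kronProg_writesReg h; omega)]
      simpa [Prog.after] using r42
    · rw [Prog.after, State.setReg_reg, if_pos rfl, Expr.val_reg,
        hf₄.reg 44 (fun h => by have := kronProg_writesReg h; omega)]
      simpa [Prog.after] using r44
    have hreg : ∀ x, x < 52 → s₅.reg x = s₃.reg x := by
      intro x hx
      rw [hf₅.reg x (fun h => by have := kronProg_writesReg h; omega), Prog.after,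
        State.setReg_reg, if_neg (by omega),
        hf₄.reg x (fun h => by have := kronProg_writesReg h; omega), Prog.after,
        State.setReg_reg, if_neg (by omega)]
    have h13 : s₅.arr 13 = s₄.arr 13 := by
      rw [hf₅.arr 13 (fun h => by have := kronProg_writesArr h; omega)]; rfl
    have h14 : s₄.arr 14 = s₃.arr 14 := by
      rw [hf₄.arr 14 (fun h => by have := kronProg_writesArr h; omega)]; rfl
    refine Runs.seq (Runs.mono (Runs.count (N := r ^ H) (T := 20) (fun k s' =>
      (∀ p < k, ((s'.arr 13 p : ℕ) : ZMod (2 ^ w)) =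
        ((s₅.arr 13 p : ℕ) : ZMod (2 ^ w)) * ((s₅.arr 14 p : ℕ) : ZMod (2 ^ w))) ∧
      ∀ p, k ≤ p → s'.arr 13 p = s₅.arr 13 p) ?_ ?_ (by omega) h52 ?_ ?_ ?_) le_rfl
      (fun _ _ _ h => h.1)) fun s₆ hs₆ hf₆ hpt => ?_
    · simp [Prog.WritesReg]
    · simp [Prog.WritesReg]
    · intro k s v h; exact h
    · exact ⟨fun p hp => by omega, fun _ _ => rfl⟩
    · rintro k hk s' hs' hf' hi - ⟨ih₁, ih₂⟩
      refine Runs.mono (Runs.store _ _ _) (by simp [Prog.size, Expr.cost]) ?_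
      rintro s'' - - rfl
      have hk' : (𝐫 57).eval w s' = k := hi
      refine ⟨fun p hp => ?_, fun p hp => ?_⟩
      · simp only [State.setArr_arr, if_true, hk', Function.update_apply]
        split_ifs with hpk
        · rw [Expr.cast_eval_mul]
          change ((s'.arr 13 (s'.reg 57) : ℕ) : ZMod (2 ^ w)) *
            ((s'.arr 14 (s'.reg 57) : ℕ) : ZMod (2 ^ w)) = _
          rw [hi, ih₂ k le_rfl, hpk, hf'.arr 14 (by simp [Prog.WritesArr])]
        · exact ih₁ p (by omega)
      · simp only [State.setArr_arr, if_true, hk']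
        rw [Function.update_of_ne (by omega), ih₂ p (by omega)]
    have hreg₆ : ∀ x, x < 52 → s₆.reg x = s₃.reg x := by
      intro x hx
      rw [hf₆.reg x (by simp [Prog.WritesReg]; omega), hreg x hx]
    refine Runs.seq (Runs.le (kronProg_runs (M := r ^ H) ?_ (by omega) B.γ hr0 hq0 ?_ ?_
      (key _ _ le_rfl hr) (by omega) (by omega) (by omega)) (by rw [hb₃]))
      fun s₇ hs₇ hf₇ ⟨_, hγ⟩ => ?_
    · rw [hreg₆ 40 (by omega), r40]
    · rw [hreg₆ 42 (by omega), r42]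
    · rw [hf₆.reg 52 (by simp [Prog.WritesReg]), h52]
    have hreg₇ : ∀ x, x < 52 → s₇.reg x = s₃.reg x := by
      intro x hx
      rw [hf₇.reg x (fun h => by have := kronProg_writesReg h; omega), hreg₆ x hx]
    refine Runs.mono (unloadProg_runs (H := H) (n := n) (Q := Q ^ H) hn₀ ?_ ?_ ?_ (by omega)
      (by omega) (by omega)) le_rfl ?_
    · rw [hreg₇ 1 (by omega), r1]
    · rw [hreg₇ 42 (by omega), r42]
    · rw [hreg₇ 43 (by omega), r43]
    intro s₈ _ _ h12 u hu v hv
    have huN := hu.trans_le hnN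
    have hvN := hv.trans_le hnN
    rw [h12 u hu v hv]
    have hsum := sum_padded hnN hu hv (s.arr 10) (s.arr 11)
    have hle : ∑ l ∈ Finset.range n, s.arr 10 (u * n + l) * s.arr 11 (l * n + v) ≤ n ^ 3 := by
      calc _ ≤ ∑ l ∈ Finset.range n, n * n := Finset.sum_le_sum fun l hl => by
            have hl' := Finset.mem_range.1 hl
            exact Nat.mul_le_mul (hX _ (DSO.index_lt hu hl')) (hY _ (DSO.index_lt hl' hv))
        _ = n ^ 3 := by simp; ring
    have hcast : ((s₇.arr 13 (interleave n₀ H u v) : ℕ) : ZMod (2 ^ w)) =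
        ((Q ^ H * ∑ l ∈ Finset.range n, s.arr 10 (u * n + l) * s.arr 11 (l * n + v) : ℕ) :
          ZMod (2 ^ w)) := by
      rw [hγ _ (interleave_lt (by omega) H u v), ← hsum]
      have hm := kron_mul (R := ZMod (2 ^ w)) B (by omega) H
        (fun a => ((s₃.arr 13 a : ℕ) : ZMod (2 ^ w))) (fun a => ((s₃.arr 14 a : ℕ) : ZMod (2 ^ w)))
        huN hvN
      rw [Nat.cast_mul, Nat.cast_pow, Nat.cast_sum]
      refine (Finset.sum_congr rfl fun p hp => ?_).trans (hm.trans ?_)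
      · have hp' := Finset.mem_range.1 hp
        rw [hpt p hp', h13, hα p hp', hβ p hp']
        simp only [Prog.after, State.setReg_arr, h14]
      · congr 1
        refine Finset.sum_congr rfl fun l hl => ?_
        have hl' := Finset.mem_range.1 hl
        rw [(hload u huN l hl').1, (hload l hl' v hvN).2, Nat.cast_mul]
    have hlt : Q ^ H * ∑ l ∈ Finset.range n, s.arr 10 (u * n + l) * s.arr 11 (l * n + v) < 2 ^ w :=
      (Nat.mul_le_mul hQH hle).trans_lt hbig
    rw [ZMod.natCast_eq_natCast_iff', Nat.mod_eq_of_lt (hs₇.arr _ _), Nat.mod_eq_of_lt hlt] at hcast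
    rw [hcast, Nat.mul_div_cancel_left _ (by positivity)]
  · have hM : 1 ≤ r ^ H := hr0.trans_le hrr
    obtain ⟨M, hM'⟩ : ∃ M, r ^ H = M := ⟨_, rfl⟩
    obtain ⟨X, hX'⟩ : ∃ X, (n₀ * n₀) ^ H = X := ⟨_, rfl⟩
    rw [hM'] at hM hqr ⊢
    rw [hX'] at hqr hnn ⊢
    obtain ⟨b, hb⟩ : ∃ b, b₁ + b₂ + b₃ = b := ⟨_, rfl⟩
    have e1 : (H + 1) * X ≤ (H + 1) * M := Nat.mul_le_mul_left _ hqr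
    have e2 : (H + 1) * (n * n) ≤ (H + 1) * M := Nat.mul_le_mul_left _ (hnn.trans hqr)
    have e3 : (H + 1) * (M + 1) ≤ 2 * ((H + 1) * M) := by nlinarith
    have e4 : H + 1 ≤ (H + 1) * M := Nat.le_mul_of_pos_right _ hM
    have e5 : M ≤ (H + 1) * M := Nat.le_mul_of_pos_left _ (by omega)
    have e6 : (H + 1) * (M + 1) * b ≤ 2 * ((H + 1) * M) * b := Nat.mul_le_mul_right _ e3
    rw [hb]
    obtain ⟨Z, hZ⟩ : ∃ Z, (H + 1) * M = Z := ⟨_, rfl⟩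
    rw [hZ] at e1 e2 e3 e4 e5 e6 ⊢
    have e7 : (H + 1) * (M + 1) * (b₁ + 100) + (H + 1) * (M + 1) * (b₂ + 100) +
      (H + 1) * (M + 1) * (b₃ + 100) = (H + 1) * (M + 1) * b + 300 * ((H + 1) * (M + 1)) := by
      rw [← hb]; ring
    have e8 : (2000 + 2 * b) * (w + Z) = 2000 * w + 2000 * Z + 2 * b * w + 2 * Z * b := by ring
    rw [e8, mul_assoc 200, mul_assoc 200]
    generalize (H + 1) * (M + 1) * (b₁ + 100) = t₁ at *
    generalize (H + 1) * (M + 1) * (b₂ + 100) = t₂ at *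
    generalize (H + 1) * (M + 1) * (b₃ + 100) = t₃ at *
    generalize (H + 1) * (M + 1) * b = t₄ at *
    generalize (H + 1) * (M + 1) = t₅ at *
    generalize 2 * Z * b = t₆ at *
    generalize 2 * b * w = t₇ at *
    generalize (H + 1) * X = t₈ at *
    generalize (H + 1) * (n * n) = t₉ at *
    omega

end MatMul

namespace WordRAM

/-- Filling a segment of an array, which starts at the index `o`. -/
theorem Runs.fill {w i b N a o c : ℕ} {s : State} {x e : Expr} (F : ℕ → ℕ) (hib : b ≠ i)
    (hN : s.reg b = N) (hc : x.cost + e.cost + 1 = c)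
    (h : ∀ k < N, ∀ s₁, (∀ y, y ≠ i → s₁.reg y = s.reg y) → (∀ y, y ≠ a → s₁.arr y = s.arr y) →
      s₁.reg i = k → (∀ j, (j < o ∨ o + k ≤ j) → s₁.arr a j = s.arr a j) →
      (x.Fits w s₁ ∧ e.Fits w s₁) ∧ x.val s₁ = o + k ∧ e.val s₁ = F k) :
    Runs w (.count i b (.store a x e)) s (N * (c + 8) + 6) fun s' =>
      (∀ j < N, s'.arr a (o + j) = F j) ∧ ∀ j, (j < o ∨ o + N ≤ j) → s'.arr a j = s.arr a j := by
  refine Runs.count (I := fun k s' => (∀ j < k, s'.arr a (o + j) = F j) ∧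
    ∀ j, (j < o ∨ o + k ≤ j) → s'.arr a j = s.arr a j) (by simp [Prog.WritesReg])
    (by simp [Prog.WritesReg]) hib hN (fun k s v h => h) ⟨by omega, fun _ _ => rfl⟩ ?_
  rintro k hk s₁ hs₁ hf hi - ⟨h1, h2⟩
  obtain ⟨⟨f1, f2⟩, v1, v2⟩ := h k hk s₁
    (fun y hy => hf.reg y (by simpa [Prog.WritesReg] using hy))
    (fun y hy => hf.arr y (by simpa [Prog.WritesArr] using hy)) hi h2
  refine Runs.le (Runs.of_after (fun _ => ?_) fun _ => ?_) hc.le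
  · exact ⟨f1, f2⟩
  simp only [Prog.after, v1, v2, State.setArr_arr, if_true]
  refine ⟨fun j hj => ?_, fun j hj => ?_⟩
  · rcases Nat.lt_succ_iff_lt_or_eq.1 hj with hj' | rfl
    · rw [Function.update_of_ne (by omega), h1 j hj']
    · rw [Function.update_self]
  · rw [Function.update_of_ne (by omega), h2 j (by omega)]

end WordRAM

namespace Seidel

/-! ### Seidel's algorithm: distances on a logarithmic scale -/

variable {n : ℕ} (H : SimpleGraph (Fin n))

/-- The distance in units of `2 ^ k`, rounded up, with the value `0` if there is no path. -/
noncomputable def scaledDist (k : ℕ) (u v : Fin n) : ℕ := (H.dist u v + 2 ^ k - 1) / 2 ^ k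

open Classical in
/-- The indicator of distance at most `2 ^ k`; nodes without a connecting path are not near. -/
noncomputable def near (k : ℕ) (u v : Fin n) : ℕ :=
  if H.Reachable u v ∧ H.dist u v ≤ 2 ^ k then 1 else 0

variable {H}

theorem scaledDist_le_iff {k m : ℕ} {u v : Fin n} :
    scaledDist H k u v ≤ m ↔ H.dist u v ≤ m * 2 ^ k := by
  have hk : 0 < 2 ^ k := by positivity
  rw [scaledDist, ← Nat.lt_succ_iff, Nat.div_lt_iff_lt_mul hk, Nat.succ_mul]
  omega

theorem lt_scaledDist_iff {k m : ℕ} {u v : Fin n} :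
    m < scaledDist H k u v ↔ m * 2 ^ k < H.dist u v := by
  rw [← not_le, scaledDist_le_iff, not_le]

theorem scaledDist_le_dist (k : ℕ) (u v : Fin n) : scaledDist H k u v ≤ H.dist u v := by
  rw [scaledDist_le_iff]
  exact Nat.le_mul_of_pos_right _ (by positivity)

theorem scaledDist_zero (u v : Fin n) : scaledDist H 0 u v = H.dist u v := by
  simp [scaledDist]

theorem dist_lt_card (u v : Fin n) : H.dist u v < n := by
  by_cases h : H.Reachable u v
  · obtain ⟨p, hp, hl⟩ := h.exists_path_of_dist
    rw [← hl]
    simpa using hp.length_lt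
  · rw [SimpleGraph.dist_eq_zero_of_not_reachable h]
    exact u.pos

/-- Shortest paths can be cut at every length. -/
theorem exists_between {u v : Fin n} (h : H.Reachable u v) (a : ℕ) :
    ∃ l, H.Reachable u l ∧ H.Reachable l v ∧ H.dist u l ≤ a ∧ H.dist l v ≤ H.dist u v - a := by
  obtain ⟨p, hp⟩ := h.exists_walk_length_eq_dist
  refine ⟨p.getVert a, ⟨p.take a⟩, ⟨p.drop a⟩, ?_, ?_⟩
  · refine (SimpleGraph.dist_le (p.take a)).trans ?_
    simp
  · refine (SimpleGraph.dist_le (p.drop a)).trans ?_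
    simp [hp]

theorem near_le_one (k : ℕ) (u v : Fin n) : near H k u v ≤ 1 := by
  unfold near; split_ifs <;> omega

open Classical in
theorem near_zero (u v : Fin n) : near H 0 u v = if u = v ∨ H.Adj u v then 1 else 0 := by
  unfold near
  congr 1
  rw [eq_iff_iff, pow_zero]
  constructor
  · rintro ⟨h1, h2⟩
    rcases Nat.le_one_iff_eq_zero_or_eq_one.1 h2 with h | h
    · exact .inl (h1.dist_eq_zero_iff.1 h)
    · exact .inr (SimpleGraph.dist_eq_one_iff_adj.1 h)
  · rintro (rfl | h)
    · simp
    · exact ⟨h.reachable, (SimpleGraph.dist_eq_one_iff_adj.2 h).le⟩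

theorem near_ne_zero {k : ℕ} {u v : Fin n} :
    near H k u v ≠ 0 ↔ H.Reachable u v ∧ H.dist u v ≤ 2 ^ k := by
  simp [near]

theorem dist_triangle_of {u v l : Fin n} (h₁ : H.Reachable u l) (h₂ : H.Reachable l v) :
    H.dist u v ≤ H.dist u l + H.dist l v := by
  obtain ⟨p, hp⟩ := h₁.exists_walk_length_eq_dist
  obtain ⟨q, hq⟩ := h₂.exists_walk_length_eq_dist
  rw [← hp, ← hq, ← SimpleGraph.Walk.length_append]
  exact SimpleGraph.dist_le _

/-- Boolean squaring doubles the range. -/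
theorem near_succ (k : ℕ) (u v : Fin n) :
    near H (k + 1) u v = if 0 < ∑ l, near H k u l * near H k l v then 1 else 0 := by
  have : 0 < ∑ l, near H k u l * near H k l v ↔ H.Reachable u v ∧ H.dist u v ≤ 2 ^ (k + 1) := by
    rw [Nat.pos_iff_ne_zero, Ne, Finset.sum_eq_zero_iff]
    push Not
    constructor
    · rintro ⟨l, -, hl⟩
      obtain ⟨h1, h2⟩ := near_ne_zero.1 (left_ne_zero_of_mul hl)
      obtain ⟨h3, h4⟩ := near_ne_zero.1 (right_ne_zero_of_mul hl)
      refine ⟨h1.trans h3, (dist_triangle_of h1 h3).trans ?_⟩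
      rw [pow_succ]; omega
    · rintro ⟨h1, h2⟩
      rw [pow_succ] at h2
      obtain ⟨l, h3, h4, h5, h6⟩ := exists_between h1 (min (H.dist u v) (2 ^ k))
      exact ⟨l, Finset.mem_univ _, mul_ne_zero (near_ne_zero.2 ⟨h3, by omega⟩)
        (near_ne_zero.2 ⟨h4, by omega⟩)⟩
  classical
  rw [near]
  exact (if_congr this rfl rfl).symm

/-- On the coarsest scale all distances are `0` or `1`, which is where the refinement starts. -/
theorem scaledDist_top {h : ℕ} (hh : n ≤ 2 ^ h) (u v : Fin n) :
    scaledDist H h u v = if u = v then 0 else near H h u v := by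
  have hlt := dist_lt_card (H := H) u v
  split_ifs with huv
  · subst huv
    exact Nat.le_zero.1 (scaledDist_le_iff.2 (by simp))
  · by_cases hr : H.Reachable u v
    · rw [near, if_pos ⟨hr, by omega⟩]
      refine le_antisymm (scaledDist_le_iff.2 (by omega)) ?_
      rw [Nat.one_le_iff_ne_zero, ← Nat.pos_iff_ne_zero, lt_scaledDist_iff]
      simpa using hr.pos_dist_of_ne huv
    · rw [near, if_neg fun h => hr h.1]
      exact Nat.le_zero.1 (scaledDist_le_iff.2
        (by simp [SimpleGraph.dist_eq_zero_of_not_reachable hr]))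

/-- Seidel's parity test, on the graph of pairs at distance at most `2 ^ k`: the distance on the finer scale is twice that on the coarser scale, or one
less, and it is one less if and only if the average over the neighbours is smaller than the value at the node itself. -/
theorem scaledDist_eq (k : ℕ) (u v : Fin n) :
    scaledDist H k u v = 2 * scaledDist H (k + 1) u v -
      if ∑ l, scaledDist H (k + 1) u l * near H k l v <
        scaledDist H (k + 1) u v * ∑ l, near H k l v then 1 else 0 := by
  obtain ⟨x, hx⟩ : ∃ x, scaledDist H (k + 1) u v = x := ⟨_, rfl⟩
  by_cases hr : H.Reachable u v
  swap
  · have h0 : H.dist u v = 0 := SimpleGraph.dist_eq_zero_of_not_reachable hr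
    have h1 : ∀ k, scaledDist H k u v = 0 := fun k =>
      Nat.le_zero.1 (scaledDist_le_iff.2 (by simp [h0]))
    simp [h1]
  have hd1 : H.dist u v ≤ x * (2 * 2 ^ k) := by
    rw [← pow_succ']; exact scaledDist_le_iff.1 hx.le
  have hd2 : ∀ m, m < x → m * (2 * 2 ^ k) < H.dist u v := fun m hm => by
    rw [← pow_succ']; exact lt_scaledDist_iff.1 (hx ▸ hm)
  have hnb : ∀ l, near H k l v ≠ 0 → H.Reachable u l ∧ H.dist u l ≤ H.dist u v + 2 ^ k ∧
      H.dist u v ≤ H.dist u l + 2 ^ k := by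
    intro l hl
    obtain ⟨h1, h2⟩ := near_ne_zero.1 hl
    have h3 := hr.trans h1.symm
    have h4 := dist_triangle_of hr h1.symm
    have h5 := dist_triangle_of h3 h1
    rw [SimpleGraph.dist_comm (u := v)] at h4
    exact ⟨h3, by omega, by omega⟩
  rw [hx, Finset.mul_sum]
  have e1 : x * (2 * 2 ^ k) = 2 * x * 2 ^ k := by ring
  rcases Nat.eq_zero_or_pos x with rfl | hx0
  · have : scaledDist H k u v = 0 := Nat.le_zero.1 (scaledDist_le_iff.2 (by omega))
    simp [this]
  by_cases hpar : (2 * x - 1) * 2 ^ k < H.dist u v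
  · -- the distance is even on the finer scale: no neighbour is closer on the coarser scale
    have hle : ∑ l, x * near H k l v ≤ ∑ l, scaledDist H (k + 1) u l * near H k l v := by
      refine Finset.sum_le_sum fun l _ => ?_
      by_cases hl : near H k l v = 0
      · simp [hl]
      refine Nat.mul_le_mul_right _ ?_
      obtain ⟨h1, h2, h3⟩ := hnb l hl
      by_contra hc
      have h4 : scaledDist H (k + 1) u l ≤ x - 1 := by omega
      rw [scaledDist_le_iff, pow_succ'] at h4
      have e2 : (x - 1) * (2 * 2 ^ k) = (2 * x - 2) * 2 ^ k := by
        rw [← mul_assoc]; congr 1; omega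
      have e3 : (2 * x - 1) * 2 ^ k = (2 * x - 2) * 2 ^ k + 2 ^ k := by
        rw [← Nat.succ_mul]; congr 1; omega
      omega
    rw [if_neg (not_lt.2 hle), Nat.sub_zero]
    refine le_antisymm (scaledDist_le_iff.2 (by omega)) ?_
    by_contra hc
    have h4 : scaledDist H k u v ≤ 2 * x - 1 := by omega
    rw [scaledDist_le_iff] at h4
    omega
  · -- the distance is odd on the finer scale: some neighbour is closer on the coarser scale
    have e2 : (x - 1) * (2 * 2 ^ k) = (2 * x - 2) * 2 ^ k := by
      rw [← mul_assoc]; congr 1; omega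
    have e3 : (2 * x - 1) * 2 ^ k = (2 * x - 2) * 2 ^ k + 2 ^ k := by
      rw [← Nat.succ_mul]; congr 1; omega
    have e4 : 2 * x * 2 ^ k = (2 * x - 1) * 2 ^ k + 2 ^ k := by
      rw [← Nat.succ_mul]; congr 1; omega
    have h3 := hd2 (x - 1) (by omega)
    have hlt : ∑ l, scaledDist H (k + 1) u l * near H k l v < ∑ l, x * near H k l v := by
      obtain ⟨l₀, h4, h5, h6, h7⟩ := exists_between hr (H.dist u v - 2 ^ k)
      have hn0 : near H k l₀ v ≠ 0 := near_ne_zero.2 ⟨h5, by omega⟩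
      refine Finset.sum_lt_sum (fun l _ => ?_) ⟨l₀, Finset.mem_univ _, ?_⟩
      · by_cases hl : near H k l v = 0
        · simp [hl]
        refine Nat.mul_le_mul_right _ (scaledDist_le_iff.2 ?_)
        obtain ⟨h1, h2, h3⟩ := hnb l hl
        rw [pow_succ']; omega
      · refine Nat.mul_lt_mul_of_pos_right ?_ (Nat.pos_of_ne_zero hn0)
        have : scaledDist H (k + 1) u l₀ ≤ x - 1 := scaledDist_le_iff.2 (by rw [pow_succ']; omega)
        omega
    rw [if_pos hlt]
    refine le_antisymm (scaledDist_le_iff.2 (by omega)) ?_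
    by_contra hc
    have h4 : scaledDist H k u v ≤ 2 * x - 2 := by omega
    rw [scaledDist_le_iff] at h4
    omega

theorem encodeDist_eq (u v : Fin n) : DSO.encodeDist (H.edist u v) =
    if u = v then 1 else if H.dist u v = 0 then 0 else H.dist u v + 1 := by
  split_ifs with h1 h2
  · subst h1; simp [DSO.encodeDist]
  · rw [SimpleGraph.dist_eq_zero_iff_eq_or_not_reachable] at h2
    rw [SimpleGraph.edist_eq_top_of_not_reachable (h2.resolve_left h1)]
    simp [DSO.encodeDist]
  · have hr : H.Reachable u v := by
      by_contra h
      exact h2 (SimpleGraph.dist_eq_zero_of_not_reachable h)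
    rw [DSO.encodeDist, if_neg (SimpleGraph.edist_ne_top_iff_reachable.2 hr)]
    rfl

end Seidel

/-! ### Seidel's algorithm: the program -/

namespace WordRAM

/-- Filling an array with the entries of a matrix, row by row. -/
theorem Runs.fillMatrix {w i b n a o c : ℕ} {s : State} {x e : Expr} (F : Fin n → Fin n → ℕ)
    (hib : b ≠ i) (hN : s.reg b = n * n) (hc : x.cost + e.cost + 1 = c)
    (h : ∀ u v : Fin n, ∀ s₁, (∀ y, y ≠ i → s₁.reg y = s.reg y) →
      (∀ y, y ≠ a → s₁.arr y = s.arr y) → s₁.reg i = u * n + v →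
      (∀ j, (j < o ∨ o + (u * n + v) ≤ j) → s₁.arr a j = s.arr a j) →
      (x.Fits w s₁ ∧ e.Fits w s₁) ∧ x.val s₁ = o + (u * n + v) ∧ e.val s₁ = F u v) :
    Runs w (.count i b (.store a x e)) s (n * n * (c + 8) + 6) fun s' =>
      (∀ u v : Fin n, s'.arr a (o + (u * n + v)) = F u v) ∧
        ∀ j, (j < o ∨ o + n * n ≤ j) → s'.arr a j = s.arr a j := by
  have hk : ∀ k < n * n, k / n < n ∧ k % n < n := fun k hk =>
    ⟨Nat.div_lt_of_lt_mul hk, Nat.mod_lt _ (Nat.pos_of_ne_zero (by rintro rfl; simp at hk))⟩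
  refine Runs.mono (Runs.fill (o := o) (fun k => if h : k / n < n ∧ k % n < n then
    F ⟨k / n, h.1⟩ ⟨k % n, h.2⟩ else 0) hib hN hc ?_) le_rfl ?_
  · intro k hkn s₁ h1 h2 h3 h4
    have he : k / n * n + k % n = k := Nat.div_add_mod' k n
    rw [dif_pos (hk k hkn)]
    have := h ⟨k / n, (hk k hkn).1⟩ ⟨k % n, (hk k hkn).2⟩ s₁ h1 h2
    simp only [he] at this
    exact this h3 h4
  · rintro s' - - ⟨h1, h2⟩
    refine ⟨fun u v => ?_, h2⟩
    rw [h1 _ (DSO.index_lt u.2 v.2), dif_pos ⟨by rw [DSO.index_div _ v.2]; exact u.2,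
      by rw [DSO.index_mod _ v.2]; exact v.2⟩]
    congr 1 <;> apply Fin.ext
    · exact DSO.index_div _ v.2
    · exact DSO.index_mod _ v.2

end WordRAM

namespace Seidel

variable {w n : ℕ} {s : State} {H : SimpleGraph (Fin n)} {P : Prog} {TM : ℕ → ℕ → ℕ} {κ : ℕ}

theorem scaledDist_le_card (k : ℕ) (u v : Fin n) : scaledDist H k u v ≤ n :=
  (scaledDist_le_dist k u v).trans (dist_lt_card u v).le

/-- One step of the computation of the matrices `near k`. -/
def squareProg (P : Prog) : Prog :=
  .assign 23 (𝐫 22 * 𝐫 20) ;;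
  .count 24 20 (.store 10 (𝐫 24) (𝐚 5 (𝐫 23 + 𝐫 24))) ;;
  .count 24 20 (.store 11 (𝐫 24) (𝐚 5 (𝐫 23 + 𝐫 24))) ;;
  P ;;
  .count 24 20 (.store 5 (𝐫 23 + 𝐫 20 + 𝐫 24) (.op .lt (𝐜 0) (𝐚 12 (𝐫 24))))

/-- The matrix `near (k + 1)` is obtained from the square of `near k`, by `near_succ`. All these
matrices are kept, one after the other, in array `5`. -/
theorem squareProg_runs (hP : MatMul.MultipliesMatrices P TM κ) (hn : 2 ≤ n) {k : ℕ} (hkn : k < n)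
    (hw : κ * n.size ≤ w) (hb : (n + 1) ^ 3 < 2 ^ w) (h1 : s.reg 1 = n) (h20 : s.reg 20 = n * n)
    (h22 : s.reg 22 = k)
    (hk : ∀ u v : Fin n, s.arr 5 (k * (n * n) + (u * n + v)) = near H k u v) :
    Runs w (squareProg P) s (TM w n + 70 * (n * n) + 40) fun s' =>
      (∀ u v : Fin n, s'.arr 5 ((k + 1) * (n * n) + (u * n + v)) = near H (k + 1) u v) ∧
      ∀ j < (k + 1) * (n * n), s'.arr 5 j = s.arr 5 j := by
  intro hs
  have hb2 : k * (n * n) + n * n + n * n < 2 ^ w := by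
    refine lt_of_le_of_lt ?_ hb
    have : (k + 1) * (n * n) ≤ n * (n * n) := Nat.mul_le_mul_right _ hkn
    nlinarith
  have hw0 : w ≠ 0 := hs.pos.ne'
  have ix : ∀ u v : Fin n, (u : ℕ) * n + v < n * n := fun u v => DSO.index_lt u.2 v.2
  obtain ⟨K, hK⟩ : ∃ K, k * (n * n) = K := ⟨_, rfl⟩
  have hK1 : (k + 1) * (n * n) = K + n * n := by rw [← hK]; ring
  rw [hK] at hb2 hk
  rw [hK1]
  have pr : ∀ x < 40, ¬ P.WritesReg x := fun x hx h => by have := hP.reg x h; omega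
  have pa : ∀ x < 12, ¬ P.WritesArr x := fun x hx h => by have := hP.arr x h; omega
  refine Runs.le (Runs.step ?_ (Runs.seq (Runs.fillMatrix (o := 0) (near H k) (by omega) ?_ rfl ?_)
    fun s₁ hs₁ hf₁ q₁ => Runs.seq (Runs.fillMatrix (o := 0) (near H k) (by omega) ?_ rfl ?_)
    fun s₂ hs₂ hf₂ q₂ => Runs.seq (hP.runs w n s₂ hn hw ?_ ?_ ?_)
    fun s₃ hs₃ hf₃ q₃ => Runs.mono
      (Runs.fillMatrix (o := K + n * n) (near H (k + 1)) (by omega) ?_ rfl ?_)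
      le_rfl ?_)) ?_ hs
  · intro _; simp [Prog.Fits, h20, h22, hK]; omega
  · simpa [Prog.after] using h20
  · intro u v s' hr ha hi _
    have := ix u v
    have r23 : s'.reg 23 = K := by rw [hr 23 (by omega)]; simp [Prog.after, h20, h22, hK]
    have a5 : s'.arr 5 = s.arr 5 := by rw [ha 5 (by omega)]; rfl
    simp [hi, r23, a5, hk]; omega
  · rw [hf₁.reg 20 (by simp [Prog.WritesReg])]
    simpa [Prog.after] using h20
  · intro u v s' hr ha hi _
    have := ix u v
    have r23 : s'.reg 23 = K := by
      rw [hr 23 (by omega), hf₁.reg 23 (by simp [Prog.WritesReg])]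
      simp [Prog.after, h20, h22, hK]
    have a5 : s'.arr 5 = s.arr 5 := by
      rw [ha 5 (by omega), hf₁.arr 5 (by simp [Prog.WritesArr])]; rfl
    simp [hi, r23, a5, hk]; omega
  · rw [hf₂.reg 1 (by simp [Prog.WritesReg]), hf₁.reg 1 (by simp [Prog.WritesReg])]
    simpa [Prog.after] using h1
  · intro i hi
    have h10 : s₂.arr 10 = s₁.arr 10 := hf₂.arr 10 (by simp [Prog.WritesArr])
    have := q₁.1 ⟨i / n, Nat.div_lt_of_lt_mul hi⟩ ⟨i % n, Nat.mod_lt _ (by omega)⟩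
    simp only [Nat.div_add_mod', zero_add] at this
    rw [h10, this]
    exact (near_le_one _ _ _).trans (by omega)
  · intro i hi
    have := q₂.1 ⟨i / n, Nat.div_lt_of_lt_mul hi⟩ ⟨i % n, Nat.mod_lt _ (by omega)⟩
    simp only [Nat.div_add_mod', zero_add] at this
    rw [this]
    exact (near_le_one _ _ _).trans (by omega)
  · rw [hf₃.reg 20 (pr _ (by omega)), hf₂.reg 20 (by simp [Prog.WritesReg]),
      hf₁.reg 20 (by simp [Prog.WritesReg])]
    simpa [Prog.after] using h20
  · intro u v s' hr ha hi _
    have := ix u v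
    have r23 : s'.reg 23 = K := by
      rw [hr 23 (by omega), hf₃.reg 23 (pr _ (by omega)), hf₂.reg 23 (by simp [Prog.WritesReg]),
        hf₁.reg 23 (by simp [Prog.WritesReg])]
      simp [Prog.after, h20, h22, hK]
    have r20 : s'.reg 20 = n * n := by
      rw [hr 20 (by omega), hf₃.reg 20 (pr _ (by omega)), hf₂.reg 20 (by simp [Prog.WritesReg]),
        hf₁.reg 20 (by simp [Prog.WritesReg])]
      simpa [Prog.after] using h20
    have a12 : s'.arr 12 (u * n + v) = ∑ l, near H k u l * near H k l v := by
      rw [ha 12 (by omega), q₃ u u.2 v v.2, Finset.sum_range]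
      refine Finset.sum_congr rfl fun l _ => ?_
      rw [hf₂.arr 10 (by simp [Prog.WritesArr])]
      have e1 := q₁.1 u l
      have e2 := q₂.1 l v
      rw [zero_add] at e1 e2
      rw [e1, e2]
    simp [hi, r23, r20, a12, near_succ k u v]
    omega
  · rintro s' - - ⟨e1, e2⟩
    refine ⟨e1, fun j hj => ?_⟩
    rw [e2 j (.inl hj), hf₃.arr 5 (pa _ (by omega)), hf₂.arr 5 (by simp [Prog.WritesArr]),
      hf₁.arr 5 (by simp [Prog.WritesArr])]
    rfl
  · simp [Prog.size, Expr.cost]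
    generalize n * n = N
    omega

/-- The numbers of pairs at distance at most `2 ^ k`, column by column. -/
def columnSumProg : Prog :=
  .count 24 1 (.assign 26 (𝐜 0) ;;
    .count 25 1 (.assign 26 (𝐫 26 + 𝐚 11 (𝐫 25 * 𝐫 1 + 𝐫 24))) ;;
    .store 6 (𝐫 24) (𝐫 26))

theorem columnSumProg_runs (hb : n * n < 2 ^ w) (h1 : s.reg 1 = n) {A : Fin n → Fin n → ℕ}
    (hA : ∀ u v : Fin n, s.arr 11 (u * n + v) = A u v) (hA1 : ∀ u v, A u v ≤ 1) :
    Runs w columnSumProg s (60 * (n * n) + 60 * n + 60) fun s' =>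
      ∀ v : Fin n, s'.arr 6 v = ∑ l, A l v := by
  have ix : ∀ u v : Fin n, (u : ℕ) * n + v < n * n := fun u v => DSO.index_lt u.2 v.2
  have hnn : n ≤ n * n := Nat.le_mul_self n
  refine Runs.mono (Runs.count (N := n) (T := n * 17 + 20)
    (fun k s' => ∀ v : Fin n, v < k → s'.arr 6 v = ∑ l, A l v) ?_ ?_ (by omega) h1 ?_ ?_ ?_)
    (by nlinarith) (fun s' _ _ h v => h v v.2)
  · simp [Prog.WritesReg]
  · simp [Prog.WritesReg]
  · intro k s v h; exact h
  · intro v hv; omega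
  · intro k hk s₁ hs₁ hf hi h1' ih
    have hw0 : w ≠ 0 := hs₁.pos.ne'
    have a11 : s₁.arr 11 = s.arr 11 := hf.arr 11 (by simp [Prog.WritesArr])
    let g : ℕ → ℕ := fun l => if h : l < n then A ⟨l, h⟩ ⟨k, hk⟩ else 0
    have hg : ∀ j, ∑ l ∈ Finset.range j, g l ≤ j := fun j => by
      refine (Finset.sum_le_card_nsmul _ _ 1 fun l _ => ?_).trans (by simp)
      dsimp only [g]; split_ifs
      exacts [hA1 _ _, by omega]
    refine Runs.le (Runs.step (T := (n * (9 + 8) + 6) + 3) ?_ (Runs.seq (Runs.count (N := n) (T := 9)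
      (fun j s' => s'.reg 26 = ∑ l ∈ Finset.range j, g l) ?_ ?_ (by omega) ?_ ?_ ?_ ?_)
      fun s₂ hs₂ hf₂ q₂ => Runs.le (Runs.of_after (fun _ => ?_) fun _ => ?_) ?_)) ?_
    · intro _; simp [Prog.Fits]
    · simp [Prog.WritesReg]
    · simp [Prog.WritesReg]
    · simpa [Prog.after] using h1'
    · intro k s v h; simpa using h
    · simp [Prog.after]
    · intro j hj s₂ hs₂ hf₂ hj2 h12 ih2
      have r24 : s₂.reg 24 = k := by
        rw [hf₂.reg 24 (by simp [Prog.WritesReg])]; simpa [Prog.after] using hi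
      have e11 : s₂.arr 11 (j * n + k) = g j := by
        rw [hf₂.arr 11 (by simp [Prog.WritesArr])]
        have := hA ⟨j, hj⟩ ⟨k, hk⟩
        simpa [Prog.after, a11, g, hj] using this
      have := ix ⟨j, hj⟩ ⟨k, hk⟩
      have hgj := hg (j + 1)
      rw [Finset.sum_range_succ] at hgj
      simp only at this
      refine Runs.le (Runs.of_after (fun _ => ?_) fun _ => ?_) ?_
      · simp [Prog.Fits, hj2, h12, r24, ih2, e11]
        omega
      · simp [Prog.after, hj2, h12, r24, ih2, e11, Finset.sum_range_succ]
      · simp [Prog.size, Expr.cost]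
    · simp [Prog.Fits]
    · have r24 : s₂.reg 24 = k := by
        rw [hf₂.reg 24 (by simp [Prog.WritesReg])]; simpa [Prog.after] using hi
      intro v hv
      simp only [Prog.after, Expr.val_reg, r24, q₂, State.setArr_arr, if_true]
      rcases Nat.lt_succ_iff_lt_or_eq.1 hv with hv' | hv'
      · rw [Function.update_of_ne (by omega), hf₂.arr 6 (by simp [Prog.WritesArr])]
        exact ih v hv'
      · rw [hv', Function.update_self, Finset.sum_range]
        refine Finset.sum_congr rfl fun l _ => ?_
        obtain rfl : (⟨k, hk⟩ : Fin n) = v := Fin.ext hv'.symm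
        simp [g]
    · simp [Prog.size, Expr.cost]
    · simp [Prog.size, Expr.cost]
      omega

/-- One step of the computation of the distances from the matrices `near k`. -/
def refineProg (P : Prog) : Prog :=
  .assign 23 ((𝐫 21 - 𝐜 1 - 𝐫 22) * 𝐫 20) ;;
  .count 24 20 (.store 10 (𝐫 24) (𝐚 4 (𝐫 24))) ;;
  .count 24 20 (.store 11 (𝐫 24) (𝐚 5 (𝐫 23 + 𝐫 24))) ;;
  columnSumProg ;;
  P ;;
  .count 24 20 (.store 4 (𝐫 24) (𝐜 2 * 𝐚 4 (𝐫 24) -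
    .op .lt (𝐚 12 (𝐫 24)) (𝐚 4 (𝐫 24) * 𝐚 6 (𝐫 24 % 𝐫 1))))

/-- One matrix product refines the distances by a factor of `2`, by `scaledDist_eq`. -/
theorem refineProg_runs (hP : MatMul.MultipliesMatrices P TM κ) (hn : 2 ≤ n) {k h j : ℕ}
    (hkn : k < n) (hkj : k + 1 + j = h)
    (hw : κ * n.size ≤ w) (hb : (n + 1) ^ 3 < 2 ^ w) (h1 : s.reg 1 = n) (h20 : s.reg 20 = n * n)
    (h21 : s.reg 21 = h) (h22 : s.reg 22 = j)
    (hk : ∀ u v : Fin n, s.arr 5 (k * (n * n) + (u * n + v)) = near H k u v)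
    (hd : ∀ u v : Fin n, s.arr 4 (u * n + v) = scaledDist H (k + 1) u v) :
    Runs w (refineProg P) s (TM w n + 200 * (n * n) + 60 * n + 200) fun s' =>
      ∀ u v : Fin n, s'.arr 4 (u * n + v) = scaledDist H k u v := by
  intro hs
  have hb2 : k * (n * n) + n * n + n * n < 2 ^ w := by
    refine lt_of_le_of_lt ?_ hb
    have : (k + 1) * (n * n) ≤ n * (n * n) := Nat.mul_le_mul_right _ hkn
    nlinarith
  have hb3 : 2 * n < 2 ^ w := by
    refine lt_of_le_of_lt ?_ hb
    nlinarith [Nat.zero_le (n ^ 3)]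
  have hw0 : w ≠ 0 := hs.pos.ne'
  have ix : ∀ u v : Fin n, (u : ℕ) * n + v < n * n := fun u v => DSO.index_lt u.2 v.2
  obtain ⟨K, hK⟩ : ∃ K, k * (n * n) = K := ⟨_, rfl⟩
  have hkj' : h - 1 - j = k := by omega
  rw [hK] at hb2 hk
  have pr : ∀ x < 40, ¬ P.WritesReg x := fun x hx h => by have := hP.reg x h; omega
  have pa : ∀ x < 12, ¬ P.WritesArr x := fun x hx h => by have := hP.arr x h; omega
  have cr : ∀ x < 24, ¬ columnSumProg.WritesReg x := fun x hx => by
    simp [columnSumProg, Prog.WritesReg]; omega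
  have ca : ∀ x, x ≠ 6 → ¬ columnSumProg.WritesArr x := fun x hx => by
    simpa [columnSumProg, Prog.WritesArr] using hx
  refine Runs.le (Runs.step ?_ (Runs.seq
    (Runs.fillMatrix (o := 0) (scaledDist H (k + 1)) (by omega) ?_ rfl ?_)
    fun s₁ hs₁ hf₁ q₁ => Runs.seq (Runs.fillMatrix (o := 0) (near H k) (by omega) ?_ rfl ?_)
    fun s₂ hs₂ hf₂ q₂ => Runs.seq (columnSumProg_runs (A := near H k) (by omega) ?_ ?_ (near_le_one k))
    fun s₃ hs₃ hf₃ q₃ => Runs.seq (hP.runs w n s₃ hn hw ?_ ?_ ?_)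
    fun s₄ hs₄ hf₄ q₄ => Runs.mono
      (Runs.fillMatrix (o := 0) (scaledDist H k) (by omega) ?_ rfl ?_)
      le_rfl ?_)) ?_ hs
  · intro _; simp [Prog.Fits, h20, h21, h22, hkj', hK, hw0]; omega
  · simpa [Prog.after] using h20
  · intro u v s' hr ha hi _
    have a4 : s'.arr 4 = s.arr 4 := by rw [ha 4 (by omega)]; rfl
    simp [hi, a4, hd]
  · rw [hf₁.reg 20 (by simp [Prog.WritesReg])]
    simpa [Prog.after] using h20
  · intro u v s' hr ha hi _
    have := ix u v
    have r23 : s'.reg 23 = K := by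
      rw [hr 23 (by omega), hf₁.reg 23 (by simp [Prog.WritesReg])]
      simp [Prog.after, h20, h21, h22, hK, hkj']
    have a5 : s'.arr 5 = s.arr 5 := by
      rw [ha 5 (by omega), hf₁.arr 5 (by simp [Prog.WritesArr])]; rfl
    simp [hi, r23, a5, hk]; omega
  · rw [hf₂.reg 1 (by simp [Prog.WritesReg]), hf₁.reg 1 (by simp [Prog.WritesReg])]
    simpa [Prog.after] using h1
  · intro u v
    simpa using q₂.1 u v
  · rw [hf₃.reg 1 (cr _ (by omega)), hf₂.reg 1 (by simp [Prog.WritesReg]),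
      hf₁.reg 1 (by simp [Prog.WritesReg])]
    simpa [Prog.after] using h1
  · intro i hi
    rw [hf₃.arr 10 (ca _ (by omega)), hf₂.arr 10 (by simp [Prog.WritesArr])]
    have := q₁.1 ⟨i / n, Nat.div_lt_of_lt_mul hi⟩ ⟨i % n, Nat.mod_lt _ (by omega)⟩
    simp only [Nat.div_add_mod', zero_add] at this
    rw [this]
    exact scaledDist_le_card _ _ _
  · intro i hi
    rw [hf₃.arr 11 (ca _ (by omega))]
    have := q₂.1 ⟨i / n, Nat.div_lt_of_lt_mul hi⟩ ⟨i % n, Nat.mod_lt _ (by omega)⟩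
    simp only [Nat.div_add_mod', zero_add] at this
    rw [this]
    exact (near_le_one _ _ _).trans (by omega)
  · rw [hf₄.reg 20 (pr _ (by omega)), hf₃.reg 20 (cr _ (by omega)),
      hf₂.reg 20 (by simp [Prog.WritesReg]), hf₁.reg 20 (by simp [Prog.WritesReg])]
    simpa [Prog.after] using h20
  · intro u v s' hr ha hi hun
    have := ix u v
    have r1 : s'.reg 1 = n := by
      rw [hr 1 (by omega), hf₄.reg 1 (pr _ (by omega)), hf₃.reg 1 (cr _ (by omega)),
        hf₂.reg 1 (by simp [Prog.WritesReg]), hf₁.reg 1 (by simp [Prog.WritesReg])]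
      simpa [Prog.after] using h1
    have a4 : s'.arr 4 (u * n + v) = scaledDist H (k + 1) u v := by
      rw [hun _ (.inr (by omega)), hf₄.arr 4 (pa _ (by omega)), hf₃.arr 4 (ca _ (by omega)),
        hf₂.arr 4 (by simp [Prog.WritesArr]), hf₁.arr 4 (by simp [Prog.WritesArr])]
      exact hd u v
    have a6 : s'.arr 6 v = ∑ l, near H k l v := by
      rw [ha 6 (by omega), hf₄.arr 6 (pa _ (by omega))]
      exact q₃ v
    have a12 : s'.arr 12 (u * n + v) = ∑ l, scaledDist H (k + 1) u l * near H k l v := by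
      rw [ha 12 (by omega), q₄ u u.2 v v.2, Finset.sum_range]
      refine Finset.sum_congr rfl fun l _ => ?_
      rw [hf₃.arr 10 (ca _ (by omega)), hf₃.arr 11 (ca _ (by omega)),
        hf₂.arr 10 (by simp [Prog.WritesArr])]
      have e1 := q₁.1 u l
      have e2 := q₂.1 l v
      rw [zero_add] at e1 e2
      rw [e1, e2]
    have e1 := scaledDist_le_card (H := H) (k + 1) u v
    have e2 : ∑ l, near H k l v ≤ n := by
      refine (Finset.sum_le_card_nsmul _ _ 1 fun l _ => near_le_one _ _ _).trans (by simp)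
    have e3 := Nat.mul_le_mul e1 e2
    have hm : (u * n + v : ℕ) % n = v := DSO.index_mod _ v.2
    simp [hi, r1, a4, a12, hm, a6, scaledDist_eq k u v]
    omega
  · rintro s' - - ⟨e1, -⟩ u v
    simpa using e1 u v
  · simp [Prog.size, Expr.cost]
    generalize n * n = N
    omega

end Seidel

namespace Seidel

variable {w n : ℕ} {s : State} {H : SimpleGraph (Fin n)} {P : Prog} {TM : ℕ → ℕ → ℕ} {κ : ℕ}

/-- The computation of the matrices `near k`. -/
def nearProg (P : Prog) : Prog :=
  .assign 20 (𝐫 1 * 𝐫 1) ;; MatMul.powersProg 2 1 ;; .assign 21 (𝐫 42) ;;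
  .count 24 20 (.store 5 (𝐫 24) (.op .eq (𝐫 24 / 𝐫 1) (𝐫 24 % 𝐫 1) + 𝐚 3 (𝐫 24))) ;;
  .count 22 21 (squareProg P)

/-- The computation of the distances from the matrices `near k`. -/
def fromNearProg (P : Prog) : Prog :=
  .assign 23 (𝐫 21 * 𝐫 20) ;;
  .count 24 20 (.store 4 (𝐫 24) (𝐚 5 (𝐫 23 + 𝐫 24) - .op .eq (𝐫 24 / 𝐫 1) (𝐫 24 % 𝐫 1))) ;;
  .count 22 21 (refineProg P) ;;
  .count 24 20 (.store 4 (𝐫 24) (.op .eq (𝐫 24 / 𝐫 1) (𝐫 24 % 𝐫 1) +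
    .op .lt (𝐜 0) (𝐚 4 (𝐫 24)) * (𝐚 4 (𝐫 24) + 𝐜 1)))

/-- The distances in a graph by `O(log n)` multiplications of matrices. -/
def distancesProg (P : Prog) : Prog := nearProg P ;; fromNearProg P

theorem squareProg_reg (hP : MatMul.MultipliesMatrices P TM κ) {x : ℕ} (hx : x < 40)
    (h : (squareProg P).WritesReg x) : x = 23 ∨ x = 24 := by
  have pr : ¬ P.WritesReg x := fun h => by have := hP.reg x h; omega
  simp [squareProg, Prog.WritesReg, pr] at h
  omega

theorem squareProg_loop_reg (hP : MatMul.MultipliesMatrices P TM κ) {x : ℕ} (hx : x < 22) :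
    ¬ (Prog.count 22 21 (squareProg P)).WritesReg x := by
  rw [Prog.count_writesReg]
  rintro (h | h)
  · omega
  · have := squareProg_reg hP (by omega) h; omega

theorem refineProg_reg (hP : MatMul.MultipliesMatrices P TM κ) {x : ℕ} (hx : x < 40)
    (h : (refineProg P).WritesReg x) : 23 ≤ x := by
  have pr : ¬ P.WritesReg x := fun h => by have := hP.reg x h; omega
  simp [refineProg, columnSumProg, Prog.WritesReg, pr] at h
  omega

theorem refineProg_loop_reg (hP : MatMul.MultipliesMatrices P TM κ) {x : ℕ} (hx : x < 22) :
    ¬ (Prog.count 22 21 (refineProg P)).WritesReg x := by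
  rw [Prog.count_writesReg]
  rintro (h | h)
  · omega
  · have := refineProg_reg hP (by omega) h; omega

theorem refineProg_arr (hP : MatMul.MultipliesMatrices P TM κ) {x : ℕ} (hx : x < 10)
    (h : (refineProg P).WritesArr x) : x = 4 ∨ x = 6 := by
  have pr : ¬ P.WritesArr x := fun h => by have := hP.arr x h; omega
  simp [refineProg, columnSumProg, Prog.WritesArr, pr] at h
  omega

open Classical in
theorem nearProg_runs (hP : MatMul.MultipliesMatrices P TM κ) {h : ℕ} (hn : 2 ≤ n)
    (hh : Nat.clog 2 n = h) (hhn : h < n) (hw : κ * n.size ≤ w) (hb : (n + 1) ^ 3 < 2 ^ w)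
    (h1 : s.reg 1 = n) (hadj : ∀ u v : Fin n, s.arr 3 (u * n + v) = if H.Adj u v then 1 else 0) :
    Runs w (nearProg P) s (300 * ((h + 1) * (TM w n + n * n))) fun s' =>
      (s'.reg 1 = n ∧ s'.reg 20 = n * n ∧ s'.reg 21 = h) ∧
      ∀ j ≤ h, ∀ u v : Fin n, s'.arr 5 (j * (n * n) + (u * n + v)) = near H j u v := by
  intro hs
  have hb3 : n * n + 2 * n + 4 < 2 ^ w := by
    refine lt_of_le_of_lt ?_ hb
    nlinarith [Nat.zero_le (n ^ 3)]
  have hw0 : w ≠ 0 := hs.pos.ne'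
  have ix : ∀ u v : Fin n, (u : ℕ) * n + v < n * n := fun u v => DSO.index_lt u.2 v.2
  have dv : ∀ u v : Fin n, (u * n + v : ℕ) / n = u := fun u v => DSO.index_div _ v.2
  have md : ∀ u v : Fin n, (u * n + v : ℕ) % n = v := fun u v => DSO.index_mod _ v.2
  have hpow : (2 * 2) ^ h < 2 ^ w := by
    have := MatMul.pow_clog_le (n₀ := 2) (n := n) (a := 2 * 2) (e := 2) le_rfl hn (by norm_num)
    rw [hh] at this
    refine this.trans_lt (lt_of_le_of_lt ?_ hb)
    nlinarith [Nat.zero_le (n ^ 3), Nat.mul_le_mul_left (n * n) (show 1 ≤ n by omega)]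
  refine Runs.le (Runs.step ?_ (Runs.seq (MatMul.powersProg_runs (n := n) (H := h) le_rfl ?_ hh hpow
    (by simp [hw0]) (by omega) (by omega) (by simp [hw0])) fun s₁ hs₁ hf₁ ⟨_, h42, _, _⟩ =>
    Runs.step (T := (n * n * 20 + 6) + (h * (TM w n + 70 * (n * n) + 40 + 8) + 6)) ?_ ?_)) ?_ hs
  · intro _; simp [Prog.Fits, h1]; omega
  · simpa [Prog.after] using h1
  · simp [Prog.size, Expr.cost]
    have e1 : 1 ≤ n * n := Nat.mul_pos (by omega) (by omega)
    obtain ⟨T, hT⟩ : ∃ T, TM w n = T := ⟨_, rfl⟩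
    obtain ⟨N, hN⟩ : ∃ N, n * n = N := ⟨_, rfl⟩
    rw [hT]
    rw [hN] at e1 ⊢
    have e4 : h ≤ h * N := Nat.le_mul_of_pos_right _ e1
    have e5 : h * (T + 70 * N + 40 + 8) = h * T + 70 * (h * N) + 48 * h := by ring
    have e7 : (h + 1) * (T + N) = h * T + h * N + T + N := by ring
    rw [e5, e7]
    generalize h * T = t₁ at *
    generalize h * N = t₂ at *
    omega
  · simp [Prog.Fits]
  have r1 : s₁.reg 1 = n := by
    rw [hf₁.reg 1 (by simp [Prog.WritesReg, MatMul.powersProg])]; simpa [Prog.after] using h1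
  have r20 : s₁.reg 20 = n * n := by
    rw [hf₁.reg 20 (by simp [Prog.WritesReg, MatMul.powersProg])]; simp [Prog.after, h1]
  have a3 : s₁.arr 3 = s.arr 3 := by
    rw [hf₁.arr 3 (by simp [Prog.WritesArr, MatMul.powersProg])]; rfl
  obtain ⟨s₂, hs₂⟩ : ∃ s₂, Prog.after s₁ (.assign 21 (𝐫 42)) = s₂ := ⟨_, rfl⟩
  have b1 : s₂.reg 1 = n := by simpa [← hs₂, Prog.after] using r1
  have b20 : s₂.reg 20 = n * n := by simpa [← hs₂, Prog.after] using r20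
  have b21 : s₂.reg 21 = h := by simpa [← hs₂, Prog.after] using h42
  have b3 : ∀ u v : Fin n, s₂.arr 3 (u * n + v) = if H.Adj u v then 1 else 0 := by
    intro u v; simpa [← hs₂, Prog.after, a3] using hadj u v
  rw [hs₂]
  refine Runs.seq (Runs.fillMatrix (o := 0) (near H 0) (by omega) b20 (by simp [Expr.cost]) ?_)
    fun s₃ hs₃ hf₃ q₃ => Runs.mono (Runs.count (N := h) (fun k s' => ∀ j ≤ k, ∀ u v : Fin n,
      s'.arr 5 (j * (n * n) + (u * n + v)) = near H j u v) ?_ ?_ (by omega) ?_ ?_ ?_ ?_) le_rfl ?_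
  · intro u v s' hr ha hi _
    have r1' : s'.reg 1 = n := by rw [hr 1 (by omega), b1]
    have a3' : s'.arr 3 (u * n + v) = if H.Adj u v then 1 else 0 := by rw [ha 3 (by omega), b3]
    rw [near_zero]
    by_cases huv : u = v
    · subst huv
      simp [hi, r1', dv, md, a3']
      omega
    · have := Fin.val_ne_of_ne huv
      simp [hi, r1', dv, md, a3', huv, this]
      split_ifs <;> omega
  · exact fun h => by have := squareProg_reg hP (by omega) h; omega
  · exact fun h => by have := squareProg_reg hP (by omega) h; omega
  · rw [hf₃.reg 21 (by simp [Prog.WritesReg]), b21]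
  · intro k s v h; exact h
  · intro j hj u v
    obtain rfl : j = 0 := by omega
    simpa using q₃.1 u v
  · intro k hk s' hs' hf' hi hN ih
    refine Runs.mono (squareProg_runs hP hn (by omega) hw hb ?_ ?_ hi (ih k le_rfl)) le_rfl ?_
    · rw [hf'.reg 1 (squareProg_loop_reg hP (by omega)), hf₃.reg 1 (by simp [Prog.WritesReg]), b1]
    · rw [hf'.reg 20 (squareProg_loop_reg hP (by omega)), hf₃.reg 20 (by simp [Prog.WritesReg]), b20]
    · rintro s'' - - ⟨e1, e2⟩ j hj u v
      rcases Nat.le_succ_iff.1 hj with hj | rfl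
      · rw [e2 _ ?_, ih j hj]
        have := ix u v
        have : (j + 1) * (n * n) ≤ (k + 1) * (n * n) := Nat.mul_le_mul_right _ (by omega)
        have e : (j + 1) * (n * n) = j * (n * n) + n * n := by ring
        omega
      · exact e1 u v
  · intro s' _ hf' hI
    refine ⟨⟨?_, ?_, ?_⟩, hI⟩
    · rw [hf'.reg 1 (squareProg_loop_reg hP (by omega)), hf₃.reg 1 (by simp [Prog.WritesReg]), b1]
    · rw [hf'.reg 20 (squareProg_loop_reg hP (by omega)), hf₃.reg 20 (by simp [Prog.WritesReg]), b20]
    · rw [hf'.reg 21 (squareProg_loop_reg hP (by omega)), hf₃.reg 21 (by simp [Prog.WritesReg]), b21]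

theorem fromNearProg_runs (hP : MatMul.MultipliesMatrices P TM κ) {h : ℕ} (hn : 2 ≤ n)
    (hh : Nat.clog 2 n = h) (hhn : h < n) (hw : κ * n.size ≤ w) (hb : (n + 1) ^ 3 < 2 ^ w)
    (h1 : s.reg 1 = n) (h20 : s.reg 20 = n * n) (h21 : s.reg 21 = h)
    (hA : ∀ j ≤ h, ∀ u v : Fin n, s.arr 5 (j * (n * n) + (u * n + v)) = near H j u v) :
    Runs w (fromNearProg P) s (600 * ((h + 1) * (TM w n + n * n))) fun s' =>
      ∀ u v : Fin n, s'.arr 4 (u * n + v) = DSO.encodeDist (H.edist u v) := by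
  intro hs
  have hb2 : h * (n * n) + n * n + n * n < 2 ^ w := by
    refine lt_of_le_of_lt ?_ hb
    have : (h + 1) * (n * n) ≤ n * (n * n) := Nat.mul_le_mul_right _ hhn
    nlinarith
  have hb3 : 2 * n + 4 < 2 ^ w := by
    refine lt_of_le_of_lt ?_ hb
    nlinarith [Nat.zero_le (n ^ 3)]
  have hh2 : n ≤ 2 ^ h := hh ▸ Nat.le_pow_clog (by omega) n
  have hw0 : w ≠ 0 := hs.pos.ne'
  have ix : ∀ u v : Fin n, (u : ℕ) * n + v < n * n := fun u v => DSO.index_lt u.2 v.2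
  have dv : ∀ u v : Fin n, (u * n + v : ℕ) / n = u := fun u v => DSO.index_div _ v.2
  have md : ∀ u v : Fin n, (u * n + v : ℕ) % n = v := fun u v => DSO.index_mod _ v.2
  obtain ⟨K, hK⟩ : ∃ K, h * (n * n) = K := ⟨_, rfl⟩
  refine Runs.le (Runs.step ?_ (Runs.seq
    (Runs.fillMatrix (o := 0) (scaledDist H h) (by omega) ?_ rfl ?_) fun s₁ hs₁ hf₁ q₁ => Runs.seq
    (Runs.count (N := h) (T := TM w n + 200 * (n * n) + 60 * n + 200) (fun k s' => ∀ u v : Fin n,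
      s'.arr 4 (u * n + v) = scaledDist H (h - k) u v) ?_ ?_ (by omega) ?_ ?_ ?_ ?_)
    fun s₂ hs₂ hf₂ q₂ => Runs.mono
    (Runs.fillMatrix (o := 0) (fun u v => DSO.encodeDist (H.edist u v)) (by omega) ?_ rfl ?_)
    le_rfl ?_)) ?_ hs
  rotate_right
  · simp [Prog.size, Expr.cost]
    have e1 : 1 ≤ n * n := Nat.mul_pos (by omega) (by omega)
    have e2 : n ≤ n * n := Nat.le_mul_self n
    obtain ⟨T, hT⟩ : ∃ T, TM w n = T := ⟨_, rfl⟩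
    obtain ⟨N, hN⟩ : ∃ N, n * n = N := ⟨_, rfl⟩
    rw [hT]
    rw [hN] at e1 e2 ⊢
    have e3 : h * n ≤ h * N := Nat.mul_le_mul_left _ e2
    have e4 : h ≤ h * N := Nat.le_mul_of_pos_right _ e1
    have e6 : h * (T + 200 * N + 60 * n + 200 + 8) = h * T + 200 * (h * N) + 60 * (h * n) + 208 * h := by
      ring
    have e7 : (h + 1) * (T + N) = h * T + h * N + T + N := by ring
    rw [e6, e7]
    generalize h * T = t₁ at *
    generalize h * N = t₂ at *
    generalize h * n = t₃ at *
    omega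
  · intro _; simp [Prog.Fits, h20, h21]; omega
  · simpa [Prog.after] using h20
  · intro u v s' hr ha hi _
    have := ix u v
    have r1 : s'.reg 1 = n := by rw [hr 1 (by omega)]; simpa [Prog.after] using h1
    have r23 : s'.reg 23 = K := by rw [hr 23 (by omega)]; simpa [Prog.after, h20, h21] using hK
    have a5 : s'.arr 5 (K + (u * n + v)) = near H h u v := by
      rw [ha 5 (by omega), ← hK]; exact hA h le_rfl u v
    rw [scaledDist_top hh2]
    by_cases huv : u = v
    · subst huv
      have := near_le_one (H := H) h u u
      simp [hi, r1, r23, a5, dv, md]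
      omega
    · have := Fin.val_ne_of_ne huv
      simp [hi, r1, r23, a5, dv, md, huv, this]
      omega
  · exact fun h => by have := refineProg_reg hP (by omega) h; omega
  · exact fun h => by have := refineProg_reg hP (by omega) h; omega
  · rw [hf₁.reg 21 (by simp [Prog.WritesReg])]
    simpa [Prog.after] using h21
  · intro k s v h; exact h
  · intro u v
    simpa using q₁.1 u v
  · intro k hk s' hs' hf' hi hN ih
    refine refineProg_runs hP hn (k := h - (k + 1)) (by omega) (by omega) hw hb ?_ ?_ hN hi ?_ ?_
    · rw [hf'.reg 1 (refineProg_loop_reg hP (by omega)), hf₁.reg 1 (by simp [Prog.WritesReg])]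
      simpa [Prog.after] using h1
    · rw [hf'.reg 20 (refineProg_loop_reg hP (by omega)), hf₁.reg 20 (by simp [Prog.WritesReg])]
      simpa [Prog.after] using h20
    · intro u v
      rw [hf'.arr 5 (fun h => by have := refineProg_arr hP (by omega) (Prog.count_writesArr.1 h); omega),
        hf₁.arr 5 (by simp [Prog.WritesArr])]
      exact hA _ (by omega) u v
    · rwa [show h - (k + 1) + 1 = h - k by omega]
  · rw [hf₂.reg 20 (refineProg_loop_reg hP (by omega)), hf₁.reg 20 (by simp [Prog.WritesReg])]
    simpa [Prog.after] using h20
  · intro u v s' hr ha hi hun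
    have r1 : s'.reg 1 = n := by
      rw [hr 1 (by omega), hf₂.reg 1 (refineProg_loop_reg hP (by omega)), hf₁.reg 1 (by simp [Prog.WritesReg])]
      simpa [Prog.after] using h1
    have a4 : s'.arr 4 (u * n + v) = H.dist u v := by
      rw [hun _ (.inr (by omega)), q₂ u v, Nat.sub_self, scaledDist_zero]
    have := ix u v
    have hlt := dist_lt_card (H := H) u v
    rw [encodeDist_eq]
    by_cases huv : u = v
    · subst huv
      simp [hi, r1, a4, dv, md, hw0]
    · have := Fin.val_ne_of_ne huv
      by_cases h0 : H.dist u v = 0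
      · simp [hi, r1, a4, dv, md, huv, this, h0, hw0]
      · simp [hi, r1, a4, dv, md, huv, this, h0, hw0, Nat.pos_of_ne_zero h0]
        omega
  · rintro s' - - ⟨h1, -⟩ u v
    simpa using h1 u v

/-- Seidel's algorithm, for graphs that need not be connected: `O(log n)` products of matrices with
entries up to `n`. The links only enter through the adjacency matrix, and their number plays no
role. -/
theorem distancesProg_computes (hP : MatMul.MultipliesMatrices P TM κ) :
    DSO.ComputesDistances (distancesProg P)
      (fun w n _ => 1000 * ((Nat.clog 2 n + 1) * (TM w n + n * n))) (κ + 4) := by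
  have pr : ∀ x < 40, ¬ P.WritesReg x := fun x hx h => by have := hP.reg x h; omega
  have pa : ∀ x < 12, ¬ P.WritesArr x := fun x hx h => by have := hP.arr x h; omega
  refine ⟨fun x hx => ?_, fun x hx => ?_, ?_, ?_⟩
  · by_contra hlt
    simp [distancesProg, nearProg, fromNearProg, refineProg, squareProg, columnSumProg,
      MatMul.powersProg, Prog.WritesReg, pr x (by omega)] at hx
    omega
  · by_contra hlt
    simp [distancesProg, nearProg, fromNearProg, refineProg, squareProg, columnSumProg,
      MatMul.powersProg, Prog.WritesArr, pa x (by omega)] at hx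
    omega
  · simp [distancesProg, nearProg, fromNearProg, refineProg, squareProg, columnSumProg,
      MatMul.powersProg, Prog.Tosses, hP.tosses]
  intro w n m s H hn hw h1 _ hadj
  have hhn : Nat.clog 2 n < n := by
    have : Nat.clog 2 n ≤ n - 1 := Nat.clog_le_of_le_pow (by
      have := Nat.lt_two_pow_self (n := n - 1); omega)
    omega
  have hw' : κ * n.size ≤ w := le_trans (Nat.mul_le_mul_right _ (by omega)) hw
  have hb : (n + 1) ^ 3 < 2 ^ w := by
    have h2 : n + 1 ≤ 2 ^ n.size := Nat.lt_size_self n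
    have h3 : 3 * n.size < w := by
      have : 0 < n.size := Nat.size_pos.2 (by omega)
      nlinarith
    calc (n + 1) ^ 3 ≤ (2 ^ n.size) ^ 3 := Nat.pow_le_pow_left h2 3
      _ = 2 ^ (3 * n.size) := by rw [← pow_mul, mul_comm]
      _ < 2 ^ w := Nat.pow_lt_pow_right (by omega) h3
  exact Runs.le (Runs.seq (nearProg_runs hP hn rfl hhn hw' hb h1 hadj)
    fun s₁ _ _ ⟨⟨e1, e2, e3⟩, e4⟩ => fromNearProg_runs hP hn rfl hhn hw' hb e1 e2 e3 e4) (by omega)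

end Seidel

/-! ### The exponent of matrix multiplication -/

namespace MatMul

/-- The matrices `M i` of a bilinear algorithm span the space of all matrices, as one factor may be
the identity. -/
theorem sq_le_of_rankLE {n r : ℕ} (h : MatMulRankLE n r) : n * n ≤ r := by
  obtain ⟨α, β, M, h⟩ := h
  have hM : Submodule.span ℚ (Set.range M) = ⊤ := by
    refine Submodule.eq_top_iff'.2 fun A => ?_
    have := h A 1
    rw [mul_one] at this
    rw [this]
    exact Submodule.sum_mem _ fun i _ => Submodule.smul_mem _ _ (Submodule.subset_span ⟨i, rfl⟩)
  have h1 := finrank_range_le_card (R := ℚ) M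
  rw [Set.finrank, hM, finrank_top, Module.finrank_matrix] at h1
  simpa using h1

/-- The ordinary algorithm, which shows that the infimum in the definition of `matMulExponent` is
taken over a nonempty set. -/
theorem rankLE_cube (n : ℕ) : MatMulRankLE n (n ^ 3) := by
  let e : Fin (n ^ 3) ≃ Fin n × Fin n × Fin n :=
    Fintype.equivOfCardEq (by simp; ring)
  refine ⟨fun i => Matrix.entryLinearMap ℚ ℚ (e i).1 (e i).2.1,
    fun i => Matrix.entryLinearMap ℚ ℚ (e i).2.1 (e i).2.2,
    fun i => Matrix.single (e i).1 (e i).2.2 1, fun A B => ?_⟩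
  rw [e.sum_comp (fun p : Fin n × Fin n × Fin n => (Matrix.entryLinearMap ℚ ℚ p.1 p.2.1 A *
    Matrix.entryLinearMap ℚ ℚ p.2.1 p.2.2 B) • Matrix.single p.1 p.2.2 (1 : ℚ))]
  ext x y
  simp only [Matrix.sum_apply, Matrix.mul_apply, Fintype.sum_prod_type, Matrix.smul_apply,
    Matrix.single_apply, smul_eq_mul, mul_ite, mul_one, mul_zero, Matrix.entryLinearMap_apply]
  symm
  rw [Finset.sum_eq_single x (by intro b _ hb; simp [hb]) (by simp)]
  refine Finset.sum_congr rfl fun l _ => ?_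
  simp

theorem exists_common_denominator {ι : Type*} [Fintype ι] (g : ι → ℚ) :
    ∃ q : ℕ, 0 < q ∧ ∃ z : ι → ℤ, ∀ i, (z i : ℚ) = q * g i := by
  refine ⟨∏ i, (g i).den, Finset.prod_pos fun i _ => (g i).pos, ?_⟩
  have h : ∀ i, ∃ z : ℤ, (z : ℚ) = (∏ i, (g i).den : ℕ) * g i := by
    intro i
    obtain ⟨c, hc⟩ := Finset.dvd_prod_of_mem (fun i => (g i).den) (Finset.mem_univ i)
    refine ⟨c * (g i).num, ?_⟩
    rw [hc]
    push_cast
    rw [mul_comm ((g i).den : ℚ), mul_assoc, Rat.den_mul_eq_num]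
  choose z hz using h
  exact ⟨z, hz⟩

/-- A bilinear algorithm over the rationals becomes one over the integers, up to a factor, when the
denominators are cleared. -/
theorem exists_bilinearAlgorithm {n r : ℕ} (h : MatMulRankLE n r) :
    ∃ Q, 0 < Q ∧ Nonempty (BilinearAlgorithm n r Q) := by
  obtain ⟨α, β, M, h⟩ := h
  obtain ⟨a, ha0, α', hα⟩ := exists_common_denominator fun p : Fin r × Fin n × Fin n =>
    α p.1 (Matrix.single p.2.1 p.2.2 1)
  obtain ⟨b, hb0, β', hβ⟩ := exists_common_denominator fun p : Fin r × Fin n × Fin n =>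
    β p.1 (Matrix.single p.2.1 p.2.2 1)
  obtain ⟨c, hc0, γ', hγ⟩ := exists_common_denominator fun p : Fin r × Fin n × Fin n =>
    M p.1 p.2.1 p.2.2
  let ext (f : Fin r × Fin n × Fin n → ℤ) (i k : ℕ) : ℤ :=
    if h : i < r ∧ k / n < n ∧ k % n < n then f (⟨i, h.1⟩, ⟨k / n, h.2.1⟩, ⟨k % n, h.2.2⟩) else 0
  have hext : ∀ f (i : Fin r) (u v : Fin n), ext f i (u * n + v) = f (i, u, v) := by
    intro f i u v
    have h1 := DSO.index_div u v.2
    have h2 := DSO.index_mod u v.2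
    simp only [ext, h1, h2]
    rw [dif_pos ⟨i.2, u.2, v.2⟩]
  refine ⟨c * a * b, by positivity, ⟨⟨ext α', ext β', fun k i => ext γ' i k, ?_⟩⟩⟩
  intro x hx y hy u hu v hv v' hv' z hz
  have key := congrFun (congrFun (h (Matrix.single ⟨u, hu⟩ ⟨v, hv⟩ 1)
    (Matrix.single ⟨v', hv'⟩ ⟨z, hz⟩ 1)) ⟨x, hx⟩) ⟨y, hy⟩
  rw [Finset.sum_range]
  have : ∀ i : Fin r, ext γ' i (x * n + y) * ext α' i (u * n + v) * ext β' i (v' * n + z) =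
      γ' (i, ⟨x, hx⟩, ⟨y, hy⟩) * α' (i, ⟨u, hu⟩, ⟨v, hv⟩) * β' (i, ⟨v', hv'⟩, ⟨z, hz⟩) := fun i => by
    rw [← hext γ' i ⟨x, hx⟩ ⟨y, hy⟩, ← hext α' i ⟨u, hu⟩ ⟨v, hv⟩, ← hext β' i ⟨v', hv'⟩ ⟨z, hz⟩]
  simp only [this]
  have hq : ((∑ i : Fin r, γ' (i, ⟨x, hx⟩, ⟨y, hy⟩) * α' (i, ⟨u, hu⟩, ⟨v, hv⟩) *
      β' (i, ⟨v', hv'⟩, ⟨z, hz⟩) : ℤ) : ℚ) =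
      (c * a * b : ℕ) * (Matrix.single ⟨u, hu⟩ ⟨v, hv⟩ 1 * Matrix.single ⟨v', hv'⟩ ⟨z, hz⟩ 1 :
        Matrix (Fin n) (Fin n) ℚ) ⟨x, hx⟩ ⟨y, hy⟩ := by
    rw [key]
    push_cast
    rw [Matrix.sum_apply, Finset.mul_sum]
    refine Finset.sum_congr rfl fun i _ => ?_
    rw [hα, hβ, hγ, Matrix.smul_apply, smul_eq_mul]
    ring
  have hs : (Matrix.single ⟨u, hu⟩ ⟨v, hv⟩ 1 * Matrix.single ⟨v', hv'⟩ ⟨z, hz⟩ 1 :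
      Matrix (Fin n) (Fin n) ℚ) ⟨x, hx⟩ ⟨y, hy⟩ =
      if x = u ∧ v = v' ∧ z = y then 1 else 0 := by
    by_cases hvv : v = v'
    · subst hvv
      rw [Matrix.single_mul_single_same, Matrix.single_apply]
      simp [Fin.ext_iff, eq_comm]
    · rw [Matrix.single_mul_single_of_ne (h := by simpa [Fin.ext_iff] using hvv)]
      simp [hvv]
  rw [hs] at hq
  split_ifs at hq ⊢ with hc
  · exact_mod_cast hq.trans (mul_one _)
  · exact_mod_cast hq.trans (mul_zero _)

/-- Algorithms whose powers have a running time close to the exponent of matrix multiplication.  A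
constant factor in the number of multiplications is absorbed by `n₀ ^ ε` for a large `n₀`, so that
powers of a single algorithm of fixed size suffice. -/
theorem exists_bilinearAlgorithm_exponent {δ : ℝ} (hδ : 0 < δ) :
    ∃ n₀ r Q : ℕ, 2 ≤ n₀ ∧ n₀ * n₀ ≤ r ∧ (r : ℝ) ≤ (n₀ : ℝ) ^ (matMulExponent + δ) ∧ 0 < Q ∧
      Nonempty (BilinearAlgorithm n₀ r Q) := by
  obtain ⟨τ, ⟨C, hC⟩, hτ⟩ := exists_lt_of_csInf_lt
    (s := {τ : ℝ | ∃ C : ℝ, ∀ n : ℕ, 1 ≤ n → ∃ r : ℕ, (r : ℝ) ≤ C * (n : ℝ) ^ τ ∧ MatMulRankLE n r})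
    ⟨3, 1, fun n _ => ⟨n ^ 3, by norm_num, rankLE_cube n⟩⟩
    (show matMulExponent < matMulExponent + δ by linarith)
  have hlim : Tendsto (fun n : ℕ => (n : ℝ) ^ (matMulExponent + δ - τ)) atTop atTop :=
    (tendsto_rpow_atTop (by linarith)).comp tendsto_natCast_atTop_atTop
  obtain ⟨n₀, h1, h2⟩ := ((hlim.eventually_ge_atTop C).and (eventually_ge_atTop 2)).exists
  obtain ⟨r, hr, hrank⟩ := hC n₀ (by omega)
  obtain ⟨Q, hQ, hB⟩ := exists_bilinearAlgorithm hrank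
  have hn : (0 : ℝ) < n₀ := by positivity
  refine ⟨n₀, r, Q, h2, sq_le_of_rankLE hrank, hr.trans ?_, hQ, hB⟩
  calc C * (n₀ : ℝ) ^ τ ≤ (n₀ : ℝ) ^ (matMulExponent + δ - τ) * (n₀ : ℝ) ^ τ := by gcongr
    _ = _ := by rw [← Real.rpow_add hn]; congr 1; ring

/-- The exponents in question are at least `2`, so that the time `n ^ 2` for reading the matrices
does not matter. -/
theorem two_le_of_le_rpow {n₀ r : ℕ} {τ : ℝ} (hn : 2 ≤ n₀) (hr : n₀ * n₀ ≤ r)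
    (h : (r : ℝ) ≤ (n₀ : ℝ) ^ τ) : 2 ≤ τ := by
  have h1 : (1 : ℝ) < n₀ := by exact_mod_cast hn
  have h2 : (n₀ : ℝ) ^ (2 : ℝ) ≤ (n₀ : ℝ) ^ τ := by
    refine le_trans ?_ h
    rw [Real.rpow_two, sq]
    exact_mod_cast hr
  exact (Real.rpow_le_rpow_left_iff h1).1 h2

theorem pow_clog_le_rpow {n₀ r n : ℕ} {τ : ℝ} (hn₀ : 2 ≤ n₀) (hτ : 0 ≤ τ)
    (h : (r : ℝ) ≤ (n₀ : ℝ) ^ τ) (hn : 2 ≤ n) :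
    ((r ^ Nat.clog n₀ n : ℕ) : ℝ) ≤ (n₀ : ℝ) ^ τ * (n : ℝ) ^ τ := by
  have h1 := Nat.pow_pred_clog_lt_self (b := n₀) (by omega) (x := n) (by omega)
  have hpos : 0 < Nat.clog n₀ n := Nat.clog_pos (by omega) hn
  obtain ⟨H, hH⟩ : ∃ H, Nat.clog n₀ n = H + 1 := ⟨_, (Nat.succ_pred_eq_of_pos hpos).symm⟩
  rw [hH] at h1 ⊢
  have h2 : ((n₀ : ℝ) ^ H) ≤ n := by exact_mod_cast h1.le
  calc ((r ^ (H + 1) : ℕ) : ℝ) = (r : ℝ) ^ H * r := by push_cast; ring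
    _ ≤ ((n₀ : ℝ) ^ τ) ^ H * (n₀ : ℝ) ^ τ := by gcongr
    _ = ((n₀ : ℝ) ^ H) ^ τ * (n₀ : ℝ) ^ τ := by
      rw [← Real.rpow_natCast, ← Real.rpow_mul (by positivity), mul_comm τ, Real.rpow_mul (by positivity),
        Real.rpow_natCast]
    _ ≤ (n : ℝ) ^ τ * (n₀ : ℝ) ^ τ := by gcongr
    _ = _ := mul_comm _ _

end MatMul

/-! ### Failures and colours -/

namespace DSO

/-- If every node is close to one of few landmarks, then all distances are small or infinite. -/
theorem dist_lt_of_landmarks {V : Type*} (H : SimpleGraph V) (Λ : Finset V) (D : ℕ)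
    (hΛ : ∀ v, ∃ l ∈ Λ, H.edist v l ≤ D) {s t : V} (hst : H.Reachable s t) :
    H.dist s t < Λ.card * (2 * D + 1) := by
  by_contra! hle
  obtain ⟨p, hp⟩ := hst.exists_walk_length_eq_dist
  choose l hl hlD using hΛ
  obtain ⟨i, hi, j, hj, hne, hij⟩ := Finset.exists_ne_map_eq_of_card_lt_of_maps_to
    (s := Finset.range (Λ.card + 1)) (t := Λ) (by simp)
    (f := fun i => l (p.getVert (i * (2 * D + 1)))) fun i _ => hl _
  wlog hlt : i < j generalizing i j
  · exact this j hj i hi hne.symm hij.symm (by omega)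
  have hj' : j ≤ Λ.card := by simpa [Nat.lt_succ_iff] using hj
  -- By the pigeonhole principle, the nodes at positions `a` and `b` of a shortest path have the same landmark,
  -- so the path could be shortened between them.
  obtain ⟨a, ha⟩ : ∃ a, i * (2 * D + 1) = a := ⟨_, rfl⟩
  obtain ⟨b, hb⟩ : ∃ b, j * (2 * D + 1) = b := ⟨_, rfl⟩
  have hab : a + (2 * D + 1) ≤ b := by
    rw [← ha, ← hb, ← Nat.succ_mul]; exact Nat.mul_le_mul_right _ hlt
  have hbl : b ≤ p.length := by
    rw [hp, ← hb]; exact (Nat.mul_le_mul_right _ hj').trans hle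
  simp only [ha, hb] at hij
  have h1 : H.edist (p.getVert a) (p.getVert b) ≤ (2 * D : ℕ) := by
    calc H.edist (p.getVert a) (p.getVert b)
        ≤ H.edist (p.getVert a) (l (p.getVert a)) + H.edist (l (p.getVert a)) (p.getVert b) :=
          SimpleGraph.edist_triangle
      _ ≤ D + D := by
        gcongr
        · exact hlD _
        · rw [hij, SimpleGraph.edist_comm]; exact hlD _
      _ = (2 * D : ℕ) := by push_cast; ring
  have h2 : H.edist s (p.getVert a) ≤ a :=
    (SimpleGraph.edist_le (p.take a)).trans (by simp)
  have h3 : H.edist (p.getVert b) t ≤ (p.length - b : ℕ) :=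
    (SimpleGraph.edist_le (p.drop b)).trans (by simp)
  have h4 : H.edist s t ≤ (a + (2 * D) + (p.length - b) : ℕ) := by
    calc H.edist s t ≤ H.edist s (p.getVert b) + H.edist (p.getVert b) t :=
          SimpleGraph.edist_triangle
      _ ≤ (H.edist s (p.getVert a) + H.edist (p.getVert a) (p.getVert b)) +
          H.edist (p.getVert b) t := by gcongr; exact SimpleGraph.edist_triangle
      _ ≤ (a + (2 * D : ℕ)) + (p.length - b : ℕ) := by gcongr
      _ = _ := by push_cast; rfl
  rw [← hst.coe_dist_eq_edist, ← hp] at h4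
  have h5 : p.length ≤ a + 2 * D + (p.length - b) := by exact_mod_cast h4
  omega

variable {n f : ℕ} {G : SimpleGraph (Fin n)}

/-- Nodes and links as pairs of nodes: the node `v` is represented by `(v, v)`. -/
def Query.elements (q : Query G f) : List (Fin n × Fin n) :=
  (q.nodes.map fun v => (v, v)) ++ q.links

theorem Query.length_elements (q : Query G f) : q.elements.length ≤ f := by
  simpa [Query.elements] using q.card_le

theorem Query.node_mem {q : Query G f} {v : Fin n} : (v, v) ∈ q.elements ↔ v ∈ q.nodes := by
  simp only [Query.elements, List.mem_append, List.mem_map, Prod.mk.injEq, and_self,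
    exists_eq_right]
  exact or_iff_left fun h => (q.links_adj _ h).ne rfl

theorem Query.remaining_adj {q : Query G f} {u v : {v : Fin n | v ∉ q.nodes}} :
    q.remaining.Adj u v ↔ G.Adj u v ∧ ((u : Fin n), (v : Fin n)) ∉ q.elements ∧
      ((v : Fin n), (u : Fin n)) ∉ q.elements := by
  have h : ∀ x y : Fin n, x ≠ y → ((x, y) ∈ q.elements ↔ (x, y) ∈ q.links) := by
    intro x y hxy
    simp only [Query.elements, List.mem_append, List.mem_map, Prod.mk.injEq]
    refine or_iff_right ?_
    rintro ⟨z, -, rfl, rfl⟩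
    exact hxy rfl
  simp only [Query.remaining, SimpleGraph.comap_adj, SimpleGraph.deleteEdges_adj,
    Function.Embedding.subtype_apply]
  refine and_congr_right fun hadj => ?_
  rw [h _ _ hadj.ne, h _ _ hadj.ne', ← not_or, not_iff_not]
  simp only [Set.mem_ofPred_eq, List.mem_map, Sym2.eq_iff]
  constructor
  · rintro ⟨⟨x, y⟩, hp, ⟨rfl, rfl⟩ | ⟨rfl, rfl⟩⟩
    · exact .inl hp
    · exact .inr hp
  · rintro (hp | hp)
    · exact ⟨_, hp, .inl ⟨rfl, rfl⟩⟩
    · exact ⟨_, hp, .inr ⟨rfl, rfl⟩⟩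

/-- If only links fail, then distances remain small as long as they remain finite: following a
shortest path to a fixed node until it meets a failing link, one sees that all nodes are close to
this node or to an end of a failing link. -/
theorem Query.dist_le_of_links (q : Query G f) (hG : G.Connected) (hq : q.nodes = [])
    (hd : q.dist ≠ ⊤) : q.dist ≤ ((2 * f + 1) * (2 * G.diam + 1) : ℕ) := by
  classical
  have hmem : ∀ v, v ∉ q.nodes := by simp [hq]
  let Λ : Finset {v : Fin n | v ∉ q.nodes} :=
    insert ⟨q.src, q.src_notMem⟩ ((q.links.map fun p => ⟨p.1, hmem _⟩).toFinset ∪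
      (q.links.map fun p => ⟨p.2, hmem _⟩).toFinset)
  have hcard : Λ.card ≤ 2 * f + 1 := by
    have h1 := List.toFinset_card_le
      (q.links.map fun p => (⟨p.1, hmem _⟩ : {v : Fin n | v ∉ q.nodes}))
    have h2 := List.toFinset_card_le
      (q.links.map fun p => (⟨p.2, hmem _⟩ : {v : Fin n | v ∉ q.nodes}))
    have h3 := q.card_le
    simp only [List.length_map] at h1 h2
    refine (Finset.card_insert_le _ _).trans ?_
    have := Finset.card_union_le
      (q.links.map fun p => (⟨p.1, hmem _⟩ : {v : Fin n | v ∉ q.nodes})).toFinset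
      (q.links.map fun p => (⟨p.2, hmem _⟩ : {v : Fin n | v ∉ q.nodes})).toFinset
    omega
  have hwalk : ∀ (u v : Fin n) (p : G.Walk u v), v = q.src →
      ∃ l ∈ Λ, q.remaining.edist ⟨u, hmem u⟩ l ≤ p.length := by
    intro u v p
    induction p with
    | nil => rintro rfl; exact ⟨_, Finset.mem_insert_self _ _, by simp⟩
    | @cons u x v hadj p ih =>
      intro hv
      obtain ⟨l, hl, hle⟩ := ih hv
      by_cases hux : q.remaining.Adj ⟨u, hmem u⟩ ⟨x, hmem x⟩
      · refine ⟨l, hl, (SimpleGraph.edist_triangle (v := ⟨x, hmem x⟩)).trans ?_⟩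
        rw [SimpleGraph.edist_eq_one_iff_adj.2 hux, SimpleGraph.Walk.length_cons, add_comm]
        push_cast
        gcongr
      · refine ⟨⟨u, hmem u⟩, ?_, by simp⟩
        rw [Query.remaining_adj] at hux
        have : (u, x) ∈ q.links ∨ (x, u) ∈ q.links := by
          simp only [Query.elements, hq, List.map_nil, List.nil_append] at hux
          tauto
        refine Finset.mem_insert_of_mem (Finset.mem_union.2 ?_)
        rcases this with h | h
        · exact .inl (List.mem_toFinset.2 (List.mem_map.2 ⟨_, h, rfl⟩))
        · exact .inr (List.mem_toFinset.2 (List.mem_map.2 ⟨_, h, rfl⟩))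
  have hreach : q.remaining.Reachable ⟨q.src, q.src_notMem⟩ ⟨q.tgt, q.tgt_notMem⟩ :=
    SimpleGraph.edist_ne_top_iff_reachable.1 hd
  have key := dist_lt_of_landmarks q.remaining Λ G.diam (fun v => by
    have : Nonempty (Fin n) := ⟨q.src⟩
    obtain ⟨p, hp⟩ := (hG.preconnected v q.src).exists_walk_length_eq_dist
    obtain ⟨l, hl, hle⟩ := hwalk _ _ p rfl
    refine ⟨l, hl, hle.trans ?_⟩
    rw [hp]
    exact_mod_cast SimpleGraph.dist_le_diam (SimpleGraph.connected_iff_ediam_ne_top.1 hG)) hreach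
  rw [Query.dist, ← hreach.coe_dist_eq_edist]
  exact_mod_cast key.le.trans (Nat.mul_le_mul_right _ hcard)

/-- The links of `G` without colours in `S`, both in themselves and in their ends. (Every link has
two colours, one for each orientation.) -/
def avoiding (G : SimpleGraph (Fin n)) (χ : Fin n → Fin n → ℕ) (S : Set ℕ) :
    SimpleGraph (Fin n) where
  Adj u v := G.Adj u v ∧ (χ u v ∉ S ∧ χ v u ∉ S) ∧ χ u u ∉ S ∧ χ v v ∉ S
  symm := ⟨fun _ _ h => ⟨h.1.symm, h.2.1.symm, h.2.2.symm⟩⟩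
  loopless := ⟨fun _ h => h.1.ne rfl⟩

/-- If the colours of all failing elements are avoided, no distance becomes too small. -/
theorem Query.dist_le_edist_avoiding (q : Query G f) {χ : Fin n → Fin n → ℕ} {S : Set ℕ}
    (hS : ∀ p ∈ q.elements, χ p.1 p.2 ∈ S) : q.dist ≤ (avoiding G χ S).edist q.src q.tgt := by
  have h : ∀ (u v : Fin n) (p : (avoiding G χ S).Walk u v) (hu : u ∉ q.nodes) (hv : v ∉ q.nodes),
      q.remaining.edist ⟨u, hu⟩ ⟨v, hv⟩ ≤ p.length := by
    intro u v p
    induction p with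
    | nil => intro hu hv; simp
    | @cons u x v hadj p ih =>
      intro hu hv
      obtain ⟨h1, ⟨h2, h3⟩, h4, h5⟩ := id hadj
      have hx : x ∉ q.nodes := fun h => h5 (hS _ (Query.node_mem.2 h))
      have : q.remaining.Adj ⟨u, hu⟩ ⟨x, hx⟩ :=
        Query.remaining_adj.2 ⟨h1, fun h => h2 (hS _ h), fun h => h3 (hS _ h)⟩
      refine (SimpleGraph.edist_triangle (v := ⟨x, hx⟩)).trans ?_
      rw [SimpleGraph.edist_eq_one_iff_adj.2 this, SimpleGraph.Walk.length_cons, add_comm]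
      push_cast
      gcongr
      exact ih hx hv
  rcases eq_or_ne ((avoiding G χ S).edist q.src q.tgt) ⊤ with ht | ht
  · rw [ht]; exact le_top
  · obtain ⟨p, hp⟩ := SimpleGraph.exists_walk_of_edist_ne_top ht
    rw [← hp]
    exact h _ _ p q.src_notMem q.tgt_notMem

/-- If the colours of a few other elements, namely those on a shortest path, are not avoided, then
the distance does not become too large either.  These elements are the nodes of the path, and its
links in both orientations. -/
theorem Query.exists_elements (q : Query G f) {d : ℕ} (hd : q.dist = d) :
    ∃ E : List (Fin n × Fin n), E.length ≤ 3 * d + 1 ∧ (∀ p ∈ E, p ∉ q.elements) ∧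
      ∀ (χ : Fin n → Fin n → ℕ) (S : Set ℕ), (∀ p ∈ E, χ p.1 p.2 ∉ S) →
        (avoiding G χ S).edist q.src q.tgt ≤ d := by
  have h : ∀ (u v : {v : Fin n | v ∉ q.nodes}) (p : q.remaining.Walk u v),
      ∃ E : List (Fin n × Fin n), E.length ≤ 3 * p.length + 1 ∧ (∀ p ∈ E, p ∉ q.elements) ∧
        ((u : Fin n), (u : Fin n)) ∈ E ∧
        ∀ (χ : Fin n → Fin n → ℕ) (S : Set ℕ), (∀ p ∈ E, χ p.1 p.2 ∉ S) →
          (avoiding G χ S).edist u v ≤ p.length := by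
    intro u v p
    induction p with
    | @nil u =>
      refine ⟨[((u : Fin n), (u : Fin n))], by simp, ?_, by simp, by simp⟩
      simp only [List.mem_singleton, forall_eq]
      exact fun h => u.2 (Query.node_mem.1 h)
    | @cons u x v hadj p ih =>
      obtain ⟨E, h1, h2, h3, h4⟩ := ih
      refine ⟨((u : Fin n), (u : Fin n)) :: ((u : Fin n), (x : Fin n)) ::
        ((x : Fin n), (u : Fin n)) :: E, ?_, ?_, List.mem_cons_self, ?_⟩
      · simp only [List.length_cons, SimpleGraph.Walk.length_cons]; omega
      · have hadj' := Query.remaining_adj.1 hadj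
        simp only [List.forall_mem_cons]
        exact ⟨fun h => u.2 (Query.node_mem.1 h), hadj'.2.1, hadj'.2.2, h2⟩
      · intro χ S hS
        simp only [List.forall_mem_cons] at hS
        obtain ⟨k1, k2, k3, k4⟩ := hS
        have : (avoiding G χ S).Adj u x :=
          ⟨(Query.remaining_adj.1 hadj).1, ⟨k2, k3⟩, k1, k4 _ h3⟩
        refine (SimpleGraph.edist_triangle (v := (x : Fin n))).trans ?_
        rw [SimpleGraph.edist_eq_one_iff_adj.2 this, SimpleGraph.Walk.length_cons, add_comm]
        push_cast
        gcongr
        exact h4 χ S k4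
  obtain ⟨p, hp⟩ := SimpleGraph.exists_walk_of_edist_ne_top
    (show q.remaining.edist ⟨q.src, q.src_notMem⟩ ⟨q.tgt, q.tgt_notMem⟩ ≠ ⊤ by
      rw [Query.dist] at hd; rw [hd]; exact ENat.natCast_ne_top d)
  obtain ⟨E, h1, h2, -, h4⟩ := h _ _ p
  have hpd : p.length = d := by
    rw [Query.dist, ← hp] at hd
    exact_mod_cast hd
  rw [hpd] at h1 h4
  exact ⟨E, h1, h2, h4⟩

end DSO

/-! ### Random colours -/

namespace WordRAM

instance : IsProbabilityMeasure coinMeasure := by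
  unfold coinMeasure
  infer_instance

/-- The values of the coin tosses at finitely many different positions are independent and uniform.
-/
theorem coinMeasure_cylinder {ι : Type*} [Fintype ι] {φ : ι → ℕ} (hφ : Function.Injective φ)
    (y : ι → Bool) : coinMeasure.real {ρ | ∀ i, ρ (φ i) = y i} = (1 / 2) ^ Fintype.card ι := by
  have h : {ρ : ℕ → Bool | ∀ i, ρ (φ i) = y i} =
      Set.pi (Finset.univ.map ⟨φ, hφ⟩ : Finset ℕ) fun m => {Function.extend φ y (fun _ => false) m} := by
    ext ρ
    simp [Set.mem_pi, hφ.extend_apply]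
  rw [h, Measure.real, coinMeasure, Measure.infinitePi_pi _ (fun _ _ => MeasurableSet.of_discrete),
    Finset.prod_map]
  simp [PMF.uniformOfFintype_apply]

end WordRAM

namespace DSO

/-- The number with the binary digits `ρ o, ρ (o + 1), …, ρ (o + k - 1)`. -/
def ofBits (ρ : ℕ → Bool) (o : ℕ) : ℕ → ℕ
  | 0 => 0
  | k + 1 => ofBits ρ o k * 2 + (ρ (o + k)).toNat

theorem ofBits_lt (ρ : ℕ → Bool) (o k : ℕ) : ofBits ρ o k < 2 ^ k := by
  induction k with
  | zero => simp [ofBits]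
  | succ k ih =>
    have := Bool.toNat_le (ρ (o + k))
    rw [ofBits, pow_succ]; omega

theorem eq_of_ofBits_eq {ρ : ℕ → Bool} {o o' k : ℕ} (h : ofBits ρ o k = ofBits ρ o' k) :
    ∀ b < k, ρ (o + b) = ρ (o' + b) := by
  induction k with
  | zero => intro b hb; omega
  | succ k ih =>
    have h1 := Bool.toNat_le (ρ (o + k))
    have h2 := Bool.toNat_le (ρ (o' + k))
    simp only [ofBits] at h
    intro b hb
    rcases Nat.lt_succ_iff_lt_or_eq.1 hb with hb | rfl
    · exact ih (by omega) b hb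
    · have h3 : (ρ (o + b)).toNat = (ρ (o' + b)).toNat := by omega
      revert h3
      cases ρ (o + b) <;> cases ρ (o' + b) <;> simp

variable {n f : ℕ} {G : SimpleGraph (Fin n)}

/-- The colour of the pair `(u, v)` in the colouring number `j`: a number between `1` and `2 ^ k`,
given by a block of `k` coin tosses. -/
def colour (n k : ℕ) (ρ : ℕ → Bool) (j : ℕ) (u v : Fin n) : ℕ :=
  ofBits ρ ((j * (n * n) + (u * n + v)) * k) k + 1

/-- Different digits of different colours come from different coin tosses. -/
theorem block_injective {j j' k b b' n : ℕ} {p p' : Fin n × Fin n} (hb : b < k) (hb' : b' < k)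
    (h : (j * (n * n) + (p.1 * n + p.2)) * k + b = (j' * (n * n) + (p'.1 * n + p'.2)) * k + b') :
    j = j' ∧ p = p' ∧ b = b' := by
  have e1 := index_div (j * (n * n) + (p.1 * n + p.2)) hb
  have e2 := index_mod (j * (n * n) + (p.1 * n + p.2)) hb
  rw [h, index_div _ hb'] at e1
  rw [h, index_mod _ hb'] at e2
  have hp := index_lt p.1.2 p.2.2
  have hp' := index_lt p'.1.2 p'.2.2
  have e3 := index_div j hp
  have e4 := index_mod j hp
  rw [← e1, index_div _ hp'] at e3
  rw [← e1, index_mod _ hp'] at e4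
  have e5 := index_div p.1 p.2.2
  have e6 := index_mod p.1 p.2.2
  rw [← e4, index_div _ p'.2.2] at e5
  rw [← e4, index_mod _ p'.2.2] at e6
  exact ⟨e3.symm, Prod.ext (Fin.ext e5.symm) (Fin.ext e6.symm), e2.symm⟩

/-- It is unlikely that each of many colourings has a collision between two given disjoint lists.
This is a union bound over the colliding pairs and their common colours in all rounds: each round
fails with probability at most `E.length * F.length / 2 ^ k ≤ 1 / 2`. -/
theorem measure_collisions_le {k R : ℕ} (E F : List (Fin n × Fin n)) (hEF : ∀ p ∈ E, p ∉ F)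
    (hk : 2 * (E.length * F.length) ≤ 2 ^ k) :
    coinMeasure.real {ρ | ∀ j < R, ∃ p ∈ E, ∃ p' ∈ F,
      colour n k ρ j p.1 p.2 = colour n k ρ j p'.1 p'.2} ≤ (1 / 2) ^ R := by
  -- The positions of the coin tosses for the colours of the pairs selected by `c`.
  let φ (c : Fin R → Fin E.length × Fin F.length) : (Fin R × Fin k) × Bool → ℕ := fun i =>
    let p := if i.2 then E[(c i.1.1).1] else F[(c i.1.1).2]
    (i.1.1 * (n * n) + (p.1 * n + p.2)) * k + i.1.2
  have hφ : ∀ c, Function.Injective (φ c) := by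
    rintro c ⟨⟨j, b⟩, t⟩ ⟨⟨j', b'⟩, t'⟩ h
    obtain ⟨h1, h2, h3⟩ := block_injective b.2 b'.2 h
    obtain rfl := Fin.ext h1
    obtain rfl := Fin.ext h3
    congr 1
    cases t <;> cases t' <;> simp only [if_true, Bool.false_eq_true, if_false] at h2 ⊢
    · exact absurd (List.getElem_mem _) (h2 ▸ hEF _ (List.getElem_mem _))
    · exact absurd (List.getElem_mem _) (h2 ▸ hEF _ (List.getElem_mem _))
  have hsub : {ρ | ∀ j < R, ∃ p ∈ E, ∃ p' ∈ F,
      colour n k ρ j p.1 p.2 = colour n k ρ j p'.1 p'.2} ⊆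
      ⋃ i : (Fin R → Fin E.length × Fin F.length) × (Fin R × Fin k → Bool),
        {ρ | ∀ l, ρ (φ i.1 l) = i.2 l.1} := by
    intro ρ hρ
    have hρ' : ∀ j : Fin R, ∃ x : Fin E.length × Fin F.length,
        colour n k ρ j E[x.1].1 E[x.1].2 = colour n k ρ j F[x.2].1 F[x.2].2 := by
      intro j
      obtain ⟨p, hp, p', hp', h⟩ := hρ j j.2
      obtain ⟨a, ha, rfl⟩ := List.getElem_of_mem hp
      obtain ⟨b, hb, rfl⟩ := List.getElem_of_mem hp'
      exact ⟨(⟨a, ha⟩, ⟨b, hb⟩), h⟩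
    choose c hc using hρ'
    refine Set.mem_iUnion.2 ⟨(c, fun jb => ρ (φ c (jb, true))), ?_⟩
    rintro ⟨⟨j, b⟩, t⟩
    cases t
    · have := eq_of_ofBits_eq (Nat.succ_injective (hc j)) b b.2
      exact this.symm
    · rfl
  refine (measureReal_mono hsub).trans ((measureReal_iUnion_fintype_le _).trans ?_)
  rw [Finset.sum_congr rfl fun i _ => coinMeasure_cylinder (hφ i.1) fun l => i.2 l.1]
  simp only [Finset.sum_const, Finset.card_univ, Fintype.card_prod, Fintype.card_fun,
    Fintype.card_fin, Fintype.card_bool, nsmul_eq_mul]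
  have h1 : (2 * (E.length * F.length) : ℝ) ≤ 2 ^ k := by exact_mod_cast hk
  push_cast
  have h2 : ((E.length : ℝ) * F.length) ^ R * 2 ^ (R * k) * (1 / 2) ^ (R * k * 2) =
      ((2 * ((E.length : ℝ) * F.length)) * (1 / 2) ^ k * (1 / 2)) ^ R := by
    rw [show (2 : ℝ) ^ (R * k) = (2 ^ k) ^ R by rw [← pow_mul, mul_comm],
      show (1 / 2 : ℝ) ^ (R * k * 2) = ((1 / 2) ^ k * (1 / 2) ^ k) ^ R by
        rw [← pow_add, ← pow_mul]; congr 1; ring, ← mul_pow, ← mul_pow]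
    congr 1
    have : (2 : ℝ) ^ k * (1 / 2) ^ k = 1 := by rw [← mul_pow]; norm_num
    calc (E.length : ℝ) * F.length * 2 ^ k * ((1 / 2) ^ k * (1 / 2) ^ k) =
        E.length * F.length * (2 ^ k * (1 / 2) ^ k) * (1 / 2) ^ k := by ring
      _ = _ := by rw [this]; ring
  rw [h2]
  refine pow_le_pow_left₀ (by positivity) ?_ R
  have h3 : (2 * ((E.length : ℝ) * F.length)) * (1 / 2) ^ k ≤ 1 := by
    calc _ ≤ (2 : ℝ) ^ k * (1 / 2) ^ k := by gcongr
      _ = 1 := by rw [← mul_pow]; norm_num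
  linarith

theorem Query.ext_elements {q q' : Query G f} (h : q.elements = q'.elements)
    (hs : q.src = q'.src) (ht : q.tgt = q'.tgt) : q = q' := by
  have h1 : ∀ q : Query G f, q.elements.filter (fun p => p.1 ≠ p.2) = q.links := by
    intro q
    rw [Query.elements, List.filter_append, List.filter_eq_nil_iff.2, List.nil_append,
      List.filter_eq_self.2]
    · intro p hp; simpa using (q.links_adj p hp).ne
    · simp
  have h2 : ∀ q : Query G f, (q.elements.filter (fun p => p.1 = p.2)).map Prod.fst = q.nodes := by
    intro q
    rw [Query.elements, List.filter_append, List.filter_eq_self.2, List.filter_eq_nil_iff.2,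
      List.append_nil, List.map_map]
    · exact List.map_id _
    · intro p hp; simpa using (q.links_adj p hp).ne
    · simp
  have e1 := h1 q
  have e2 := h2 q
  rw [h, h1] at e1
  rw [h, h2] at e2
  cases q; cases q'
  simp only at *
  subst e1 e2 hs ht
  rfl

/-- A query as a pair of nodes with a tuple of at most `f` elements. -/
def Query.code (q : Query G f) : Fin n × Fin n × (Fin f → Option (Fin n × Fin n)) :=
  (q.src, q.tgt, fun i => q.elements[(i : ℕ)]?)

theorem Query.code_injective : Function.Injective (Query.code : Query G f → _) := by
  intro q q' h
  simp only [Query.code, Prod.mk.injEq] at h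
  refine Query.ext_elements (List.ext_getElem? fun i => ?_) h.1 h.2.1
  by_cases hi : i < f
  · exact congrFun h.2.2 ⟨i, hi⟩
  · rw [List.getElem?_eq_none (q.length_elements.trans (by omega)),
      List.getElem?_eq_none (q'.length_elements.trans (by omega))]

instance : Finite (Query G f) := Finite.of_injective _ Query.code_injective

/-- A query consists of two nodes and at most `f` elements, which are pairs of nodes. -/
theorem card_query_le (hn : 2 ≤ n) [Fintype (Query G f)] :
    Fintype.card (Query G f) ≤ n ^ (3 * f + 2) := by
  refine (Fintype.card_le_of_injective _ Query.code_injective).trans ?_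
  simp only [Fintype.card_prod, Fintype.card_fin, Fintype.card_fun, Fintype.card_option]
  have h : n * n + 1 ≤ n ^ 3 := by
    have : 2 * (n * n) ≤ n * (n * n) := Nat.mul_le_mul_right _ hn
    have h2 : 1 ≤ n * n := Nat.mul_pos (by omega) (by omega)
    calc n * n + 1 ≤ n * (n * n) := by omega
      _ = n ^ 3 := by ring
  calc n * (n * (n * n + 1) ^ f) ≤ n * (n * (n ^ 3) ^ f) := by gcongr
    _ = n ^ (3 * f + 2) := by rw [← pow_mul]; ring

/-- The colouring `χ` serves the query `q`: all colours of failing elements can be avoided without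
increasing the distance in the remaining graph.  The value `0` is no colour; it is allowed in `S` as
the leading digits of a palette with fewer than `f` colours are `0`. -/
def Query.ServedBy (q : Query G f) (χ : Fin n → Fin n → ℕ) : Prop :=
  ∀ S : Set ℕ, (∀ c ∈ S, c = 0 ∨ ∃ p ∈ q.elements, c = χ p.1 p.2) →
    (avoiding G χ S).edist q.src q.tgt ≤ q.dist

/-- With high probability, every query up to a distance of `L` is served by some colouring: a
colouring serves a query unless a failing element has the same colour as an element of a fixed
shortest path, and there are at most `n ^ (3 * f + 2)` queries. -/
theorem measure_served_ge {c k L R : ℕ} (hn : 2 ≤ n) (hk : 2 * ((3 * L + 1) * f) ≤ 2 ^ k)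
    (hR : n ^ (3 * f + 2 + c) ≤ 2 ^ R) :
    1 - 1 / (n : ℝ) ^ c ≤ coinMeasure.real {ρ | ∀ q : Query G f, q.dist ≤ L →
      ∃ j < R, q.ServedBy (colour n k ρ j)} := by
  have := Fintype.ofFinite (Query G f)
  let bad (q : Query G f) : Set (ℕ → Bool) :=
    {ρ | q.dist ≤ L ∧ ∀ j < R, ¬ q.ServedBy (colour n k ρ j)}
  have hbad : ∀ q, coinMeasure.real (bad q) ≤ (1 / 2) ^ R := by
    intro q
    by_cases hq : q.dist ≤ L
    swap
    · have : bad q = ∅ := by ext ρ; simp [bad, hq]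
      rw [this, measureReal_empty]; positivity
    obtain ⟨d, hd⟩ : ∃ d : ℕ, q.dist = d :=
      ⟨_, (ENat.natCast_toNat (ne_top_of_le_ne_top (ENat.natCast_ne_top L) hq)).symm⟩
    have hdL : d ≤ L := by rw [hd] at hq; exact_mod_cast hq
    obtain ⟨E, h1, h2, h3⟩ := q.exists_elements hd
    refine (measureReal_mono ?_).trans (measure_collisions_le E q.elements h2 (k := k) ?_)
    · rintro ρ ⟨-, hρ⟩ j hj
      by_contra! hc
      refine hρ j hj fun S hS => ?_
      rw [hd]
      refine h3 _ S fun p hp hpS => ?_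
      rcases hS _ hpS with h0 | ⟨p', hp', h0⟩
      · exact absurd h0 (Nat.succ_ne_zero _)
      · exact hc p hp p' hp' h0
    · refine le_trans ?_ hk
      gcongr
      · omega
      · exact q.length_elements
  have huniv : (Set.univ : Set (ℕ → Bool)) ⊆ {ρ | ∀ q : Query G f, q.dist ≤ L →
      ∃ j < R, q.ServedBy (colour n k ρ j)} ∪ ⋃ q, bad q := by
    intro ρ _
    by_cases h : ∀ q : Query G f, q.dist ≤ L → ∃ j < R, q.ServedBy (colour n k ρ j)
    · exact .inl h
    · push Not at h
      obtain ⟨q, h1, h2⟩ := h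
      exact .inr (Set.mem_iUnion.2 ⟨q, h1, h2⟩)
  have h1 := (measureReal_mono (μ := coinMeasure) huniv).trans (measureReal_union_le _ _)
  rw [probReal_univ] at h1
  have h2 : coinMeasure.real (⋃ q, bad q) ≤ 1 / (n : ℝ) ^ c := by
    refine (measureReal_iUnion_fintype_le _).trans ((Finset.sum_le_sum fun q _ => hbad q).trans ?_)
    rw [Finset.sum_const, nsmul_eq_mul, Finset.card_univ]
    have e1 : (Fintype.card (Query G f) : ℝ) ≤ n ^ (3 * f + 2) := by exact_mod_cast card_query_le hn
    have e2 : (n : ℝ) ^ (3 * f + 2) * n ^ c ≤ 2 ^ R := by rw [← pow_add]; exact_mod_cast hR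
    have e3 : (0 : ℝ) < (n : ℝ) ^ c := by positivity
    rw [le_div_iff₀ e3]
    calc _ ≤ (n : ℝ) ^ (3 * f + 2) * (1 / 2) ^ R * n ^ c := by gcongr
      _ = (n : ℝ) ^ (3 * f + 2) * n ^ c * (1 / 2) ^ R := by ring
      _ ≤ 2 ^ R * (1 / 2) ^ R := by gcongr
      _ = 1 := by rw [← mul_pow]; norm_num
  linarith

end DSO

/-! ### Queries -/

namespace DSO

variable {n f : ℕ} {G : SimpleGraph (Fin n)}

/-- The number whose digits in base `B` are the colours of the pairs in a list. -/
def palette (B : ℕ) (χ : Fin n → Fin n → ℕ) (l : List (Fin n × Fin n)) : ℕ :=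
  l.foldl (fun g p => g * B + χ p.1 p.2) 0

theorem palette_append (B : ℕ) (χ : Fin n → Fin n → ℕ) (l : List (Fin n × Fin n))
    (p : Fin n × Fin n) : palette B χ (l ++ [p]) = palette B χ l * B + χ p.1 p.2 := by
  simp [palette]

theorem palette_lt {B : ℕ} {χ : Fin n → Fin n → ℕ} (hχ : ∀ u v, χ u v < B)
    (l : List (Fin n × Fin n)) : palette B χ l < B ^ l.length := by
  induction l using List.reverseRecOn with
  | nil => simp [palette]
  | append_singleton l p ih =>
    rw [palette_append, List.length_append, List.length_singleton, pow_succ]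
    have := hχ p.1 p.2
    calc _ < palette B χ l * B + B := by omega
      _ = (palette B χ l + 1) * B := by ring
      _ ≤ _ := Nat.mul_le_mul_right _ ih

/-- The lowest `f` digits of `g` in base `B`. -/
def digits (B f g : ℕ) : Set ℕ := {x | ∃ i < f, x = g / B ^ i % B}

theorem palette_digit {B : ℕ} {χ : Fin n → Fin n → ℕ} (hχ : ∀ u v, χ u v < B)
    (l : List (Fin n × Fin n)) (p : Fin n × Fin n) (i : ℕ) :
    palette B χ (l ++ [p]) / B ^ i % B =
      if i = 0 then χ p.1 p.2 else palette B χ l / B ^ (i - 1) % B := by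
  have h := hχ p.1 p.2
  rw [palette_append]
  cases i with
  | zero => simp [Nat.mod_eq_of_lt h]
  | succ i =>
    rw [pow_succ', ← Nat.div_div_eq_div_mul, index_div _ h]
    simp

theorem mem_digits_palette {B : ℕ} {χ : Fin n → Fin n → ℕ} (hχ : ∀ u v, χ u v < B)
    {l : List (Fin n × Fin n)} (hl : l.length ≤ f) {p : Fin n × Fin n} (hp : p ∈ l) :
    χ p.1 p.2 ∈ digits B f (palette B χ l) := by
  suffices h : ∃ i < l.length, χ p.1 p.2 = palette B χ l / B ^ i % B by
    obtain ⟨i, hi, h⟩ := h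
    exact ⟨i, by omega, h⟩
  clear hl
  induction l using List.reverseRecOn with
  | nil => simp at hp
  | append_singleton l p' ih =>
    rw [List.length_append, List.length_singleton]
    rcases List.mem_append.1 hp with hp | hp
    · obtain ⟨i, hi, h⟩ := ih hp
      exact ⟨i + 1, by omega, by rw [palette_digit hχ]; simpa using h⟩
    · obtain rfl := List.mem_singleton.1 hp
      exact ⟨0, by omega, by rw [palette_digit hχ]; simp⟩

theorem of_mem_digits_palette {B : ℕ} {χ : Fin n → Fin n → ℕ} (hχ : ∀ u v, χ u v < B)
    {l : List (Fin n × Fin n)} {x : ℕ} (hx : x ∈ digits B f (palette B χ l)) :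
    x = 0 ∨ ∃ p ∈ l, x = χ p.1 p.2 := by
  obtain ⟨i, -, rfl⟩ := hx
  induction l using List.reverseRecOn generalizing i with
  | nil => simp [palette]
  | append_singleton l p' ih =>
    rw [palette_digit hχ]
    split_ifs with hi
    · exact .inr ⟨p', by simp, rfl⟩
    · rcases ih (i - 1) with h | ⟨p, hp, h⟩
      · exact .inl h
      · exact .inr ⟨p, by simp [hp], h⟩

/-- The data structure of the oracle for the colourings `χ 0, …, χ (R - 1)` with colours between `1`
and `B - 1`: after a header, it consists of the colours and of the distances in the graphs that avoid
the colours given by the digits of a number `g < B ^ f`. -/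
structure IsTable (G : SimpleGraph (Fin n)) (f R B : ℕ) (χ : ℕ → Fin n → Fin n → ℕ) (A : ℕ → ℕ) :
    Prop where
  size : A 0 = n
  base : A 1 = B
  rounds : A 2 = R
  palettes : A 3 = B ^ f
  colour : ∀ j < R, ∀ u v : Fin n, A (4 + (j * (n * n) + (u * n + v))) = χ j u v
  dist : ∀ j < R, ∀ g < B ^ f, ∀ u v : Fin n,
    A (4 + R * (n * n) + ((j * B ^ f + g) * (n * n) + (u * n + v))) =
      encodeDist ((avoiding G (χ j) (digits B f g)).edist u v)

/-- The answer to a query: the best of the distances found in the different rounds. -/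
noncomputable def Query.answer (q : Query G f) (R B : ℕ) (χ : ℕ → Fin n → Fin n → ℕ) : ℕ∞ :=
  (Finset.range R).inf fun j =>
    (avoiding G (χ j) (digits B f (palette B (χ j) q.elements))).edist q.src q.tgt

/-- All estimates are upper bounds, and one is exact when the distance is at most `L`. Finite
distances exceed `L` only if nodes fail, and then only beyond the range in which the answer has to
be exact; infinite distances are never underestimated. -/
theorem Query.correct_answer (q : Query G f) {R B L : ℕ} {χ : ℕ → Fin n → Fin n → ℕ}
    (hG : G.Connected) (hχ : ∀ j < R, ∀ u v, χ j u v < B)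
    (hL : (2 * f + 1) * (2 * G.diam + 1) ≤ L)
    (hq : q.dist ≤ L → ∃ j < R, q.ServedBy (χ j)) : q.Correct (q.answer R B χ) := by
  have hle : q.dist ≤ q.answer R B χ := Finset.le_inf fun j hj =>
    q.dist_le_edist_avoiding fun p hp =>
      mem_digits_palette (hχ j (Finset.mem_range.1 hj)) q.length_elements hp
  refine ⟨hle, fun h => le_antisymm ?_ hle⟩
  by_cases htop : q.dist = ⊤
  · rw [htop]; exact le_top
  have hdL : q.dist ≤ L := by
    rcases h with h | h
    · exact (q.dist_le_of_links hG h htop).trans (by exact_mod_cast hL)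
    · refine h.trans ?_
      have : (f + 1) * G.diam ≤ L := le_trans (by nlinarith [Nat.zero_le (f * G.diam)]) hL
      exact_mod_cast this
  obtain ⟨j, hj, hs⟩ := hq hdL
  exact (Finset.inf_le (Finset.mem_range.2 hj)).trans
    (hs _ fun x hx => of_mem_digits_palette (hχ j hj) hx)

/-- The minimum of distances in terms of their encodings, as the query program computes it. -/
theorem encodeDist_min (a b : ℕ∞) : encodeDist (min a b) =
    if 0 < encodeDist b ∧ (encodeDist a = 0 ∨ encodeDist b < encodeDist a) then encodeDist b
    else encodeDist a := by
  induction a using ENat.recTopCoe with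
  | top => induction b using ENat.recTopCoe <;> simp [encodeDist]
  | coe a =>
    induction b using ENat.recTopCoe with
    | top => simp [encodeDist]
    | coe b =>
      have h : min (a : ℕ∞) b = (min a b : ℕ) := by norm_cast
      rw [h]
      simp only [encodeDist, ENat.natCast_ne_top, if_false, ENat.toNat_natCast]
      rcases Nat.lt_or_ge b a with hab | hab
      · rw [min_eq_right hab.le, if_pos (by omega)]
      · rw [min_eq_left hab, if_neg (by omega)]

theorem flatten_getD (l : List (Fin n × Fin n)) (i : ℕ) (hi : i < l.length) :
    (flatten l).getD (2 * i) 0 = l[i].1 ∧ (flatten l).getD (2 * i + 1) 0 = l[i].2 := by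
  induction l generalizing i with
  | nil => simp at hi
  | cons p l ih =>
    cases i with
    | zero => simp [flatten]
    | succ i => simpa [flatten, Nat.mul_succ] using ih i (by simpa using hi)

theorem Query.encode_node (q : Query G f) {i : ℕ} (hi : i < q.nodes.length) :
    q.encode.getD (i + 4) 0 = q.nodes[i] := by
  simp only [Query.encode, List.cons_append, List.getD_cons_succ]
  rw [List.getD_append _ _ _ _ (by simpa using hi)]
  simp [hi, ← List.map_eq_flatMap]

theorem Query.encode_link (q : Query G f) {i : ℕ} (hi : i < q.links.length) :
    q.encode.getD (q.nodes.length + 2 * i + 4) 0 = q.links[i].1 ∧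
      q.encode.getD (q.nodes.length + 2 * i + 5) 0 = q.links[i].2 := by
  have := flatten_getD q.links i hi
  rw [← this.1, ← this.2]
  simp only [Query.encode, List.cons_append, List.getD_cons_succ]
  constructor
  · rw [List.getD_append_right _ _ _ _ (by simp)]
    simp
  · rw [List.getD_append_right _ _ _ _ (by simp; omega)]
    simp [add_assoc]

end DSO

/-! ### The query program -/

namespace DSO

variable {n f : ℕ} {G : SimpleGraph (Fin n)}

/-- Computing the palette of the failing elements, in the round given by register `8`, in register
`10`.  Array `0` holds the query: the failing nodes start in cell `4`, followed by the links. -/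
def paletteProg : Prog :=
  (.assign 10 (𝐜 0) ;; .assign 11 (𝐫 8 * 𝐫 5 + 𝐜 4)) ;;
  .count 9 6 (.assign 10 (𝐫 10 * 𝐫 2 +
    𝐚 1 (𝐫 11 + (𝐚 0 (𝐫 9 + 𝐜 4) * 𝐫 1 + 𝐚 0 (𝐫 9 + 𝐜 4))))) ;;
  .count 9 7 (.assign 10 (𝐫 10 * 𝐫 2 +
    𝐚 1 (𝐫 11 + (𝐚 0 (𝐫 6 + 𝐜 2 * 𝐫 9 + 𝐜 4) * 𝐫 1 + 𝐚 0 (𝐫 6 + 𝐜 2 * 𝐫 9 + 𝐜 5)))))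

/-- The query program: in every round, it looks up the distance for the palette of the failing
elements.  Register `0` holds the best distance so far, encoded by `encodeDist`. -/
def queryProg : Prog :=
  (.assign 1 (𝐚 1 (𝐜 0)) ;; .assign 2 (𝐚 1 (𝐜 1)) ;; .assign 3 (𝐚 1 (𝐜 2)) ;;
    .assign 4 (𝐚 1 (𝐜 3)) ;; .assign 5 (𝐫 1 * 𝐫 1) ;; .assign 6 (𝐚 0 (𝐜 2)) ;;
    .assign 7 (𝐚 0 (𝐜 3))) ;;
  .count 8 3 (
    paletteProg ;;
    .assign 12 (𝐚 1 (𝐜 4 + 𝐫 3 * 𝐫 5 + ((𝐫 8 * 𝐫 4 + 𝐫 10) * 𝐫 5 +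
      (𝐚 0 (𝐜 0) * 𝐫 1 + 𝐚 0 (𝐜 1))))) ;;
    .cond (.op .lt (𝐜 0) (𝐫 12))
      (.cond (.op .eq (𝐫 0) (𝐜 0) + .op .lt (𝐫 12) (𝐫 0)) (.assign 0 (𝐫 12)) .skip) .skip)

variable {w R B : ℕ} {s : State} {χ : ℕ → Fin n → Fin n → ℕ}

theorem Query.elements_take_node (q : Query G f) {i : ℕ} (hi : i < q.nodes.length) :
    q.elements.take (i + 1) = q.elements.take i ++ [(q.nodes[i], q.nodes[i])] := by
  have hi' : i < q.elements.length := by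
    simp only [Query.elements, List.length_append, List.length_map]; omega
  rw [List.take_succ_eq_append_getElem hi']
  congr 2
  simp [Query.elements, List.getElem_append_left, hi]

theorem Query.elements_take_link (q : Query G f) {i : ℕ} (hi : i < q.links.length) :
    q.elements.take (q.nodes.length + i + 1) =
      q.elements.take (q.nodes.length + i) ++ [q.links[i]] := by
  have hi' : q.nodes.length + i < q.elements.length := by
    simp only [Query.elements, List.length_append, List.length_map]; omega
  rw [List.take_succ_eq_append_getElem hi']
  congr 2
  simp [Query.elements, List.getElem_append_right]

theorem paletteProg_runs (q : Query G f) (hT : IsTable G f R B χ (s.arr 1))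
    (hχ : ∀ j < R, ∀ u v, χ j u v < B) (hB : 0 < B)
    (hw : 4 + R * (n * n) + R * B ^ f * (n * n) < 2 ^ w) (hfw : 2 * f + 8 < 2 ^ w)
    (h0 : ∀ i, s.arr 0 i = q.encode.getD i 0)
    (h1 : s.reg 1 = n) (h2 : s.reg 2 = B) (h5 : s.reg 5 = n * n) (h6 : s.reg 6 = q.nodes.length)
    (h7 : s.reg 7 = q.links.length) {j : ℕ} (hj : j < R) (h8 : s.reg 8 = j) :
    Runs w paletteProg s (100 * f + 50) fun s' => s'.reg 10 = palette B (χ j) q.elements := by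
  have hlen := q.card_le
  have hn0 : 0 < n := q.src.pos
  have hRN : (j + 1) * (n * n) ≤ R * (n * n) := Nat.mul_le_mul_right _ hj
  have hBf : B ^ f ≤ R * B ^ f * (n * n) := by
    have h1 : 0 < R * (n * n) := Nat.mul_pos (by omega) (Nat.mul_pos hn0 hn0)
    calc B ^ f ≤ R * (n * n) * B ^ f := Nat.le_mul_of_pos_left _ h1
      _ = _ := by ring
  have hpal : ∀ i, palette B (χ j) (q.elements.take i) < B ^ f := fun i =>
    (palette_lt (hχ j hj) _).trans_le (Nat.pow_le_pow_right hB
      (((List.length_take_le' _ _)).trans q.length_elements))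
  have ix : ∀ u v : Fin n, (u : ℕ) * n + v < n * n := fun u v => index_lt u.2 v.2
  obtain ⟨J, hJ⟩ : ∃ J, j * (n * n) = J := ⟨_, rfl⟩
  have hJ' : (j + 1) * (n * n) = J + n * n := by rw [← hJ]; ring
  have hcol := fun u v => hT.colour j hj u v
  rw [hJ'] at hRN
  simp only [hJ] at hcol
  refine Runs.le (Runs.step ?_ (Runs.seq (Runs.count (N := q.nodes.length) (T := 30)
    (fun i s' => s'.reg 10 = palette B (χ j) (q.elements.take i)) ?_ ?_ (by omega) ?_ ?_ ?_ ?_)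
    fun s₁ hs₁ hf₁ q₁ => Runs.mono (Runs.count (N := q.links.length) (T := 40)
    (fun i s' => s'.reg 10 = palette B (χ j) (q.elements.take (q.nodes.length + i)))
    ?_ ?_ (by omega) ?_ ?_ q₁ ?_) le_rfl ?_)) ?_
  rotate_right
  · simp [Prog.size, Expr.cost]
    omega
  · intro hs
    have hw0 := hs.pos.ne'
    simp [Prog.Fits, Prog.after, h8, h5, hJ]
    omega
  · simp [Prog.WritesReg]
  · simp [Prog.WritesReg]
  · simpa [Prog.after] using h6
  · intro k s v h; simpa using h
  · simp [Prog.after, palette]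
  · intro i hi s₁ hs₁ hf₁ hi₁ _ ih
    have r1 : s₁.reg 1 = n := by
      rw [hf₁.reg 1 (by simp [Prog.WritesReg])]; simpa [Prog.after] using h1
    have r2 : s₁.reg 2 = B := by
      rw [hf₁.reg 2 (by simp [Prog.WritesReg])]; simpa [Prog.after] using h2
    have r11 : s₁.reg 11 = J + 4 := by
      rw [hf₁.reg 11 (by simp [Prog.WritesReg])]; simp [Prog.after, h5, h8, hJ]
    have a0 : s₁.arr 0 (i + 4) = q.nodes[i] := by
      rw [hf₁.arr 0 (by simp [Prog.WritesArr]), ← q.encode_node hi]; exact h0 _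
    have a1 := hcol q.nodes[i] q.nodes[i]
    have := ix q.nodes[i] q.nodes[i]
    have a1' : s₁.arr 1 (J + 4 + (q.nodes[i] * n + q.nodes[i])) = χ j q.nodes[i] q.nodes[i] := by
      rw [hf₁.arr 1 (by simp [Prog.WritesArr]), ← a1]
      simp only [Prog.after, State.setReg_arr]
      congr 1; omega
    have hp := hpal (i + 1)
    rw [q.elements_take_node hi, palette_append] at hp
    dsimp only at hp
    refine Runs.le (Runs.of_after (fun _ => ?_) fun _ => ?_) ?_
    · simp [Prog.Fits, ih, hi₁, r1, r2, r11, a0, a1']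
      omega
    · rw [q.elements_take_node hi, palette_append]
      simp [Prog.after, ih, hi₁, r1, r2, r11, a0, a1']
    · simp [Prog.size, Expr.cost]
  · simp [Prog.WritesReg]
  · simp [Prog.WritesReg]
  · rw [hf₁.reg 7 (by simp [Prog.WritesReg])]; simpa [Prog.after] using h7
  · intro k s v h; simpa using h
  · intro i hi s₂ hs₂ hf₂ hi₂ _ ih
    have r1 : s₂.reg 1 = n := by
      rw [hf₂.reg 1 (by simp [Prog.WritesReg]), hf₁.reg 1 (by simp [Prog.WritesReg])]
      simpa [Prog.after] using h1
    have r2 : s₂.reg 2 = B := by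
      rw [hf₂.reg 2 (by simp [Prog.WritesReg]), hf₁.reg 2 (by simp [Prog.WritesReg])]
      simpa [Prog.after] using h2
    have r6 : s₂.reg 6 = q.nodes.length := by
      rw [hf₂.reg 6 (by simp [Prog.WritesReg]), hf₁.reg 6 (by simp [Prog.WritesReg])]
      simpa [Prog.after] using h6
    have r11 : s₂.reg 11 = J + 4 := by
      rw [hf₂.reg 11 (by simp [Prog.WritesReg]), hf₁.reg 11 (by simp [Prog.WritesReg])]
      simp [Prog.after, h5, h8, hJ]
    have a0 : s₂.arr 0 = s.arr 0 := by
      rw [hf₂.arr 0 (by simp [Prog.WritesArr]), hf₁.arr 0 (by simp [Prog.WritesArr])]; rfl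
    have a04 : s₂.arr 0 (q.nodes.length + 2 * i + 4) = q.links[i].1 := by
      rw [a0, ← (q.encode_link hi).1, h0]
    have a05 : s₂.arr 0 (q.nodes.length + 2 * i + 5) = q.links[i].2 := by
      rw [a0, ← (q.encode_link hi).2, h0]
    have a1 := hcol q.links[i].1 q.links[i].2
    have := ix q.links[i].1 q.links[i].2
    have a1' : s₂.arr 1 (J + 4 + (q.links[i].1 * n + q.links[i].2)) =
        χ j q.links[i].1 q.links[i].2 := by
      rw [hf₂.arr 1 (by simp [Prog.WritesArr]), hf₁.arr 1 (by simp [Prog.WritesArr]), ← a1]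
      simp only [Prog.after, State.setReg_arr]
      congr 1; omega
    have hp := hpal (q.nodes.length + i + 1)
    rw [q.elements_take_link hi, palette_append] at hp
    refine Runs.le (Runs.of_after (fun _ => ?_) fun _ => ?_) ?_
    · simp [Prog.Fits, ih, hi₂, r1, r2, r6, r11, a04, a05, a1']
      omega
    · rw [← add_assoc, q.elements_take_link hi, palette_append]
      simp [Prog.after, ih, hi₂, r1, r2, r6, r11, a04, a05, a1']
    · simp [Prog.size, Expr.cost]
  · intro s' _ _ h
    rw [h, List.take_of_length_le (by simp [Query.elements])]

theorem queryProg_runs (q : Query G f) (hT : IsTable G f R B χ (s.arr 1))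
    (hχ : ∀ j < R, ∀ u v, χ j u v < B) (hB : 0 < B)
    (hw : 4 + R * (n * n) + R * B ^ f * (n * n) < 2 ^ w) (hfw : 2 * f + 8 < 2 ^ w)
    (hR0 : 0 < R) (h0 : ∀ i, s.arr 0 i = q.encode.getD i 0) (hr : s.reg 0 = 0) :
    Runs w queryProg s (R * (100 * f + 200) + 50) fun s' =>
      s'.reg 0 = encodeDist (q.answer R B χ) := by
  have hn0 : 0 < n := q.src.pos
  have ix : ∀ u v : Fin n, (u : ℕ) * n + v < n * n := fun u v => index_lt u.2 v.2
  have e0 : s.arr 0 0 = q.src := h0 0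
  have e1 : s.arr 0 1 = q.tgt := h0 1
  have e2 : s.arr 0 2 = q.nodes.length := h0 2
  have e3 : s.arr 0 3 = q.links.length := h0 3
  have hnn : 0 < n * n := Nat.mul_pos hn0 hn0
  have hnw : n * n ≤ R * (n * n) := Nat.le_mul_of_pos_left _ hR0
  obtain ⟨s₀, hs₀⟩ : ∃ s₀, Prog.after s (.assign 1 (𝐚 1 (𝐜 0)) ;; .assign 2 (𝐚 1 (𝐜 1)) ;;
    .assign 3 (𝐚 1 (𝐜 2)) ;; .assign 4 (𝐚 1 (𝐜 3)) ;; .assign 5 (𝐫 1 * 𝐫 1) ;;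
    .assign 6 (𝐚 0 (𝐜 2)) ;; .assign 7 (𝐚 0 (𝐜 3))) = s₀ := ⟨_, rfl⟩
  have b : s₀.reg 0 = 0 ∧ s₀.reg 1 = n ∧ s₀.reg 2 = B ∧ s₀.reg 3 = R ∧ s₀.reg 4 = B ^ f ∧
      s₀.reg 5 = n * n ∧ s₀.reg 6 = q.nodes.length ∧ s₀.reg 7 = q.links.length := by
    rw [← hs₀]
    simp [Prog.after, hT.size, hT.base, hT.rounds, hT.palettes, hr, e2, e3]
  have ba : s₀.arr = s.arr := by rw [← hs₀]; rfl
  refine Runs.le (Runs.step ?_ (T := R * (100 * f + 150) + 6) ?_) ?_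
  · intro hs
    have hw0 := hs.pos.ne'
    simp [Prog.Fits, Prog.after, hT.size, hw0]
    omega
  swap
  · simp [Prog.size, Expr.cost]
    nlinarith
  rw [hs₀]
  clear hs₀
  obtain ⟨b0, b1, b2, b3, b4, b5, b6, b7⟩ := b
  refine Runs.mono (Runs.count (N := R) (T := 100 * f + 140) (fun j s' => s'.reg 0 = encodeDist
    ((Finset.range j).inf fun j =>
      (avoiding G (χ j) (digits B f (palette B (χ j) q.elements))).edist q.src q.tgt))
    ?_ ?_ (by omega) b3 ?_ ?_ ?_) (by nlinarith) (fun s' _ _ h => h)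
  · simp [Prog.WritesReg, paletteProg]
  · simp [Prog.WritesReg, paletteProg]
  · intro k s v h; simpa using h
  · simp [b0, encodeDist]
  · intro j hj s₁ hs₁ hf₁ hj₁ r3 ih
    have rr : ∀ x, x = 1 ∨ x = 2 ∨ x = 4 ∨ x = 5 ∨ x = 6 ∨ x = 7 → s₁.reg x = s₀.reg x := by
      intro x hx
      refine hf₁.reg x ?_
      simp [Prog.WritesReg, paletteProg]
      omega
    have aa : ∀ a, s₁.arr a = s.arr a := fun a => by
      rw [hf₁.arr a (by simp [Prog.WritesArr, paletteProg]), ba]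
    refine Runs.le (Runs.seq (T₂ := 80) (paletteProg_runs q (by rwa [aa]) hχ hB hw hfw (fun i => by rw [aa, h0])
      ((rr 1 (by simp)).trans b1) ((rr 2 (by simp)).trans b2) ((rr 5 (by simp)).trans b5)
      ((rr 6 (by simp)).trans b6) ((rr 7 (by simp)).trans b7) hj hj₁)
      fun s₂ hs₂ hf₂ h10 => ?_) (by omega)
    have r0 : s₂.reg 0 = s₁.reg 0 := hf₂.reg 0 (by simp [Prog.WritesReg, paletteProg])
    have r8 : s₂.reg 8 = j := (hf₂.reg 8 (by simp [Prog.WritesReg, paletteProg])).trans hj₁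
    have c3 : s₂.reg 3 = R := (hf₂.reg 3 (by simp [Prog.WritesReg, paletteProg])).trans r3
    have c1 : s₂.reg 1 = n :=
      (hf₂.reg 1 (by simp [Prog.WritesReg, paletteProg])).trans ((rr 1 (by simp)).trans b1)
    have c4 : s₂.reg 4 = B ^ f :=
      (hf₂.reg 4 (by simp [Prog.WritesReg, paletteProg])).trans ((rr 4 (by simp)).trans b4)
    have c5 : s₂.reg 5 = n * n :=
      (hf₂.reg 5 (by simp [Prog.WritesReg, paletteProg])).trans ((rr 5 (by simp)).trans b5)
    have a2 : ∀ a, s₂.arr a = s.arr a := fun a => by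
      rw [hf₂.arr a (by simp [Prog.WritesArr, paletteProg]), aa]
    obtain ⟨g, hg⟩ : ∃ g, palette B (χ j) q.elements = g := ⟨_, rfl⟩
    have hgB : g < B ^ f := by
      rw [← hg]
      exact (palette_lt (hχ j hj) _).trans_le (Nat.pow_le_pow_right hB q.length_elements)
    rw [hg] at h10
    have hX : j * B ^ f + g + 1 ≤ R * B ^ f := by
      calc j * B ^ f + g + 1 ≤ j * B ^ f + B ^ f := by omega
        _ = (j + 1) * B ^ f := by ring
        _ ≤ R * B ^ f := Nat.mul_le_mul_right _ hj
    have hX2 := Nat.mul_le_mul_right (n * n) hX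
    rw [Nat.succ_mul] at hX2
    have hX3 : j * B ^ f + g ≤ (j * B ^ f + g) * (n * n) := Nat.le_mul_of_pos_right _ hnn
    have := ix q.src q.tgt
    refine Runs.le (Runs.of_after (fun hs => ?_) fun _ => ?_) ?_
    · have hw0 := hs.pos.ne'
      simp [Prog.Fits, Prog.after, r8, c3, c1, c4, c5, a2, h10, e0, e1, hw0]
      split_ifs <;> omega
    · rw [Finset.range_add_one, Finset.inf_insert, inf_comm]
      have hm := encodeDist_min ((Finset.range j).inf fun j => (avoiding G (χ j) (digits B f
        (palette B (χ j) q.elements))).edist q.src q.tgt) ((avoiding G (χ j) (digits B f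
        (palette B (χ j) q.elements))).edist q.src q.tgt)
      rw [← ih, hg, ← hT.dist j hj g hgB] at hm
      rw [hg]
      refine Eq.trans ?_ hm.symm
      obtain ⟨d, hd⟩ : ∃ d, s.arr 1 (4 + R * (n * n) + ((j * B ^ f + g) * (n * n) +
        (q.src * n + q.tgt))) = d := ⟨_, rfl⟩
      obtain ⟨r, hr⟩ : ∃ r, s₁.reg 0 = r := ⟨_, rfl⟩
      rw [hd, hr]
      rw [hr] at r0
      by_cases hd0 : d = 0
      · simp [Prog.after, r0, r8, c3, c1, c4, c5, a2, h10, e0, e1, hd, hd0]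
      have hdpos := Nat.pos_of_ne_zero hd0
      by_cases hr0 : r = 0
      · simp [Prog.after, r0, r8, c3, c1, c4, c5, a2, h10, e0, e1, hd, hr0, hdpos]
      · by_cases hdr : d < r
        · simp [Prog.after, r0, r8, c3, c1, c4, c5, a2, h10, e0, e1, hd, hr0, hdr, hdpos]
        · simp [Prog.after, r0, r8, c3, c1, c4, c5, a2, h10, e0, e1, hd, hr0, hdr, hdpos]
    · simp [Prog.size, Expr.cost]

end DSO

/-! ### Preprocessing -/

namespace DSO

variable {n f : ℕ} {G : SimpleGraph (Fin n)} {w : ℕ} {s : State}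

/-- Reading the network: `n` goes to register `1`, `n * n` to register `3`, and the adjacency matrix
to array `2`. -/
def readProg : Prog :=
  (.assign 1 (𝐚 0 (𝐜 0)) ;; .assign 2 (𝐚 0 (𝐜 1)) ;; .assign 3 (𝐫 1 * 𝐫 1)) ;;
  .count 4 2 (
    .store 2 (𝐚 0 (𝐜 2 * 𝐫 4 + 𝐜 2) * 𝐫 1 + 𝐚 0 (𝐜 2 * 𝐫 4 + 𝐜 3)) (𝐜 1) ;;
    .store 2 (𝐚 0 (𝐜 2 * 𝐫 4 + 𝐜 3) * 𝐫 1 + 𝐚 0 (𝐜 2 * 𝐫 4 + 𝐜 2)) (𝐜 1))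

theorem IsLinkList.length_le {l : List (Fin n × Fin n)} (hl : IsLinkList G l) :
    l.length ≤ n * n := by
  simpa using (List.Nodup.of_map _ hl.1).length_le_card

theorem IsLinkList.adj_iff {l : List (Fin n × Fin n)} (hl : IsLinkList G l) (u v : Fin n) :
    G.Adj u v ↔ (u, v) ∈ l ∨ (v, u) ∈ l := by
  rw [← SimpleGraph.mem_edgeSet, ← hl.2, Set.mem_ofPred_eq, List.mem_map]
  constructor
  · rintro ⟨⟨x, y⟩, hp, h⟩
    rcases Sym2.eq_iff.1 h with ⟨rfl, rfl⟩ | ⟨rfl, rfl⟩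
    exacts [.inl hp, .inr hp]
  · rintro (h | h)
    exacts [⟨_, h, rfl⟩, ⟨_, h, Sym2.eq_swap⟩]

theorem index_inj {u v u' v' : Fin n} (h : (u * n + v : ℕ) = u' * n + v') : u = u' ∧ v = v' := by
  have e1 := index_div u v.2
  have e2 := index_mod u v.2
  rw [h, index_div _ v'.2] at e1
  rw [h, index_mod _ v'.2] at e2
  exact ⟨Fin.ext e1.symm, Fin.ext e2.symm⟩

open Classical in
theorem readProg_runs {l : List (Fin n × Fin n)} (hl : IsLinkList G l)
    (hw : 2 * (n * n) + 8 < 2 ^ w) (h0 : ∀ i, s.arr 0 i = (encodeNetwork l).getD i 0)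
    (h2 : ∀ i, s.arr 2 i = 0) :
    Runs w readProg s (50 * (n * n) + 30) fun s' => s'.reg 1 = n ∧ s'.reg 3 = n * n ∧
      ∀ u v : Fin n, s'.arr 2 (u * n + v) = if G.Adj u v then 1 else 0 := by
  have e0 : s.arr 0 0 = n := h0 0
  have e1 : s.arr 0 1 = l.length := h0 1
  have hlen := hl.length_le
  have hnn : n ≤ n * n := Nat.le_mul_self n
  refine Runs.mono (Runs.step ?_ (Runs.count (N := l.length) (T := 34) (fun k s' =>
    (s'.reg 1 = n ∧ s'.reg 3 = n * n) ∧ ∀ u v : Fin n, s'.arr 2 (u * n + v) =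
      if (u, v) ∈ l.take k ∨ (v, u) ∈ l.take k then 1 else 0) ?_ ?_ (by omega) ?_ ?_ ?_ ?_)) ?_ ?_
  · intro hs
    have hw0 := hs.pos.ne'
    simp [Prog.Fits, Prog.after, e0, hw0]
    omega
  · simp [Prog.WritesReg]
  · simp [Prog.WritesReg]
  · simp [Prog.after, e1]
  · intro k s v h; simpa using h
  · simp [Prog.after, h2, e0]
  · rintro k hk s₁ hs₁ hf₁ hi - ⟨⟨r1, r3⟩, ih⟩
    have a0 : s₁.arr 0 = s.arr 0 := by rw [hf₁.arr 0 (by simp [Prog.WritesArr])]; rfl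
    have hg := flatten_getD l k hk
    have a02 : s₁.arr 0 (2 * k + 2) = l[k].1 := by
      rw [a0, h0, ← hg.1]; simp [encodeNetwork]
    have a03 : s₁.arr 0 (2 * k + 3) = l[k].2 := by
      rw [a0, h0, ← hg.2]; simp [encodeNetwork]
    have ix : ∀ u v : Fin n, (u : ℕ) * n + v < n * n := fun u v => index_lt u.2 v.2
    have i1 := ix l[k].1 l[k].2
    have i2 := ix l[k].2 l[k].1
    refine Runs.le (Runs.of_after (fun hs => ?_) fun _ => ?_) ?_
    · have hw0 := hs.pos.ne'
      simp [Prog.Fits, Prog.after, r1, hi, a02, a03, hw0]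
      omega
    · refine ⟨⟨r1, r3⟩, fun u v => ?_⟩
      rw [List.take_succ_eq_append_getElem hk]
      simp only [Prog.after, State.setArr_arr, State.setArr_reg, Expr.val_add, Expr.val_mul,
        Expr.val_get, Expr.val_reg, Expr.val_const, r1, hi, a02, a03, if_true,
        show (0 : ℕ) ≠ 2 by omega, if_false, Function.update_apply, ih, List.mem_append,
        List.mem_singleton]
      by_cases c1 : (u * n + v : ℕ) = l[k].2 * n + l[k].1
      · obtain ⟨c2, c3⟩ := index_inj c1
        have : (v, u) = l[k] := Prod.ext c3 c2
        simp [c1, this]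
      by_cases c2 : (u * n + v : ℕ) = l[k].1 * n + l[k].2
      · obtain ⟨c3, c4⟩ := index_inj c2
        have : (u, v) = l[k] := Prod.ext c3 c4
        simp [c2, this]
      have k1 : (u, v) ≠ l[k] := fun h => c2 (by rw [← h])
      have k2 : (v, u) ≠ l[k] := fun h => c1 (by rw [← h])
      simp [c1, c2, k1, k2]
    · simp [Prog.size, Expr.cost]
  · simp [Prog.size, Expr.cost]
    omega
  · rintro s' - - ⟨⟨h1, h3⟩, h⟩
    refine ⟨h1, h3, fun u v => (h u v).trans (if_congr ?_ rfl rfl)⟩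
    rw [List.take_length, hl.adj_iff]

/-- Computing the diameter of the network, increased by `1`, in register `5`: the largest encoded
distance. -/
def diamProg (P : Prog) : Prog :=
  .count 4 3 (.store 3 (𝐫 4) (𝐚 2 (𝐫 4))) ;; P ;; .assign 5 (𝐜 0) ;;
  .count 4 3 (.cond (.op .lt (𝐫 5) (𝐚 4 (𝐫 4))) (.assign 5 (𝐚 4 (𝐫 4))) .skip)

variable {P : Prog} {T : ℕ → ℕ → ℕ → ℕ} {κ : ℕ}

open Classical in
theorem diamProg_runs (hP : ComputesDistances P T κ) (hn : 2 ≤ n) (hG : G.Connected)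
    (hw : κ * n.size ≤ w) (h1 : s.reg 1 = n) (h3 : s.reg 3 = n * n)
    (h2 : ∀ u v : Fin n, s.arr 2 (u * n + v) = if G.Adj u v then 1 else 0) :
    Runs w (diamProg P) s (T w n G.edgeSet.ncard + 40 * (n * n) + 30)
      fun s' => s'.reg 5 = G.diam + 1 := by
  have pr : ∀ x < 20, ¬ P.WritesReg x := fun x hx h => by have := hP.reg x h; omega
  refine Runs.le (Runs.seq (Runs.fillMatrix (o := 0) (fun u v => if G.Adj u v then 1 else 0)
    (by omega) h3 rfl ?_) fun s₁ hs₁ hf₁ q₁ => Runs.seq (hP.runs w n _ s₁ G hn hw ?_ le_rfl ?_)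
    fun s₂ hs₂ hf₂ q₂ => Runs.step ?_ (Runs.mono (Runs.count (N := n * n) (T := 12)
      (fun k s' => s'.reg 5 = (Finset.range k).sup (s₂.arr 4)) ?_ ?_ (by omega) ?_ ?_ ?_ ?_)
      le_rfl ?_)) ?_
  · intro u v s' hr ha hi _
    have a2 : s'.arr 2 (u * n + v) = if G.Adj u v then 1 else 0 := by rw [ha 2 (by omega), h2]
    simp [hi, a2]
  · rw [hf₁.reg 1 (by simp [Prog.WritesReg]), h1]
  · intro u v
    simpa using q₁.1 u v
  · intro _; simp [Prog.Fits]
  · simp [Prog.WritesReg]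
  · simp [Prog.WritesReg]
  · simp only [Prog.after, State.setReg_reg]
    rw [if_neg (by omega), hf₂.reg 3 (pr _ (by omega)), hf₁.reg 3 (by simp [Prog.WritesReg]), h3]
  · intro k s v h; simpa using h
  · simp [Prog.after]
  · intro k hk s₃ hs₃ hf₃ hi _ ih
    have a4 : s₃.arr 4 = s₂.arr 4 := by rw [hf₃.arr 4 (by simp [Prog.WritesArr])]; rfl
    refine Runs.le (Runs.of_after (fun hs => ?_) fun _ => ?_) ?_
    · simp [Prog.Fits]
    · rw [Finset.range_add_one, Finset.sup_insert, ← ih]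
      by_cases hlt : s₃.reg 5 < s₂.arr 4 k
      · simp [Prog.after, a4, hi, hlt, hlt.le]
      · simp [Prog.after, a4, hi, hlt, not_lt.1 hlt]
    · simp [Prog.size, Expr.cost]
  · intro s₃ hs₃ hf₃ h
    have : Nonempty (Fin n) := ⟨⟨0, by omega⟩⟩
    have hd : ∀ u v : Fin n, s₂.arr 4 (u * n + v) = G.dist u v + 1 := by
      intro u v
      rw [q₂ u v, encodeDist, if_neg (SimpleGraph.edist_ne_top_iff_reachable.2 (hG.preconnected u v))]
      rfl
    rw [h]
    refine le_antisymm (Finset.sup_le fun i hi => ?_) ?_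
    · have hi' := Finset.mem_range.1 hi
      have := hd ⟨i / n, Nat.div_lt_of_lt_mul hi'⟩ ⟨i % n, Nat.mod_lt _ (by omega)⟩
      simp only [Nat.div_add_mod'] at this
      rw [this]
      have := SimpleGraph.dist_le_diam (SimpleGraph.connected_iff_ediam_ne_top.1 hG)
        (u := ⟨i / n, Nat.div_lt_of_lt_mul hi'⟩) (v := ⟨i % n, Nat.mod_lt _ (by omega)⟩)
      omega
    · obtain ⟨u, v, huv⟩ := G.exists_dist_eq_diam
      rw [← huv, ← hd]
      exact Finset.le_sup (f := s₂.arr 4) (Finset.mem_range.2 (index_lt u.2 v.2))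
  · simp [Prog.size, Expr.cost]
    generalize T w n G.edgeSet.ncard = t
    omega

end DSO

namespace DSO

variable {n f : ℕ} {G : SimpleGraph (Fin n)} {w : ℕ} {s : State}

/-- Computing the logarithm of register `z`, rounded up, in register `y`, and the corresponding power
of `2` in register `x`. -/
def clogProg (x y z : ℕ) : Prog :=
  (.assign x (𝐜 1) ;; .assign y (𝐜 0)) ;;
  .loop (.op .lt (𝐫 x) (𝐫 z)) (.assign x (𝐫 x * 𝐜 2) ;; .assign y (𝐫 y + 𝐜 1))

theorem clogProg_runs {x y z W : ℕ} (hxy : x ≠ y) (hxz : z ≠ x) (hyz : z ≠ y) (hz : s.reg z = W)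
    (hw : 2 * W + 2 < 2 ^ w) : Runs w (clogProg x y z) s (20 * W + 20)
      fun s' => s'.reg x = 2 ^ Nat.clog 2 W ∧ s'.reg y = Nat.clog 2 W := by
  have hWk : ∀ k, 2 ^ k < W ↔ k < Nat.clog 2 W := fun k => (Nat.lt_clog_iff_pow_lt (by omega)).symm
  obtain ⟨K, hK⟩ : ∃ K, Nat.clog 2 W = K := ⟨_, rfl⟩
  have hKW : K ≤ W := hK ▸ Nat.clog_le_of_le_pow Nat.lt_two_pow_self.le
  refine Runs.le (Runs.step ?_ (Runs.mono (Runs.loop (T := 8) (K := K)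
    (fun k s' => k ≤ K ∧ s'.reg x = 2 ^ (K - k) ∧ s'.reg y = K - k) ?_ ?_ ?_) le_rfl ?_)) ?_
  · intro hs
    have hw0 := hs.pos.ne'
    simp [Prog.Fits, Prog.after, hw0]
  · intros; simp
  · rintro k s₁ hs₁ hf ⟨hk, hx, hy⟩ hb
    have hzr : s₁.reg z = W := by
      rw [hf.reg z (by simp [Prog.WritesReg, hxz, hyz])]
      simpa [Prog.after, hxz, hyz] using hz
    have hlt : 2 ^ (K - k) < W := by
      rw [← hx, ← hzr]
      by_contra h
      exact hb (if_neg h)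
    have hlt' := (hWk _).1 hlt
    rw [hK] at hlt'
    have e : K - (k - 1) = K - k + 1 := by omega
    have hKw : K - k + 1 < 2 ^ w := by omega
    refine Runs.le (Runs.of_after (fun _ => ?_) fun _ => ?_) ?_
    · have hw0 := hs₁.pos.ne'
      simp [Prog.Fits, Prog.after, hxy.symm, hx, hy]
      omega
    · refine ⟨k - 1, ?_, by omega, ?_, ?_⟩
      · have : k ≠ 0 := by rintro rfl; simp at hlt'
        omega
      · simp [Prog.after, hxy, hx, e, pow_succ]
      · simp [Prog.after, hxy.symm, hy, e]
    · simp [Prog.size, Expr.cost]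
  · simp [Prog.after, hxy]
  · rintro s₁ hs₁ hf ⟨hb, k, hk, hx, hy⟩
    have hzr : s₁.reg z = W := by
      rw [hf.reg z (by simp [Prog.WritesReg, hxz, hyz])]
      simpa [Prog.after, hxz, hyz] using hz
    have hnl : ¬ 2 ^ (K - k) < W := by
      rw [← hx, ← hzr]
      intro h
      exact one_ne_zero ((if_pos h).symm.trans hb)
    rw [hWk, hK] at hnl
    have : K - k = K := by omega
    rw [hx, hy, hK, this]
    exact ⟨rfl, rfl⟩
  · simp [Prog.size, Expr.cost]
    omega

/-- The power with exponent `i` of register `x`. -/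
def powExpr (x : ℕ) : ℕ → Expr
  | 0 => 𝐜 1
  | i + 1 => powExpr x i * 𝐫 x

theorem powExpr_val (x i : ℕ) : (powExpr x i).val s = s.reg x ^ i := by
  induction i with
  | zero => rfl
  | succ i ih => rw [powExpr, Expr.val_mul, ih, pow_succ]; rfl

theorem powExpr_fits {x i : ℕ} (hx : 0 < s.reg x) (h : s.reg x ^ i < 2 ^ w) :
    (powExpr x i).Fits w s := by
  induction i with
  | zero => simpa [powExpr] using h
  | succ i ih =>
    have h' : s.reg x ^ i < 2 ^ w := lt_of_le_of_lt (Nat.pow_le_pow_right hx (by omega)) h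
    simp only [powExpr, Expr.fits_mul, Expr.fits_reg, powExpr_val, Expr.val_reg, true_and]
    exact ⟨ih h', by rwa [← pow_succ]⟩

theorem powExpr_cost (x i : ℕ) : (powExpr x i).cost = 2 * i + 1 := by
  induction i with
  | zero => rfl
  | succ i ih => rw [powExpr, Expr.cost_mul, ih]; simp [Expr.cost]; omega

/-- An upper bound for the finite distances that have to be computed exactly in networks of diameter
`D`; see `Query.dist_le_of_links`. -/
def maxDist (f D : ℕ) : ℕ := (2 * f + 1) * (2 * D + 1)

/-- The number of colours has to be at least this large: twice the number of pairs of a failing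
element and an element of a shortest path. -/
def minColours (f D : ℕ) : ℕ := 2 * ((3 * maxDist f D + 1) * f)

/-- The number of coin tosses for a colour. -/
def colourBits (f D : ℕ) : ℕ := Nat.clog 2 (minColours f D)

/-- The base in which palettes are encoded: the number of colours, increased by `1`, as the digit `0`
is no colour. -/
def paletteBase (f D : ℕ) : ℕ := 2 ^ colourBits f D + 1

/-- The number of rounds, that is, of independent colourings. -/
def rounds (f c n : ℕ) : ℕ := (3 * f + 2 + c) * Nat.clog 2 (n + 1)

/-- Computing the parameters from `n` and the diameter: `colourBits`, `paletteBase`, its `f`-th power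
and `rounds` in the registers `7` to `10`, and the numbers of colours and of distance tables in the
registers `12` and `16`. -/
def paramProg (f c : ℕ) : Prog :=
  .assign 6 (𝐜 2 * ((𝐜 3 * (𝐜 (2 * f + 1) * (𝐜 2 * (𝐫 5 - 𝐜 1) + 𝐜 1)) + 𝐜 1) * 𝐜 f)) ;;
  clogProg 8 7 6 ;;
  (.assign 8 (𝐫 8 + 𝐜 1) ;; .assign 9 (powExpr 8 f) ;; .assign 6 (𝐫 1 + 𝐜 1)) ;;
  clogProg 11 10 6 ;;
  (.assign 10 (𝐜 (3 * f + 2 + c) * 𝐫 10) ;; .assign 12 (𝐫 10 * 𝐫 3) ;; .assign 16 (𝐫 10 * 𝐫 9))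

theorem two_pow_clog_le (W : ℕ) : 2 ^ Nat.clog 2 W ≤ 2 * W + 1 := by
  rcases Nat.lt_or_ge 1 W with h | h
  · have h1 := Nat.pow_pred_clog_lt_self (b := 2) (by omega) h
    obtain ⟨H, hH⟩ : ∃ H, Nat.clog 2 W = H + 1 :=
      ⟨_, (Nat.succ_pred_eq_of_pos (Nat.clog_pos (by omega) h)).symm⟩
    rw [hH] at h1 ⊢
    rw [pow_succ]
    simp only [Nat.pred_succ] at h1
    omega
  · rw [Nat.clog_of_right_le_one h]; omega

theorem paramProg_runs {c D : ℕ} (h1 : s.reg 1 = n) (h3 : s.reg 3 = n * n) (h5 : s.reg 5 = D + 1)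
    (hn : 0 < n) (hD : D ≤ n) (hw₁ : 2 * ((3 * maxDist f D + 1) * (2 * f + 2)) + 4 < 2 ^ w)
    (hw₂ : 4 + rounds f c n * (n * n) + rounds f c n * paletteBase f D ^ f * (n * n) < 2 ^ w)
    (hw₃ : 2 * n + 4 < 2 ^ w) (hfc : 3 * f + 2 + c < 2 ^ w) :
    Runs w (paramProg f c) s (20 * minColours f D + 20 * n + 200 + 2 * f) fun s' =>
      s'.reg 7 = colourBits f D ∧ s'.reg 8 = paletteBase f D ∧ s'.reg 9 = paletteBase f D ^ f ∧
      s'.reg 10 = rounds f c n ∧ s'.reg 12 = rounds f c n * (n * n) ∧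
      s'.reg 16 = rounds f c n * paletteBase f D ^ f := by
  have hW : 2 * minColours f D + 4 < 2 ^ w := by
    refine lt_of_le_of_lt ?_ hw₁
    have : (3 * maxDist f D + 1) * (2 * f) ≤ (3 * maxDist f D + 1) * (2 * f + 2) :=
      Nat.mul_le_mul_left _ (by omega)
    have e : minColours f D = (3 * maxDist f D + 1) * (2 * f) := by rw [minColours]; ring
    omega
  have hR : 0 < rounds f c n := Nat.mul_pos (by omega) (Nat.clog_pos (by omega) (by omega))
  have hnn : 0 < n * n := Nat.mul_pos hn hn
  have hK := two_pow_clog_le (minColours f D)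
  refine Runs.le (Runs.step ?_ (Runs.seq (clogProg_runs (by omega) (by omega) (by omega)
    (W := minColours f D) ?_ (by omega)) fun s₁ hs₁ hf₁ ⟨q8, q7⟩ => Runs.step ?_ (Runs.seq
    (clogProg_runs (by omega) (by omega) (by omega) (W := n + 1) ?_ (by omega))
    fun s₂ hs₂ hf₂ ⟨q11, q10⟩ => Runs.of_after (fun _ => ?_) fun _ => ?_))) ?_
  · intro hs
    have hw0 := hs.pos.ne'
    have e1 : 2 * D + 1 ≤ maxDist f D := Nat.le_mul_of_pos_left _ (by omega)
    have e2 : 2 * f + 1 ≤ maxDist f D := Nat.le_mul_of_pos_right _ (by omega)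
    have e3 : (3 * maxDist f D + 1) ≤ (3 * maxDist f D + 1) * (2 * f + 2) :=
      Nat.le_mul_of_pos_right _ (by omega)
    have e4 : (3 * maxDist f D + 1) * (2 * f) ≤ (3 * maxDist f D + 1) * (2 * f + 2) :=
      Nat.mul_le_mul_left _ (by omega)
    have e5 : (3 * maxDist f D + 1) * (2 * f) = 2 * ((3 * maxDist f D + 1) * f) := by ring
    have e6 : (2 * f + 1) * (2 * D + 1) = maxDist f D := rfl
    simp [Prog.Fits, h5, hw0, e6]
    omega
  · simp [Prog.after, h5, minColours, maxDist]
  · simp [Prog.size, Expr.cost, powExpr_cost]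
    omega
  · have hB : paletteBase f D ^ f < 2 ^ w := by
      refine lt_of_le_of_lt ?_ hw₂
      have : paletteBase f D ^ f ≤ rounds f c n * (n * n) * paletteBase f D ^ f :=
        Nat.le_mul_of_pos_left _ (Nat.mul_pos hR hnn)
      have e : rounds f c n * (n * n) * paletteBase f D ^ f =
        rounds f c n * paletteBase f D ^ f * (n * n) := by ring
      omega
    intro hs
    have hw0 := hs.pos.ne'
    have r1 : s₁.reg 1 = n := by
      rw [hf₁.reg 1 (by simp [Prog.WritesReg, clogProg])]; simpa [Prog.after] using h1
    have q8' : s₁.reg 8 + 1 = paletteBase f D := by rw [q8]; rfl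
    simp only [Prog.Fits, Prog.after, Expr.fits_add, Expr.fits_reg, Expr.fits_const, Expr.val_add,
      Expr.val_reg, Expr.val_const, State.setReg_reg, true_and]
    refine ⟨⟨by omega, by omega⟩, powExpr_fits ?_ ?_, ?_⟩
    · simp
    · simpa [q8'] using hB
    · simp [r1]; omega
  · have r1 : s₁.reg 1 = n := by
      rw [hf₁.reg 1 (by simp [Prog.WritesReg, clogProg])]; simpa [Prog.after] using h1
    simp [Prog.after, r1]
  all_goals
    have hreg : ∀ x, x = 7 ∨ x = 8 ∨ x = 9 ∨ x = 3 → s₂.reg x =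
        (Prog.after s₁ (.assign 8 (𝐫 8 + 𝐜 1) ;; .assign 9 (powExpr 8 f) ;;
          .assign 6 (𝐫 1 + 𝐜 1))).reg x := fun x hx => hf₂.reg x (by
      simp [Prog.WritesReg, clogProg]; omega)
    have b3 : s₂.reg 3 = n * n := by
      rw [hreg 3 (by simp)]
      simp only [Prog.after, State.setReg_reg]
      rw [if_neg (by omega), if_neg (by omega), if_neg (by omega),
        hf₁.reg 3 (by simp [Prog.WritesReg, clogProg])]
      simpa [Prog.after] using h3
    have b7 : s₂.reg 7 = colourBits f D := by
      rw [hreg 7 (by simp)]; simpa [Prog.after, colourBits] using q7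
    have b8 : s₂.reg 8 = paletteBase f D := by
      rw [hreg 8 (by simp)]; simp [Prog.after, q8, paletteBase, colourBits]
    have b9 : s₂.reg 9 = paletteBase f D ^ f := by
      rw [hreg 9 (by simp)]
      simp [Prog.after, q8, paletteBase, colourBits, powExpr_val]
    have e : (3 * f + 2 + c) * Nat.clog 2 (n + 1) = rounds f c n := rfl
  · have hR1 : rounds f c n ≤ rounds f c n * (n * n) := Nat.le_mul_of_pos_right _ hnn
    have hR2 : rounds f c n * paletteBase f D ^ f ≤
      rounds f c n * paletteBase f D ^ f * (n * n) := Nat.le_mul_of_pos_right _ hnn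
    simp [Prog.Fits, Prog.after, q10, b3, b9, e]
    omega
  · simp [Prog.after, q10, b3, b7, b8, b9, e]

end DSO

/-! ### Random colours and distance tables -/

namespace DSO

variable {n f : ℕ} {G : SimpleGraph (Fin n)} {w : ℕ} {s : State}

/-- Writing the header of the data structure and the random colours. -/
def colourProg : Prog :=
  (.store 1 (𝐜 0) (𝐫 1) ;; .store 1 (𝐜 1) (𝐫 8) ;; .store 1 (𝐜 2) (𝐫 10) ;;
    .store 1 (𝐜 3) (𝐫 9)) ;;
  .count 4 12 (.assign 13 (𝐜 0) ;;
    .count 14 7 (.flip 15 ;; .assign 13 (𝐫 13 * 𝐜 2 + 𝐫 15)) ;;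
    .store 1 (𝐜 4 + 𝐫 4) (𝐫 13 + 𝐜 1))

theorem colourProg_runs {N k B R F : ℕ} (h1 : s.reg 1 = n) (h8 : s.reg 8 = B) (h10 : s.reg 10 = R)
    (h9 : s.reg 9 = F) (h12 : s.reg 12 = N) (h7 : s.reg 7 = k) (hN : N + 4 < 2 ^ w)
    (hk : 2 ^ k + 4 < 2 ^ w) :
    Runs w colourProg s (N * (20 * k + 30) + 30) fun s' =>
      (s'.arr 1 0 = n ∧ s'.arr 1 1 = B ∧ s'.arr 1 2 = R ∧ s'.arr 1 3 = F) ∧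
      ∀ i < N, s'.arr 1 (4 + i) = ofBits s.coin (i * k) k + 1 := by
  refine Runs.mono (Runs.step ?_ (Runs.count (N := N) (T := 20 * k + 20) (fun i s' =>
    (s'.arr 1 0 = n ∧ s'.arr 1 1 = B ∧ s'.arr 1 2 = R ∧ s'.arr 1 3 = F) ∧
    (∀ j < i, s'.arr 1 (4 + j) = ofBits s.coin (j * k) k + 1) ∧
    ∀ t, s'.coin t = s.coin (i * k + t)) ?_ ?_ (by omega) ?_ ?_ ?_ ?_)) ?_ ?_
  · intro hs
    have hw0 := hs.pos.ne'
    simp [Prog.Fits, Prog.after, hw0]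
    omega
  · simp [Prog.WritesReg]
  · simp [Prog.WritesReg]
  · simpa [Prog.after] using h12
  · intro k s v h; exact h
  · simp [Prog.after, h1, h8, h10, h9]
  · rintro i hi s₁ hs₁ hf₁ hi₁ - ⟨hh, ih, hc⟩
    have hw0 := hs₁.pos.ne'
    have r7 : s₁.reg 7 = k := by
      rw [hf₁.reg 7 (by simp [Prog.WritesReg])]; simpa [Prog.after] using h7
    refine Runs.le (Runs.step ?_ (Runs.seq (Runs.count (N := k) (T := 8) (fun b s' =>
      s'.reg 13 = ofBits s.coin (i * k) b ∧ ∀ t, s'.coin t = s.coin (i * k + b + t))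
      ?_ ?_ (by omega) ?_ ?_ ?_ ?_) fun s₂ hs₂ hf₂ ⟨q13, qc⟩ =>
      Runs.of_after (fun _ => ?_) fun _ => ?_)) ?_
    rotate_right
    · simp [Prog.size, Expr.cost]; omega
    · intro _; simp [Prog.Fits]
    · simp [Prog.WritesReg]
    · simp [Prog.WritesReg]
    · simpa [Prog.after] using r7
    · intro k s v h; simpa using h
    · simp [Prog.after, ofBits, hc]
    · rintro b hb s₂ hs₂ hf₂ - - ⟨h13, hc2⟩
      have hlt := ofBits_lt s.coin (i * k) (b + 1)
      have hle : 2 ^ (b + 1) ≤ 2 ^ k := Nat.pow_le_pow_right (by omega) hb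
      rw [ofBits] at hlt
      have h0 := hc2 0
      rw [add_zero] at h0
      refine Runs.le (Runs.of_after (fun _ => ?_) fun _ => ?_) ?_
      · simp [Prog.Fits, Prog.after, h13, h0]
        omega
      · refine ⟨?_, fun t => ?_⟩
        · simp [Prog.after, h13, h0, ofBits]
        · simp only [Prog.after, State.setReg_coin, State.toss_coin, hc2]
          congr 1; omega
      · simp [Prog.size, Expr.cost]
    · have r4 : s₂.reg 4 = i := by
        rw [hf₂.reg 4 (by simp [Prog.WritesReg])]; simpa [Prog.after] using hi₁
      have := ofBits_lt s.coin (i * k) k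
      simp [Prog.Fits, q13, r4]
      omega
    · have r4 : s₂.reg 4 = i := by
        rw [hf₂.reg 4 (by simp [Prog.WritesReg])]; simpa [Prog.after] using hi₁
      have a1 : s₂.arr 1 = s₁.arr 1 := by rw [hf₂.arr 1 (by simp [Prog.WritesArr])]; rfl
      have e : ∀ x, x < 4 → x ≠ 4 + i := fun x hx => by omega
      refine ⟨?_, fun j hj => ?_, fun t => ?_⟩
      · simpa [Prog.after, q13, r4, a1, Function.update_apply, e] using hh
      · simp only [Prog.after, State.setArr_arr, Expr.val_add, Expr.val_const, Expr.val_reg, r4,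
          q13, if_true, Function.update_apply, a1]
        rcases Nat.lt_succ_iff_lt_or_eq.1 hj with hj' | rfl
        · rw [if_neg (by omega), ih j hj']
        · rw [if_pos rfl]
      · simp only [Prog.after, State.setArr_coin, qc]
        congr 1; ring
  · simp [Prog.size, Expr.cost]
    nlinarith
  · rintro s' - - ⟨a, b, -⟩
    exact ⟨a, b⟩

/-- The quotient of register `14` by the `i`th power of register `8`. -/
def shiftExpr : ℕ → Expr
  | 0 => 𝐫 14
  | i + 1 => shiftExpr i / 𝐫 8

theorem shiftExpr_val (i : ℕ) : (shiftExpr i).val s = s.reg 14 / s.reg 8 ^ i := by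
  induction i with
  | zero => simp [shiftExpr]
  | succ i ih => rw [shiftExpr, Expr.val_div, ih, Expr.val_reg, Nat.div_div_eq_div_mul, pow_succ]

theorem shiftExpr_fits (i : ℕ) : (shiftExpr i).Fits w s := by
  induction i with
  | zero => simp [shiftExpr]
  | succ i ih => simp [shiftExpr, ih]

/-- The test whether a colour is not among the lowest `i` digits of register `14` in the base given
by register `8`. -/
def aliveExpr (e : Expr) : ℕ → Expr
  | 0 => 𝐜 1
  | i + 1 => aliveExpr e i * (𝐜 1 - .op .eq e (shiftExpr i % 𝐫 8))

open Classical in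
theorem aliveExpr_val (e : Expr) (i : ℕ) : (aliveExpr e i).val s =
    if e.val s ∈ digits (s.reg 8) i (s.reg 14) then 0 else 1 := by
  induction i with
  | zero => simp [aliveExpr, digits]
  | succ i ih =>
    have : e.val s ∈ digits (s.reg 8) (i + 1) (s.reg 14) ↔ e.val s ∈ digits (s.reg 8) i (s.reg 14) ∨
        e.val s = s.reg 14 / s.reg 8 ^ i % s.reg 8 := by
      constructor
      · rintro ⟨j, hj, h⟩
        rcases Nat.lt_succ_iff_lt_or_eq.1 hj with hj | rfl
        exacts [.inl ⟨j, hj, h⟩, .inr h]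
      · rintro (⟨j, hj, h⟩ | h)
        exacts [⟨j, by omega, h⟩, ⟨i, by omega, h⟩]
    simp only [aliveExpr, Expr.val_mul, ih, Expr.val_sub, Expr.val_const, Expr.val_eq, Expr.val_mod,
      shiftExpr_val, Expr.val_reg, this]
    by_cases h1 : e.val s ∈ digits (s.reg 8) i (s.reg 14) <;>
      by_cases h2 : e.val s = s.reg 14 / s.reg 8 ^ i % s.reg 8 <;> simp [h1, h2]

theorem aliveExpr_fits (hw : w ≠ 0) {e : Expr} (he : e.Fits w s) (i : ℕ) :
    (aliveExpr e i).Fits w s := by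
  classical
  have h1 := Nat.one_lt_two_pow hw
  induction i with
  | zero => simpa [aliveExpr] using hw
  | succ i ih =>
    simp only [aliveExpr, Expr.fits_mul, Expr.fits_sub, Expr.fits_const, Expr.fits_eq,
      Expr.fits_mod, Expr.fits_reg, ih, he, shiftExpr_fits, h1, true_and, and_true, aliveExpr_val,
      Expr.val_sub, Expr.val_const]
    refine lt_of_le_of_lt ?_ h1
    calc _ ≤ 1 * 1 := Nat.mul_le_mul (by split_ifs <;> omega) (Nat.sub_le _ _)
      _ = 1 := rfl

end DSO

namespace DSO

variable {n f : ℕ} {G : SimpleGraph (Fin n)} {w : ℕ} {s : State} {P : Prog} {T : ℕ → ℕ → ℕ → ℕ}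
  {κ : ℕ}

/-- Computing one table of distances: register `4` encodes the round and the palette.  Array `4`
first marks the pairs whose colours do not belong to the palette; then `P` is run on the graph
`avoiding`, and its output is copied to the data structure. -/
def roundProg (P : Prog) (f : ℕ) : Prog :=
  (.assign 13 (𝐫 4 / 𝐫 9) ;; .assign 14 (𝐫 4 % 𝐫 9) ;; .assign 11 (𝐜 4 + 𝐫 13 * 𝐫 3)) ;;
  .count 6 3 (.store 4 (𝐫 6) (aliveExpr (𝐚 1 (𝐫 11 + 𝐫 6)) f)) ;;
  .count 6 3 (.store 3 (𝐫 6) (𝐚 2 (𝐫 6) *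
    ((𝐚 4 (𝐫 6) * 𝐚 4 (𝐫 6 % 𝐫 1 * 𝐫 1 + 𝐫 6 / 𝐫 1)) *
      (𝐚 4 (𝐫 6 / 𝐫 1 * 𝐫 1 + 𝐫 6 / 𝐫 1) * 𝐚 4 (𝐫 6 % 𝐫 1 * 𝐫 1 + 𝐫 6 % 𝐫 1))))) ;;
  P ;;
  .assign 11 (𝐜 4 + 𝐫 12 + 𝐫 4 * 𝐫 3) ;;
  .count 6 3 (.store 1 (𝐫 11 + 𝐫 6) (𝐚 4 (𝐫 6)))

/-- The time to test whether a colour belongs to a palette. -/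
def testCost (f : ℕ) : ℕ := (aliveExpr (𝐚 1 (𝐫 11 + 𝐫 6)) f).cost

open Classical in
theorem roundProg_runs (hP : ComputesDistances P T κ) (hn : 2 ≤ n) {R B t : ℕ}
    {χ : ℕ → Fin n → Fin n → ℕ} (hw : κ * n.size ≤ w)
    (hwd : 4 + R * (n * n) + R * B ^ f * (n * n) < 2 ^ w) (h1 : s.reg 1 = n) (h3 : s.reg 3 = n * n)
    (h4 : s.reg 4 = t) (ht : t < R * B ^ f)
    (h8 : s.reg 8 = B) (h9 : s.reg 9 = B ^ f) (h12 : s.reg 12 = R * (n * n))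
    (h2 : ∀ u v : Fin n, s.arr 2 (u * n + v) = if G.Adj u v then 1 else 0)
    (hχ : ∀ j < R, ∀ u v : Fin n, s.arr 1 (4 + (j * (n * n) + (u * n + v))) = χ j u v) :
    Runs w (roundProg P f) s (T w n G.edgeSet.ncard + n * n * (testCost f + 100) + 100) fun s' =>
      (∀ i, (i < 4 + R * (n * n) + t * (n * n) ∨ 4 + R * (n * n) + t * (n * n) + n * n ≤ i) →
        s'.arr 1 i = s.arr 1 i) ∧
      ∀ u v : Fin n, s'.arr 1 (4 + R * (n * n) + t * (n * n) + (u * n + v)) =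
        encodeDist ((avoiding G (χ (t / B ^ f)) (digits B f (t % B ^ f))).edist u v) := by
  intro hs
  have hw0 := hs.pos.ne'
  have pr : ∀ x < 20, ¬ P.WritesReg x := fun x hx h => by have := hP.reg x h; omega
  have pa : ∀ x < 4, ¬ P.WritesArr x := fun x hx h => by have := hP.arr x h; omega
  have ix : ∀ u v : Fin n, (u : ℕ) * n + v < n * n := fun u v => index_lt u.2 v.2
  have dv : ∀ u v : Fin n, (u * n + v : ℕ) / n = u := fun u v => index_div _ v.2
  have md : ∀ u v : Fin n, (u * n + v : ℕ) % n = v := fun u v => index_mod _ v.2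
  obtain ⟨j, hj⟩ : ∃ j, t / B ^ f = j := ⟨_, rfl⟩
  obtain ⟨g, hg⟩ : ∃ g, t % B ^ f = g := ⟨_, rfl⟩
  have hjR : j < R := by rw [← hj]; exact Nat.div_lt_of_lt_mul (by rwa [mul_comm])
  rw [hj, hg]
  have hjn : (j + 1) * (n * n) ≤ R * (n * n) := Nat.mul_le_mul_right _ hjR
  have htn : (t + 1) * (n * n) ≤ R * B ^ f * (n * n) := Nat.mul_le_mul_right _ ht
  have hc := hχ j hjR
  rw [Nat.succ_mul] at hjn htn
  have hnn1 : 0 < n * n := Nat.mul_pos (by omega) (by omega)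
  have htle : t ≤ t * (n * n) := Nat.le_mul_of_pos_right _ hnn1
  have hjle : j ≤ j * (n * n) := Nat.le_mul_of_pos_right _ hnn1
  obtain ⟨J, hJ⟩ : ∃ J, j * (n * n) = J := ⟨_, rfl⟩
  obtain ⟨A, hA⟩ : ∃ A, t * (n * n) = A := ⟨_, rfl⟩
  obtain ⟨N, hN⟩ : ∃ N, R * (n * n) = N := ⟨_, rfl⟩
  obtain ⟨M, hM⟩ : ∃ M, R * B ^ f * (n * n) = M := ⟨_, rfl⟩
  simp only [hJ] at hjn hc hjle
  simp only [hA] at htn htle ⊢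
  simp only [hN] at hjn h12 hwd ⊢
  simp only [hM] at htn hwd
  let H := avoiding G (χ j) (digits B f g)
  have hHm : H.edgeSet.ncard ≤ G.edgeSet.ncard :=
    Set.ncard_le_ncard (SimpleGraph.edgeSet_mono fun u v h => h.1) (Set.toFinite _)
  obtain ⟨s₀, hs₀⟩ : ∃ s₀, Prog.after s (.assign 13 (𝐫 4 / 𝐫 9) ;; .assign 14 (𝐫 4 % 𝐫 9) ;;
    .assign 11 (𝐜 4 + 𝐫 13 * 𝐫 3)) = s₀ := ⟨_, rfl⟩
  have b : s₀.reg 1 = n ∧ s₀.reg 3 = n * n ∧ s₀.reg 4 = t ∧ s₀.reg 8 = B ∧ s₀.reg 12 = N ∧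
      s₀.reg 14 = g ∧ s₀.reg 11 = 4 + J := by
    rw [← hs₀]
    simp [Prog.after, h1, h3, h4, h8, h12, hj, hg, h9, hJ]
  have ba : s₀.arr = s.arr := by rw [← hs₀]; rfl
  refine Runs.le (Runs.step ?_ (T := T w n G.edgeSet.ncard + n * n * (testCost f + 100) + 80) ?_)
    ?_ hs
  · intro _
    simp [Prog.Fits, Prog.after, h4, h9, h3, hj, hJ]
    omega
  swap
  · simp [Prog.size, Expr.cost]
    omega
  rw [hs₀]
  clear hs₀
  obtain ⟨b1, b3, b4, b8, b12, b14, b11⟩ := b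
  let al (u v : Fin n) : ℕ := if χ j u v ∈ digits B f g then 0 else 1
  have al1 : ∀ u v, al u v ≤ 1 := fun u v => by dsimp only [al]; split_ifs <;> omega
  refine Runs.le (Runs.seq (Runs.fillMatrix (o := 0) al (by omega) b3 rfl ?_)
    fun s₁ hs₁ hf₁ q₁ => Runs.seq (Runs.fillMatrix (o := 0) (fun u v => if H.Adj u v then 1 else 0)
    (by omega) ?_ rfl ?_) fun s₂ hs₂ hf₂ q₂ => Runs.seq (hP.runs w n _ s₂ H hn hw ?_ hHm ?_)
    fun s₃ hs₃ hf₃ q₃ => Runs.step ?_ (Runs.mono (Runs.fillMatrix (o := 4 + N + A)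
    (fun u v => encodeDist (H.edist u v)) (by omega) ?_ rfl ?_) le_rfl ?_)) ?_
  rotate_right
  · rw [show (aliveExpr (𝐚 1 (𝐫 11 + 𝐫 6)) f).cost = testCost f from rfl]
    simp [Prog.size, Expr.cost]
    generalize T w n G.edgeSet.ncard = x
    generalize testCost f = y
    generalize n * n = z
    rw [show z * (y + 100) = z * y + 100 * z by ring, show z * (1 + y + 1 + 8) = z * y + 10 * z by ring]
    omega
  · intro u v s' hr ha hi hun
    have a1 : s'.arr 1 (4 + J + (u * n + v)) = χ j u v := by
      rw [ha 1 (by omega), ba, ← hc u v, add_assoc]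
    have r11 : s'.reg 11 = 4 + J := by rw [hr 11 (by omega), b11]
    have r8 : s'.reg 8 = B := by rw [hr 8 (by omega), b8]
    have r14 : s'.reg 14 = g := by rw [hr 14 (by omega), b14]
    have := ix u v
    refine ⟨⟨by simp, ?_⟩, by simpa using hi, ?_⟩
    · refine aliveExpr_fits hw0 ?_ f
      simp [r11, hi]
      omega
    · rw [aliveExpr_val, r8, r14]
      simp [r11, hi, a1, al]
  · rw [hf₁.reg 3 (by simp [Prog.WritesReg]), b3]
  · intro u v s' hr ha hi hun
    have a2 : s'.arr 2 (u * n + v) = if G.Adj u v then 1 else 0 := by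
      rw [ha 2 (by omega), hf₁.arr 2 (by simp [Prog.WritesArr]), ba, h2]
    have a4 : ∀ u v : Fin n, s'.arr 4 (u * n + v) = al u v := by
      intro u v
      rw [ha 4 (by omega)]
      simpa using q₁.1 u v
    have r1 : s'.reg 1 = n := by rw [hr 1 (by omega), hf₁.reg 1 (by simp [Prog.WritesReg]), b1]
    have m1 : al u v * al v u ≤ 1 := Nat.mul_le_mul (al1 u v) (al1 v u)
    have m2 : al u u * al v v ≤ 1 := Nat.mul_le_mul (al1 u u) (al1 v v)
    have m3 := Nat.mul_le_mul m1 m2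
    have i1 := ix v u
    have i2 := ix u u
    have i3 := ix v v
    have key : (if G.Adj u v then 1 else 0) * (al u v * al v u * (al u u * al v v)) =
        if H.Adj u v then 1 else 0 := by
      have hH : H.Adj u v ↔ G.Adj u v ∧ (χ j u v ∉ digits B f g ∧ χ j v u ∉ digits B f g) ∧
        χ j u u ∉ digits B f g ∧ χ j v v ∉ digits B f g := Iff.rfl
      simp only [hH]
      dsimp only [al]
      by_cases k0 : G.Adj u v <;> by_cases k1 : χ j u v ∈ digits B f g <;>
        by_cases k2 : χ j v u ∈ digits B f g <;> by_cases k3 : χ j u u ∈ digits B f g <;>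
        by_cases k4 : χ j v v ∈ digits B f g <;> simp [k0, k1, k2, k3, k4]
    have m4 : (if G.Adj u v then 1 else 0) * (al u v * al v u * (al u u * al v v)) ≤ 1 := by
      rw [key]; split_ifs <;> omega
    refine ⟨⟨by simp, ?_⟩, by simpa using hi, ?_⟩
    · simp only [Expr.fits_mul, Expr.fits_get, Expr.fits_reg, Expr.fits_add, Expr.fits_div,
        Expr.fits_mod, Expr.val_mul, Expr.val_get, Expr.val_reg, Expr.val_add, Expr.val_div,
        Expr.val_mod, hi, r1, dv, md, a2, a4, true_and, and_true]
      omega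
    · rw [← key]
      simp [hi, r1, dv, md, a2, a4]
  · rw [hf₂.reg 1 (by simp [Prog.WritesReg]), hf₁.reg 1 (by simp [Prog.WritesReg]), b1]
  · intro u v
    simpa using q₂.1 u v
  · have c3 : s₃.reg 3 = n * n := by
      rw [hf₃.reg 3 (pr _ (by omega)), hf₂.reg 3 (by simp [Prog.WritesReg]),
        hf₁.reg 3 (by simp [Prog.WritesReg]), b3]
    have c4 : s₃.reg 4 = t := by
      rw [hf₃.reg 4 (pr _ (by omega)), hf₂.reg 4 (by simp [Prog.WritesReg]),
        hf₁.reg 4 (by simp [Prog.WritesReg]), b4]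
    have c12 : s₃.reg 12 = N := by
      rw [hf₃.reg 12 (pr _ (by omega)), hf₂.reg 12 (by simp [Prog.WritesReg]),
        hf₁.reg 12 (by simp [Prog.WritesReg]), b12]
    intro _
    simp [Prog.Fits, c3, c4, c12, hA]
    omega
  · simp only [Prog.after, State.setReg_reg]
    rw [if_neg (by omega), hf₃.reg 3 (pr _ (by omega)), hf₂.reg 3 (by simp [Prog.WritesReg]),
      hf₁.reg 3 (by simp [Prog.WritesReg]), b3]
  · intro u v s' hr ha hi hun
    have c3 : s₃.reg 3 = n * n := by
      rw [hf₃.reg 3 (pr _ (by omega)), hf₂.reg 3 (by simp [Prog.WritesReg]),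
        hf₁.reg 3 (by simp [Prog.WritesReg]), b3]
    have c4 : s₃.reg 4 = t := by
      rw [hf₃.reg 4 (pr _ (by omega)), hf₂.reg 4 (by simp [Prog.WritesReg]),
        hf₁.reg 4 (by simp [Prog.WritesReg]), b4]
    have c12 : s₃.reg 12 = N := by
      rw [hf₃.reg 12 (pr _ (by omega)), hf₂.reg 12 (by simp [Prog.WritesReg]),
        hf₁.reg 12 (by simp [Prog.WritesReg]), b12]
    have r11 : s'.reg 11 = 4 + N + A := by
      rw [hr 11 (by omega)]
      simp [Prog.after, c3, c4, c12, hA]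
    have a4 : s'.arr 4 (u * n + v) = encodeDist (H.edist u v) := by
      rw [ha 4 (by omega)]; exact q₃ u v
    have := ix u v
    simp [hi, r11, a4]
    omega
  · rintro s' - - ⟨e1, e2⟩
    refine ⟨fun i hi => ?_, e1⟩
    rw [e2 i hi]
    simp only [Prog.after, State.setReg_arr]
    rw [hf₃.arr 1 (pa _ (by omega)), hf₂.arr 1 (by simp [Prog.WritesArr]),
      hf₁.arr 1 (by simp [Prog.WritesArr]), ba]

end DSO

namespace DSO

variable {n f : ℕ} {G : SimpleGraph (Fin n)} {w : ℕ} {s : State} {P : Prog} {T : ℕ → ℕ → ℕ → ℕ}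
  {κ : ℕ}

theorem roundProg_reg (hP : ComputesDistances P T κ) {x : ℕ} (hx : x < 20)
    (h : (roundProg P f).WritesReg x) : x = 6 ∨ x = 11 ∨ x = 13 ∨ x = 14 := by
  have pr : ¬ P.WritesReg x := fun h => by have := hP.reg x h; omega
  simp [roundProg, Prog.WritesReg, pr] at h
  omega

theorem roundProg_arr (hP : ComputesDistances P T κ) {x : ℕ} (hx : x < 3)
    (h : (roundProg P f).WritesArr x) : x = 1 := by
  have pa : ¬ P.WritesArr x := fun h => by have := hP.arr x h; omega
  simp [roundProg, Prog.WritesArr, pa] at h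
  omega

open Classical in
/-- The tables for all rounds and palettes. -/
theorem tables_runs (hP : ComputesDistances P T κ) (hn : 2 ≤ n) {R B : ℕ}
    {χ : ℕ → Fin n → Fin n → ℕ} (hw : κ * n.size ≤ w)
    (hwd : 4 + R * (n * n) + R * B ^ f * (n * n) < 2 ^ w) (h1 : s.reg 1 = n) (h3 : s.reg 3 = n * n)
    (h8 : s.reg 8 = B) (h9 : s.reg 9 = B ^ f) (h12 : s.reg 12 = R * (n * n))
    (h16 : s.reg 16 = R * B ^ f)
    (h2 : ∀ u v : Fin n, s.arr 2 (u * n + v) = if G.Adj u v then 1 else 0)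
    (hχ : ∀ j < R, ∀ u v : Fin n, s.arr 1 (4 + (j * (n * n) + (u * n + v))) = χ j u v) :
    Runs w (.count 4 16 (roundProg P f)) s
      (R * B ^ f * (T w n G.edgeSet.ncard + n * n * (testCost f + 100) + 100 + 8) + 6) fun s' =>
      (∀ i < 4 + R * (n * n), s'.arr 1 i = s.arr 1 i) ∧
      ∀ t < R * B ^ f, ∀ u v : Fin n, s'.arr 1 (4 + R * (n * n) + (t * (n * n) + (u * n + v))) =
        encodeDist ((avoiding G (χ (t / B ^ f)) (digits B f (t % B ^ f))).edist u v) := by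
  have ix : ∀ u v : Fin n, (u : ℕ) * n + v < n * n := fun u v => index_lt u.2 v.2
  refine Runs.count (N := R * B ^ f) (fun k s' =>
    (∀ i < 4 + R * (n * n), s'.arr 1 i = s.arr 1 i) ∧
      ∀ t < k, ∀ u v : Fin n, s'.arr 1 (4 + R * (n * n) + (t * (n * n) + (u * n + v))) =
        encodeDist ((avoiding G (χ (t / B ^ f)) (digits B f (t % B ^ f))).edist u v))
    (fun h => by have := roundProg_reg hP (by omega) h; omega)
    (fun h => by have := roundProg_reg hP (by omega) h; omega) (by omega) h16
    (fun k s v h => h) ⟨fun _ _ => rfl, by omega⟩ ?_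
  rintro k hk s₁ hs₁ hf₁ hi - ⟨ih₁, ih₂⟩
  have rr : ∀ x, x = 1 ∨ x = 3 ∨ x = 8 ∨ x = 9 ∨ x = 12 → s₁.reg x = s.reg x := fun x hx =>
    hf₁.reg x fun h => by
      rcases Prog.count_writesReg.1 h with h | h
      · omega
      · have := roundProg_reg hP (by omega) h; omega
  have a2 : s₁.arr 2 = s.arr 2 := hf₁.arr 2 fun h => by
    have := roundProg_arr hP (by omega) (Prog.count_writesArr.1 h); omega
  refine Runs.mono (roundProg_runs (χ := χ) hP hn hw hwd ((rr 1 (by simp)).trans h1)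
    ((rr 3 (by simp)).trans h3) hi hk ((rr 8 (by simp)).trans h8) ((rr 9 (by simp)).trans h9)
    ((rr 12 (by simp)).trans h12) (by rwa [a2]) ?_) le_rfl ?_
  · intro j hj u v
    have := ix u v
    have hjR : (j + 1) * (n * n) ≤ R * (n * n) := Nat.mul_le_mul_right _ hj
    rw [Nat.succ_mul] at hjR
    rw [ih₁ _ (by omega), hχ j hj]
  · rintro s' - - ⟨e1, e2⟩
    refine ⟨fun i hi => by rw [e1 i (.inl (by omega)), ih₁ i hi], fun t ht u v => ?_⟩
    rcases Nat.lt_succ_iff_lt_or_eq.1 ht with ht | rfl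
    · have := ix u v
      have htk : (t + 1) * (n * n) ≤ k * (n * n) := Nat.mul_le_mul_right _ ht
      rw [Nat.succ_mul] at htk
      rw [e1 _ (.inl (by omega)), ih₂ t ht]
    · rw [← e2 u v, add_assoc (4 + R * (n * n))]

/-- The preprocessing program: reading the network, its diameter, the parameters, the random
colours, and one distance table for every round and palette.  Register `0` announces the size. -/
def preProg (P : Prog) (f c : ℕ) : Prog :=
  readProg ;; diamProg P ;; paramProg f c ;; colourProg ;; .count 4 16 (roundProg P f) ;;
  .assign 0 (𝐜 4 + 𝐫 12 + 𝐫 16 * 𝐫 3)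

/-- The size of the data structure. -/
def tableSize (f c n D : ℕ) : ℕ :=
  4 + rounds f c n * (n * n) + rounds f c n * paletteBase f D ^ f * (n * n)

theorem preProg_runs {c : ℕ} (hP : ComputesDistances P T κ) (hn : 2 ≤ n) (hG : G.Connected)
    {l : List (Fin n × Fin n)} (hl : IsLinkList G l) (hκ : κ * n.size ≤ w)
    (hD : G.diam ≤ n)
    (hw₁ : 2 * ((3 * maxDist f G.diam + 1) * (2 * f + 2)) + 4 < 2 ^ w)
    (hw₂ : tableSize f c n G.diam < 2 ^ w) (hw₃ : 2 * (n * n) + 8 < 2 ^ w)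
    (hw₄ : 3 * f + 2 + c < 2 ^ w) (hw₅ : 2 ^ colourBits f G.diam + 4 < 2 ^ w)
    (h0 : ∀ i, s.arr 0 i = (encodeNetwork l).getD i 0) (h2 : ∀ i, s.arr 2 i = 0) :
    Runs w (preProg P f c) s
      ((50 * (n * n) + 30) + ((T w n G.edgeSet.ncard + 40 * (n * n) + 30) +
        ((20 * minColours f G.diam + 20 * n + 200 + 2 * f) +
          ((rounds f c n * (n * n) * (20 * colourBits f G.diam + 30) + 30) +
            ((rounds f c n * paletteBase f G.diam ^ f *
              (T w n G.edgeSet.ncard + n * n * (testCost f + 100) + 100 + 8) + 6) + 20)))))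
      fun s' => s'.reg 0 = tableSize f c n G.diam ∧
        IsTable G f (rounds f c n) (paletteBase f G.diam)
          (colour n (colourBits f G.diam) s.coin) (s'.arr 1) := by
  classical
  have pr : ∀ x < 20, ¬ P.WritesReg x := fun x hx h => by have := hP.reg x h; omega
  have pa : ∀ x < 4, ¬ P.WritesArr x := fun x hx h => by have := hP.arr x h; omega
  have dr : ∀ x, x = 1 ∨ x = 3 → ¬ (diamProg P).WritesReg x := fun x hx => by
    simp [diamProg, Prog.WritesReg, pr x (by omega)]; omega
  have hnn : n ≤ n * n := Nat.le_mul_self n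
  have ix : ∀ u v : Fin n, (u : ℕ) * n + v < n * n := fun u v => index_lt u.2 v.2
  obtain ⟨R, hR⟩ : ∃ R, rounds f c n = R := ⟨_, rfl⟩
  obtain ⟨B, hB⟩ : ∃ B, paletteBase f G.diam = B := ⟨_, rfl⟩
  obtain ⟨k, hk⟩ : ∃ k, colourBits f G.diam = k := ⟨_, rfl⟩
  rw [tableSize] at hw₂ ⊢
  refine Runs.seq (readProg_runs hl hw₃ h0 h2) fun s₁ hs₁ hf₁ ⟨q1, q3, q2⟩ =>
    Runs.seq (diamProg_runs hP hn hG hκ q1 q3 q2) fun s₂ hs₂ hf₂ q5 =>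
    Runs.seq (paramProg_runs (c := c) (n := n) (f := f) ?_ ?_ q5 (by omega) hD hw₁ hw₂ (by omega)
      hw₄) fun s₃ hs₃ hf₃ ⟨r7, r8, r9, r10, r12, r16⟩ => ?_
  · rw [hf₂.reg 1 (dr _ (by omega)), q1]
  · rw [hf₂.reg 3 (dr _ (by omega)), q3]
  have r1 : s₃.reg 1 = n := by
    rw [hf₃.reg 1 (by simp [paramProg, clogProg, Prog.WritesReg]), hf₂.reg 1 (dr _ (by omega)), q1]
  have r3 : s₃.reg 3 = n * n := by
    rw [hf₃.reg 3 (by simp [paramProg, clogProg, Prog.WritesReg]), hf₂.reg 3 (dr _ (by omega)), q3]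
  have a2 : s₃.arr 2 = s₁.arr 2 := by
    rw [hf₃.arr 2 (by simp [paramProg, clogProg, Prog.WritesArr]),
      hf₂.arr 2 (by simp [diamProg, Prog.WritesArr, pa])]
  have cc : s₃.coin = s.coin := by
    rw [hf₃.coin (by simp [paramProg, clogProg, Prog.Tosses]),
      hf₂.coin (by simp [diamProg, Prog.Tosses, hP.tosses]),
      hf₁.coin (by simp [readProg, Prog.Tosses])]
  simp only [hR, hB, hk] at hw₂ hw₅ r7 r8 r9 r10 r12 r16 ⊢
  have hwR : R * (n * n) + 4 < 2 ^ w := by omega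
  refine Runs.seq (colourProg_runs r1 r8 r10 r9 r12 r7 hwR hw₅)
    fun s₄ hs₄ hf₄ ⟨⟨t0, t1, t2, t3⟩, tc⟩ => ?_
  have rr : ∀ x, x < 13 → x ≠ 4 → s₄.reg x = s₃.reg x := fun x hx hx' =>
    hf₄.reg x (by simp [colourProg, Prog.WritesReg]; omega)
  have r16' : s₄.reg 16 = s₃.reg 16 := hf₄.reg 16 (by simp [colourProg, Prog.WritesReg])
  have hcol : ∀ j < R, ∀ u v : Fin n, s₄.arr 1 (4 + (j * (n * n) + (u * n + v))) =
      colour n k s.coin j u v := by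
    intro j hj u v
    have := ix u v
    have hjR : (j + 1) * (n * n) ≤ R * (n * n) := Nat.mul_le_mul_right _ hj
    rw [Nat.succ_mul] at hjR
    rw [tc _ (by omega), cc]
    rfl
  refine Runs.seq (tables_runs hP hn (χ := colour n k s.coin) hκ hw₂
    ((rr 1 (by omega) (by omega)).trans r1) ((rr 3 (by omega) (by omega)).trans r3)
    ((rr 8 (by omega) (by omega)).trans r8) ((rr 9 (by omega) (by omega)).trans r9)
    ((rr 12 (by omega) (by omega)).trans r12) (r16'.trans r16) ?_ hcol)
    fun s₅ hs₅ hf₅ ⟨u1, u2⟩ => Runs.le (Runs.of_after (fun _ => ?_) fun _ => ?_) ?_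
  · rw [hf₄.arr 2 (by simp [colourProg, Prog.WritesArr]), a2]
    exact q2
  all_goals
    have lr : ∀ x, x = 3 ∨ x = 12 ∨ x = 16 → s₅.reg x = s₄.reg x := fun x hx =>
      hf₅.reg x fun h => by
        rcases Prog.count_writesReg.1 h with h | h
        · omega
        · have := roundProg_reg hP (by omega) h; omega
    have l3 : s₅.reg 3 = n * n :=
      (lr 3 (by simp)).trans ((rr 3 (by omega) (by omega)).trans r3)
    have l12 : s₅.reg 12 = R * (n * n) :=
      (lr 12 (by simp)).trans ((rr 12 (by omega) (by omega)).trans r12)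
    have l16 : s₅.reg 16 = R * B ^ f := (lr 16 (by simp)).trans (r16'.trans r16)
  · simp [Prog.Fits, l3, l12, l16]
    omega
  · refine ⟨by simp [Prog.after, l3, l12, l16], ?_⟩
    simp only [Prog.after, State.setReg_arr]
    refine ⟨?_, ?_, ?_, ?_, fun j hj u v => ?_, fun j hj g hg u v => ?_⟩
    · rw [u1 _ (by omega), t0]
    · rw [u1 _ (by omega), t1]
    · rw [u1 _ (by omega), t2]
    · rw [u1 _ (by omega), t3]
    · have := ix u v
      have hjR : (j + 1) * (n * n) ≤ R * (n * n) := Nat.mul_le_mul_right _ hj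
      rw [Nat.succ_mul] at hjR
      rw [u1 _ (by omega), hcol j hj]
    · have hlt : j * B ^ f + g < R * B ^ f := by
        calc j * B ^ f + g < j * B ^ f + B ^ f := by omega
          _ = (j + 1) * B ^ f := by ring
          _ ≤ R * B ^ f := Nat.mul_le_mul_right _ hj
      rw [u2 _ hlt, index_div _ hg, index_mod _ hg]
  · simp [Prog.size, Expr.cost]

end DSO

/-! ### The oracle -/

namespace DSO

variable {n f c : ℕ} {G : SimpleGraph (Fin n)} {w : ℕ} {s : State} {P : Prog}
  {T : ℕ → ℕ → ℕ → ℕ} {κ : ℕ}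

theorem Oracle.Works.mono {O : Oracle} {A S Q A' S' Q' : ℝ} (h : O.Works G f c A S Q)
    (hA : A ≤ A') (hS : S ≤ S') (hQ : Q ≤ Q') : O.Works G f c A' S' Q' := fun l hl =>
  ⟨fun ρ =>
    let ⟨t, data, h₁, h₂, h₃, h₄⟩ := (h l hl).1 ρ
    ⟨t, data, h₁, h₂.trans hA, h₃.trans hS, fun q =>
      let ⟨t', a, h₅, h₆⟩ := h₄ q
      ⟨t', a, h₅, h₆.trans hQ⟩⟩, (h l hl).2⟩

/-- A constant such that palettes are encoded in a base of at most `paletteFactor f * D`. -/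
def paletteFactor (f : ℕ) : ℕ := 200 * (f + 1) ^ 2

theorem maxDist_bound {D : ℕ} (hD : 1 ≤ D) :
    2 * (2 * ((3 * maxDist f D + 1) * (2 * f + 2)) + 4) ≤ paletteFactor f * D := by
  obtain ⟨d, rfl⟩ := Nat.exists_eq_add_of_le hD
  rw [paletteFactor, maxDist]
  nlinarith [Nat.zero_le (f * d), Nat.zero_le (f * f * d), Nat.zero_le (f * f), Nat.zero_le f]

theorem two_pow_colourBits_add_le {D : ℕ} (hD : 1 ≤ D) :
    2 ^ colourBits f D + 4 ≤ paletteFactor f * D := by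
  have h1 := two_pow_clog_le (minColours f D)
  have h2 := maxDist_bound (f := f) hD
  have h3 : minColours f D ≤ 2 * ((3 * maxDist f D + 1) * (2 * f + 2)) := by
    rw [minColours]; gcongr; omega
  rw [colourBits]
  omega

theorem paletteBase_le {D : ℕ} (hD : 1 ≤ D) : paletteBase f D ≤ paletteFactor f * D := by
  have := two_pow_colourBits_add_le (f := f) hD
  rw [paletteBase]
  omega

theorem rounds_pos (hn : 2 ≤ n) : 0 < rounds f c n :=
  Nat.mul_pos (by omega) (Nat.clog_pos (by omega) (by omega))

theorem clog_succ_le (n : ℕ) : Nat.clog 2 (n + 1) ≤ n :=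
  Nat.clog_le_of_le_pow Nat.lt_two_pow_self

theorem tableSize_le {D : ℕ} (hn : 2 ≤ n) (hD : 1 ≤ D) :
    tableSize f c n D ≤ 6 * (rounds f c n * (paletteFactor f * D) ^ f * (n * n)) := by
  have hB := Nat.pow_le_pow_left (paletteBase_le (f := f) hD) f
  have hB0 : 1 ≤ (paletteFactor f * D) ^ f := Nat.one_le_pow _ _
    (Nat.mul_pos (by rw [paletteFactor]; positivity) hD)
  have hR := rounds_pos (f := f) (c := c) hn
  have hn2 : 1 ≤ n * n := Nat.mul_pos (by omega) (by omega)
  rw [tableSize]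
  have h1 : 1 ≤ rounds f c n * (paletteFactor f * D) ^ f * (n * n) := Nat.mul_pos (Nat.mul_pos hR hB0) hn2
  have h2 : rounds f c n * (n * n) ≤ rounds f c n * (paletteFactor f * D) ^ f * (n * n) :=
    Nat.mul_le_mul_right _ (Nat.le_mul_of_pos_right _ hB0)
  have h3 : rounds f c n * paletteBase f D ^ f * (n * n) ≤
      rounds f c n * (paletteFactor f * D) ^ f * (n * n) := by gcongr
  omega

/-- A factor in the word size for which no number overflows. -/
def wordFactor (f c : ℕ) : ℕ :=
  (6 * (3 * f + 2 + c) * paletteFactor f ^ f + paletteFactor f + (3 * f + 2 + c) + 10) + (f + 3)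

/-- Polynomials in `n` fit into words with a constant multiple of `Nat.size n` bits. -/
theorem lt_two_pow_of_le {M e x : ℕ} (hn : 0 < n) (hx : x ≤ M * n ^ e)
    (hw : (M + e) * n.size ≤ w) : x < 2 ^ w := by
  have hs : 0 < n.size := Nat.size_pos.2 hn
  have hM : M < 2 ^ (M * n.size) :=
    Nat.lt_two_pow_self.trans_le (Nat.pow_le_pow_right (by omega) (Nat.le_mul_of_pos_right _ hs))
  have hne : n ^ e ≤ 2 ^ (e * n.size) := by
    rw [mul_comm, pow_mul]
    exact Nat.pow_le_pow_left (Nat.lt_size_self n).le _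
  calc x ≤ M * n ^ e := hx
    _ < 2 ^ (M * n.size) * 2 ^ (e * n.size) := by
      refine lt_of_lt_of_le (Nat.mul_lt_mul_of_pos_right hM (by positivity)) ?_
      gcongr
    _ = 2 ^ ((M + e) * n.size) := by rw [← pow_add, add_mul]
    _ ≤ 2 ^ w := Nat.pow_le_pow_right (by omega) hw

/-- Words of `w ≥ wordFactor f c * Nat.size n` bits are long enough. -/
theorem word_bounds {D : ℕ} (hn : 2 ≤ n) (hD : 1 ≤ D) (hDn : D ≤ n)
    (hw : wordFactor f c * n.size ≤ w) :
    2 * ((3 * maxDist f D + 1) * (2 * f + 2)) + 4 < 2 ^ w ∧ tableSize f c n D < 2 ^ w ∧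
      2 * (n * n) + 8 < 2 ^ w ∧ 3 * f + 2 + c < 2 ^ w ∧ 2 ^ colourBits f D + 4 < 2 ^ w ∧
      2 * f + 8 < 2 ^ w := by
  obtain ⟨M, hM⟩ : ∃ M, 6 * (3 * f + 2 + c) * paletteFactor f ^ f + paletteFactor f +
    (3 * f + 2 + c) + 10 = M := ⟨_, rfl⟩
  rw [wordFactor, hM] at hw
  have key : ∀ {x}, x ≤ M * n ^ (f + 3) → x < 2 ^ w := fun hx => lt_two_pow_of_le (by omega) hx hw
  have n1 : 1 ≤ n ^ (f + 3) := Nat.one_le_pow _ _ (by omega)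
  have nn : n ≤ n ^ (f + 3) := Nat.le_self_pow (by omega) n
  have n2 : n * n ≤ n ^ (f + 3) := by
    rw [← sq]; exact Nat.pow_le_pow_right (by omega) (by omega)
  have hM1 : M ≤ M * n ^ (f + 3) := Nat.le_mul_of_pos_right _ n1
  have hMn : ∀ {x}, x ≤ paletteFactor f * D → x ≤ M * n ^ (f + 3) := fun hx =>
    hx.trans (Nat.mul_le_mul (by omega) (hDn.trans nn))
  have hM2 : 10 * (n * n) ≤ M * n ^ (f + 3) := Nat.mul_le_mul (by omega) n2
  refine ⟨key (hMn ?_), key ?_, key ?_, key (by omega),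
    key (hMn (two_pow_colourBits_add_le hD)), key ?_⟩
  · have := maxDist_bound (f := f) hD
    omega
  · have hR : rounds f c n ≤ (3 * f + 2 + c) * n := Nat.mul_le_mul_left _ (clog_succ_le n)
    calc tableSize f c n D ≤ 6 * (rounds f c n * (paletteFactor f * D) ^ f * (n * n)) :=
          tableSize_le hn hD
      _ ≤ 6 * (((3 * f + 2 + c) * n) * (paletteFactor f * n) ^ f * (n * n)) := by gcongr
      _ = 6 * (3 * f + 2 + c) * paletteFactor f ^ f * n ^ (f + 3) := by ring
      _ ≤ M * n ^ (f + 3) := Nat.mul_le_mul_right _ (by omega)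
  · have : 1 ≤ n * n := Nat.mul_pos (by omega) (by omega)
    omega
  · omega

theorem initState_wf {l₀ l₁ : List ℕ} {ρ : ℕ → Bool} (hw : 0 < w) (h₀ : ∀ x ∈ l₀, x < 2 ^ w)
    (h₁ : ∀ x ∈ l₁, x < 2 ^ w) : (initState l₀ l₁ ρ).WF w := by
  have key : ∀ {l : List ℕ}, (∀ x ∈ l, x < 2 ^ w) → ∀ i, l.getD i 0 < 2 ^ w := by
    intro l hl i
    rcases Nat.lt_or_ge i l.length with h | h
    · rw [List.getD_eq_getElem _ _ h]
      exact hl _ (List.getElem_mem h)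
    · rw [List.getD_eq_default _ _ h]
      positivity
  refine ⟨hw, fun x => by simp [initState], fun a i => ?_⟩
  simp only [initState]
  split_ifs
  exacts [key h₀ i, key h₁ i, by positivity]

theorem lt_of_mem_flatten {l : List (Fin n × Fin n)} {x : ℕ} (hx : x ∈ flatten l) : x < n := by
  simp only [flatten, List.mem_flatMap, List.mem_cons, List.not_mem_nil, or_false] at hx
  obtain ⟨p, -, rfl | rfl⟩ := hx
  exacts [p.1.2, p.2.2]

/-- The data structure can be cut off after its last cell. -/
theorem IsTable.congr {R B : ℕ} {χ : ℕ → Fin n → Fin n → ℕ} {A A' : ℕ → ℕ}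
    (h : IsTable G f R B χ A)
    (hA : ∀ i < 4 + R * (n * n) + R * B ^ f * (n * n), A' i = A i) : IsTable G f R B χ A' := by
  have ix : ∀ u v : Fin n, (u : ℕ) * n + v < n * n := fun u v => index_lt u.2 v.2
  refine ⟨?_, ?_, ?_, ?_, fun j hj u v => ?_, fun j hj g hg u v => ?_⟩
  · rw [hA _ (by omega), h.size]
  · rw [hA _ (by omega), h.base]
  · rw [hA _ (by omega), h.rounds]
  · rw [hA _ (by omega), h.palettes]
  · have := ix u v
    have hjR : (j + 1) * (n * n) ≤ R * (n * n) := Nat.mul_le_mul_right _ hj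
    rw [Nat.succ_mul] at hjR
    rw [hA _ (by omega), h.colour j hj]
  · have := ix u v
    have hlt : j * B ^ f + g + 1 ≤ R * B ^ f := by
      calc j * B ^ f + g + 1 ≤ j * B ^ f + B ^ f := by omega
        _ = (j + 1) * B ^ f := by ring
        _ ≤ R * B ^ f := Nat.mul_le_mul_right _ hj
    have := Nat.mul_le_mul_right (n * n) hlt
    rw [Nat.succ_mul] at this
    rw [hA _ (by omega), h.dist j hj g hg]

theorem diam_lt [NeZero n] : G.diam < n := by
  obtain ⟨u, v, h⟩ := G.exists_dist_eq_diam
  exact h ▸ Seidel.dist_lt_card u v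

theorem one_le_diam (hn : 2 ≤ n) (hG : G.Connected) : 1 ≤ G.diam := by
  have : Nontrivial (Fin n) := Fin.nontrivial_iff_two_le.2 hn
  have : Nonempty (Fin n) := ⟨⟨0, by omega⟩⟩
  exact Nat.one_le_iff_ne_zero.2
    (SimpleGraph.diam_ne_zero_of_ediam_ne_top (SimpleGraph.connected_iff_ediam_ne_top.1 hG))

/-- A bound for the time of the preprocessing when computing distances takes time `t`. -/
theorem preProg_time_le {D t : ℕ} (hn : 2 ≤ n) (hD : 1 ≤ D) :
    (50 * (n * n) + 30) + ((t + 40 * (n * n) + 30) +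
        ((20 * minColours f D + 20 * n + 200 + 2 * f) +
          ((rounds f c n * (n * n) * (20 * colourBits f D + 30) + 30) +
            ((rounds f c n * paletteBase f D ^ f *
              (t + n * n * (testCost f + 100) + 100 + 8) + 6) + 20)))) ≤
      rounds f c n * (paletteFactor f * D) ^ f * ((testCost f + 2 * f + 1000) * (t + n * n)) := by
  obtain ⟨R, hR⟩ : ∃ R, rounds f c n = R := ⟨_, rfl⟩
  have hR0 : 1 ≤ R := hR ▸ rounds_pos hn
  have hB0 : 1 ≤ paletteBase f D ^ f := Nat.one_le_pow _ _ (Nat.succ_pos _)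
  have hkB : colourBits f D ≤ paletteBase f D ^ f ∧ minColours f D ≤ paletteBase f D ^ f := by
    rcases Nat.eq_zero_or_pos f with rfl | hf
    · simp [colourBits, minColours]
    · have h1 : paletteBase f D ≤ paletteBase f D ^ f := Nat.le_self_pow hf.ne' _
      have h2 : colourBits f D < 2 ^ colourBits f D := Nat.lt_two_pow_self
      have h3 : minColours f D ≤ 2 ^ colourBits f D := Nat.le_pow_clog (by omega) _
      rw [paletteBase] at h1 ⊢
      omega
  obtain ⟨hk, hm⟩ := hkB
  have hB := Nat.pow_le_pow_left (paletteBase_le (f := f) hD) f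
  rw [hR]
  refine le_trans ?_ (Nat.mul_le_mul_right _ (Nat.mul_le_mul_left R hB))
  generalize paletteBase f D ^ f = B at *
  generalize minColours f D = m at *
  generalize colourBits f D = k at *
  generalize testCost f = K at *
  have hN : 2 * n ≤ n * n := Nat.mul_le_mul_right _ hn
  generalize n * n = N at *
  have hN4 : 4 ≤ N := by omega
  have hRB : 1 ≤ R * B := Nat.mul_pos hR0 hB0
  have h1 : R * N * (20 * k + 30) ≤ R * B * (50 * N) := by
    calc R * N * (20 * k + 30) ≤ R * N * (20 * B + 30 * B) := by gcongr; omega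
      _ = R * B * (50 * N) := by ring
  have h2 : B ≤ R * B := Nat.le_mul_of_pos_left _ hR0
  have h3 : ∀ x, x ≤ R * B * x := fun x => Nat.le_mul_of_pos_left _ hRB
  have h4 := h3 (100 * N + t + 346 + 2 * f + 20 * n)
  have h5 : R * B * (100 * N + t + 346 + 2 * f + 20 * n) + R * B * (50 * N) + 20 * (R * B)
      + R * B * (t + N * (K + 100) + 100 + 8) ≤ R * B * ((K + 2 * f + 1000) * (t + N)) := by
    rw [← mul_comm (R * B) 20, ← mul_add, ← mul_add, ← mul_add]
    refine Nat.mul_le_mul_left _ ?_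
    nlinarith [Nat.zero_le (K * t), Nat.zero_le (f * t), Nat.mul_le_mul_left f hN4]
  omega

/-- The oracle that computes distances by the program `P`. -/
def oracle (P : Prog) (f c κ : ℕ) : Oracle := ⟨κ + wordFactor f c, preProg P f c, queryProg⟩

/-- The oracle with explicit bounds, whatever program computes the distances. The time bounds hold
for all coin tosses, and the answers are correct if the colourings serve all queries. -/
theorem oracle_works (hP : ComputesDistances P T κ) (hn : 2 ≤ n) (hG : G.Connected) :
    (oracle P f c κ).Works G f c
      ((rounds f c n * (paletteFactor f * G.diam) ^ f * ((testCost f + 2 * f + 1000) *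
        (T ((oracle P f c κ).wordSize n) n G.edgeSet.ncard + n * n)) : ℕ) : ℝ)
      ((6 * (rounds f c n * (paletteFactor f * G.diam) ^ f * (n * n)) : ℕ) : ℝ)
      ((rounds f c n * (100 * f + 200) + 50 : ℕ) : ℝ) := by
  obtain ⟨w, hw⟩ : ∃ w, (oracle P f c κ).wordSize n = w := ⟨_, rfl⟩
  have hw' : (κ + wordFactor f c) * n.size = w := hw
  have : NeZero n := ⟨by omega⟩
  have hD := one_le_diam hn hG
  have hDn : G.diam ≤ n := diam_lt.le
  have hκ : κ * n.size ≤ w := by rw [← hw', add_mul]; omega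
  obtain ⟨w₁, w₂, w₃, w₄, w₅, w₆⟩ := word_bounds (f := f) (c := c) (w := w) hn hD hDn
    (by rw [← hw', add_mul]; omega)
  have hw0 : 0 < w := by
    rcases Nat.eq_zero_or_pos w with rfl | h
    · simp at w₃
    · exact h
  have hnn : n ≤ n * n := Nat.le_mul_self n
  intro l hl
  have hpre : ∀ ρ, ∃ t s', Exec w (preProg P f c) (initState (encodeNetwork l) [] ρ) t s' ∧
      t ≤ rounds f c n * (paletteFactor f * G.diam) ^ f * ((testCost f + 2 * f + 1000) *
        (T w n G.edgeSet.ncard + n * n)) ∧ s'.reg 0 = tableSize f c n G.diam ∧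
      IsTable G f (rounds f c n) (paletteBase f G.diam)
        (colour n (colourBits f G.diam) ρ) (s'.arr 1) ∧ s'.WF w := by
    intro ρ
    have hwf : (initState (encodeNetwork l) [] ρ).WF w := by
      refine initState_wf hw0 (fun x hx => ?_) (by simp)
      rw [encodeNetwork, List.mem_cons, List.mem_cons] at hx
      rcases hx with rfl | rfl | hx
      · omega
      · have := hl.length_le
        omega
      · have := lt_of_mem_flatten hx
        omega
    obtain ⟨t, s', he, ht, h0, hT⟩ := preProg_runs (c := c) hP hn hG hl hκ hDn w₁ w₂ w₃ w₄ w₅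
      (fun i => rfl) (fun i => rfl) hwf
    exact ⟨t, s', he, ht.trans (preProg_time_le hn hD), h0, hT, he.wf hwf⟩
  have hcol : ∀ ρ, ∀ j < rounds f c n, ∀ u v : Fin n,
      colour n (colourBits f G.diam) ρ j u v < paletteBase f G.diam := fun ρ j _ u v =>
    Nat.succ_lt_succ (ofBits_lt _ _ _)
  have hquery : ∀ (ρ : ℕ → Bool) (s' : State), s'.reg 0 = tableSize f c n G.diam →
      IsTable G f (rounds f c n) (paletteBase f G.diam)
        (colour n (colourBits f G.diam) ρ) (s'.arr 1) → s'.WF w → ∀ q : Query G f,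
      ∃ t, (oracle P f c κ).Answers ((List.range (s'.reg 0)).map (s'.arr 1)) q t
        (q.answer (rounds f c n) (paletteBase f G.diam) (colour n (colourBits f G.diam) ρ)) ∧
        t ≤ rounds f c n * (100 * f + 200) + 50 := by
    intro ρ s' h0 hT hs' q
    have hcard := q.card_le
    have hwf : (initState q.encode ((List.range (s'.reg 0)).map (s'.arr 1)) fun _ => false).WF w := by
      refine initState_wf hw0 (fun x hx => ?_) fun x hx => ?_
      · simp only [Query.encode, List.cons_append, List.mem_cons, List.mem_append] at hx
        have := q.src.2
        have := q.tgt.2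
        rcases hx with rfl | rfl | rfl | rfl | hx | hx
        · omega
        · omega
        · omega
        · omega
        · obtain ⟨v, -, rfl⟩ : ∃ v ∈ q.nodes, x = (v : ℕ) := by
            simpa [List.map_eq_flatMap, eq_comm] using hx
          have := v.2
          omega
        · have := lt_of_mem_flatten hx
          omega
      · obtain ⟨i, -, rfl⟩ := List.mem_map.1 hx
        exact hs'.arr 1 i
    have hT' : IsTable G f (rounds f c n) (paletteBase f G.diam)
        (colour n (colourBits f G.diam) ρ)
        ((initState q.encode ((List.range (s'.reg 0)).map (s'.arr 1)) fun _ => false).arr 1) := by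
      refine hT.congr fun i hi => ?_
      have hi' : i < s'.reg 0 := by rw [h0]; exact hi
      simp [initState, hi']
    obtain ⟨t, s₂, he, ht, ha⟩ := queryProg_runs q hT' (hcol ρ) (Nat.succ_pos _) w₂ w₆
      (rounds_pos hn) (fun i => rfl) rfl hwf
    refine ⟨t, ⟨s₂, by rw [hw]; exact he, ?_⟩, ht⟩
    rw [ha, decodeAnswer_encodeDist]
  refine ⟨fun ρ => ?_, ?_⟩
  · obtain ⟨t, s', he, ht, h0, hT, hs'⟩ := hpre ρ
    refine ⟨t, _, ⟨s', by rw [hw]; exact he, rfl⟩, ?_, ?_, fun q => ?_⟩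
    · rw [hw]
      exact_mod_cast ht
    · rw [List.length_map, List.length_range, h0]
      exact_mod_cast tableSize_le hn hD
    · obtain ⟨t', hA, ht'⟩ := hquery ρ s' h0 hT hs' q
      exact ⟨t', _, hA, by exact_mod_cast ht'⟩
  · have hk : 2 * ((3 * maxDist f G.diam + 1) * f) ≤ 2 ^ colourBits f G.diam :=
      Nat.le_pow_clog (by omega) _
    have hR : n ^ (3 * f + 2 + c) ≤ 2 ^ rounds f c n := by
      rw [rounds, mul_comm (3 * f + 2 + c) (Nat.clog 2 (n + 1)), pow_mul]
      exact Nat.pow_le_pow_left ((Nat.le_succ n).trans (Nat.le_pow_clog one_lt_two _)) _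
    refine (measure_served_ge (G := G) hn hk hR).trans (measureReal_mono fun ρ hρ => ?_)
    obtain ⟨t, s', he, -, h0, hT, hs'⟩ := hpre ρ
    refine ⟨t, _, ⟨s', by rw [hw]; exact he, rfl⟩, fun q => ?_⟩
    obtain ⟨t', hA, -⟩ := hquery ρ s' h0 hT hs' q
    exact ⟨t', _, hA, q.correct_answer hG (hcol ρ) le_rfl (hρ q)⟩

end DSO

/-! ### Bounds up to logarithms -/

namespace DSO

variable {n f c : ℕ} {G : SimpleGraph (Fin n)} {P : Prog} {T : ℕ → ℕ → ℕ → ℕ} {κ : ℕ}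

theorem clog_le_log (hn : 2 ≤ n) : (Nat.clog 2 (n + 1) : ℝ) ≤ 3 * Real.log n := by
  have h1 := Nat.pow_pred_clog_lt_self (b := 2) (by omega) (x := n + 1) (by omega)
  have hpos : 0 < Nat.clog 2 (n + 1) := Nat.clog_pos (by omega) (by omega)
  obtain ⟨H, hH⟩ : ∃ H, Nat.clog 2 (n + 1) = H + 1 := ⟨_, (Nat.succ_pred_eq_of_pos hpos).symm⟩
  rw [hH] at h1 ⊢
  simp only [Nat.pred_succ] at h1
  have h2 : (2 : ℝ) ^ H ≤ n := by exact_mod_cast Nat.lt_succ_iff.1 h1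
  have h3 := Real.log_le_log (by positivity) h2
  have h4 : Real.log 2 ≤ Real.log n := Real.log_le_log (by norm_num) (by exact_mod_cast hn)
  rw [Real.log_pow] at h3
  have h5 := Real.log_two_gt_d9
  push_cast
  nlinarith [Nat.cast_nonneg (α := ℝ) H]

theorem size_eq_clog (n : ℕ) : n.size = Nat.clog 2 (n + 1) := by
  apply le_antisymm
  · exact Nat.size_le.2 (Nat.lt_of_succ_le (Nat.le_pow_clog one_lt_two _))
  · exact Nat.clog_le_of_le_pow (Nat.lt_size_self n)

/-- The oracle that computes distances by the program `P`, with its bounds up to constant factors;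
`U` bounds the time for computing distances. -/
theorem oracle_works_log (hP : ComputesDistances P T κ) (hn : 2 ≤ n) (hG : G.Connected) {U : ℝ}
    {C k : ℕ} (hU : (T ((oracle P f c κ).wordSize n) n G.edgeSet.ncard + n * n : ℝ) ≤
      C * Nat.clog 2 (n + 1) ^ k * U) :
    (oracle P f c κ).Works G f c
      (((3 * f + 2 + c) * paletteFactor f ^ f * (testCost f + 2 * f + 1000) * C * 3 ^ (k + 1) : ℕ)
        * (G.diam : ℝ) ^ f * U * Real.log n ^ (k + 1))
      ((6 * (3 * f + 2 + c) * paletteFactor f ^ f * 3 ^ (k + 1) : ℕ) * (G.diam : ℝ) ^ f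
        * (n : ℝ) ^ 2 * Real.log n ^ (k + 1))
      ((((3 * f + 2 + c) * (100 * f + 200) + 50) * 3 ^ (k + 1) : ℕ) * Real.log n ^ (k + 1)) := by
  have hℓ := clog_le_log hn
  have hℓ1 : (1 : ℝ) ≤ Nat.clog 2 (n + 1) := by
    exact_mod_cast Nat.clog_pos (by omega) (show 1 < n + 1 by omega)
  have hℓk : (Nat.clog 2 (n + 1) : ℝ) ≤ (Nat.clog 2 (n + 1) : ℝ) ^ (k + 1) :=
    le_self_pow₀ hℓ1 (by omega)
  have hlog : (Nat.clog 2 (n + 1) : ℝ) ^ (k + 1) ≤ 3 ^ (k + 1) * Real.log n ^ (k + 1) := by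
    rw [← mul_pow]; gcongr
  have hU0 : 0 ≤ (C : ℝ) * U := by
    by_contra! h
    have h1 : (C : ℝ) * Nat.clog 2 (n + 1) ^ k * U < 0 := by
      have : (0 : ℝ) < (Nat.clog 2 (n + 1) : ℝ) ^ k := by positivity
      nlinarith
    have h2 : (0 : ℝ) ≤ (T ((oracle P f c κ).wordSize n) n G.edgeSet.ncard + n * n : ℝ) := by
      positivity
    linarith
  refine (oracle_works hP hn hG).mono ?_ ?_ ?_
  · rw [rounds]
    push_cast
    generalize (Nat.clog 2 (n + 1) : ℝ) = ℓ at *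
    calc _ ≤ (3 * f + 2 + c : ℝ) * ℓ * (paletteFactor f * G.diam) ^ f *
          ((testCost f + 2 * f + 1000) * (C * ℓ ^ k * U)) := by gcongr
      _ = ((3 * f + 2 + c : ℝ) * paletteFactor f ^ f * (testCost f + 2 * f + 1000) * G.diam ^ f) *
          (C * U) * ℓ ^ (k + 1) := by ring
      _ ≤ ((3 * f + 2 + c : ℝ) * paletteFactor f ^ f * (testCost f + 2 * f + 1000) * G.diam ^ f) *
          (C * U) * (3 ^ (k + 1) * Real.log n ^ (k + 1)) := by gcongr
      _ = _ := by ring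
  · rw [rounds]
    push_cast
    generalize (Nat.clog 2 (n + 1) : ℝ) = ℓ at *
    calc _ = (6 * (3 * f + 2 + c : ℝ) * paletteFactor f ^ f * G.diam ^ f * n ^ 2) * ℓ := by ring
      _ ≤ (6 * (3 * f + 2 + c : ℝ) * paletteFactor f ^ f * G.diam ^ f * n ^ 2) *
          (3 ^ (k + 1) * Real.log n ^ (k + 1)) := by gcongr; exact hℓk.trans hlog
      _ = _ := by ring
  · rw [rounds]
    push_cast
    generalize (Nat.clog 2 (n + 1) : ℝ) = ℓ at *
    calc _ ≤ (3 * f + 2 + c : ℝ) * ℓ * (100 * f + 200) + 50 * ℓ := by linarith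
      _ = ((3 * f + 2 + c : ℝ) * (100 * f + 200) + 50) * ℓ := by ring
      _ ≤ ((3 * f + 2 + c : ℝ) * (100 * f + 200) + 50) * (3 ^ (k + 1) * Real.log n ^ (k + 1)) := by
        gcongr; exact hℓk.trans hlog
      _ = _ := by ring

theorem card_le_two_mul_ncard (hn : 2 ≤ n) (hG : G.Connected) : n ≤ 2 * G.edgeSet.ncard := by
  have h := hG.card_vert_le_card_edgeSet_add_one
  rw [Nat.card_eq_fintype_card, Fintype.card_fin, Nat.card_coe_set_eq] at h
  omega

theorem breadthFirst_time_le (hn : 2 ≤ n) (hG : G.Connected) :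
    1000 * (n * (n + G.edgeSet.ncard)) + n * n ≤ 4000 * (G.edgeSet.ncard * n) := by
  have h := Nat.mul_le_mul_left n (card_le_two_mul_ncard hn hG)
  nlinarith

/-- The time of Seidel's algorithm with fast matrix multiplication: `O(n ^ τ)` up to logarithms. -/
theorem seidel_time_le {κ K N n₀ r : ℕ} {τ : ℝ} (hn₀ : 2 ≤ n₀) (hr : n₀ * n₀ ≤ r)
    (h : (r : ℝ) ≤ (n₀ : ℝ) ^ τ) (hN : (n₀ : ℝ) ^ τ ≤ N) (hn : 2 ≤ n) :
    ((1000 * ((Nat.clog 2 n + 1) * (K * (κ * n.size + (Nat.clog n₀ n + 1) * r ^ Nat.clog n₀ n) +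
      n * n)) + n * n : ℕ) : ℝ) ≤
      (2001 * (K * (κ + 2 * N) + 1) : ℕ) * (Nat.clog 2 (n + 1) : ℝ) ^ 2 * (n : ℝ) ^ τ := by
  have hτ := MatMul.two_le_of_le_rpow hn₀ hr h
  have hX := (MatMul.pow_clog_le_rpow hn₀ (by linarith) h hn).trans
    (mul_le_mul_of_nonneg_right hN (by positivity : (0 : ℝ) ≤ (n : ℝ) ^ τ))
  have hn1 : (1 : ℝ) ≤ n := by exact_mod_cast (by omega : 1 ≤ n)
  have hnX : (n : ℝ) * n ≤ (n : ℝ) ^ τ := by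
    rw [← sq, ← Real.rpow_two]
    exact Real.rpow_le_rpow_of_exponent_le hn1 hτ
  have hX1 : (1 : ℝ) ≤ (n : ℝ) ^ τ := by nlinarith
  have hle : ∀ b, 2 ≤ b → Nat.clog b n ≤ Nat.clog 2 (n + 1) := fun b hb =>
    Nat.clog_le_of_le_pow (((Nat.le_succ n).trans (Nat.le_pow_clog one_lt_two _)).trans
      (Nat.pow_le_pow_left hb _))
  have hℓ0 : 1 ≤ Nat.clog 2 (n + 1) := Nat.clog_pos one_lt_two (by omega)
  have h2 : (Nat.clog 2 n + 1 : ℝ) ≤ 2 * Nat.clog 2 (n + 1) := by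
    exact_mod_cast (by have := hle 2 le_rfl; omega : Nat.clog 2 n + 1 ≤ 2 * Nat.clog 2 (n + 1))
  have h3 : (Nat.clog n₀ n + 1 : ℝ) ≤ 2 * Nat.clog 2 (n + 1) := by
    exact_mod_cast (by have := hle n₀ hn₀; omega : Nat.clog n₀ n + 1 ≤ 2 * Nat.clog 2 (n + 1))
  have hℓ : (1 : ℝ) ≤ Nat.clog 2 (n + 1) := by exact_mod_cast hℓ0
  rw [size_eq_clog]
  push_cast at hX ⊢
  generalize (Nat.clog 2 (n + 1) : ℝ) = ℓ at *
  generalize (n : ℝ) ^ τ = X at *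
  calc _ ≤ 1000 * (2 * ℓ * (K * (κ * ℓ * X + 2 * ℓ * (N * X)) + ℓ * X)) + ℓ ^ 2 * X := by
        have e1 : κ * ℓ ≤ κ * ℓ * X :=
          le_mul_of_one_le_right (mul_nonneg κ.cast_nonneg (by linarith)) hX1
        have e2 : (n : ℝ) * n ≤ ℓ * X := hnX.trans (le_mul_of_one_le_left (by linarith) hℓ)
        have e3 : (n : ℝ) * n ≤ ℓ ^ 2 * X :=
          hnX.trans (le_mul_of_one_le_left (by linarith) (one_le_pow₀ hℓ))
        refine add_le_add ?_ e3
        gcongr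
    _ = (2000 * (K * (κ + 2 * N) + 1) + 1) * ℓ ^ 2 * X := by ring
    _ ≤ 2001 * (K * (κ + 2 * N) + 1) * ℓ ^ 2 * X := by
        gcongr
        nlinarith [(by positivity : (0 : ℝ) ≤ K * (κ + 2 * N))]

end DSO

theorem corollary3 (f c : ℕ) :
    (∃ (O : DSO.Oracle) (ε : ℕ → ℝ) (C : ℝ) (k : ℕ), Tendsto ε atTop (𝓝 0) ∧
      ∀ (n : ℕ) (G : SimpleGraph (Fin n)), 2 ≤ n → G.Connected →
        O.Works G f c
          (C * (G.diam : ℝ) ^ ((f : ℝ) + ε G.diam) * ((G.edgeSet.ncard : ℝ) * (n : ℝ))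
            * Real.log n ^ k)
          (C * (G.diam : ℝ) ^ ((f : ℝ) + ε G.diam) * (n : ℝ) ^ 2 * Real.log n ^ k)
          (C * (G.diam : ℝ) ^ (ε G.diam) * Real.log n ^ k)) ∧
    (∀ δ : ℝ, 0 < δ →
      ∃ (O : DSO.Oracle) (ε : ℕ → ℝ) (C : ℝ) (k : ℕ), Tendsto ε atTop (𝓝 0) ∧
      ∀ (n : ℕ) (G : SimpleGraph (Fin n)), 2 ≤ n → G.Connected →
        O.Works G f c
          (C * (G.diam : ℝ) ^ ((f : ℝ) + ε G.diam) * (n : ℝ) ^ (matMulExponent + δ)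
            * Real.log n ^ k)
          (C * (G.diam : ℝ) ^ ((f : ℝ) + ε G.diam) * (n : ℝ) ^ 2 * Real.log n ^ k)
          (C * (G.diam : ℝ) ^ (ε G.diam) * Real.log n ^ k)) := by
  -- Both parts are instances of `oracle_works_log`; its bounds hold with `ε = 0`, and its three
  -- constants are bounded by their sum.
  have key : ∀ {P T κ C k} {U : ∀ n : ℕ, SimpleGraph (Fin n) → ℝ} (hP : DSO.ComputesDistances P T κ)
      (hU0 : ∀ n G, 0 ≤ U n G)
      (hU : ∀ (n : ℕ) (G : SimpleGraph (Fin n)), 2 ≤ n → G.Connected →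
        (T ((DSO.oracle P f c κ).wordSize n) n G.edgeSet.ncard + n * n : ℝ) ≤
          (C : ℕ) * Nat.clog 2 (n + 1) ^ k * U n G),
      ∃ (O : DSO.Oracle) (ε : ℕ → ℝ) (C : ℝ) (k : ℕ), Tendsto ε atTop (𝓝 0) ∧
      ∀ (n : ℕ) (G : SimpleGraph (Fin n)), 2 ≤ n → G.Connected →
        O.Works G f c (C * (G.diam : ℝ) ^ ((f : ℝ) + ε G.diam) * U n G * Real.log n ^ k)
          (C * (G.diam : ℝ) ^ ((f : ℝ) + ε G.diam) * (n : ℝ) ^ 2 * Real.log n ^ k)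
          (C * (G.diam : ℝ) ^ (ε G.diam) * Real.log n ^ k) := by
    intro P T κ C k U hP hU0 hU
    obtain ⟨C₁, hC₁⟩ : ∃ C₁, (3 * f + 2 + c) * DSO.paletteFactor f ^ f *
      (DSO.testCost f + 2 * f + 1000) * C * 3 ^ (k + 1) = C₁ := ⟨_, rfl⟩
    obtain ⟨C₂, hC₂⟩ : ∃ C₂, 6 * (3 * f + 2 + c) * DSO.paletteFactor f ^ f * 3 ^ (k + 1) = C₂ :=
      ⟨_, rfl⟩
    obtain ⟨C₃, hC₃⟩ : ∃ C₃, ((3 * f + 2 + c) * (100 * f + 200) + 50) * 3 ^ (k + 1) = C₃ :=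
      ⟨_, rfl⟩
    refine ⟨DSO.oracle P f c κ, fun _ => 0, (C₁ + C₂ + C₃ : ℕ), k + 1, tendsto_const_nhds,
      fun n G hn hG => ?_⟩
    have hlog : 0 ≤ Real.log n := Real.log_natCast_nonneg n
    have hU0 := hU0 n G
    rw [add_zero, Real.rpow_natCast, Real.rpow_zero, mul_one]
    have h := DSO.oracle_works_log (f := f) (c := c) hP hn hG (hU n G hn hG)
    rw [hC₁, hC₂, hC₃] at h
    refine h.mono ?_ ?_ ?_ <;> gcongr <;> omega
  refine ⟨key (T := fun _ n m => 1000 * (n * (n + m)))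
    (U := fun n G => (G.edgeSet.ncard : ℝ) * (n : ℝ)) (C := 4000) (k := 0)
    DSO.breadthFirst_computesDistances (fun n G => by positivity) fun n G hn hG => ?_,
    fun δ hδ => ?_⟩
  · rw [pow_zero, mul_one]
    exact_mod_cast DSO.breadthFirst_time_le hn hG
  · obtain ⟨n₀, r, Q, hn₀, hr, hle, hQ, ⟨B⟩⟩ := MatMul.exists_bilinearAlgorithm_exponent hδ
    obtain ⟨K, κ, hB⟩ := MatMul.matMulProg_computes B hn₀ hr hQ
    refine key (U := fun n _ => (n : ℝ) ^ (matMulExponent + δ)) (k := 2)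
      (C := 2001 * (K * (κ + 4 + DSO.wordFactor f c +
        2 * ⌈(n₀ : ℝ) ^ (matMulExponent + δ)⌉₊) + 1))
      (Seidel.distancesProg_computes hB) (fun n G => by positivity) fun n G hn hG => ?_
    have h := DSO.seidel_time_le (K := K) (κ := κ + 4 + DSO.wordFactor f c) hn₀ hr hle
      (Nat.le_ceil _) hn
    refine le_trans (le_of_eq ?_) h
    push_cast [DSO.Oracle.wordSize, DSO.oracle]
    rfl
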